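/- Let $B_r=\{x\in\mathbb R^3:|x|<r\}$, $B^{r}=\{|x|>r\}$, $q\in(3/2,\infty)$, $q'=q/(q-1)$, $\rho>0$ and $s>0$. Then there is a constant $c=c(q,\rho,s)>0$ with the following property. Let $G$ be a second-order tensor field on $\mathbb R^3$ with $|x|^2G\in L^\infty(\mathbb R^3)$ and $G\in L^q(B_s)$ (the latter is automatic if $G$ vanishes a.e. in $B_s$). Let $f$ be an $\mathbb R^3$-valued distribution on $\mathbb R^3$ supported in $\overline{B_\rho}$ with $f\in W^{-1,q}(B_{2\rho})$, the dual of $W^{1,q'}_0(B_{2\rho})$, i.e. $\|f\|_{-1,q,B_{2\rho}}=\sup\{|\langle f,\varphi\rangle|:\varphi\in C_0^\infty(B_{2\rho})^3,\ \|\varphi\|_{q'}+\|\nabla\varphi\|_{q'}\le 1\}<\infty$. Let $g\in L^q(B_{2\rho})$ be a scalar field that vanishes a.e. outside $B_\rho$. Write $(\operatorname{div}G)_i=\sum_k\partial_kG_{ki}$. Then the Stokes system $$\Delta u=\nabla p+\operatorname{div}G+f,\qquad \operatorname{div}u=g\qquad\text{in }\mathbb R^3,$$ understood in the sense of distributions,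 has one and only one solution $(u,p)$ (up to equality almost everywhere) with $u\in L^1_{\rm loc}(\mathbb R^3)^3$, weak gradient $\nabla u\in L^q(\mathbb R^3)$, $p\in L^q(\mathbb R^3)$ and $|x|u\in L^\infty(B^{2\rho})$. This solution satisfies $$\||x|u\|_{\infty,B^{2\rho}}+\|\nabla u\|_{q,\mathbb R^3}+\|p\|_{q,\mathbb R^3}\le c\left(\||x|^2G\|_{\infty,\mathbb R^3}+\|G\|_{q,B_s}+\|f\|_{-1,q,B_{2\rho}}+\|g\|_{q,B_\rho}\right).$$ In particular, if $G=0$ a.e. in $B_s$, then $$\||x|u\|_{\infty,B^{2\rho}}+\|\nabla u\|_{q,\mathbb R^3}+\|p\|_{q,\mathbb R^3}\le c\left(\||x|^2G\|_{\infty,\mathbb R^3}+\|f\|_{-1,q,B_{2\rho}}+\|g\|_{q,B_\rho}\right).\tag{A.2}$$ -/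

import Mathlib

open MeasureTheory Distribution
open scoped ENNReal Distributions Laplacian

noncomputable section

namespace StokesWholeSpace

/-- The Euclidean space `ℝ³`. -/
abbrev E3 := EuclideanSpace ℝ (Fin 3)

/-- Second-order tensors on `ℝ³`, with the Euclidean (Frobenius) norm. -/
abbrev Tensor := EuclideanSpace ℝ (Fin 3 × Fin 3)

/-- Real-valued smooth compactly supported functions on `ℝ³`. -/
abbrev ScalarTest := 𝓓((⊤ : TopologicalSpace.Opens E3), ℝ)

/-- `ℝ³`-valued smooth compactly supported functions on `ℝ³`. -/
abbrev VectorTest := 𝓓((⊤ : TopologicalSpace.Opens E3), E3)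

/-- Vector-valued distributions on `ℝ³`: the `i`-th component is `φ ↦ f φ i`. -/
abbrev VectorDistribution := 𝓓'((⊤ : TopologicalSpace.Opens E3), E3)

/-- The partial derivative `∂ₖ φ (x)`. -/
def pderiv (k : Fin 3) (φ : E3 → ℝ) (x : E3) : ℝ :=
  fderiv ℝ φ x (EuclideanSpace.single k 1)

/-- `U` is the weak gradient of the vector field `u`: `U (i, j) = ∂ⱼ uᵢ` in the sense of
distributions. -/
structure IsWeakGradient (u : E3 → E3) (U : E3 → Tensor) : Prop where
  locallyIntegrable_field : LocallyIntegrable u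
  locallyIntegrable_grad : LocallyIntegrable U
  integral_eq : ∀ (i j : Fin 3) (φ : ScalarTest),
    ∫ x, u x i * pderiv j φ x = - ∫ x, U x (i, j) * φ x

/-- The pairing `⟨f, φ⟩ = ∑ᵢ ⟨fᵢ, φᵢ⟩` of a vector distribution with a vector test function. -/
def pairing (f : VectorDistribution) (φ : VectorTest) : ℝ :=
  ∑ i : Fin 3, f (TestFunction.postcompCLM (𝕜 := ℝ) (EuclideanSpace.proj i : E3 →L[ℝ] ℝ) φ) i

/-- The norm `‖φ‖_{1,r} = ‖φ‖_r + ‖∇φ‖_r` of a vector test function. -/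
def sobolevNorm (r : ℝ) (φ : VectorTest) : ℝ≥0∞ :=
  eLpNorm φ (ENNReal.ofReal r) volume + eLpNorm (fderiv ℝ φ) (ENNReal.ofReal r) volume

/-- The norm `‖f‖_{-1,q,D}` of `W^{-1,q}(D) = (W₀^{1,q'}(D))'`, with `q' = q / (q - 1)`:
the supremum of `|⟨f, φ⟩|` over the unit ball of `W₀^{1,q'}(D)`, taken over the dense set
of smooth fields with compact support in the open set `D`. It is `∞` if the restriction
of `f` to `D` is not in `W^{-1,q}(D)`. -/
def negSobolevNorm (q : ℝ) (D : Set E3) (f : VectorDistribution) : ℝ≥0∞ :=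
  ⨆ (φ : VectorTest) (_ : tsupport φ ⊆ D) (_ : sobolevNorm (q / (q - 1)) φ ≤ 1),
    ENNReal.ofReal |pairing f φ|

/-- The hypotheses on the data: `|x|² G ∈ L^∞(ℝ³)`; `G ∈ L^q(B_s)`; `f ∈ W^{-1,q}(B_{2ρ})`,
supported in the closed ball of radius `ρ`; `g ∈ L^q(B_{2ρ})`, vanishing outside `B_ρ`. -/
structure IsAdmissibleData (q ρ s : ℝ) (G : E3 → Tensor) (f : VectorDistribution)
    (g : E3 → ℝ) : Prop where
  memLp_weighted_tensor : MemLp (fun x => ‖x‖ ^ 2 • G x) ∞ volume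
  memLp_tensor_near_zero :
    MemLp G (ENNReal.ofReal q) (volume.restrict (Metric.ball 0 s))
  negSobolevNorm_lt_top : negSobolevNorm q (Metric.ball 0 (2 * ρ)) f < ∞
  support_force : IsVanishingOn f (Metric.closedBall (0 : E3) ρ)ᶜ
  memLp_divergence :
    MemLp g (ENNReal.ofReal q) (volume.restrict (Metric.ball 0 (2 * ρ)))
  support_divergence : ∀ᵐ x, x ∉ Metric.ball (0 : E3) ρ → g x = 0

/-- `(u, p)` solves `Δu = ∇p + div G + f`, `div u = g` in `ℝ³` in the sense of distributions,
where `(div G)ᵢ = ∑ₖ ∂ₖ G (k, i)`. -/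
structure IsStokesSolution (G : E3 → Tensor) (f : VectorDistribution) (g : E3 → ℝ)
    (u : E3 → E3) (p : E3 → ℝ) : Prop where
  locallyIntegrable_velocity : LocallyIntegrable u
  locallyIntegrable_pressure : LocallyIntegrable p
  momentum : ∀ (i : Fin 3) (φ : ScalarTest),
    ∫ x, u x i * (Δ (φ : E3 → ℝ)) x
      = - (∫ x, p x * pderiv i φ x) - (∫ x, ∑ k : Fin 3, G x (k, i) * pderiv k φ x) + f φ i
  divergence : ∀ φ : ScalarTest,
    - (∫ x, ∑ k : Fin 3, u x k * pderiv k φ x) = ∫ x, g x * φ x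

/-- The class of solutions: `u ∈ D^{1,q}(ℝ³)`, `p ∈ L^q(ℝ³)`, and `|x| u` essentially bounded
in the exterior domain `|x| > 2ρ`. -/
structure IsInSolutionClass (q ρ : ℝ) (u : E3 → E3) (p : E3 → ℝ) : Prop where
  exists_grad : ∃ U : E3 → Tensor, IsWeakGradient u U ∧ MemLp U (ENNReal.ofReal q) volume
  memLp_pressure : MemLp p (ENNReal.ofReal q) volume
  decay : MemLp (fun x => ‖x‖ • u x) ∞ (volume.restrict (Metric.closedBall 0 (2 * ρ))ᶜ)

end StokesWholeSpace

end

noncomputable section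

namespace StokesWholeSpace

open scoped ContDiff Topology
open Set Filter

/-! Let N = -1/(4π|x|) and Φ = -|x|/(8π), so that ΔN = δ and ΔΦ = N. Once the force is written as a
divergence and added to G, giving a tensor Γ, taking the divergence of the momentum equation leads
to p = g - ∑ ∂ₖ∂ₗN * Γₖₗ, and then to uᵢ = ∑ ∂ₖN * Γₖᵢ - ∑ ∂ᵢ∂ₗ∂ₖΦ * Γₖₗ + ∂ᵢN * g. The two families
of kernels are `gradKer` (∂ₖN) and `thirdKer` (∂ᵢ∂ₗ∂ₖΦ). Both are O(|x|⁻²). They are defined as time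
integrals of derivatives of the heat kernel, formally N = -∫ Pₜ dt and Φ = ∫ t Pₜ dt, so every
identity between them, tested against smooth functions, comes from ∂ₜPₜ = ΔPₜ and an integration by
parts in t.

Decay. A density that is in L^q and is bounded by |y|⁻² far away has a potential of size |x|⁻¹,
because ∫ |x-y|⁻² |y|⁻² dy is O(|x|⁻¹) (`exists_lintegral_inv_sq_mul_inv_sq`,
`IsNewtonType.exists_decay`). The condition q > 3/2 says that |x|⁻² is in L^q at infinity, so that G
is globally in L^q.

Gradient and pressure. Both are controlled by second order Riesz transforms, whose L^p boundedness
is proved by the Bellman function method. The semigroup law gives ⟨∂ₖN * f, ∂ⱼφ⟩ = -2 ∫∫ ∂ₖPₛf ∂ⱼPₛφ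
dx ds, so it suffices to bound the space-time integral of |∂ₖPₛf ∂ⱼPₛφ| by a multiple of ‖f‖_p ‖φ‖_q
for conjugate exponents (`exists_gradForm_le`). For nonnegative data and p ≥ 2 the function B(u,v) =
K v^q + u² (u^p + v^q)^(1-2/p) is of size u^p + v^q and so convex (`bellman_hessian_ge`) that (Δ -
∂ₜ) B(Pₜf, Pₜg) dominates twice the product of the derivatives. Integration over space-time, scaling
and splitting into signs finish the bound. Duality of L^p, obtained from the Radon-Nikodym theorem
(`exists_memLp_dual`), turns such pairings into weak derivatives. For `thirdKer`, Liouville's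
theorem identifies ∂ᵢ∂ₗ∂ₖΦ * f with ∂ᵢN * ∂ₗ(∂ₖN * f), so two Riesz bounds are composed.

Force. A cutoff and the Hahn-Banach theorem write fᵢ as a - div b with a, b in L^q and supported in
a slightly larger ball; since a = div(∇N * a), the force is the divergence of an L^q tensor decaying
like |x|⁻² (`exists_force_tensor`).

Uniqueness. The difference of two pressures is weakly harmonic and in L^q, hence zero. The
difference of the velocities is then weakly harmonic and O(|x|⁻¹), hence zero. Both follow from a
Liouville theorem for weakly harmonic functions whose means over large balls tend to zero
(`ae_eq_zero_of_harmonic`). The estimate, proved for the constructed solution, thereby holds for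
every solution in the class. -/

/-- Smooth compactly supported real functions. -/
structure IsTest (φ : E3 → ℝ) : Prop where
  smooth : ContDiff ℝ ∞ φ
  compact : HasCompactSupport φ

/-- The `k`-th standard basis vector. -/
abbrev basisVec (k : Fin 3) : E3 := EuclideanSpace.single k 1

lemma ScalarTest.isTest (φ : ScalarTest) : IsTest φ := ⟨φ.contDiff, φ.hasCompactSupport⟩

/-- A smooth compactly supported function as a bundled test function. -/
def IsTest.bundle {φ : E3 → ℝ} (h : IsTest φ) : ScalarTest :=
  ⟨φ, h.smooth, h.compact, by simp⟩

@[simp] lemma IsTest.coe_bundle {φ : E3 → ℝ} (h : IsTest φ) : ⇑h.bundle = φ := rfl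

/-! ### Partial derivatives, test functions and integration by parts. -/

lemma pderiv_eq_deriv {φ : E3 → ℝ} {x : E3} (k : Fin 3) (h : DifferentiableAt ℝ φ x) :
    HasDerivAt (fun s : ℝ => φ (x + s • basisVec k)) (pderiv k φ x) 0 := by
  have h1 : HasFDerivAt φ (fderiv ℝ φ x) (x + (0 : ℝ) • basisVec k) := by
    simpa using h.hasFDerivAt
  have h2 : HasDerivAt (fun s : ℝ => x + s • basisVec k) (basisVec k) 0 := by
    simpa using ((hasDerivAt_id (0 : ℝ)).smul_const (basisVec k)).const_add x
  exact h1.comp_hasDerivAt 0 h2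

lemma contDiff_pderiv {φ : E3 → ℝ} {n : ℕ∞ω} (k : Fin 3) {m : ℕ∞ω} (h : ContDiff ℝ n φ)
    (hm : m + 1 ≤ n) : ContDiff ℝ m (pderiv k φ) :=
  (h.fderiv_right hm).clm_apply contDiff_const

lemma contDiff_top_pderiv {φ : E3 → ℝ} (k : Fin 3) (h : ContDiff ℝ ∞ φ) :
    ContDiff ℝ ∞ (pderiv k φ) :=
  contDiff_pderiv k h (by simp)

namespace IsTest

variable {φ ψ : E3 → ℝ}

lemma continuous (h : IsTest φ) : Continuous φ := h.smooth.continuous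

lemma differentiable (h : IsTest φ) : Differentiable ℝ φ := h.smooth.differentiable (by simp)

lemma integrable (h : IsTest φ) : Integrable φ := h.continuous.integrable_of_hasCompactSupport h.compact

lemma pderiv (h : IsTest φ) (k : Fin 3) : IsTest (pderiv k φ) where
  smooth := contDiff_top_pderiv k h.smooth
  compact := (h.compact.fderiv ℝ).comp_left (g := fun L : E3 →L[ℝ] ℝ => L (basisVec k)) (by simp)

lemma add (h : IsTest φ) (h' : IsTest ψ) : IsTest (fun x => φ x + ψ x) :=
  ⟨h.smooth.add h'.smooth, h.compact.add h'.compact⟩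

lemma const_mul (h : IsTest φ) (c : ℝ) : IsTest (fun x => c * φ x) :=
  ⟨contDiff_const.mul h.smooth, h.compact.mul_left (f := fun _ => c)⟩

lemma mul_left (h : IsTest φ) (h' : ContDiff ℝ ∞ ψ) : IsTest (fun x => ψ x * φ x) :=
  ⟨h'.mul h.smooth, h.compact.mul_left (f := ψ)⟩

lemma sum {ι : Type*} {s : Finset ι} {φ : ι → E3 → ℝ} (h : ∀ i ∈ s, IsTest (φ i)) :
    IsTest (fun x => ∑ i ∈ s, φ i x) := by
  classical
  induction s using Finset.induction_on with
  | empty =>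
    simp only [Finset.sum_empty]
    exact ⟨contDiff_const, HasCompactSupport.zero⟩
  | insert a s ha ih =>
    simp only [Finset.sum_insert ha]
    exact (h a (by simp)).add (ih fun i hi => h i (by simp [hi]))

lemma translate (h : IsTest φ) (a : E3) : IsTest (fun x => φ (x + a)) :=
  ⟨h.smooth.comp (contDiff_id.add contDiff_const),
    h.compact.comp_homeomorph (Homeomorph.addRight a)⟩

lemma reflect (h : IsTest φ) (a : E3) : IsTest (fun x => φ (a - x)) :=
  ⟨h.smooth.comp (contDiff_const.sub contDiff_id),
    h.compact.comp_homeomorph (Homeomorph.subLeft a)⟩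

lemma exists_bound (h : IsTest φ) : ∃ C, 0 ≤ C ∧ ∀ x, |φ x| ≤ C := by
  obtain ⟨C, hC⟩ := h.continuous.bounded_above_of_compact_support h.compact
  exact ⟨C, (norm_nonneg _).trans (hC 0), fun x => by simpa using hC x⟩

lemma exists_support (h : IsTest φ) : ∃ R, 0 < R ∧ ∀ x, R ≤ ‖x‖ → φ x = 0 := by
  obtain ⟨R, hR, hb⟩ := h.compact.isCompact.isBounded.exists_pos_norm_lt
  refine ⟨R, hR, fun x hx => ?_⟩
  by_contra hne
  exact absurd (hb x (subset_tsupport φ hne)) (not_lt.2 hx)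

end IsTest

lemma pderiv_translate (φ : E3 → ℝ) (k : Fin 3) (a x : E3) :
    pderiv k (fun y => φ (y + a)) x = pderiv k φ (x + a) := by
  simp only [pderiv]
  rw [fderiv_comp_add_right]

lemma pderiv_comm {φ : E3 → ℝ} (h : ContDiff ℝ 2 φ) (i j : Fin 3) :
    pderiv i (pderiv j φ) = pderiv j (pderiv i φ) := by
  have key : ∀ (i j : Fin 3) (x : E3), pderiv i (pderiv j φ) x
      = fderiv ℝ (fderiv ℝ φ) x (basisVec i) (basisVec j) := by
    intro i j x
    have hd : DifferentiableAt ℝ (fderiv ℝ φ) x :=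
      (h.fderiv_right (m := 1) (by norm_num)).differentiable (by norm_num) x
    have : HasFDerivAt (fun y => fderiv ℝ φ y (basisVec j))
        ((fderiv ℝ (fderiv ℝ φ) x).flip (basisVec j)) x := by
      exact ((ContinuousLinearMap.apply ℝ ℝ (basisVec j)).hasFDerivAt.comp x hd.hasFDerivAt)
    change fderiv ℝ (fun y => fderiv ℝ φ y (basisVec j)) x (basisVec i) = _
    rw [this.fderiv]; rfl
  funext x
  rw [key, key]
  have := (h.contDiffAt (x := x)).isSymmSndFDerivAt (by simp [minSmoothness_of_isRCLikeNormedField])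
  exact this.eq _ _

lemma laplacian_eq_sum {φ : E3 → ℝ} (h : ContDiff ℝ 2 φ) (x : E3) :
    (Δ φ) x = ∑ k, pderiv k (pderiv k φ) x := by
  rw [InnerProductSpace.laplacian_eq_iteratedFDeriv_orthonormalBasis φ
    (EuclideanSpace.basisFun (Fin 3) ℝ)]
  refine Finset.sum_congr rfl fun k _ => ?_
  rw [iteratedFDeriv_two_apply]
  have hd : DifferentiableAt ℝ (fderiv ℝ φ) x :=
    (h.fderiv_right (m := 1) (by norm_num)).differentiable (by norm_num) x
  have : HasFDerivAt (fun y => fderiv ℝ φ y (basisVec k))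
      ((fderiv ℝ (fderiv ℝ φ) x).flip (basisVec k)) x := by
    exact ((ContinuousLinearMap.apply ℝ ℝ (basisVec k)).hasFDerivAt.comp x hd.hasFDerivAt)
  change _ = fderiv ℝ (fun y => fderiv ℝ φ y (basisVec k)) x (basisVec k)
  rw [this.fderiv]
  simp

/-- Integration by parts for a `C¹` function against a test function. -/
lemma integral_mul_pderiv {f φ : E3 → ℝ} (hf : ContDiff ℝ 1 f) (hφ : ContDiff ℝ 1 φ)
    (hc : HasCompactSupport φ) (k : Fin 3) :
    ∫ x, f x * pderiv k φ x = - ∫ x, pderiv k f x * φ x := by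
  have c1 : Continuous (pderiv k f) := (contDiff_pderiv (m := 0) k hf (by norm_num)).continuous
  have c2 : Continuous (pderiv k φ) := (contDiff_pderiv (m := 0) k hφ (by norm_num)).continuous
  have hc' : HasCompactSupport (pderiv k φ) :=
    (hc.fderiv ℝ).comp_left (g := fun L : E3 →L[ℝ] ℝ => L (basisVec k)) (by simp)
  apply integral_mul_fderiv_eq_neg_fderiv_mul_of_integrable
  · exact (c1.mul hφ.continuous).integrable_of_hasCompactSupport hc.mul_left
  · exact (hf.continuous.mul c2).integrable_of_hasCompactSupport hc'.mul_left
  · exact (hf.continuous.mul hφ.continuous).integrable_of_hasCompactSupport hc.mul_left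
  · exact fun x _ => hf.differentiable (by norm_num) x
  · exact fun x _ => hφ.differentiable (by norm_num) x

lemma IsTest.contDiff {φ : E3 → ℝ} (h : IsTest φ) (n : ℕ) : ContDiff ℝ n φ :=
  h.smooth.of_le (by exact_mod_cast le_top)

lemma IsTest.laplacian {φ : E3 → ℝ} (h : IsTest φ) : IsTest (Δ φ) := by
  have : Δ φ = fun x => ∑ k, StokesWholeSpace.pderiv k (StokesWholeSpace.pderiv k φ) x := by
    funext x; exact laplacian_eq_sum (h.contDiff 2) x
  rw [this]
  exact IsTest.sum fun k _ => (h.pderiv k).pderiv k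

/-- Two integrations by parts for the Laplacian. -/
lemma integral_mul_laplacian {f φ : E3 → ℝ} (hf : ContDiff ℝ 2 f) (hφ : IsTest φ) :
    ∫ x, f x * (Δ φ) x = ∫ x, (∑ k, pderiv k (pderiv k f) x) * φ x := by
  have h1 : ∀ k, ContDiff ℝ 1 (pderiv k f) := fun k => contDiff_pderiv k hf (by norm_num)
  have h2 : ∀ k, Continuous (pderiv k (pderiv k f)) := fun k =>
    (contDiff_pderiv (m := 0) k (h1 k) (by norm_num)).continuous
  simp_rw [laplacian_eq_sum (hφ.contDiff 2), Finset.mul_sum, Finset.sum_mul]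
  rw [integral_finsetSum, integral_finsetSum]
  · refine Finset.sum_congr rfl fun k _ => ?_
    rw [integral_mul_pderiv (hf.of_le (by norm_num)) ((hφ.pderiv k).contDiff 1) (hφ.pderiv k).compact,
      integral_mul_pderiv (h1 k) (hφ.contDiff 1) hφ.compact, neg_neg]
  · exact fun k _ => ((h2 k).mul hφ.continuous).integrable_of_hasCompactSupport hφ.compact.mul_left
  · exact fun k _ => (hf.continuous.mul ((hφ.pderiv k).pderiv k).continuous).integrable_of_hasCompactSupport
      ((hφ.pderiv k).pderiv k).compact.mul_left

/-! ### Convolution of a smooth kernel with a function of bounded support. -/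

/-- The convolution `∫ K (x - y) f y dy`. -/
def conv (K f : E3 → ℝ) (x : E3) : ℝ := ∫ y, K (x - y) * f y

lemma contDiffOn_conv_param {H : ℝ → E3 → ℝ} {s : Set ℝ} (hs : IsOpen s)
    (hH : ContDiffOn ℝ ∞ (fun p : ℝ × E3 => H p.1 p.2) (s ×ˢ univ)) {f : E3 → ℝ}
    (hf : Integrable f) {R : ℝ} (hR : 0 < R) (hsupp : ∀ y, R ≤ ‖y‖ → f y = 0) :
    ContDiffOn ℝ ∞ (fun p : ℝ × E3 => conv (H p.1) f p.2) (s ×ˢ univ) := by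
  let χ : ContDiffBump (0 : E3) := ⟨R, R + 1, hR, by linarith⟩
  -- The point x goes into the parameter and the convolution is evaluated at 0. The cutoff that
  -- makes the kernel compactly supported then does not depend on the parameter, and it equals 1
  -- wherever f is nonzero.
  let g : (ℝ × E3) → E3 → ℝ := fun p z => χ z * H p.1 (p.2 + z)
  have hg : ContDiffOn ℝ ∞ (Function.uncurry g) ((s ×ˢ (univ : Set E3)) ×ˢ univ) := by
    have h1 : ContDiff ℝ ∞ fun q : (ℝ × E3) × E3 => χ q.2 := χ.contDiff.comp contDiff_snd
    have h2 : ContDiffOn ℝ ∞ (fun q : (ℝ × E3) × E3 => H q.1.1 (q.1.2 + q.2))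
        ((s ×ˢ (univ : Set E3)) ×ˢ univ) := by
      have h3 : ContDiff ℝ ∞ fun q : (ℝ × E3) × E3 => (q.1.1, q.1.2 + q.2) := by fun_prop
      exact hH.comp h3.contDiffOn (fun q hq => ⟨hq.1.1, mem_univ _⟩)
    exact h1.contDiffOn.mul h2
  have := contDiffOn_convolution_right_with_param_comp (n := ⊤) (μ := volume)
    (ContinuousLinearMap.mul ℝ ℝ) (s := s ×ˢ (univ : Set E3)) (v := fun _ => (0 : E3))
    contDiffOn_const (f := f) (g := g) (k := Metric.closedBall 0 (R + 1))
    (hs.prod isOpen_univ) (isCompact_closedBall _ _) (fun p x _ hx => by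
      have : χ x = 0 := χ.zero_of_le_dist (not_le.1 hx).le
      simp [g, this]) hf.locallyIntegrable hg
  refine this.congr fun p _ => ?_
  simp only [conv, convolution, ContinuousLinearMap.mul_apply', g]
  refine integral_congr_ae (Eventually.of_forall fun y => ?_)
  by_cases hy : R ≤ ‖y‖
  · simp [hsupp y hy]
  · have : χ (0 - y) = 1 := χ.one_of_mem_closedBall (by simpa [χ] using (not_le.1 hy).le)
    simp only [this]
    rw [one_mul, mul_comm, zero_sub, ← sub_eq_add_neg]

lemma contDiff_conv {K f : E3 → ℝ} (hK : ContDiff ℝ ∞ K)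
    (hf : Integrable f) {R : ℝ} (hR : 0 < R) (hsupp : ∀ y, R ≤ ‖y‖ → f y = 0) :
    ContDiff ℝ ∞ (conv K f) := by
  have := contDiffOn_conv_param (H := fun _ => K) (s := univ) isOpen_univ
    (hK.comp contDiff_snd).contDiffOn hf hR hsupp
  rw [univ_prod_univ, contDiffOn_univ] at this
  exact this.comp (contDiff_prodMk_right (0 : ℝ))

/-- Only |y| < R matters, so F' is bounded on the compact set of relevant (s, y) and a multiple of
|f| dominates the difference quotients. -/
lemma hasDerivAt_integral_of_support {F F' : ℝ → E3 → ℝ} {f : E3 → ℝ} {R a δ : ℝ} (hδ : 0 < δ)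
    (hf : Integrable f) (hsupp : ∀ y, R ≤ ‖y‖ → f y = 0)
    (hd : ∀ s ∈ Metric.closedBall a δ, ∀ y, HasDerivAt (fun r => F r y) (F' s y) s)
    (hF : ∀ s ∈ Metric.closedBall a δ, Continuous (F s))
    (hF' : ContinuousOn (Function.uncurry F') (Metric.closedBall a δ ×ˢ univ)) :
    HasDerivAt (fun s => ∫ y, F s y * f y) (∫ y, F' a y * f y) a := by
  have ha : a ∈ Metric.closedBall a δ := Metric.mem_closedBall_self hδ.le
  have hcomp : IsCompact (Metric.closedBall a δ ×ˢ Metric.closedBall (0 : E3) R) :=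
    (isCompact_closedBall _ _).prod (isCompact_closedBall _ _)
  obtain ⟨C, hC⟩ := hcomp.exists_bound_of_continuousOn
    (hF'.mono (prod_mono_right (subset_univ _)))
  have hFc : Continuous (F' a) := by
    rw [← continuousOn_univ]
    exact hF'.comp (f := fun y : E3 => (a, y)) (by fun_prop) (fun y _ => ⟨ha, mem_univ _⟩)
  have hsub : ∀ g : E3 → ℝ, Continuous g → Integrable fun y => g y * f y := by
    intro g hg
    obtain ⟨M, hM⟩ := (isCompact_closedBall (0 : E3) R).exists_bound_of_continuousOn hg.continuousOn
    refine (hf.norm.const_mul M).mono' (hg.aestronglyMeasurable.mul hf.aestronglyMeasurable)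
      (Eventually.of_forall fun y => ?_)
    by_cases hy : R ≤ ‖y‖
    · simp [hsupp y hy]
    · rw [norm_mul]
      exact mul_le_mul_of_nonneg_right (hM y (by simpa using (not_le.1 hy).le)) (norm_nonneg _)
  refine (hasDerivAt_integral_of_dominated_loc_of_deriv_le (𝕜 := ℝ) (F := fun s y => F s y * f y)
    (F' := fun s y => F' s y * f y) (bound := fun y => C * ‖f y‖)
    (Metric.closedBall_mem_nhds a hδ) ?_ (hsub _ (hF a ha)) (hsub _ hFc).aestronglyMeasurable ?_
    (hf.norm.const_mul C) ?_).2
  · filter_upwards [Metric.closedBall_mem_nhds a hδ] with s hs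
    exact (hsub _ (hF s hs)).aestronglyMeasurable
  · refine Eventually.of_forall fun y s hs => ?_
    by_cases hy : R ≤ ‖y‖
    · simp [hsupp y hy]
    · rw [norm_mul]
      exact mul_le_mul_of_nonneg_right (hC (s, y) ⟨hs, by simpa using (not_le.1 hy).le⟩)
        (norm_nonneg _)
  · exact Eventually.of_forall fun y s hs => (hd s hs y).mul_const _

lemma hasDerivAt_line {K : E3 → ℝ} (hK : Differentiable ℝ K) (k : Fin 3) (x : E3) (s : ℝ) :
    HasDerivAt (fun r : ℝ => K (x + r • basisVec k)) (pderiv k K (x + s • basisVec k)) s := by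
  have h2 : HasDerivAt (fun r : ℝ => x + r • basisVec k) (basisVec k) s := by
    simpa using ((hasDerivAt_id s).smul_const (basisVec k)).const_add x
  exact (hK _).hasFDerivAt.comp_hasDerivAt s h2

lemma pderiv_conv {K f : E3 → ℝ} (hK : ContDiff ℝ ∞ K)
    (hf : Integrable f) {R : ℝ} (hR : 0 < R) (hsupp : ∀ y, R ≤ ‖y‖ → f y = 0) (k : Fin 3) :
    pderiv k (conv K f) = conv (pderiv k K) f := by
  funext x
  have h1 := pderiv_eq_deriv k ((contDiff_conv hK hf hR hsupp).differentiable (by simp) x)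
  refine h1.unique ?_
  have hc : Continuous (pderiv k K) := (contDiff_top_pderiv k hK).continuous
  have := hasDerivAt_integral_of_support (a := 0) (δ := 1) (f := f) (R := R)
    (F := fun s y => K ((x - y) + s • basisVec k))
    (F' := fun s y => pderiv k K ((x - y) + s • basisVec k)) one_pos hf hsupp
    (fun s _ y => hasDerivAt_line (hK.differentiable (by simp)) k _ s)
    (fun s _ => hK.continuous.comp (by fun_prop))
    (Continuous.continuousOn (hc.comp (by fun_prop)))
  simp only [zero_smul, add_zero] at this
  refine this.congr_of_eventuallyEq (Eventually.of_forall fun s => ?_)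
  simp only [conv]
  congr 1; funext y; rw [add_sub_right_comm]

lemma conv_comm (K f : E3 → ℝ) (x : E3) : conv K f x = ∫ z, K z * f (x - z) := by
  simp only [conv]
  rw [← integral_sub_left_eq_self (fun z => K z * f (x - z)) volume x]
  simp

/-! ### The heat kernel: derivatives, heat equation, semigroup law. -/

/-- The heat kernel on `ℝ³`. -/
def heat (t : ℝ) (x : E3) : ℝ :=
  (4 * Real.pi * t) ^ (-(3 / 2) : ℝ) * Real.exp (-(4 * t)⁻¹ * ‖x‖ ^ 2)

lemma heat_pos {t : ℝ} (ht : 0 < t) (x : E3) : 0 < heat t x := by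
  have := Real.pi_pos
  unfold heat; positivity

lemma heat_le {t : ℝ} (ht : 0 < t) (x : E3) : heat t x ≤ (4 * Real.pi * t) ^ (-(3 / 2) : ℝ) := by
  have := Real.pi_pos
  refine mul_le_of_le_one_right (by positivity) (Real.exp_le_one_iff.2 ?_)
  have : 0 ≤ (4 * t)⁻¹ * ‖x‖ ^ 2 := by positivity
  linarith

lemma heat_neg (t : ℝ) (x : E3) : heat t (-x) = heat t x := by simp [heat]

lemma heat_sub_comm (t : ℝ) (x y : E3) : heat t (x - y) = heat t (y - x) := by
  rw [← heat_neg, neg_sub]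

lemma contDiff_heat (t : ℝ) : ContDiff ℝ ∞ (heat t) := by
  unfold heat
  exact contDiff_const.mul (contDiff_const.mul (contDiff_norm_sq ℝ)).exp

lemma contDiffOn_heat : ContDiffOn ℝ ∞ (fun p : ℝ × E3 => heat p.1 p.2) (Ioi 0 ×ˢ univ) := by
  intro p hp
  have hp : 0 < p.1 := hp.1
  have := Real.pi_pos
  apply ContDiffAt.contDiffWithinAt
  unfold heat
  refine ContDiffAt.mul ?_ ?_
  · refine ContDiffAt.rpow_const_of_ne ?_ (by positivity)
    exact contDiffAt_const.mul contDiffAt_fst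
  · refine (ContDiffAt.mul ?_ ?_).exp
    · exact ((contDiffAt_const.mul contDiffAt_fst).inv (by positivity)).neg
    · exact (contDiff_norm_sq ℝ).contDiffAt.comp p contDiffAt_snd

lemma integrable_heat {t : ℝ} (ht : 0 < t) : Integrable (heat t) := by
  unfold heat
  have : Integrable fun x : E3 => Real.exp (-(4 * t)⁻¹ * ‖x‖ ^ 2) := by
    have h := (GaussianFourier.integrable_cexp_neg_mul_sq_norm_add (V := E3)
      (b := ((4 * t)⁻¹ : ℝ)) (by simpa using ht) 0 0).norm
    refine h.congr (Eventually.of_forall fun x => ?_)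
    simp only [Complex.norm_exp]
    congr 1
    have e : -(((4 * t)⁻¹ : ℝ) : ℂ) * (‖x‖ : ℂ) ^ 2 + 0 * ((inner ℝ 0 x : ℝ) : ℂ)
        = ((-(4 * t)⁻¹ * ‖x‖ ^ 2 : ℝ) : ℂ) := by push_cast; ring
    rw [e, Complex.ofReal_re]
  exact this.const_mul _

lemma integral_heat {t : ℝ} (ht : 0 < t) : ∫ x, heat t x = 1 := by
  unfold heat
  rw [integral_const_mul, GaussianFourier.integral_rexp_neg_mul_sq_norm (by positivity)]
  have hpi := Real.pi_pos
  have : Real.pi / (4 * t)⁻¹ = 4 * Real.pi * t := by field_simp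
  rw [this, ← Real.rpow_add (by positivity)]
  simp

lemma hasFDerivAt_norm_sq_E3 (x : E3) :
    HasFDerivAt (fun y : E3 => ‖y‖ ^ 2) (2 • (innerSL ℝ x)) x := by
  simpa using (hasStrictFDerivAt_norm_sq x).hasFDerivAt

lemma pderiv_heat (t : ℝ) (k : Fin 3) :
    pderiv k (heat t) = fun x => -(2 * t)⁻¹ * x k * heat t x := by
  funext x
  have h1 := ((hasFDerivAt_norm_sq_E3 x).const_mul (-(4 * t)⁻¹)).exp.const_mul
    ((4 * Real.pi * t) ^ (-(3 / 2) : ℝ))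
  simp only [pderiv]
  unfold heat
  rw [h1.fderiv]
  simp only [_root_.smul_apply, innerSL_apply_apply, smul_eq_mul, nsmul_eq_mul,
    EuclideanSpace.inner_single_right, mul_inv]
  simp
  ring

lemma pderiv_mul {f g : E3 → ℝ} (k : Fin 3) {x : E3} (hf : DifferentiableAt ℝ f x)
    (hg : DifferentiableAt ℝ g x) :
    pderiv k (fun y => f y * g y) x = f x * pderiv k g x + pderiv k f x * g x := by
  simp only [pderiv]
  rw [(hf.hasFDerivAt.fun_mul hg.hasFDerivAt).fderiv]
  simp [mul_comm]

lemma pderiv_coord (k l : Fin 3) (c : ℝ) (x : E3) :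
    pderiv k (fun y => c * y l) x = if l = k then c else 0 := by
  have : HasFDerivAt (fun y : E3 => c * y l) (c • (EuclideanSpace.proj l : E3 →L[ℝ] ℝ)) x :=
    ((EuclideanSpace.proj l : E3 →L[ℝ] ℝ).hasFDerivAt).const_mul c
  simp only [pderiv]
  rw [this.fderiv]
  simp

lemma pderiv_pderiv_heat (t : ℝ) (k l : Fin 3) :
    pderiv l (pderiv k (heat t)) = fun x =>
      ((2 * t)⁻¹ ^ 2 * x k * x l - (2 * t)⁻¹ * (if k = l then 1 else 0)) * heat t x := by
  funext x
  rw [pderiv_heat, pderiv_mul l (by fun_prop) ((contDiff_heat t).differentiable (by simp) x),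
    pderiv_coord, pderiv_heat]
  split_ifs <;> ring

lemma pderiv3_heat (t : ℝ) (i k l : Fin 3) :
    pderiv i (pderiv l (pderiv k (heat t))) = fun x =>
      (-(2 * t)⁻¹ ^ 3 * x k * x l * x i + (2 * t)⁻¹ ^ 2 * ((if k = l then 1 else 0) * x i +
        (if k = i then 1 else 0) * x l + (if l = i then 1 else 0) * x k)) * heat t x := by
  funext x
  have h1 : pderiv i (fun x : E3 => (2 * t)⁻¹ ^ 2 * x k * x l
      - (2 * t)⁻¹ * (if k = l then 1 else 0)) x
      = (2 * t)⁻¹ ^ 2 * ((if k = i then 1 else 0) * x l + (if l = i then 1 else 0) * x k) := by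
    have h2 : HasFDerivAt (fun y : E3 => (2 * t)⁻¹ ^ 2 * y k)
        ((2 * t)⁻¹ ^ 2 • (EuclideanSpace.proj k : E3 →L[ℝ] ℝ)) x :=
      ((EuclideanSpace.proj k : E3 →L[ℝ] ℝ).hasFDerivAt).const_mul _
    have h3 : HasFDerivAt (fun y : E3 => y l) ((EuclideanSpace.proj l : E3 →L[ℝ] ℝ)) x :=
      ((EuclideanSpace.proj l : E3 →L[ℝ] ℝ).hasFDerivAt)
    have h4 := (h2.fun_mul h3).sub_const ((2 * t)⁻¹ * (if k = l then (1 : ℝ) else 0))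
    simp only [pderiv]
    rw [h4.fderiv]
    simp
    split_ifs <;> ring
  rw [pderiv_pderiv_heat, pderiv_mul i (by fun_prop) ((contDiff_heat t).differentiable (by simp) x),
    h1, pderiv_heat]
  split_ifs <;> ring

lemma hasDerivAt_heat {t : ℝ} (ht : 0 < t) (x : E3) :
    HasDerivAt (fun s => heat s x) (∑ k, pderiv k (pderiv k (heat t)) x) t := by
  have hpi := Real.pi_pos
  have h1 : HasDerivAt (fun s : ℝ => (4 * Real.pi * s) ^ (-(3 / 2) : ℝ))
      ((4 * Real.pi * 1) * (-(3 / 2) : ℝ) * (4 * Real.pi * t) ^ (-(3 / 2) - 1 : ℝ)) t :=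
    ((hasDerivAt_id t).const_mul (4 * Real.pi)).rpow_const (Or.inl (by simp; positivity))
  have h2 : HasDerivAt (fun s : ℝ => Real.exp (-(4 * s)⁻¹ * ‖x‖ ^ 2)) _ t :=
    (((((hasDerivAt_id t).const_mul 4).inv (by simp; positivity)).neg).mul_const (‖x‖ ^ 2)).exp
  refine (h1.mul h2).congr_deriv ?_
  have h3 : (4 * Real.pi * t) ^ (-(3 / 2) - 1 : ℝ)
      = (4 * Real.pi * t) ^ (-(3 / 2) : ℝ) * (4 * Real.pi * t)⁻¹ := by
    rw [Real.rpow_sub_one (by positivity), div_eq_mul_inv]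
  have h4 : ‖x‖ ^ 2 = x 0 ^ 2 + x 1 ^ 2 + x 2 ^ 2 := by
    rw [EuclideanSpace.norm_sq_eq, Fin.sum_univ_three]; simp
  simp only [pderiv_pderiv_heat, Fin.sum_univ_three, heat, h3, id, if_true]
  simp only [Pi.inv_apply, Pi.neg_apply]
  rw [h4]
  field_simp
  ring

/-- The parallelogram identity |x-y|² + |x-z|² = |y-z|²/2 + 2|x-(y+z)/2|² separates the exponents.
Integrating in x gives the semigroup law. -/
lemma heat_mul_heat {t : ℝ} (ht : 0 < t) (x y z : E3) :
    heat t (x - y) * heat t (x - z)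
      = heat (2 * t) (y - z) * heat (t / 2) (x - (2 : ℝ)⁻¹ • (y + z)) := by
  have hpi := Real.pi_pos
  have hn : ∀ w : E3, ‖w‖ ^ 2 = w 0 ^ 2 + w 1 ^ 2 + w 2 ^ 2 := fun w => by
    rw [EuclideanSpace.norm_sq_eq, Fin.sum_univ_three]; simp
  have hc : (4 * Real.pi * t) ^ (-(3 / 2) : ℝ) * (4 * Real.pi * t) ^ (-(3 / 2) : ℝ)
      = (4 * Real.pi * (2 * t)) ^ (-(3 / 2) : ℝ) * (4 * Real.pi * (t / 2)) ^ (-(3 / 2) : ℝ) := by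
    rw [← Real.mul_rpow (by positivity) (by positivity),
      ← Real.mul_rpow (by positivity) (by positivity)]
    congr 1; ring
  unfold heat
  rw [mul_mul_mul_comm, ← Real.exp_add, hc, mul_mul_mul_comm _ (Real.exp _), ← Real.exp_add]
  congr 2
  simp only [hn]
  simp
  field_simp
  ring

lemma integral_heat_mul_heat {t : ℝ} (ht : 0 < t) (y z : E3) :
    ∫ x, heat t (x - y) * heat t (x - z) = heat (2 * t) (y - z) := by
  simp_rw [heat_mul_heat ht]
  rw [integral_const_mul, integral_sub_right_eq_self (heat (t / 2)), integral_heat (by positivity),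
    mul_one]

/-! ### The Bellman function -/

/-- The function `u ^ p + v ^ q`. -/
def powSum (p q u v : ℝ) : ℝ := u ^ p + v ^ q

/-- The constant in the Bellman function. -/
def bellmanConst (q : ℝ) : ℝ := (5 * q ^ 2 + 1) / (q * (q - 1))

/-- The Bellman function `K v ^ q + u² (u ^ p + v ^ q) ^ (1 - 2 / p)`. -/
def bellman (p q u v : ℝ) : ℝ :=
  bellmanConst q * v ^ q + u ^ 2 * powSum p q u v ^ (1 - 2 / p)

/-- The partial derivative of the Bellman function in its first variable. -/
def bellmanU (p q u v : ℝ) : ℝ :=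
  2 * u * powSum p q u v ^ (1 - 2 / p)
    + u ^ 2 * ((1 - 2 / p) * powSum p q u v ^ (1 - 2 / p - 1) * (p * u ^ (p - 1)))

/-- The partial derivative of the Bellman function in its second variable. -/
def bellmanV (p q u v : ℝ) : ℝ :=
  bellmanConst q * (q * v ^ (q - 1))
    + u ^ 2 * ((1 - 2 / p) * powSum p q u v ^ (1 - 2 / p - 1) * (q * v ^ (q - 1)))

/-- The second partial derivative of the Bellman function in its first variable. -/
def bellmanUU (p q u v : ℝ) : ℝ :=
  2 * powSum p q u v ^ (1 - 2 / p)
    + 4 * u * ((1 - 2 / p) * powSum p q u v ^ (1 - 2 / p - 1) * (p * u ^ (p - 1)))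
    + u ^ 2 * ((1 - 2 / p) * powSum p q u v ^ (1 - 2 / p - 1) * (p * ((p - 1) * u ^ (p - 1 - 1))))
    + u ^ 2 * ((1 - 2 / p) * ((1 - 2 / p - 1) * powSum p q u v ^ (1 - 2 / p - 1 - 1))
      * (p * u ^ (p - 1)) ^ 2)

/-- The mixed second partial derivative of the Bellman function. -/
def bellmanUV (p q u v : ℝ) : ℝ :=
  2 * u * ((1 - 2 / p) * powSum p q u v ^ (1 - 2 / p - 1) * (q * v ^ (q - 1)))
    + u ^ 2 * ((1 - 2 / p) * ((1 - 2 / p - 1) * powSum p q u v ^ (1 - 2 / p - 1 - 1))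
      * (p * u ^ (p - 1)) * (q * v ^ (q - 1)))

/-- The second partial derivative of the Bellman function in its second variable. -/
def bellmanVV (p q u v : ℝ) : ℝ :=
  bellmanConst q * (q * ((q - 1) * v ^ (q - 1 - 1)))
    + u ^ 2 * ((1 - 2 / p) * powSum p q u v ^ (1 - 2 / p - 1) * (q * ((q - 1) * v ^ (q - 1 - 1))))
    + u ^ 2 * ((1 - 2 / p) * ((1 - 2 / p - 1) * powSum p q u v ^ (1 - 2 / p - 1 - 1))
      * (q * v ^ (q - 1)) ^ 2)

section Derivatives

variable {p q : ℝ} {u v : ℝ → ℝ} {u' v' s : ℝ}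

lemma powSum_pos {a b : ℝ} (ha : 0 < a) (hb : 0 < b) : 0 < powSum p q a b := by
  unfold powSum; positivity

lemma hasDerivAt_rpow_comp (r : ℝ) (hu : HasDerivAt u u' s) (h0 : 0 < u s) :
    HasDerivAt (fun x => u x ^ r) (r * u s ^ (r - 1) * u') s :=
  (hu.rpow_const (p := r) (Or.inl h0.ne')).congr_deriv (by ring)

lemma hasDerivAt_powSum (hu : HasDerivAt u u' s) (hv : HasDerivAt v v' s)
    (hu0 : 0 < u s) (hv0 : 0 < v s) :
    HasDerivAt (fun x => powSum p q (u x) (v x))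
      (p * u s ^ (p - 1) * u' + q * v s ^ (q - 1) * v') s :=
  (hasDerivAt_rpow_comp p hu hu0).add (hasDerivAt_rpow_comp q hv hv0)

lemma hasDerivAt_bellman (hu : HasDerivAt u u' s) (hv : HasDerivAt v v' s)
    (hu0 : 0 < u s) (hv0 : 0 < v s) :
    HasDerivAt (fun x => bellman p q (u x) (v x))
      (bellmanU p q (u s) (v s) * u' + bellmanV p q (u s) (v s) * v') s := by
  have hS := hasDerivAt_rpow_comp (1 - 2 / p) (hasDerivAt_powSum (p := p) (q := q) hu hv hu0 hv0)
    (powSum_pos hu0 hv0)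
  refine (((hasDerivAt_rpow_comp q hv hv0).const_mul (bellmanConst q)).add
    ((hu.fun_pow 2).fun_mul hS)).congr_deriv ?_
  simp only [bellmanU, bellmanV]
  push_cast
  ring

lemma hasDerivAt_bellmanU (hu : HasDerivAt u u' s) (hv : HasDerivAt v v' s)
    (hu0 : 0 < u s) (hv0 : 0 < v s) :
    HasDerivAt (fun x => bellmanU p q (u x) (v x))
      (bellmanUU p q (u s) (v s) * u' + bellmanUV p q (u s) (v s) * v') s := by
  have hP := hasDerivAt_powSum (p := p) (q := q) hu hv hu0 hv0
  have hS := hasDerivAt_rpow_comp (1 - 2 / p) hP (powSum_pos hu0 hv0)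
  have hS1 := hasDerivAt_rpow_comp (1 - 2 / p - 1) hP (powSum_pos hu0 hv0)
  have hU := (hasDerivAt_rpow_comp (p - 1) hu hu0).const_mul p
  refine (((hu.const_mul 2).fun_mul hS).add
    ((hu.fun_pow 2).fun_mul ((hS1.const_mul (1 - 2 / p)).fun_mul hU))).congr_deriv ?_
  simp only [bellmanUU, bellmanUV]
  push_cast
  ring

lemma hasDerivAt_bellmanV (hu : HasDerivAt u u' s) (hv : HasDerivAt v v' s)
    (hu0 : 0 < u s) (hv0 : 0 < v s) :
    HasDerivAt (fun x => bellmanV p q (u x) (v x))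
      (bellmanUV p q (u s) (v s) * u' + bellmanVV p q (u s) (v s) * v') s := by
  have hP := hasDerivAt_powSum (p := p) (q := q) hu hv hu0 hv0
  have hS1 := hasDerivAt_rpow_comp (1 - 2 / p - 1) hP (powSum_pos hu0 hv0)
  have hV := (hasDerivAt_rpow_comp (q - 1) hv hv0).const_mul q
  refine ((hV.const_mul (bellmanConst q)).add
    ((hu.fun_pow 2).fun_mul ((hS1.const_mul (1 - 2 / p)).fun_mul hV))).congr_deriv ?_
  simp only [bellmanVV, bellmanUV]
  push_cast
  ring

end Derivatives

section Convexity

variable {p q : ℝ} {u v : ℝ}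

/-- Since u² = (u^p)^(2/p), it is at most the power 2/p of the sum. This controls the size of the
Bellman function and, through S·W below, its second derivatives. -/
lemma sq_mul_powSum_rpow_le (hp : 2 ≤ p) (hu : 0 < u) (hv : 0 < v) :
    u ^ 2 * powSum p q u v ^ (1 - 2 / p) ≤ powSum p q u v := by
  have hS := powSum_pos (p := p) (q := q) hu hv
  have h1 : u ^ 2 ≤ powSum p q u v ^ (2 / p) := by
    have : u ^ 2 = (u ^ p) ^ (2 / p) := by
      rw [← Real.rpow_mul hu.le, mul_div_cancel₀ _ (by positivity)]; norm_num
    rw [this]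
    refine Real.rpow_le_rpow (by positivity) ?_ (by positivity)
    have : 0 < v ^ q := by positivity
    unfold powSum; linarith
  calc u ^ 2 * powSum p q u v ^ (1 - 2 / p)
      ≤ powSum p q u v ^ (2 / p) * powSum p q u v ^ (1 - 2 / p) := by gcongr
    _ = powSum p q u v := by rw [← Real.rpow_add hS]; simp

/-- Write S = u^p + v^q and T = S^(1-2/p). The u-u entry of the Hessian is at least 2T, the v-v
entry at least (4q²+1) v^(q-2), and the square of the mixed entry is at most 4q² v^(q-2) T. Hence T
x² and 4q² v^(q-2) y² together absorb the mixed term, and one further copy of T x² and of v^(q-2) y²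
is left over. -/
lemma bellman_hessian_ge (hp : 2 ≤ p) (hpq : p.HolderConjugate q) (hu : 0 < u) (hv : 0 < v)
    (x y : ℝ) :
    powSum p q u v ^ (1 - 2 / p) * x ^ 2 + v ^ (q - 2) * y ^ 2
      ≤ bellmanUU p q u v * x ^ 2 + 2 * bellmanUV p q u v * x * y + bellmanVV p q u v * y ^ 2 := by
  have hq : 1 < q := hpq.symm.lt
  have hS := powSum_pos (p := p) (q := q) hu hv
  have hm := sq_mul_powSum_rpow_le (q := q) hp hu hv
  set θ := 1 - 2 / p with hθ
  -- This identity merges the terms that contain the second derivative of S^θ with the others: the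
  -- u-u entry becomes a sum of nonnegative terms and the mixed entry becomes a multiple of D = v^q.
  have hθp : (θ - 1) * p = -2 := by rw [hθ]; field_simp; norm_num
  have hθ0 : 0 ≤ θ := by
    have : 2 / p ≤ 1 := (div_le_one (by linarith)).2 hp
    linarith
  have hθ1 : θ ≤ 1 := by
    have : 0 ≤ 2 / p := by positivity
    linarith
  set S := powSum p q u v with hSdef
  set W := S ^ (θ - 1 - 1) with hW
  have hW0 : 0 < W := by positivity
  have e1 : S ^ (θ - 1) = S * W := by
    rw [hW, Real.rpow_sub_one hS.ne' (θ - 1)]; field_simp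
  have e0 : S ^ θ = S ^ 2 * W := by
    have : S ^ (θ - 1) = S ^ θ / S := Real.rpow_sub_one hS.ne' θ
    rw [e1] at this; field_simp at this; rw [← this]
  set U1 := u ^ (p - 1) with hU1
  set U2 := u ^ (p - 1 - 1) with hU2
  set V1 := v ^ (q - 1) with hV1
  set V2 := v ^ (q - 1 - 1) with hV2
  set A := u ^ p with hA
  set D := v ^ q with hD
  have hA0 : 0 < A := by positivity
  have hD0 : 0 < D := by positivity
  have hV20 : 0 < V2 := by positivity
  have hSAD : S = A + D := rfl
  have a1 : u * U1 = A := by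
    rw [hU1, Real.rpow_sub_one hu.ne']; field_simp; rfl
  have a2 : u * U2 = U1 := by
    rw [hU2, Real.rpow_sub_one hu.ne']; field_simp; rfl
  have b1 : v * V1 = D := by
    rw [hV1, Real.rpow_sub_one hv.ne']; field_simp; rfl
  have b2 : v * V2 = V1 := by
    rw [hV2, Real.rpow_sub_one hv.ne']; field_simp; rfl
  have hV2' : v ^ (q - 2) = V2 := by rw [hV2]; congr 1; ring
  have b3 : V1 ^ 2 = D * V2 := by rw [← b1, ← b2]; ring
  have eUU : bellmanUU p q u v = 2 * (S ^ 2 * W) + θ * p * A * W * ((p + 1) * S + 2 * D) := by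
    simp only [bellmanUU]
    rw [← hSdef, ← hθ, ← hW, e1, e0, ← hU1, ← hU2]
    have : u ^ 2 * U2 = A := by rw [← a1, ← a2]; ring
    calc _ = 2 * (S ^ 2 * W) + 4 * θ * p * (u * U1) * (S * W)
          + θ * p * (p - 1) * (u ^ 2 * U2) * (S * W)
          + θ * p * ((θ - 1) * p) * W * (u * U1) ^ 2 := by ring
      _ = _ := by rw [a1, this, hθp, hSAD]; ring
  have eUV : bellmanUV p q u v = 2 * θ * q * u * V1 * W * D := by
    simp only [bellmanUV]
    rw [← hSdef, ← hθ, ← hW, e1, ← hU1, ← hV1]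
    calc _ = 2 * u * θ * q * V1 * (S * W) + θ * q * u * V1 * ((θ - 1) * p) * W * (u * U1) := by ring
      _ = _ := by rw [a1, hθp, hSAD]; ring
  -- The constant is chosen for this identity. Of 5q² + 1, one q² pays for the negative term with
  -- θ(θ-1), 4q² absorbs the mixed derivative and 1 survives.
  have hKq : bellmanConst q * q * (q - 1) = 5 * q ^ 2 + 1 := by
    have : q - 1 ≠ 0 := by linarith
    unfold bellmanConst; field_simp
  have eVV : bellmanVV p q u v = V2 * (5 * q ^ 2 + 1 + θ * q * (q - 1) * (u ^ 2 * (S * W))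
      + θ * (θ - 1) * q ^ 2 * (u ^ 2 * (W * D))) := by
    simp only [bellmanVV]
    rw [← hSdef, ← hθ, ← hW, e1, ← hV1, ← hV2, ← hKq]
    calc _ = bellmanConst q * (q * ((q - 1) * V2))
          + u ^ 2 * (θ * (S * W) * (q * ((q - 1) * V2)))
          + u ^ 2 * (θ * ((θ - 1) * W) * (q ^ 2 * V1 ^ 2)) := by ring
      _ = _ := by rw [b3]; ring
  have m1 : u ^ 2 * (S * W) ≤ 1 := by
    rw [e0] at hm
    have : S * (u ^ 2 * (S * W)) ≤ S * 1 := by linarith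
    exact le_of_mul_le_mul_left this hS
  have m0 : 0 ≤ u ^ 2 * (S * W) := by positivity
  have hDS : D ≤ S := by linarith
  have m2 : u ^ 2 * (W * D) ≤ 1 := by
    refine le_trans ?_ m1
    have : W * D ≤ S * W := by rw [mul_comm]; gcongr
    gcongr
  have m20 : 0 ≤ u ^ 2 * (W * D) := by positivity
  have hUUge : 2 * (S ^ 2 * W) ≤ bellmanUU p q u v := by
    rw [eUU]
    have : 0 ≤ θ * p * A * W * ((p + 1) * S + 2 * D) := by positivity
    linarith
  have hVVge : V2 * (4 * q ^ 2 + 1) ≤ bellmanVV p q u v := by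
    rw [eVV]
    refine mul_le_mul_of_nonneg_left ?_ hV20.le
    have h1 : 0 ≤ θ * q * (q - 1) * (u ^ 2 * (S * W)) :=
      mul_nonneg (mul_nonneg (mul_nonneg hθ0 (by linarith)) (by linarith)) m0
    have h2 : θ * (1 - θ) * (u ^ 2 * (W * D)) ≤ 1 := by
      have : θ * (1 - θ) ≤ 1 := mul_le_one₀ hθ1 (by linarith only [hθ1]) (by linarith only [hθ0])
      calc θ * (1 - θ) * (u ^ 2 * (W * D)) ≤ 1 * 1 :=
            mul_le_mul this m2 m20 (by norm_num)
        _ = 1 := by norm_num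
    have h3 : q ^ 2 * (θ * (1 - θ) * (u ^ 2 * (W * D))) ≤ q ^ 2 * 1 := by gcongr
    have h4 : θ * (θ - 1) * q ^ 2 * (u ^ 2 * (W * D))
        = -(q ^ 2 * (θ * (1 - θ) * (u ^ 2 * (W * D)))) := by ring
    rw [h4]
    linarith
  have hUVsq : bellmanUV p q u v ^ 2 ≤ 4 * q ^ 2 * V2 * (S ^ 2 * W) := by
    rw [eUV]
    calc (2 * θ * q * u * V1 * W * D) ^ 2 = 4 * q ^ 2 * θ ^ 2 * V1 ^ 2 * (u ^ 2 * (W * D)) * (W * D) := by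
          ring
      _ = 4 * q ^ 2 * V2 * (θ ^ 2 * (u ^ 2 * (W * D)) * (W * D ^ 2)) := by rw [b3]; ring
      _ ≤ 4 * q ^ 2 * V2 * (1 * 1 * (S ^ 2 * W)) := by
          have : θ ^ 2 ≤ 1 := pow_le_one₀ hθ0 hθ1
          have : W * D ^ 2 ≤ S ^ 2 * W := by rw [mul_comm]; gcongr
          gcongr
      _ = _ := by ring
  rw [e0, hV2']
  have hT : 0 < S ^ 2 * W := by positivity
  set T := S ^ 2 * W
  set M := bellmanUV p q u v
  have key : 0 ≤ T * x ^ 2 + 2 * M * x * y + 4 * q ^ 2 * V2 * y ^ 2 := by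
    have h4 : 0 ≤ T * (T * x ^ 2 + 2 * M * x * y + 4 * q ^ 2 * V2 * y ^ 2) := by
      have : T * (T * x ^ 2 + 2 * M * x * y + 4 * q ^ 2 * V2 * y ^ 2)
        = (T * x + M * y) ^ 2 + (4 * q ^ 2 * V2 * T - M ^ 2) * y ^ 2 := by ring
      rw [this]
      have : 0 ≤ 4 * q ^ 2 * V2 * T - M ^ 2 := by linarith
      positivity
    exact nonneg_of_mul_nonneg_right h4 hT
  have k1 := mul_le_mul_of_nonneg_right hUUge (sq_nonneg x)
  have k2 := mul_le_mul_of_nonneg_right hVVge (sq_nonneg y)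
  have k3 : V2 * (4 * q ^ 2 + 1) * y ^ 2 = 4 * q ^ 2 * V2 * y ^ 2 + V2 * y ^ 2 := by ring
  linarith

/-- The form bounding the Hessian of the Bellman function from below has determinant at least one. -/
lemma one_le_powSum_rpow_mul (hp : 2 ≤ p) (hpq : p.HolderConjugate q) (hu : 0 < u) (hv : 0 < v) :
    1 ≤ powSum p q u v ^ (1 - 2 / p) * v ^ (q - 2) := by
  have hq : 1 < q := hpq.symm.lt
  -- By conjugacy, v^q ≤ S raised to the power 1 - 2/p reads v^(2-q) ≤ S^(1-2/p).
  have h1 : q * (1 - 2 / p) = 2 - q := by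
    have := hpq.inv_add_inv_eq_one
    have hq0 : q ≠ 0 := by linarith
    have hpinv : p⁻¹ = 1 - q⁻¹ := by linarith
    rw [div_eq_mul_inv, hpinv]; field_simp; ring
  have h2 : v ^ (2 - q) ≤ powSum p q u v ^ (1 - 2 / p) := by
    rw [← h1, Real.rpow_mul hv.le]
    refine Real.rpow_le_rpow (by positivity) ?_ ?_
    · have : 0 < u ^ p := by positivity
      unfold powSum; linarith
    · have : 2 / p ≤ 1 := (div_le_one (by linarith)).2 hp
      linarith
  calc (1 : ℝ) = v ^ (2 - q) * v ^ (q - 2) := by rw [← Real.rpow_add hv]; simp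
    _ ≤ _ := by gcongr

lemma bellman_nonneg (hq : 1 < q) (hu : 0 < u) (hv : 0 < v) : 0 ≤ bellman p q u v := by
  have := powSum_pos (p := p) (q := q) hu hv
  have : 0 < q - 1 := by linarith
  unfold bellman bellmanConst; positivity

lemma bellmanConst_nonneg (hq : 1 < q) : 0 ≤ bellmanConst q := by
  have : 0 < q - 1 := by linarith
  unfold bellmanConst; positivity

lemma bellman_le (hp : 2 ≤ p) (hq : 1 < q) (hu : 0 < u) (hv : 0 < v) :
    bellman p q u v ≤ (bellmanConst q + 1) * (u ^ p + v ^ q) := by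
  have h1 := sq_mul_powSum_rpow_le (q := q) hp hu hv
  have h2 : 0 ≤ bellmanConst q * u ^ p := mul_nonneg (bellmanConst_nonneg hq) (by positivity)
  unfold bellman
  unfold powSum at h1 ⊢
  nlinarith

lemma contDiffAt_bellman {x : ℝ × ℝ} (hu : 0 < x.1) (hv : 0 < x.2) :
    ContDiffAt ℝ ∞ (fun z : ℝ × ℝ => bellman p q z.1 z.2) x := by
  unfold bellman powSum
  have h1 : ContDiffAt ℝ ∞ (fun z : ℝ × ℝ => z.1 ^ p) x := contDiffAt_fst.rpow_const_of_ne hu.ne'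
  have h2 : ContDiffAt ℝ ∞ (fun z : ℝ × ℝ => z.2 ^ q) x := contDiffAt_snd.rpow_const_of_ne hv.ne'
  refine (contDiffAt_const.mul h2).add ((contDiffAt_fst.pow 2).mul
    ((h1.add h2).rpow_const_of_ne ?_))
  have : 0 < x.1 ^ p + x.2 ^ q := by positivity
  exact this.ne'

end Convexity

/-! ### Bounded functions with bounded support and their heat extensions. -/

/-- Bounded measurable functions with bounded support. -/
structure IsBddSupp (f : E3 → ℝ) : Prop where
  meas : AEStronglyMeasurable f volume
  bound : ∃ M, ∀ x, |f x| ≤ M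
  supp : ∃ R, 0 < R ∧ ∀ x, R ≤ ‖x‖ → f x = 0

namespace IsBddSupp

variable {f : E3 → ℝ}

lemma memLp (h : IsBddSupp f) (p : ℝ≥0∞) : MemLp f p volume := by
  obtain ⟨M, hM⟩ := h.bound
  obtain ⟨R, -, hR⟩ := h.supp
  refine MemLp.of_le (g := (Metric.closedBall (0 : E3) R).indicator fun _ => M)
    (memLp_indicator_const p Metric.isClosed_closedBall.measurableSet M
      (Or.inr measure_closedBall_lt_top.ne)) h.meas
    (Eventually.of_forall fun x => ?_)
  by_cases hx : R ≤ ‖x‖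
  · rw [hR x hx]; simp
  · rw [indicator_of_mem (by simpa using (not_le.1 hx).le)]
    exact (hM x).trans (le_abs_self M)

lemma integrable (h : IsBddSupp f) : Integrable f := memLp_one_iff_integrable.1 (h.memLp 1)

lemma of_isTest (h : IsTest f) : IsBddSupp f :=
  ⟨h.continuous.aestronglyMeasurable, h.exists_bound.imp fun _ hC => hC.2, h.exists_support⟩

lemma rpow (h : IsBddSupp f) (h0 : ∀ x, 0 ≤ f x) {p : ℝ} (hp : 0 < p) :
    IsBddSupp fun x => f x ^ p := by
  obtain ⟨M, hM⟩ := h.bound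
  obtain ⟨R, hR0, hR⟩ := h.supp
  refine ⟨(h.meas.aemeasurable.pow_const p).aestronglyMeasurable, ⟨M ^ p, fun x => ?_⟩,
    ⟨R, hR0, fun x hx => by simp [hR x hx, hp.ne']⟩⟩
  rw [abs_of_nonneg (Real.rpow_nonneg (h0 x) p)]
  exact Real.rpow_le_rpow (h0 x) ((le_abs_self _).trans (hM x)) hp.le

lemma posPart (h : IsBddSupp f) : IsBddSupp fun x => max (f x) 0 := by
  obtain ⟨M, hM⟩ := h.bound
  obtain ⟨R, hR0, hR⟩ := h.supp
  refine ⟨(h.meas.aemeasurable.max aemeasurable_const).aestronglyMeasurable, ⟨M, fun x => ?_⟩,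
    ⟨R, hR0, fun x hx => by simp [hR x hx]⟩⟩
  rw [abs_of_nonneg (le_max_right _ _)]
  exact max_le ((le_abs_self _).trans (hM x)) ((abs_nonneg _).trans (hM x))

lemma neg (h : IsBddSupp f) : IsBddSupp fun x => -f x := by
  obtain ⟨M, hM⟩ := h.bound
  obtain ⟨R, hR0, hR⟩ := h.supp
  exact ⟨h.meas.neg, ⟨M, fun x => by simpa using hM x⟩, ⟨R, hR0, fun x hx => by simp [hR x hx]⟩⟩

lemma const_mul (h : IsBddSupp f) (c : ℝ) : IsBddSupp fun x => c * f x := by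
  obtain ⟨M, hM⟩ := h.bound
  obtain ⟨R, hR0, hR⟩ := h.supp
  refine ⟨h.meas.const_mul c, ⟨|c| * M, fun x => ?_⟩, ⟨R, hR0, fun x hx => by simp [hR x hx]⟩⟩
  rw [abs_mul]
  exact mul_le_mul_of_nonneg_left (hM x) (abs_nonneg c)

end IsBddSupp

/-- The heat extension of `f`. -/
abbrev heatExt (t : ℝ) (f : E3 → ℝ) : E3 → ℝ := conv (heat t) f

section HeatExt

variable {f : E3 → ℝ}

lemma contDiffOn_heatExt (hf : IsBddSupp f) :
    ContDiffOn ℝ ∞ (fun p : ℝ × E3 => heatExt p.1 f p.2) (Ioi 0 ×ˢ univ) := by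
  obtain ⟨R, hR0, hR⟩ := hf.supp
  exact contDiffOn_conv_param isOpen_Ioi contDiffOn_heat hf.integrable hR0 hR

lemma contDiff_heatExt (hf : IsBddSupp f) (t : ℝ) : ContDiff ℝ ∞ (heatExt t f) := by
  obtain ⟨R, hR0, hR⟩ := hf.supp
  exact contDiff_conv (contDiff_heat t) hf.integrable hR0 hR

lemma pderiv_heatExt (hf : IsBddSupp f) (t : ℝ) (k : Fin 3) :
    pderiv k (heatExt t f) = conv (pderiv k (heat t)) f := by
  obtain ⟨R, hR0, hR⟩ := hf.supp
  exact pderiv_conv (contDiff_heat t) hf.integrable hR0 hR k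

lemma pderiv_pderiv_heatExt (hf : IsBddSupp f) (t : ℝ) (k l : Fin 3) :
    pderiv l (pderiv k (heatExt t f)) = conv (pderiv l (pderiv k (heat t))) f := by
  obtain ⟨R, hR0, hR⟩ := hf.supp
  rw [pderiv_heatExt hf, pderiv_conv (contDiff_top_pderiv k (contDiff_heat t)) hf.integrable hR0 hR]

lemma IsBddSupp.integrable_continuous_mul (hf : IsBddSupp f) {g : E3 → ℝ} (hg : Continuous g) :
    Integrable fun y => g y * f y := by
  obtain ⟨R, -, hsupp⟩ := hf.supp
  obtain ⟨M, hM⟩ := (isCompact_closedBall (0 : E3) R).exists_bound_of_continuousOn hg.continuousOn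
  refine (hf.integrable.norm.const_mul M).mono'
    (hg.aestronglyMeasurable.mul hf.meas) (Eventually.of_forall fun y => ?_)
  by_cases hy : R ≤ ‖y‖
  · simp [hsupp y hy]
  · rw [norm_mul]
    exact mul_le_mul_of_nonneg_right (hM y (by simpa using (not_le.1 hy).le)) (norm_nonneg _)

lemma continuousOn_laplacian_heat (x : E3) : ContinuousOn
    (Function.uncurry fun (s : ℝ) (y : E3) => ∑ k, pderiv k (pderiv k (heat s)) (x - y))
    (Ioi 0 ×ˢ univ) := by
  simp only [pderiv_pderiv_heat]
  unfold Function.uncurry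
  refine continuousOn_finsetSum _ fun k _ => ?_
  have h1 : ContinuousOn (fun p : ℝ × E3 => heat p.1 (x - p.2)) (Ioi 0 ×ˢ univ) :=
    contDiffOn_heat.continuousOn.comp (f := fun p : ℝ × E3 => (p.1, x - p.2)) (by fun_prop)
      (fun p hp => ⟨hp.1, mem_univ _⟩)
  have h2 : ContinuousOn (fun p : ℝ × E3 => (2 * p.1)⁻¹) (Ioi 0 ×ˢ univ) :=
    ContinuousOn.inv₀ (by fun_prop) fun p hp => by have : 0 < p.1 := hp.1; positivity
  refine ContinuousOn.mul ?_ h1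
  refine ContinuousOn.sub ?_ (h2.mul continuousOn_const)
  exact ((h2.pow 2).mul (by fun_prop)).mul (by fun_prop)

lemma hasDerivAt_heatExt (hf : IsBddSupp f) {t : ℝ} (ht : 0 < t) (x : E3) :
    HasDerivAt (fun s => heatExt s f x) (∑ k, pderiv k (pderiv k (heatExt t f)) x) t := by
  obtain ⟨R, hR0, hR⟩ := hf.supp
  have hsub : Metric.closedBall t (t / 2) ⊆ Ioi 0 := by
    intro s hs
    rw [Metric.mem_closedBall, Real.dist_eq, abs_le] at hs
    exact mem_Ioi.2 (by linarith [hs.1])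
  have := hasDerivAt_integral_of_support (R := R) (a := t) (δ := t / 2) (f := f) (by positivity)
    hf.integrable hR (F := fun s y => heat s (x - y))
    (F' := fun s y => ∑ k, pderiv k (pderiv k (heat s)) (x - y))
    (fun s hs y => hasDerivAt_heat (hsub hs) (x - y))
    (fun s _ => (contDiff_heat s).continuous.comp (by fun_prop))
    ((continuousOn_laplacian_heat x).mono (prod_mono_left hsub))
  refine this.congr_deriv ?_
  simp_rw [pderiv_pderiv_heatExt hf, conv, Finset.sum_mul]
  refine integral_finsetSum _ fun k _ => ?_
  have hc : Continuous (pderiv k (pderiv k (heat t))) :=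
    (contDiff_top_pderiv k (contDiff_top_pderiv k (contDiff_heat t))).continuous
  exact hf.integrable_continuous_mul (hc.comp (by fun_prop))

/-- Strict positivity keeps a pair of heat extensions in the open quadrant, the only place where the
Bellman function is differentiated. -/
lemma heatExt_pos (hf : IsBddSupp f) (h0 : ∀ x, 0 ≤ f x) (hne : 0 < ∫ x, f x) {t : ℝ}
    (ht : 0 < t) (x : E3) : 0 < heatExt t f x := by
  have hc : Continuous fun y => heat t (x - y) := (contDiff_heat t).continuous.comp (by fun_prop)
  change 0 < ∫ y, heat t (x - y) * f y
  rw [integral_pos_iff_support_of_nonneg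
    (fun y => mul_nonneg (heat_pos ht _).le (h0 y)) (hf.integrable_continuous_mul hc)]
  rw [integral_pos_iff_support_of_nonneg h0 hf.integrable] at hne
  refine hne.trans_le (measure_mono fun y hy => ?_)
  simp only [Function.mem_support] at hy ⊢
  exact mul_ne_zero (heat_pos ht _).ne' hy

lemma integrable_conv_prod {K : E3 → ℝ} (hK : Integrable K) (hf : Integrable f) :
    Integrable (fun z : E3 × E3 => K (z.1 - z.2) * f z.2) (volume.prod volume) := by
  have := (hf.convolution_integrand (ContinuousLinearMap.mul ℝ ℝ) hK)
  refine this.congr (Eventually.of_forall fun z => ?_)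
  simp [mul_comm]

lemma integrable_conv {K : E3 → ℝ} (hK : Integrable K) (hf : Integrable f) :
    Integrable (conv K f) :=
  (integrable_conv_prod hK hf).integral_prod_left

lemma integral_conv {K : E3 → ℝ} (hK : Integrable K) (hf : Integrable f) :
    ∫ x, conv K f x = (∫ x, K x) * ∫ x, f x := by
  unfold conv
  rw [integral_integral_swap (integrable_conv_prod hK hf)]
  simp_rw [integral_mul_const]
  have : ∀ y, ∫ x, K (x - y) = ∫ x, K x := fun y => integral_sub_right_eq_self K y
  simp_rw [this]
  rw [integral_const_mul]

/-- Jensen's inequality for the heat extension. -/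
lemma heatExt_rpow_le (hf : IsBddSupp f) (h0 : ∀ x, 0 ≤ f x) {t p : ℝ} (ht : 0 < t) (hp : 1 ≤ p)
    (x : E3) : heatExt t f x ^ p ≤ heatExt t (fun y => f y ^ p) x := by
  have hc : Continuous fun y => heat t (x - y) := (contDiff_heat t).continuous.comp (by fun_prop)
  have hint : Integrable fun y => heat t (x - y) := (integrable_heat ht).comp_sub_left x
  have hm : Measurable fun y => ENNReal.ofReal (heat t (x - y)) := hc.measurable.ennreal_ofReal
  let μ : Measure E3 := volume.withDensity fun y => ENNReal.ofReal (heat t (x - y))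
  have hprob : IsProbabilityMeasure μ := by
    refine ⟨?_⟩
    rw [withDensity_apply _ MeasurableSet.univ, Measure.restrict_univ, ← ofReal_integral_eq_lintegral_ofReal hint
      (Eventually.of_forall fun y => (heat_pos ht _).le), integral_sub_left_eq_self (heat t),
      integral_heat ht, ENNReal.ofReal_one]
  have hconv : ∀ g : E3 → ℝ, ∫ y, g y ∂μ = heatExt t g x := by
    intro g
    rw [integral_withDensity_eq_integral_toReal_smul hm (by simp)]
    refine integral_congr_ae (Eventually.of_forall fun y => ?_)
    simp [ENNReal.toReal_ofReal (heat_pos ht (x - y)).le]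
  have hμint : ∀ g : E3 → ℝ, IsBddSupp g → Integrable g μ := by
    intro g hg
    rw [integrable_withDensity_iff_integrable_smul' hm (by simp)]
    refine (hg.integrable_continuous_mul hc).congr (Eventually.of_forall fun y => ?_)
    simp [ENNReal.toReal_ofReal (heat_pos ht (x - y)).le]
  have := (convexOn_rpow hp).map_integral_le (μ := μ) (f := f)
    (Real.continuous_rpow_const (by linarith)).continuousOn isClosed_Ici
    (Eventually.of_forall fun y => h0 y) (hμint f hf)
    (hμint _ (hf.rpow h0 (by linarith)))
  rw [hconv, hconv] at this
  exact this

lemma integrable_heatExt_rpow (hf : IsBddSupp f) (h0 : ∀ x, 0 ≤ f x) {t p : ℝ} (ht : 0 < t)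
    (hp : 1 ≤ p) : Integrable fun x => heatExt t f x ^ p := by
  have hnn : ∀ x, 0 ≤ heatExt t f x := fun x =>
    integral_nonneg fun y => mul_nonneg (heat_pos ht _).le (h0 y)
  refine (integrable_conv (integrable_heat ht)
    (hf.rpow h0 (by linarith : 0 < p)).integrable).mono' ?_ ?_
  · exact ((contDiff_heatExt hf t).continuous.rpow_const
      fun x => Or.inr (by linarith)).aestronglyMeasurable
  · refine Eventually.of_forall fun x => ?_
    rw [Real.norm_of_nonneg (Real.rpow_nonneg (hnn x) p)]
    exact heatExt_rpow_le hf h0 ht hp x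

lemma integral_heatExt_rpow_le (hf : IsBddSupp f) (h0 : ∀ x, 0 ≤ f x) {t p : ℝ} (ht : 0 < t)
    (hp : 1 ≤ p) : ∫ x, heatExt t f x ^ p ≤ ∫ x, f x ^ p := by
  have hint := (hf.rpow h0 (by linarith : 0 < p)).integrable
  refine (integral_mono (integrable_heatExt_rpow hf h0 ht hp)
    (integrable_conv (integrable_heat ht) hint) (heatExt_rpow_le hf h0 ht hp)).trans ?_
  rw [integral_conv (integrable_heat ht) hint, integral_heat ht, one_mul]

end HeatExt

/-! ### Functions smooth jointly in time and space. -/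

section Joint

variable {W : ℝ → E3 → ℝ}

lemma contDiff_of_joint (hW : ContDiffOn ℝ ∞ (fun p : ℝ × E3 => W p.1 p.2) (Ioi 0 ×ˢ univ))
    {t : ℝ} (ht : 0 < t) : ContDiff ℝ ∞ (W t) := by
  rw [← contDiffOn_univ]
  exact hW.comp (contDiff_prodMk_right t).contDiffOn (fun x _ => ⟨ht, mem_univ _⟩)

lemma hasFDerivAt_of_joint (hW : ContDiffOn ℝ ∞ (fun p : ℝ × E3 => W p.1 p.2) (Ioi 0 ×ˢ univ))
    {p : ℝ × E3} (hp : 0 < p.1) : HasFDerivAt (fun p : ℝ × E3 => W p.1 p.2)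
      (fderiv ℝ (fun p : ℝ × E3 => W p.1 p.2) p) p :=
  ((hW.contDiffAt ((isOpen_Ioi.prod isOpen_univ).mem_nhds ⟨hp, mem_univ _⟩)).differentiableAt
    (by simp)).hasFDerivAt

lemma continuousOn_pderiv_joint
    (hW : ContDiffOn ℝ ∞ (fun p : ℝ × E3 => W p.1 p.2) (Ioi 0 ×ˢ univ)) (k : Fin 3) :
    ContinuousOn (fun p : ℝ × E3 => pderiv k (W p.1) p.2) (Ioi 0 ×ˢ univ) := by
  have h1 : ContinuousOn (fun p : ℝ × E3 => fderiv ℝ (fun p : ℝ × E3 => W p.1 p.2) p (0, basisVec k))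
      (Ioi 0 ×ˢ univ) :=
    (hW.continuousOn_fderiv_of_isOpen (isOpen_Ioi.prod isOpen_univ) (by simp)).clm_apply
      continuousOn_const
  refine h1.congr fun p hp => ?_
  have h2 : HasFDerivAt (fun x : E3 => (p.1, x)) (ContinuousLinearMap.inr ℝ ℝ E3) p.2 :=
    hasFDerivAt_prodMk_right p.1 p.2
  have h3 := (hasFDerivAt_of_joint hW (p := (p.1, p.2)) hp.1).comp p.2 h2
  have h4 : fderiv ℝ (W p.1) p.2 = _ := h3.fderiv
  simp only [pderiv]
  rw [h4]
  simp

/-- The time derivative of a jointly smooth function. -/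
def timeDeriv (W : ℝ → E3 → ℝ) (t : ℝ) (x : E3) : ℝ :=
  fderiv ℝ (fun p : ℝ × E3 => W p.1 p.2) (t, x) (1, 0)

lemma hasDerivAt_timeDeriv (hW : ContDiffOn ℝ ∞ (fun p : ℝ × E3 => W p.1 p.2) (Ioi 0 ×ˢ univ))
    {t : ℝ} (ht : 0 < t) (x : E3) : HasDerivAt (fun s => W s x) (timeDeriv W t x) t :=
  (hasFDerivAt_of_joint hW (p := (t, x)) ht).comp_hasDerivAt (f := fun s : ℝ => (s, x)) t
    ((hasDerivAt_id t).prodMk (hasDerivAt_const t x))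

lemma continuousOn_timeDeriv (hW : ContDiffOn ℝ ∞ (fun p : ℝ × E3 => W p.1 p.2) (Ioi 0 ×ˢ univ)) :
    ContinuousOn (Function.uncurry (timeDeriv W)) (Ioi 0 ×ˢ univ) :=
  (hW.continuousOn_fderiv_of_isOpen (isOpen_Ioi.prod isOpen_univ) (by simp)).clm_apply
      continuousOn_const

end Joint

/-! ### The bilinear embedding for the heat extension -/

lemma contDiff_nat_of_top {φ : E3 → ℝ} (h : ContDiff ℝ ∞ φ) (n : ℕ) : ContDiff ℝ n φ :=
  h.of_le (by exact_mod_cast le_top)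

section Pointwise

variable {p q : ℝ} {u v : E3 → ℝ}

lemma pderiv_bellman (hu : ContDiff ℝ ∞ u) (hv : ContDiff ℝ ∞ v) (hu0 : ∀ x, 0 < u x)
    (hv0 : ∀ x, 0 < v x) (hb : ContDiff ℝ ∞ fun x => bellman p q (u x) (v x)) (k : Fin 3) :
    pderiv k (fun x => bellman p q (u x) (v x)) = fun x =>
      bellmanU p q (u x) (v x) * pderiv k u x + bellmanV p q (u x) (v x) * pderiv k v x := by
  funext x
  have h1 := pderiv_eq_deriv k (hb.differentiable (by simp) x)
  have h2 := hasDerivAt_bellman (p := p) (q := q)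
    (pderiv_eq_deriv k (hu.differentiable (by simp) x))
    (pderiv_eq_deriv k (hv.differentiable (by simp) x)) (hu0 _) (hv0 _)
  simpa using h1.unique h2

lemma pderiv_pderiv_bellman (hu : ContDiff ℝ ∞ u) (hv : ContDiff ℝ ∞ v) (hu0 : ∀ x, 0 < u x)
    (hv0 : ∀ x, 0 < v x) (hb : ContDiff ℝ ∞ fun x => bellman p q (u x) (v x)) (k : Fin 3)
    (x : E3) :
    pderiv k (pderiv k (fun x => bellman p q (u x) (v x))) x =
      bellmanU p q (u x) (v x) * pderiv k (pderiv k u) x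
        + bellmanV p q (u x) (v x) * pderiv k (pderiv k v) x
        + (bellmanUU p q (u x) (v x) * pderiv k u x ^ 2
          + 2 * bellmanUV p q (u x) (v x) * pderiv k u x * pderiv k v x
          + bellmanVV p q (u x) (v x) * pderiv k v x ^ 2) := by
  have h1 := pderiv_eq_deriv k ((contDiff_top_pderiv k hb).differentiable (by simp) x)
  rw [pderiv_bellman hu hv hu0 hv0 hb] at h1
  rw [pderiv_bellman hu hv hu0 hv0 hb]
  have du := pderiv_eq_deriv k (hu.differentiable (by simp) x)
  have dv := pderiv_eq_deriv k (hv.differentiable (by simp) x)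
  have du2 := pderiv_eq_deriv k ((contDiff_top_pderiv k hu).differentiable (by simp) x)
  have dv2 := pderiv_eq_deriv k ((contDiff_top_pderiv k hv).differentiable (by simp) x)
  have h2 := ((hasDerivAt_bellmanU (p := p) (q := q) du dv (hu0 _) (hv0 _)).mul du2).add
    ((hasDerivAt_bellmanV (p := p) (q := q) du dv (hu0 _) (hv0 _)).mul dv2)
  have := h1.unique h2
  simp only [zero_smul, add_zero] at this
  rw [this]
  ring

end Pointwise

section Bilinear

variable {p q : ℝ} {f g : E3 → ℝ}

lemma bellman_heatExt_contDiffOn (hf : IsBddSupp f) (hg : IsBddSupp g) (hf0 : ∀ x, 0 ≤ f x)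
    (hg0 : ∀ x, 0 ≤ g x) (hfi : 0 < ∫ x, f x) (hgi : 0 < ∫ x, g x) :
    ContDiffOn ℝ ∞ (fun z : ℝ × E3 => bellman p q (heatExt z.1 f z.2) (heatExt z.1 g z.2))
      (Ioi 0 ×ˢ univ) := by
  intro z hz
  have h1 : ContDiffAt ℝ ∞ (fun w : ℝ × ℝ => bellman p q w.1 w.2)
      (heatExt z.1 f z.2, heatExt z.1 g z.2) :=
    contDiffAt_bellman (heatExt_pos hf hf0 hfi hz.1 _) (heatExt_pos hg hg0 hgi hz.1 _)
  exact h1.comp_contDiffWithinAt (f := fun z : ℝ × E3 => (heatExt z.1 f z.2, heatExt z.1 g z.2)) z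
    ((contDiffOn_heatExt hf z hz).prodMk (contDiffOn_heatExt hg z hz))

/-- The pointwise differential inequality for the Bellman function of two heat extensions. -/
lemma two_mul_pderiv_mul_le (hp : 2 ≤ p) (hpq : p.HolderConjugate q) (hf : IsBddSupp f)
    (hg : IsBddSupp g) (hf0 : ∀ x, 0 ≤ f x)
    (hg0 : ∀ x, 0 ≤ g x) (hfi : 0 < ∫ x, f x) (hgi : 0 < ∫ x, g x) {t : ℝ} (ht : 0 < t) (x : E3)
    (i j : Fin 3) :
    2 * |pderiv i (heatExt t f) x * pderiv j (heatExt t g) x|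
      ≤ (∑ k, pderiv k (pderiv k fun x => bellman p q (heatExt t f x) (heatExt t g x)) x)
        - timeDeriv (fun t x => bellman p q (heatExt t f x) (heatExt t g x)) t x := by
  have hjoint := bellman_heatExt_contDiffOn (p := p) (q := q) hf hg hf0 hg0 hfi hgi
  have hu := contDiff_heatExt hf t
  have hv := contDiff_heatExt hg t
  have hu0 := heatExt_pos hf hf0 hfi ht
  have hv0 := heatExt_pos hg hg0 hgi ht
  have hb : ContDiff ℝ ∞ fun x => bellman p q (heatExt t f x) (heatExt t g x) :=
    contDiff_of_joint (W := fun t x => bellman p q (heatExt t f x) (heatExt t g x)) hjoint ht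
  have h1 := hasDerivAt_timeDeriv
    (W := fun t x => bellman p q (heatExt t f x) (heatExt t g x)) hjoint ht x
  have h2 := hasDerivAt_bellman (p := p) (q := q) (hasDerivAt_heatExt hf ht x)
    (hasDerivAt_heatExt hg ht x) (hu0 x) (hv0 x)
  rw [h1.unique h2]
  simp_rw [pderiv_pderiv_bellman hu hv hu0 hv0 hb]
  set u := heatExt t f
  set v := heatExt t g
  have hH := fun k => bellman_hessian_ge hp hpq (hu0 x) (hv0 x) (pderiv k u x) (pderiv k v x)
  have hdet := one_le_powSum_rpow_mul hp hpq (hu0 x) (hv0 x)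
  set a := powSum p q (u x) (v x) ^ (1 - 2 / p)
  set b := v x ^ (q - 2)
  have ha : 0 ≤ a := Real.rpow_nonneg (powSum_pos (hu0 x) (hv0 x)).le _
  have hb' : 0 ≤ b := Real.rpow_nonneg (hv0 x).le _
  -- Both extensions solve the heat equation, so the first order terms of the chain rule are the
  -- same in Δ and in ∂ₜ and cancel. Only the Hessian form of the Bellman function remains.
  rw [Finset.sum_add_distrib, Finset.sum_add_distrib, ← Finset.mul_sum, ← Finset.mul_sum]
  have e1 : ∀ A B : ℝ, A + B - A = B := fun A B => by ring
  rw [e1]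
  refine le_trans ?_ (Finset.sum_le_sum fun k _ => hH k)
  rw [Finset.sum_add_distrib]
  have s1 : a * pderiv i u x ^ 2 ≤ ∑ k, a * pderiv k u x ^ 2 :=
    Finset.single_le_sum (f := fun k => a * pderiv k u x ^ 2) (fun k _ => by positivity)
      (Finset.mem_univ i)
  have s2 : b * pderiv j v x ^ 2 ≤ ∑ k, b * pderiv k v x ^ 2 :=
    Finset.single_le_sum (f := fun k => b * pderiv k v x ^ 2) (fun k _ => by positivity)
      (Finset.mem_univ j)
  refine le_trans ?_ (add_le_add s1 s2)
  -- Arithmetic-geometric mean: with ab ≥ 1 the sum a X² + b Y² is at least 2|XY|. The inequality is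
  -- compared after squaring to avoid square roots.
  have hsq : (2 * |pderiv i u x * pderiv j v x|) ^ 2
      ≤ (a * pderiv i u x ^ 2 + b * pderiv j v x ^ 2) ^ 2 := by
    rw [mul_pow, sq_abs]
    have := mul_le_mul_of_nonneg_right hdet (sq_nonneg (pderiv i u x * pderiv j v x))
    nlinarith only [this, sq_nonneg (a * pderiv i u x ^ 2 - b * pderiv j v x ^ 2)]
  exact (sq_le_sq₀ (by positivity) (by positivity)).1 hsq

/-- The bound is uniform in time because B(u,v) is at most a multiple of u^p + v^q and the heat flow
does not increase L^p norms. It serves twice: with η a cutoff for the initial energy, and with η the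
Laplacian of that cutoff for the error. -/
lemma bellman_heatExt_le (hp : 2 ≤ p) (hpq : p.HolderConjugate q) (hf : IsBddSupp f)
    (hg : IsBddSupp g) (hf0 : ∀ x, 0 ≤ f x)
    (hg0 : ∀ x, 0 ≤ g x) (hfi : 0 < ∫ x, f x) (hgi : 0 < ∫ x, g x) {t : ℝ} (ht : 0 < t) {η : E3 → ℝ}
    (hη : Continuous η) {c : ℝ} (hηc : ∀ x, |η x| ≤ c) :
    ∫ x, bellman p q (heatExt t f x) (heatExt t g x) * η x
      ≤ c * ((bellmanConst q + 1) * ((∫ x, f x ^ p) + ∫ x, g x ^ q)) := by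
  have hq : 1 < q := hpq.symm.lt
  have hc : 0 ≤ c := (abs_nonneg _).trans (hηc 0)
  have hu0 := heatExt_pos hf hf0 hfi ht
  have hv0 := heatExt_pos hg hg0 hgi ht
  have i1 := integrable_heatExt_rpow hf hf0 ht (by linarith : 1 ≤ p)
  have i2 := integrable_heatExt_rpow hg hg0 ht hq.le
  have hK := bellmanConst_nonneg hq
  have hpt : ∀ x, bellman p q (heatExt t f x) (heatExt t g x) * η x
      ≤ c * ((bellmanConst q + 1) * (heatExt t f x ^ p + heatExt t g x ^ q)) := by
    intro x
    have h1 := bellman_nonneg (p := p) hq (hu0 x) (hv0 x)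
    calc _ ≤ bellman p q (heatExt t f x) (heatExt t g x) * c :=
          mul_le_mul_of_nonneg_left ((le_abs_self _).trans (hηc x)) h1
      _ = c * bellman p q (heatExt t f x) (heatExt t g x) := mul_comm _ _
      _ ≤ _ := mul_le_mul_of_nonneg_left (bellman_le hp hq (hu0 x) (hv0 x)) hc
  have i3 : Integrable fun x => c * ((bellmanConst q + 1) * (heatExt t f x ^ p + heatExt t g x ^ q)) :=
    ((i1.add i2).const_mul _).const_mul _
  have hnn : 0 ≤ ∫ x, c * ((bellmanConst q + 1) * (heatExt t f x ^ p + heatExt t g x ^ q)) :=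
    integral_nonneg fun x => by
      have := hu0 x
      have := hv0 x
      positivity
  have hstep : ∫ x, bellman p q (heatExt t f x) (heatExt t g x) * η x
      ≤ ∫ x, c * ((bellmanConst q + 1) * (heatExt t f x ^ p + heatExt t g x ^ q)) := by
    -- If the left side is not integrable its integral is 0 by convention, and the bound is
    -- nonnegative.
    by_cases hi : Integrable fun x => bellman p q (heatExt t f x) (heatExt t g x) * η x
    · exact integral_mono hi i3 hpt
    · rw [integral_undef hi]; exact hnn
  refine hstep.trans ?_
  rw [integral_const_mul, integral_const_mul, integral_add i1 i2]
  have j1 := integral_heatExt_rpow_le hf hf0 ht (by linarith : 1 ≤ p)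
  have j2 := integral_heatExt_rpow_le hg hg0 ht hq.le
  exact mul_le_mul_of_nonneg_left (mul_le_mul_of_nonneg_left (add_le_add j1 j2) (by linarith)) hc

/-- The absolute value of a product of spatial derivatives of two heat extensions. -/
def gradProd (f g : E3 → ℝ) (i j : Fin 3) (t : ℝ) (x : E3) : ℝ≥0∞ :=
  ‖pderiv i (heatExt t f) x * pderiv j (heatExt t g) x‖ₑ

lemma continuous_pderiv_mul_pderiv (hf : IsBddSupp f) (hg : IsBddSupp g) (i j : Fin 3) (t : ℝ) :
    Continuous fun x => pderiv i (heatExt t f) x * pderiv j (heatExt t g) x :=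
  (contDiff_top_pderiv i (contDiff_heatExt hf t)).continuous.mul
    (contDiff_top_pderiv j (contDiff_heatExt hg t)).continuous

lemma measurable_gradProd_slice (hf : IsBddSupp f) (hg : IsBddSupp g) (i j : Fin 3) (t : ℝ) :
    Measurable (gradProd f g i j t) :=
  (continuous_pderiv_mul_pderiv hf hg i j t).measurable.enorm

/-- The localized bilinear estimate. -/
lemma lintegral_cutoff_le (hp : 2 ≤ p) (hpq : p.HolderConjugate q) (hf : IsBddSupp f)
    (hg : IsBddSupp g) (hf0 : ∀ x, 0 ≤ f x)
    (hg0 : ∀ x, 0 ≤ g x) (hfi : 0 < ∫ x, f x) (hgi : 0 < ∫ x, g x) {ε T : ℝ} (hε : 0 < ε)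
    (hεT : ε ≤ T) {χ : E3 → ℝ} (hχ : IsTest χ) (hχ0 : ∀ x, 0 ≤ χ x) (hχ1 : ∀ x, χ x ≤ 1) {c : ℝ}
    (hc : ∀ x, |(Δ χ) x| ≤ c) (i j : Fin 3) :
    ∫⁻ t in Ioc ε T, ∫⁻ x, gradProd f g i j t x * ENNReal.ofReal (χ x)
      ≤ ENNReal.ofReal ((1 + (T - ε) * c) / 2 *
        ((bellmanConst q + 1) * ((∫ x, f x ^ p) + ∫ x, g x ^ q))) := by
  set M := (bellmanConst q + 1) * ((∫ x, f x ^ p) + ∫ x, g x ^ q)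
  have hjoint := bellman_heatExt_contDiffOn (p := p) (q := q) hf hg hf0 hg0 hfi hgi
  set b : ℝ → E3 → ℝ := fun t x => bellman p q (heatExt t f x) (heatExt t g x) with hbdef
  replace hjoint : ContDiffOn ℝ ∞ (fun z : ℝ × E3 => b z.1 z.2) (Ioi 0 ×ˢ univ) := hjoint
  obtain ⟨R, hR0, hR⟩ := hχ.exists_support
  have hsubs : ∀ t : ℝ, 0 < t → Metric.closedBall t (t / 2) ⊆ Ioi 0 := by
    intro t ht s hs
    rw [Metric.mem_closedBall, Real.dist_eq, abs_le] at hs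
    exact mem_Ioi.2 (by linarith [hs.1])
  have hbc : ∀ t, 0 < t → ContDiff ℝ ∞ (b t) := fun t ht => contDiff_of_joint hjoint ht
  have hIcc : Icc ε T ⊆ Ioi 0 := fun t ht => hε.trans_le ht.1
  -- the derivative of the localized energy
  have hder : ∀ t, 0 < t → HasDerivAt (fun s => ∫ x, b s x * χ x) (∫ x, timeDeriv b t x * χ x) t := by
    intro t ht
    exact hasDerivAt_integral_of_support (R := R) (δ := t / 2) (by positivity) hχ.integrable hR
      (fun s hs y => hasDerivAt_timeDeriv hjoint (hsubs t ht hs) y)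
      (fun s hs => (hbc s (hsubs t ht hs)).continuous)
      ((continuousOn_timeDeriv hjoint).mono (prod_mono_left (hsubs t ht)))
  have hcont : ∀ {F : ℝ → E3 → ℝ}, ContinuousOn (Function.uncurry F) (Ioi 0 ×ˢ univ) →
      ContinuousOn (fun t => ∫ x, F t x * χ x) (Icc ε T) := by
    intro F hF
    refine continuousOn_integral_of_compact_support (k := Metric.closedBall 0 R)
      (isCompact_closedBall _ _) ?_ ?_
    · exact (hF.mono (prod_mono_left hIcc)).mul (hχ.continuous.comp continuous_snd).continuousOn
    · intro t x _ hx
      have : R ≤ ‖x‖ := by simpa using (not_le.1 (fun h => hx (by simpa using h))).le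
      simp [hR x this]
  have hcd : ContinuousOn (Function.uncurry fun t x =>
      |pderiv i (heatExt t f) x * pderiv j (heatExt t g) x|) (Ioi 0 ×ˢ univ) :=
    ((continuousOn_pderiv_joint (W := fun t => heatExt t f) (contDiffOn_heatExt hf) i).mul
      (continuousOn_pderiv_joint (W := fun t => heatExt t g) (contDiffOn_heatExt hg) j)).abs
  have hW := hcont hcd
  have hφ' := hcont (continuousOn_timeDeriv hjoint)
  have huIcc : uIcc ε T = Icc ε T := uIcc_of_le hεT
  have iW : IntervalIntegrable (fun t => ∫ x,
      |pderiv i (heatExt t f) x * pderiv j (heatExt t g) x| * χ x) volume ε T :=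
    ContinuousOn.intervalIntegrable (by rwa [huIcc])
  have iφ : IntervalIntegrable (fun t => ∫ x, timeDeriv b t x * χ x) volume ε T :=
    ContinuousOn.intervalIntegrable (by rwa [huIcc])
  have hFTC := intervalIntegral.integral_eq_sub_of_hasDerivAt
    (f := fun s => ∫ x, b s x * χ x) (fun t ht => hder t (hIcc (huIcc ▸ ht))) iφ
  -- The differential inequality is tested against χ and the Laplacian is moved onto χ, which costs
  -- c·M at each time and hence (T - ε)·c·M in total.
  have hpt : ∀ t ∈ Icc ε T, 2 * (∫ x,
      |pderiv i (heatExt t f) x * pderiv j (heatExt t g) x| * χ x)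
      + (∫ x, timeDeriv b t x * χ x) ≤ c * M := by
    intro t ht
    have ht0 : 0 < t := hIcc ht
    have hint : ∀ {F : E3 → ℝ}, Continuous F → Integrable fun x => F x * χ x := fun hF =>
      (hF.mul hχ.continuous).integrable_of_hasCompactSupport hχ.compact.mul_left
    have hsl : ∀ {F : ℝ → E3 → ℝ}, ContinuousOn (Function.uncurry F) (Ioi 0 ×ˢ univ) →
        Continuous (F t) := by
      intro F hF
      rw [← continuousOn_univ]
      exact hF.comp (f := fun y : E3 => (t, y)) (by fun_prop) (fun y _ => ⟨ht0, mem_univ _⟩)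
    have c1 := hsl hcd
    have c2 := hsl (continuousOn_timeDeriv hjoint)
    have h1 : ∫ x, b t x * (Δ χ) x ≤ c * M :=
      bellman_heatExt_le hp hpq hf hg hf0 hg0 hfi hgi ht0 hχ.laplacian.continuous hc
    refine le_trans ?_ h1
    rw [integral_mul_laplacian (contDiff_nat_of_top (hbc t ht0) 2) hχ,
      ← integral_const_mul, ← integral_add ((hint c1).const_mul 2) (hint c2)]
    have c3 : Continuous fun x => ∑ k, pderiv k (pderiv k (b t)) x :=
      continuous_finsetSum _ fun k _ =>
        (contDiff_top_pderiv k (contDiff_top_pderiv k (hbc t ht0))).continuous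
    refine integral_mono (((hint c1).const_mul 2).add (hint c2)) (hint c3) fun x => ?_
    have := mul_le_mul_of_nonneg_right
      (two_mul_pderiv_mul_le hp hpq hf hg hf0 hg0 hfi hgi ht0 x i j) (hχ0 x)
    simp only
    linarith
  have h2 : ∫ t in ε..T, (2 * (∫ x,
      |pderiv i (heatExt t f) x * pderiv j (heatExt t g) x| * χ x)
      + (∫ x, timeDeriv b t x * χ x)) ≤ ∫ _ in ε..T, c * M :=
    intervalIntegral.integral_mono_on hεT ((iW.const_mul 2).add iφ) intervalIntegrable_const hpt
  rw [intervalIntegral.integral_add (iW.const_mul 2) iφ, intervalIntegral.integral_const_mul, hFTC,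
    intervalIntegral.integral_const, smul_eq_mul] at h2
  have h3 : ∫ x, b ε x * χ x ≤ 1 * M :=
    bellman_heatExt_le hp hpq hf hg hf0 hg0 hfi hgi hε hχ.continuous
      (fun x => by rw [abs_of_nonneg (hχ0 x)]; exact hχ1 x)
  -- The energy at the final time is nonnegative and can be dropped, so only the energy at time ε
  -- enters the bound.
  have h4 : 0 ≤ ∫ x, b T x * χ x := integral_nonneg fun x =>
    mul_nonneg (bellman_nonneg hpq.symm.lt (heatExt_pos hf hf0 hfi (hε.trans_le hεT) x)
      (heatExt_pos hg hg0 hgi (hε.trans_le hεT) x)) (hχ0 x)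
  have h5 : ∫ t in ε..T, ∫ x, |pderiv i (heatExt t f) x * pderiv j (heatExt t g) x| * χ x
      ≤ (1 + (T - ε) * c) / 2 * M := by linarith
  refine le_trans (le_of_eq ?_) (ENNReal.ofReal_le_ofReal h5)
  rw [intervalIntegral.integral_of_le hεT, ofReal_integral_eq_lintegral_ofReal
    ((intervalIntegrable_iff_integrableOn_Ioc_of_le hεT).1 iW) (Eventually.of_forall fun t =>
      integral_nonneg fun x => mul_nonneg (abs_nonneg _) (hχ0 x))]
  refine setLIntegral_congr_fun measurableSet_Ioc fun t ht => ?_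
  have c1 : Continuous fun x => |pderiv i (heatExt t f) x * pderiv j (heatExt t g) x| :=
    (continuous_pderiv_mul_pderiv hf hg i j t).abs
  have hi : Integrable fun x => |pderiv i (heatExt t f) x * pderiv j (heatExt t g) x| * χ x :=
    (c1.mul hχ.continuous).integrable_of_hasCompactSupport hχ.compact.mul_left
  rw [ofReal_integral_eq_lintegral_ofReal hi
    (Eventually.of_forall fun x => mul_nonneg (abs_nonneg _) (hχ0 x))]
  refine lintegral_congr fun x => ?_
  rw [ENNReal.ofReal_mul (abs_nonneg _), ← Real.enorm_eq_ofReal_abs, gradProd]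

lemma pderiv_comp_smul {φ : E3 → ℝ} (hφ : Differentiable ℝ φ) (k : Fin 3) (c : ℝ) (x : E3) :
    pderiv k (fun y => φ (c • y)) x = c * pderiv k φ (c • x) := by
  have h1 : HasFDerivAt (fun y : E3 => c • y) (c • ContinuousLinearMap.id ℝ E3) x :=
    (hasFDerivAt_id x).const_smul c
  have h2 := (hφ (c • x)).hasFDerivAt.comp x h1
  have h3 : fderiv ℝ (fun y => φ (c • y)) x = _ := h2.fderiv
  simp only [pderiv]
  rw [h3]
  simp

lemma pderiv_const_mul {φ : E3 → ℝ} (hφ : Differentiable ℝ φ) (k : Fin 3) (c : ℝ) (x : E3) :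
    pderiv k (fun y => c * φ y) x = c * pderiv k φ x := by
  have h : HasFDerivAt (fun y => c * φ y) (c • fderiv ℝ φ x) x := (hφ x).hasFDerivAt.const_mul c
  have h' : fderiv ℝ (fun y => c * φ y) x = _ := h.fderiv
  simp only [pderiv]
  rw [h']; rfl

lemma laplacian_comp_smul {φ : E3 → ℝ} (hφ : IsTest φ) (c : ℝ) (x : E3) :
    (Δ fun y => φ (c • y)) x = c ^ 2 * (Δ φ) (c • x) := by
  have h1 : ContDiff ℝ 2 fun y : E3 => φ (c • y) := (hφ.contDiff 2).comp (by fun_prop)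
  rw [laplacian_eq_sum h1, laplacian_eq_sum (hφ.contDiff 2), Finset.mul_sum]
  refine Finset.sum_congr rfl fun k _ => ?_
  have h2 : pderiv k (fun y => φ (c • y)) = fun x => c * pderiv k φ (c • x) := by
    funext x; exact pderiv_comp_smul hφ.differentiable k c x
  have h3 := (hφ.pderiv k).const_mul c
  rw [h2, pderiv_comp_smul (φ := fun y => c * pderiv k φ y) h3.differentiable]
  rw [pderiv_const_mul (hφ.pderiv k).differentiable]; ring

/-- A cutoff function at scale `n`. -/
lemma exists_cutoff : ∃ (χ : ℕ → E3 → ℝ) (c : ℝ), 0 ≤ c ∧ ∀ n, IsTest (χ n) ∧ (∀ x, 0 ≤ χ n x) ∧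
    (∀ x, χ n x ≤ 1) ∧ (∀ x, ‖x‖ ≤ n → χ n x = 1) ∧ ∀ x, |(Δ (χ n)) x| ≤ c / (n + 1) ^ 2 := by
  let χ : ContDiffBump (0 : E3) := ⟨1, 2, by norm_num, by norm_num⟩
  have hχ : IsTest χ := ⟨χ.contDiff, χ.hasCompactSupport⟩
  obtain ⟨c, hc0, hc⟩ := hχ.laplacian.exists_bound
  refine ⟨fun n x => χ (((n : ℝ) + 1)⁻¹ • x), c, hc0, fun n => ?_⟩
  have hn : (0 : ℝ) < n + 1 := by positivity
  refine ⟨⟨hχ.smooth.comp (by fun_prop), hχ.compact.comp_smul (inv_ne_zero hn.ne')⟩,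
    fun x => χ.nonneg, fun x => χ.le_one, fun x hx => χ.one_of_mem_closedBall ?_, fun x => ?_⟩
  · rw [mem_closedBall_zero_iff, norm_smul, Real.norm_of_nonneg (by positivity)]
    change _ ≤ (1 : ℝ)
    rw [inv_mul_le_iff₀ hn]; linarith
  · rw [laplacian_comp_smul hχ, abs_mul, abs_of_nonneg (by positivity), inv_pow, mul_comm,
      ← div_eq_mul_inv]
    gcongr
    exact hc _

lemma measurable_gradProd (hf : IsBddSupp f) (hg : IsBddSupp g) (i j : Fin 3) :
    Measurable fun z : Ioi (0 : ℝ) × E3 => gradProd f g i j z.1 z.2 := by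
  have h0 : Continuous fun z : Ioi (0 : ℝ) × E3 =>
      pderiv i (heatExt z.1 f) z.2 * pderiv j (heatExt z.1 g) z.2 := by
    have hmap : ∀ z : Ioi (0 : ℝ) × E3, ((z.1 : ℝ), z.2) ∈ Ioi (0 : ℝ) ×ˢ (univ : Set E3) :=
      fun z => ⟨z.1.2, mem_univ _⟩
    exact ((continuousOn_pderiv_joint (W := fun t => heatExt t f)
      (contDiffOn_heatExt hf) i).comp_continuous (by fun_prop) hmap).mul
      ((continuousOn_pderiv_joint (W := fun t => heatExt t g)
      (contDiffOn_heatExt hg) j).comp_continuous (by fun_prop) hmap)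
  exact h0.measurable.enorm

/-- The integrand is jointly continuous only for positive times, so measurability is obtained on the
subtype `Ioi 0` and then transferred. -/
lemma aemeasurable_lintegral_gradProd (hf : IsBddSupp f) (hg : IsBddSupp g) (i j : Fin 3)
    {ε T : ℝ} (hε : 0 < ε) {η : E3 → ℝ≥0∞} (hη : Measurable η) :
    AEMeasurable (fun t => ∫⁻ x, gradProd f g i j t x * η x) (volume.restrict (Ioc ε T)) := by
  have h1 : Measurable fun t : Ioi (0 : ℝ) => ∫⁻ x, gradProd f g i j t x * η x :=
    Measurable.lintegral_prod_right' (f := fun z : Ioi (0 : ℝ) × E3 =>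
      gradProd f g i j z.1 z.2 * η z.2)
      ((measurable_gradProd hf hg i j).mul (hη.comp measurable_snd))
  have h2 : AEMeasurable (fun t => ∫⁻ x, gradProd f g i j t x * η x)
      (volume.restrict (Ioi 0)) := by
    rw [← map_comap_subtype_coe measurableSet_Ioi]
    exact (MeasurableEmbedding.subtype_coe measurableSet_Ioi).aemeasurable_map_iff.2 h1.aemeasurable
  exact h2.mono_measure (Measure.restrict_mono (fun t ht => hε.trans ht.1) le_rfl)

/-- Cutoffs at scale n+1 have Laplacian O(n⁻²), so the error term vanishes as n → ∞ and Fatou's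
lemma removes the cutoff in space and in time. The resulting bound does not depend on ε or T. -/
lemma lintegral_bilinear_le (hp : 2 ≤ p) (hpq : p.HolderConjugate q) (hf : IsBddSupp f)
    (hg : IsBddSupp g) (hf0 : ∀ x, 0 ≤ f x)
    (hg0 : ∀ x, 0 ≤ g x) (hfi : 0 < ∫ x, f x) (hgi : 0 < ∫ x, g x) {ε T : ℝ} (hε : 0 < ε)
    (hεT : ε ≤ T) (i j : Fin 3) :
    ∫⁻ t in Ioc ε T, ∫⁻ x, gradProd f g i j t x
      ≤ ENNReal.ofReal ((1 / 2) * ((bellmanConst q + 1) * ((∫ x, f x ^ p) + ∫ x, g x ^ q))) := by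
  generalize hM : (bellmanConst q + 1) * ((∫ x, f x ^ p) + ∫ x, g x ^ q) = M
  obtain ⟨χ, c, hc0, hχ⟩ := exists_cutoff
  have hlim : ∀ t x, liminf (fun n => gradProd f g i j t x * ENNReal.ofReal (χ n x)) atTop = gradProd f g i j t x := by
    intro t x
    refine Tendsto.liminf_eq (tendsto_const_nhds.congr' ?_)
    obtain ⟨N, hN⟩ := exists_nat_ge ‖x‖
    filter_upwards [eventually_ge_atTop N] with n hn
    rw [(hχ n).2.2.2.1 x (hN.trans (by exact_mod_cast hn)), ENNReal.ofReal_one, mul_one]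
  have hb : ∀ n, ∫⁻ t in Ioc ε T, ∫⁻ x, gradProd f g i j t x * ENNReal.ofReal (χ n x)
      ≤ ENNReal.ofReal ((1 + (T - ε) * (c / ((n : ℝ) + 1) ^ 2)) / 2 * M) := fun n => hM ▸
    lintegral_cutoff_le hp hpq hf hg hf0 hg0 hfi hgi hε hεT (hχ n).1 (hχ n).2.1 (hχ n).2.2.1
      (hχ n).2.2.2.2 i j
  have htend : Tendsto (fun n : ℕ => ENNReal.ofReal ((1 + (T - ε) * (c / ((n : ℝ) + 1) ^ 2)) / 2 * M))
      atTop (𝓝 (ENNReal.ofReal ((1 / 2) * M))) := by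
    refine (ENNReal.continuous_ofReal.tendsto _).comp ?_
    have h1 : Tendsto (fun n : ℕ => c / ((n : ℝ) + 1) ^ 2) atTop (𝓝 0) := by
      refine tendsto_const_nhds.div_atTop ?_
      exact (tendsto_pow_atTop two_ne_zero).comp
        (tendsto_atTop_add_const_right _ _ tendsto_natCast_atTop_atTop)
    have h2 := (((h1.const_mul (T - ε)).const_add 1).div_const 2).mul_const M
    simpa using h2
  calc ∫⁻ t in Ioc ε T, ∫⁻ x, gradProd f g i j t x
      = ∫⁻ t in Ioc ε T, ∫⁻ x, liminf (fun n => gradProd f g i j t x * ENNReal.ofReal (χ n x)) atTop := by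
        simp_rw [hlim]
    _ ≤ ∫⁻ t in Ioc ε T, liminf (fun n => ∫⁻ x, gradProd f g i j t x * ENNReal.ofReal (χ n x)) atTop := by
        refine setLIntegral_mono' measurableSet_Ioc fun t ht => ?_
        exact lintegral_liminf_le fun n => (measurable_gradProd_slice hf hg i j t).mul
          (hχ n).1.continuous.measurable.ennreal_ofReal
    _ ≤ liminf (fun n => ∫⁻ t in Ioc ε T, ∫⁻ x, gradProd f g i j t x * ENNReal.ofReal (χ n x)) atTop :=
        lintegral_liminf_le' fun n => aemeasurable_lintegral_gradProd hf hg i j hε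
          (hχ n).1.continuous.measurable.ennreal_ofReal
    _ ≤ liminf (fun n : ℕ => ENNReal.ofReal ((1 + (T - ε) * (c / ((n : ℝ) + 1) ^ 2)) / 2 * M)) atTop :=
        liminf_le_liminf (Eventually.of_forall hb)
    _ = _ := htend.liminf_eq

end Bilinear

/-! ### From sums of powers to a product of norms, for functions of any sign. -/

section BilinearNorm

variable {p q : ℝ} {f g : E3 → ℝ}

/-- The space-time integral of `|∂ᵢ P_t f ∂ⱼ P_t g|` over `ε < t ≤ T`. -/
def gradForm (f g : E3 → ℝ) (i j : Fin 3) (ε T : ℝ) : ℝ≥0∞ :=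
  ∫⁻ t in Ioc ε T, ∫⁻ x, gradProd f g i j t x

lemma gradForm_comm (f g : E3 → ℝ) (i j : Fin 3) (ε T : ℝ) :
    gradForm f g i j ε T = gradForm g f j i ε T := by
  simp only [gradForm, gradProd, mul_comm]

lemma conv_const_mul (K f : E3 → ℝ) (c : ℝ) : conv K (fun x => c * f x) = fun x => c * conv K f x := by
  funext x
  simp only [conv, ← integral_const_mul]
  exact integral_congr_ae (Eventually.of_forall fun y => by ring)

lemma conv_congr_ae {K f g : E3 → ℝ} (h : f =ᵐ[volume] g) : conv K f = conv K g := by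
  funext x
  refine integral_congr_ae ?_
  filter_upwards [h] with y hy
  rw [hy]

lemma conv_add {K f g : E3 → ℝ} (hK : Continuous K) (hf : IsBddSupp f) (hg : IsBddSupp g) :
    conv K (fun x => f x + g x) = fun x => conv K f x + conv K g x := by
  funext x
  simp only [conv, mul_add]
  have hc : Continuous fun y => K (x - y) := hK.comp (by fun_prop)
  exact integral_add (hf.integrable_continuous_mul hc) (hg.integrable_continuous_mul hc)

lemma gradForm_const_mul_left (hf : IsBddSupp f) (i j : Fin 3) (ε T c : ℝ) :
    gradForm (fun x => c * f x) g i j ε T = ‖c‖ₑ * gradForm f g i j ε T := by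
  have : ∀ t x, gradProd (fun x => c * f x) g i j t x = ‖c‖ₑ * gradProd f g i j t x := by
    intro t x
    simp only [gradProd, heatExt]
    rw [conv_const_mul, pderiv_const_mul ((contDiff_heatExt hf t).differentiable (by simp)),
      ← enorm_mul, mul_assoc]
  simp only [gradForm, this]
  rw [← lintegral_const_mul' _ _ enorm_ne_top]
  refine lintegral_congr fun t => ?_
  rw [lintegral_const_mul' _ _ enorm_ne_top]

lemma gradForm_add_left_le (hf : IsBddSupp f) {f' : E3 → ℝ} (hf' : IsBddSupp f')
    (hg : IsBddSupp g) (i j : Fin 3) {ε T : ℝ} (hε : 0 < ε) :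
    gradForm (fun x => f x + f' x) g i j ε T ≤ gradForm f g i j ε T + gradForm f' g i j ε T := by
  have h1 : ∀ t x, gradProd (fun x => f x + f' x) g i j t x
      ≤ gradProd f g i j t x + gradProd f' g i j t x := by
    intro t x
    simp only [gradProd]
    have : pderiv i (heatExt t fun x => f x + f' x) x
        = pderiv i (heatExt t f) x + pderiv i (heatExt t f') x := by
      simp only [heatExt, pderiv]
      rw [conv_add (contDiff_heat t).continuous hf hf',
        fderiv_fun_add ((contDiff_heatExt hf t).differentiable (by simp) x)
          ((contDiff_heatExt hf' t).differentiable (by simp) x)]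
      rfl
    rw [this, add_mul]
    exact enorm_add_le _ _
  have hm := aemeasurable_lintegral_gradProd hf hg i j (T := T) hε (η := fun _ => 1) measurable_const
  simp only [mul_one] at hm
  simp only [gradForm]
  rw [← lintegral_add_left' hm]
  refine lintegral_mono fun t => ?_
  simp only
  rw [← lintegral_add_left (measurable_gradProd_slice hf hg i j t)]
  exact lintegral_mono fun x => h1 t x

lemma gradForm_eq_zero (h : f =ᵐ[volume] 0) (i j : Fin 3) (ε T : ℝ) :
    gradForm f g i j ε T = 0 := by
  have : ∀ t x, gradProd f g i j t x = 0 := by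
    intro t x
    have h0 : heatExt t f = fun _ => 0 := by
      funext y
      simp only [heatExt, conv_congr_ae h]
      simp [conv]
    simp [gradProd, h0, pderiv]
  simp [gradForm, this]

/-- The form is homogeneous in each argument, so f and g may be normalized to have norm one in L^p
and L^q. The sum of powers is then 2, and scaling back produces the product of the norms. Functions
that vanish almost everywhere are treated apart. -/
lemma gradForm_le_of_nonneg (hp : 2 ≤ p) (hpq : p.HolderConjugate q) (hf : IsBddSupp f)
    (hg : IsBddSupp g) (hf0 : ∀ x, 0 ≤ f x) (hg0 : ∀ x, 0 ≤ g x) {ε T : ℝ} (hε : 0 < ε)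
    (hεT : ε ≤ T) (i j : Fin 3) :
    gradForm f g i j ε T ≤ ENNReal.ofReal (bellmanConst q + 1) *
      (eLpNorm f (ENNReal.ofReal p) volume * eLpNorm g (ENNReal.ofReal q) volume) := by
  have hp0 : 0 < p := by linarith
  have hq0 : 0 < q := by linarith [hpq.symm.lt]
  -- The scale a is the norm of f. The positive integral is what ensures strictly positive heat
  -- extensions.
  have key : ∀ {f : E3 → ℝ} {p : ℝ}, 0 < p → IsBddSupp f → (∀ x, 0 ≤ f x) → ¬ f =ᵐ[volume] 0 →
      0 < ∫ x, f x ∧ ∃ a : ℝ, 0 < a ∧ eLpNorm f (ENNReal.ofReal p) volume = ENNReal.ofReal a ∧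
        ∫ x, (a⁻¹ * f x) ^ p = 1 := by
    intro f p hp hf hf0 hne
    have hint := (hf.rpow hf0 hp).integrable
    have hi0 : 0 < ∫ x, f x := by
      refine lt_of_le_of_ne (integral_nonneg hf0) fun h => hne ?_
      exact (integral_eq_zero_iff_of_nonneg hf0 hf.integrable).1 h.symm
    have hip : 0 < ∫ x, f x ^ p := by
      refine lt_of_le_of_ne (integral_nonneg fun x => Real.rpow_nonneg (hf0 x) p) fun h => hne ?_
      have := (integral_eq_zero_iff_of_nonneg (fun x => Real.rpow_nonneg (hf0 x) p) hint).1 h.symm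
      filter_upwards [this] with x hx
      exact (Real.rpow_eq_zero (hf0 x) hp.ne').1 hx
    refine ⟨hi0, (∫ x, f x ^ p) ^ p⁻¹, by positivity, ?_, ?_⟩
    · rw [(hf.memLp (ENNReal.ofReal p)).eLpNorm_eq_integral_rpow_norm (by simpa using hp) (by simp),
        ENNReal.toReal_ofReal hp.le]
      simp_rw [Real.norm_of_nonneg (hf0 _)]
    · have : ∀ x, (((∫ x, f x ^ p) ^ p⁻¹)⁻¹ * f x) ^ p = (∫ x, f x ^ p)⁻¹ * f x ^ p := by
        intro x
        rw [Real.mul_rpow (by positivity) (hf0 x), Real.inv_rpow (by positivity),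
          ← Real.rpow_mul hip.le, inv_mul_cancel₀ hp.ne', Real.rpow_one]
      simp_rw [this]
      rw [integral_const_mul, inv_mul_cancel₀ hip.ne']
  by_cases hfz : f =ᵐ[volume] 0
  · rw [gradForm_eq_zero hfz]; exact zero_le
  by_cases hgz : g =ᵐ[volume] 0
  · rw [gradForm_comm, gradForm_eq_zero hgz]; exact zero_le
  obtain ⟨hfi, a, ha, haN, ha1⟩ := key hp0 hf hf0 hfz
  obtain ⟨hgi, b, hb, hbN, hb1⟩ := key hq0 hg hg0 hgz
  have h1 := lintegral_bilinear_le hp hpq (hf.const_mul a⁻¹) (hg.const_mul b⁻¹)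
    (fun x => mul_nonneg (by positivity) (hf0 x)) (fun x => mul_nonneg (by positivity) (hg0 x))
    (by rw [integral_const_mul]; positivity) (by rw [integral_const_mul]; positivity) hε hεT i j
  rw [ha1, hb1] at h1
  change gradForm _ _ i j ε T ≤ _ at h1
  rw [gradForm_const_mul_left hf, gradForm_comm, gradForm_const_mul_left hg, gradForm_comm,
    ← mul_assoc] at h1
  rw [haN, hbN]
  have e1 : ENNReal.ofReal a * ENNReal.ofReal b * (‖a⁻¹‖ₑ * ‖b⁻¹‖ₑ) = 1 := by
    rw [Real.enorm_of_nonneg (by positivity), Real.enorm_of_nonneg (by positivity),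
      ← ENNReal.ofReal_mul ha.le, ← ENNReal.ofReal_mul (by positivity),
      ← ENNReal.ofReal_mul (by positivity), ← ENNReal.ofReal_one]
    congr 1
    field_simp
  calc gradForm f g i j ε T
      = ENNReal.ofReal a * ENNReal.ofReal b * (‖a⁻¹‖ₑ * ‖b⁻¹‖ₑ * gradForm f g i j ε T) := by
        rw [← mul_assoc, e1, one_mul]
    _ ≤ ENNReal.ofReal a * ENNReal.ofReal b *
        ENNReal.ofReal (1 / 2 * ((bellmanConst q + 1) * (1 + 1))) := by gcongr
    _ = _ := by
        rw [mul_comm]; congr 2; ring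

lemma eLpNorm_posPart_le (f : E3 → ℝ) (p : ℝ≥0∞) :
    eLpNorm (fun x => max (f x) 0) p volume ≤ eLpNorm f p volume :=
  eLpNorm_mono fun x => by
    rw [Real.norm_of_nonneg (le_max_right _ _)]
    exact max_le (Real.le_norm_self _) (norm_nonneg _)

lemma gradForm_le_posPart (hf : IsBddSupp f) (hg : IsBddSupp g) (i j : Fin 3) {ε T : ℝ}
    (hε : 0 < ε) : gradForm f g i j ε T ≤ gradForm (fun x => max (f x) 0) g i j ε T
      + gradForm (fun x => max (-f x) 0) g i j ε T := by
  have e : f = fun x => max (f x) 0 + (-1) * max (-f x) 0 := by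
    funext x
    rcases le_total 0 (f x) with h | h
    · simp [h]
    · simp [h]
  have h2 := gradForm_add_left_le (T := T) hf.posPart (hf.neg.posPart.const_mul (-1)) hg i j hε
  rw [← e, gradForm_const_mul_left hf.neg.posPart] at h2
  simpa using h2

/-- The positive and negative parts of f and g give four forms with nonnegative arguments, whence
the factor 4. -/
lemma gradForm_le_of_two_le (hp : 2 ≤ p) (hpq : p.HolderConjugate q) (hf : IsBddSupp f)
    (hg : IsBddSupp g) {ε T : ℝ} (hε : 0 < ε) (hεT : ε ≤ T) (i j : Fin 3) :
    gradForm f g i j ε T ≤ ENNReal.ofReal (4 * (bellmanConst q + 1)) *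
      (eLpNorm f (ENNReal.ofReal p) volume * eLpNorm g (ENNReal.ofReal q) volume) := by
  set C := ENNReal.ofReal (bellmanConst q + 1) *
      (eLpNorm f (ENNReal.ofReal p) volume * eLpNorm g (ENNReal.ofReal q) volume) with hC
  have hneg : ∀ (f : E3 → ℝ) (p : ℝ≥0∞), eLpNorm (fun x => max (-f x) 0) p volume
      ≤ eLpNorm f p volume := fun f p => by
    refine (eLpNorm_posPart_le (fun x => -f x) p).trans (le_of_eq ?_)
    exact eLpNorm_neg f p volume
  have key : ∀ {f' g' : E3 → ℝ}, IsBddSupp f' → IsBddSupp g' → (∀ x, 0 ≤ f' x) → (∀ x, 0 ≤ g' x) →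
      eLpNorm f' (ENNReal.ofReal p) volume ≤ eLpNorm f (ENNReal.ofReal p) volume →
      eLpNorm g' (ENNReal.ofReal q) volume ≤ eLpNorm g (ENNReal.ofReal q) volume →
      gradForm f' g' i j ε T ≤ C := by
    intro f' g' hf' hg' h1 h2 h3 h4
    refine (gradForm_le_of_nonneg hp hpq hf' hg' h1 h2 hε hεT i j).trans ?_
    rw [hC]
    gcongr
  have step : ∀ {f' : E3 → ℝ}, IsBddSupp f' → (∀ x, 0 ≤ f' x) →
      eLpNorm f' (ENNReal.ofReal p) volume ≤ eLpNorm f (ENNReal.ofReal p) volume →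
      gradForm f' g i j ε T ≤ C + C := by
    intro f' hf' h1 h2
    rw [gradForm_comm]
    refine (gradForm_le_posPart hg hf' j i hε).trans (add_le_add ?_ ?_) <;> rw [gradForm_comm]
    · exact key hf' hg.posPart h1 (fun x => le_max_right _ _) h2 (eLpNorm_posPart_le _ _)
    · exact key hf' hg.neg.posPart h1 (fun x => le_max_right _ _) h2 (hneg _ _)
  refine (gradForm_le_posPart hf hg i j hε).trans ?_
  refine (add_le_add (step hf.posPart (fun x => le_max_right _ _) (eLpNorm_posPart_le _ _))
    (step hf.neg.posPart (fun x => le_max_right _ _) (hneg _ _))).trans (le_of_eq ?_)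
  rw [ENNReal.ofReal_mul (by norm_num), mul_assoc, ← hC]
  norm_num
  ring

/-- The bilinear embedding for the heat semigroup, which contains the `L^p` boundedness of the second
order Riesz transforms. -/
theorem exists_gradForm_le (hpq : p.HolderConjugate q) : ∃ C : ℝ, 0 ≤ C ∧
    ∀ (f g : E3 → ℝ), IsBddSupp f → IsBddSupp g → ∀ (ε T : ℝ), 0 < ε → ε ≤ T → ∀ i j,
      gradForm f g i j ε T ≤ ENNReal.ofReal C *
        (eLpNorm f (ENNReal.ofReal p) volume * eLpNorm g (ENNReal.ofReal q) volume) := by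
  rcases le_total 2 p with hp | hp
  · have := bellmanConst_nonneg hpq.symm.lt
    exact ⟨4 * (bellmanConst q + 1), by positivity, fun f g hf hg ε T hε hεT i j =>
      gradForm_le_of_two_le hp hpq hf hg hε hεT i j⟩
  -- For p ≤ 2 the conjugate exponent is at least 2, and the form is symmetric under exchanging the
  -- two functions together with the two derivatives.
  · have hq : 2 ≤ q := by
      have h := hpq.inv_add_inv_eq_one
      have h1 : (2 : ℝ)⁻¹ ≤ p⁻¹ := inv_anti₀ hpq.pos hp
      have h2 : q⁻¹ ≤ 2⁻¹ := by linarith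
      exact (inv_le_inv₀ hpq.symm.pos two_pos).1 h2
    have := bellmanConst_nonneg hpq.lt
    refine ⟨4 * (bellmanConst p + 1), by positivity, fun f g hf hg ε T hε hεT i j => ?_⟩
    rw [gradForm_comm, mul_comm (eLpNorm f _ _)]
    exact gradForm_le_of_two_le hq hpq.symm hg hf hε hεT j i

end BilinearNorm

/-! ### The fundamental kernels -/

/-- A common majorant for the first spatial derivatives of the heat kernel and for `t` times its
third ones. -/
def kerMaj (t : ℝ) (x : E3) : ℝ :=
  ‖x‖ / t * ((4 * Real.pi * t) ^ (-(3 / 2) : ℝ) * Real.exp (-((8 * t)⁻¹ * ‖x‖ ^ 2)))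

lemma kerMaj_nonneg {t : ℝ} (ht : 0 < t) (x : E3) : 0 ≤ kerMaj t x := by
  have := Real.pi_pos
  unfold kerMaj; positivity

lemma abs_pderiv_heat_le {t : ℝ} (ht : 0 < t) (k : Fin 3) (x : E3) :
    |pderiv k (heat t) x| ≤ kerMaj t x := by
  have hpi := Real.pi_pos
  have hx : |x k| ≤ ‖x‖ := by simpa using PiLp.norm_apply_le x k
  simp only [pderiv_heat]
  unfold heat kerMaj
  rw [abs_mul, abs_mul]
  gcongr
  · rw [abs_neg, abs_of_pos (by positivity), div_eq_inv_mul]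
    gcongr
    linarith
  · rw [abs_of_pos (by positivity)]
    gcongr
    have : (8 * t)⁻¹ ≤ (4 * t)⁻¹ := by gcongr; norm_num
    have := mul_le_mul_of_nonneg_right this (sq_nonneg ‖x‖)
    linarith

/-- With z = |x|²/(8t) the Gaussian is exp(-z)². The polynomial factor is at most (|x|/t)(z + 1),
and one factor exp(-z) absorbs z + 1. The other one is kept in the majorant. -/
lemma abs_mul_pderiv3_heat_le {t : ℝ} (ht : 0 < t) (i l k : Fin 3) (x : E3) :
    |t * pderiv i (pderiv l (pderiv k (heat t))) x| ≤ kerMaj t x := by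
  have hpi := Real.pi_pos
  have hx : ∀ k, |x k| ≤ ‖x‖ := fun k => by simpa using PiLp.norm_apply_le x k
  have hite : ∀ (P : Prop) [Decidable P] (k : Fin 3), |(if P then (1 : ℝ) else 0) * x k| ≤ ‖x‖ := by
    intro P _ k
    split_ifs
    · simpa using hx k
    · simp
  rw [pderiv3_heat]
  set r := ‖x‖
  set z := (8 * t)⁻¹ * r ^ 2 with hz
  have hr : 0 ≤ r := norm_nonneg x
  have hz0 : 0 ≤ z := by positivity
  have hheat : heat t x = (4 * Real.pi * t) ^ (-(3 / 2) : ℝ) * (Real.exp (-z) * Real.exp (-z)) := by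
    rw [← Real.exp_add, heat, hz]
    congr 2
    field_simp
    ring
  have h1 : |-(2 * t)⁻¹ ^ 3 * x k * x l * x i + (2 * t)⁻¹ ^ 2 * ((if k = l then 1 else 0) * x i +
        (if k = i then 1 else 0) * x l + (if l = i then 1 else 0) * x k)|
      ≤ (2 * t)⁻¹ ^ 3 * r ^ 3 + (2 * t)⁻¹ ^ 2 * (r + r + r) := by
    refine (abs_add_le _ _).trans (add_le_add ?_ ?_)
    · rw [abs_mul, abs_mul, abs_mul, abs_neg, abs_of_pos (by positivity : 0 < (2 * t)⁻¹ ^ 3)]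
      calc (2 * t)⁻¹ ^ 3 * |x k| * |x l| * |x i| ≤ (2 * t)⁻¹ ^ 3 * r * r * r := by
            gcongr <;> exact hx _
        _ = _ := by ring
    · rw [abs_mul, abs_of_pos (by positivity : 0 < (2 * t)⁻¹ ^ 2)]
      gcongr
      refine (abs_add_le _ _).trans (add_le_add ((abs_add_le _ _).trans (add_le_add ?_ ?_)) ?_) <;>
      exact hite _ _
  have h2 : t * ((2 * t)⁻¹ ^ 3 * r ^ 3 + (2 * t)⁻¹ ^ 2 * (r + r + r)) ≤ r / t * (z + 1) := by
    have : t * ((2 * t)⁻¹ ^ 3 * r ^ 3 + (2 * t)⁻¹ ^ 2 * (r + r + r)) = r / t * (z + 3 / 4) := by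
      rw [hz]; field_simp; ring
    rw [this]
    gcongr; norm_num
  have h3 : (z + 1) * Real.exp (-z) ≤ 1 := by
    calc (z + 1) * Real.exp (-z) ≤ Real.exp z * Real.exp (-z) := by
          gcongr; exact Real.add_one_le_exp z
      _ = 1 := by rw [← Real.exp_add]; simp
  beta_reduce
  generalize -(2 * t)⁻¹ ^ 3 * x k * x l * x i + (2 * t)⁻¹ ^ 2 * ((if k = l then 1 else 0) * x i +
        (if k = i then 1 else 0) * x l + (if l = i then 1 else 0) * x k) = P at h1 ⊢
  calc |t * (P * heat t x)| = t * |P| * heat t x := by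
        rw [abs_mul, abs_mul, abs_of_pos ht, abs_of_pos (heat_pos ht x)]; ring
    _ ≤ t * ((2 * t)⁻¹ ^ 3 * r ^ 3 + (2 * t)⁻¹ ^ 2 * (r + r + r)) * heat t x := by
        have := (heat_pos ht x).le
        gcongr
    _ ≤ r / t * (z + 1) * heat t x := mul_le_mul_of_nonneg_right h2 (heat_pos ht x).le
    _ = r / t * ((4 * Real.pi * t) ^ (-(3 / 2) : ℝ) * (((z + 1) * Real.exp (-z)) * Real.exp (-z))) := by
        rw [hheat]; ring
    _ ≤ r / t * ((4 * Real.pi * t) ^ (-(3 / 2) : ℝ) * (1 * Real.exp (-z))) := by gcongr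
    _ = kerMaj t x := by rw [one_mul, hz, kerMaj]

lemma kerMaj_le_rpow {t : ℝ} (ht : 0 < t) (x : E3) : kerMaj t x ≤
    ‖x‖ * t ^ (-(5 / 2) : ℝ) * Real.exp (-((8 * t)⁻¹ * ‖x‖ ^ 2)) := by
  have hpi := Real.pi_pos
  have h1 : (4 * Real.pi * t) ^ (-(3 / 2) : ℝ) ≤ t ^ (-(3 / 2) : ℝ) := by
    refine Real.rpow_le_rpow_of_nonpos ht ?_ (by norm_num)
    have : 1 ≤ 4 * Real.pi := by linarith [Real.pi_gt_three]
    nlinarith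
  have h2 : t ^ (-(5 / 2) : ℝ) = t ^ (-(3 / 2) : ℝ) / t := by
    rw [← Real.rpow_sub_one ht.ne']; norm_num
  rw [kerMaj, h2]
  calc _ ≤ ‖x‖ / t * (t ^ (-(3 / 2) : ℝ) * Real.exp (-((8 * t)⁻¹ * ‖x‖ ^ 2))) := by gcongr
    _ = _ := by ring

lemma continuousOn_kerMaj : ContinuousOn (fun z : ℝ × E3 => kerMaj z.1 z.2) (Ioi 0 ×ˢ univ) := by
  have hpi := Real.pi_pos
  have h2 : ContinuousOn (fun p : ℝ × E3 => (8 * p.1)⁻¹) (Ioi 0 ×ˢ univ) :=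
    ContinuousOn.inv₀ (by fun_prop) fun p hp => by have : 0 < p.1 := hp.1; positivity
  unfold kerMaj
  refine ContinuousOn.mul (ContinuousOn.div (by fun_prop) (by fun_prop)
    fun p hp => (ne_of_gt hp.1)) (ContinuousOn.mul ?_ ?_)
  · refine ContinuousOn.rpow_const (by fun_prop) fun p hp => Or.inl ?_
    have : 0 < p.1 := hp.1
    positivity
  · exact ((h2.mul (by fun_prop)).neg).rexp

/-- The time integral is split at t = |x|², the parabolic scale. Below it exp(-z) ≤ 2/z² leaves 128
|x|⁻³ t^(-1/2), with integral 256 |x|⁻². Above it the exponential is dropped and |x| t^(-5/2)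
integrates to (2/3)|x|⁻². -/
lemma exists_integral_kerMaj_le : ∃ C : ℝ, 0 < C ∧ ∀ x : E3, x ≠ 0 →
    IntegrableOn (fun t => kerMaj t x) (Ioi 0) ∧ ∫ t in Ioi 0, kerMaj t x ≤ C / ‖x‖ ^ 2 := by
  refine ⟨256 + 2 / 3, by norm_num, fun x hx => ?_⟩
  have hr : 0 < ‖x‖ := norm_pos_iff.2 hx
  set r := ‖x‖ with hrdef
  have hcont : ContinuousOn (fun t => kerMaj t x) (Ioi 0) :=
    continuousOn_kerMaj.comp (f := fun t : ℝ => (t, x)) (by fun_prop) fun t ht => ⟨ht, mem_univ _⟩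
  have b1 : ∀ t, 0 < t → kerMaj t x ≤ 128 * (r ^ 3)⁻¹ * t ^ (-(1 / 2) : ℝ) := by
    intro t ht
    refine (kerMaj_le_rpow ht x).trans ?_
    have hz : 0 < (8 * t)⁻¹ * r ^ 2 := by positivity
    have h1 : Real.exp (-((8 * t)⁻¹ * r ^ 2)) ≤ 128 * t ^ 2 / r ^ 4 := by
      have h2 := Real.quadratic_le_exp_of_nonneg hz.le
      rw [Real.exp_neg]
      have h3 : ((8 * t)⁻¹ * r ^ 2) ^ 2 / 2 ≤ Real.exp ((8 * t)⁻¹ * r ^ 2) := by linarith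
      calc _ ≤ (((8 * t)⁻¹ * r ^ 2) ^ 2 / 2)⁻¹ := inv_anti₀ (by positivity) h3
        _ = _ := by field_simp; norm_num
    have h4 : t ^ (-(1 / 2) : ℝ) = t ^ (-(5 / 2) : ℝ) * t ^ 2 := by
      rw [← Real.rpow_natCast t 2, ← Real.rpow_add ht]; norm_num
    calc r * t ^ (-(5 / 2) : ℝ) * Real.exp (-((8 * t)⁻¹ * r ^ 2))
        ≤ r * t ^ (-(5 / 2) : ℝ) * (128 * t ^ 2 / r ^ 4) := by gcongr
      _ = _ := by rw [h4]; field_simp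
  have b2 : ∀ t, 0 < t → kerMaj t x ≤ r * t ^ (-(5 / 2) : ℝ) := by
    intro t ht
    refine (kerMaj_le_rpow ht x).trans ?_
    refine mul_le_of_le_one_right (by positivity) (Real.exp_le_one_iff.2 ?_)
    have : 0 ≤ (8 * t)⁻¹ * ‖x‖ ^ 2 := by positivity
    linarith
  have hr2 : 0 < r ^ 2 := by positivity
  have i1 : IntegrableOn (fun t : ℝ => t ^ (-(1 / 2) : ℝ)) (Ioc 0 (r ^ 2)) :=
    (intervalIntegrable_iff_integrableOn_Ioc_of_le hr2.le).1
      (intervalIntegral.intervalIntegrable_rpow' (by norm_num))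
  have i2 : IntegrableOn (fun t : ℝ => t ^ (-(5 / 2) : ℝ)) (Ioi (r ^ 2)) :=
    integrableOn_Ioi_rpow_of_lt (by norm_num) hr2
  have j1 : IntegrableOn (fun t => kerMaj t x) (Ioc 0 (r ^ 2)) := by
    refine (i1.const_mul (128 * (r ^ 3)⁻¹)).mono'
      ((hcont.mono fun t ht => ht.1).aestronglyMeasurable measurableSet_Ioc) ?_
    filter_upwards [ae_restrict_mem measurableSet_Ioc] with t ht
    rw [Real.norm_of_nonneg (kerMaj_nonneg ht.1 x)]
    exact b1 t ht.1
  have j2 : IntegrableOn (fun t => kerMaj t x) (Ioi (r ^ 2)) := by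
    refine (i2.const_mul r).mono'
      ((hcont.mono fun t ht => hr2.trans ht).aestronglyMeasurable measurableSet_Ioi) ?_
    filter_upwards [ae_restrict_mem measurableSet_Ioi] with t ht
    rw [Real.norm_of_nonneg (kerMaj_nonneg (hr2.trans ht) x)]
    exact b2 t (hr2.trans ht)
  have hU : Ioc 0 (r ^ 2) ∪ Ioi (r ^ 2) = Ioi 0 := Ioc_union_Ioi_eq_Ioi hr2.le
  refine ⟨hU ▸ j1.union j2, ?_⟩
  rw [← hU, setIntegral_union (Ioc_disjoint_Ioi le_rfl) measurableSet_Ioi j1 j2]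
  have k1 : ∫ t in Ioc 0 (r ^ 2), kerMaj t x ≤ 256 / r ^ 2 := by
    calc _ ≤ ∫ t in Ioc 0 (r ^ 2), 128 * (r ^ 3)⁻¹ * t ^ (-(1 / 2) : ℝ) :=
          setIntegral_mono_on j1 (i1.const_mul _) measurableSet_Ioc fun t ht => b1 t ht.1
      _ = 256 / r ^ 2 := by
          rw [integral_const_mul, ← intervalIntegral.integral_of_le hr2.le,
            integral_rpow (Or.inl (by norm_num))]
          have e : (r ^ 2) ^ (-(1 / 2) + 1 : ℝ) = r := by
            rw [← Real.rpow_natCast r 2, ← Real.rpow_mul hr.le]; norm_num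
          rw [e, Real.zero_rpow (by norm_num)]
          field_simp
          ring
  have k2 : ∫ t in Ioi (r ^ 2), kerMaj t x ≤ (2 / 3) / r ^ 2 := by
    calc _ ≤ ∫ t in Ioi (r ^ 2), r * t ^ (-(5 / 2) : ℝ) :=
          setIntegral_mono_on j2 (i2.const_mul _) measurableSet_Ioi fun t ht => b2 t (hr2.trans ht)
      _ = (2 / 3) / r ^ 2 := by
          rw [integral_const_mul, integral_Ioi_rpow_of_lt (by norm_num) hr2]
          have e : (r ^ 2) ^ (-(5 / 2) + 1 : ℝ) = (r ^ 3)⁻¹ := by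
            rw [← Real.rpow_natCast r 2, ← Real.rpow_mul hr.le, ← Real.rpow_natCast r 3,
              ← Real.rpow_neg hr.le]; norm_num
          rw [e]
          field_simp
          norm_num
  calc _ ≤ 256 / r ^ 2 + (2 / 3) / r ^ 2 := add_le_add k1 k2
    _ = _ := by ring

/-- Local integrability of `‖x‖⁻²` on `ℝ³`. -/
lemma locallyIntegrable_inv_norm_sq : LocallyIntegrable (fun x : E3 => (‖x‖ ^ 2)⁻¹) := by
  refine locallyIntegrable_of_norm_le_rpow (C := 1) (α := 2) (by simp) (by simp; norm_num) ?_ ?_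
  · refine Eventually.of_forall fun x => ?_
    rw [Real.norm_of_nonneg (by positivity), one_mul, Real.rpow_neg (norm_nonneg x)]
    norm_cast
  · exact ((measurable_norm.pow_const 2).inv).aestronglyMeasurable

/-- Kernels dominated by `C ‖x‖⁻²`. -/
structure IsNewtonType (K : E3 → ℝ) : Prop where
  meas : AEStronglyMeasurable K volume
  bound : ∃ C : ℝ, 0 < C ∧ ∀ x, x ≠ 0 → |K x| ≤ C / ‖x‖ ^ 2

lemma IsTest.integrable_mul_inv_norm_sq {ψ : E3 → ℝ} (hψ : IsTest ψ) (y : E3) :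
    Integrable fun x => (‖x - y‖ ^ 2)⁻¹ * ψ x := by
  have h := (locallyIntegrable_inv_norm_sq.integrable_smul_left_of_hasCompactSupport
    (hψ.translate y).continuous (hψ.translate y).compact).comp_sub_right y
  refine h.congr (Eventually.of_forall fun x => ?_)
  simp [mul_comm]

section TimeIntegral

variable {H : ℝ → E3 → ℝ}

lemma aestronglyMeasurable_prod_of_continuousOn
    (hH : ContinuousOn (fun z : ℝ × E3 => H z.1 z.2) (Ioi 0 ×ˢ univ)) :
    AEStronglyMeasurable (fun z : E3 × ℝ => H z.2 z.1)
      (volume.prod (volume.restrict (Ioi 0))) := by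
  have h1 : AEStronglyMeasurable (fun z : ℝ × E3 => H z.1 z.2)
      ((volume.restrict (Ioi (0 : ℝ))).prod (volume : Measure E3)) := by
    have := hH.aestronglyMeasurable (μ := (volume : Measure ℝ).prod (volume : Measure E3))
      (measurableSet_Ioi.prod MeasurableSet.univ)
    rwa [← Measure.prod_restrict, Measure.restrict_univ] at this
  exact h1.prod_swap

lemma isNewtonType_timeIntegral
    (hH : ContinuousOn (fun z : ℝ × E3 => H z.1 z.2) (Ioi 0 ×ˢ univ))
    (hb : ∀ t, 0 < t → ∀ x, |H t x| ≤ kerMaj t x) :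
    IsNewtonType fun x => ∫ t in Ioi 0, H t x := by
  obtain ⟨C, hC, hmaj⟩ := exists_integral_kerMaj_le
  refine ⟨(aestronglyMeasurable_prod_of_continuousOn hH).integral_prod_right', C, hC, fun x hx => ?_⟩
  refine le_trans ?_ (hmaj x hx).2
  rw [← Real.norm_eq_abs]
  refine norm_integral_le_of_norm_le (hmaj x hx).1 ?_
  filter_upwards [ae_restrict_mem measurableSet_Ioi] with t ht using hb t ht x

/-- Fubini's theorem: after integration in time the majorant is at most C|x-y|⁻², which is
integrable against a test function in dimension three. -/
lemma integral_timeIntegral_mul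
    (hH : ContinuousOn (fun z : ℝ × E3 => H z.1 z.2) (Ioi 0 ×ˢ univ))
    (hb : ∀ t, 0 < t → ∀ x, |H t x| ≤ kerMaj t x) {ψ : E3 → ℝ} (hψ : IsTest ψ) (y : E3) :
    IntegrableOn (fun t => ∫ x, H t (x - y) * ψ x) (Ioi 0) ∧
      ∫ x, (∫ t in Ioi 0, H t (x - y)) * ψ x = ∫ t in Ioi 0, ∫ x, H t (x - y) * ψ x := by
  obtain ⟨C, hC, hmaj⟩ := exists_integral_kerMaj_le
  have hm : AEStronglyMeasurable (fun z : E3 × ℝ => H z.2 (z.1 - y) * ψ z.1)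
      (volume.prod (volume.restrict (Ioi 0))) := by
    refine AEStronglyMeasurable.mul ?_ ?_
    · refine aestronglyMeasurable_prod_of_continuousOn (H := fun t x => H t (x - y)) ?_
      exact hH.comp (f := fun z : ℝ × E3 => (z.1, z.2 - y)) (by fun_prop)
        (fun z hz => ⟨hz.1, mem_univ _⟩)
    · exact (hψ.continuous.comp continuous_fst).aestronglyMeasurable
  have hint : Integrable (fun z : E3 × ℝ => H z.2 (z.1 - y) * ψ z.1)
      (volume.prod (volume.restrict (Ioi 0))) := by
    have hne : ∀ᵐ x : E3, x ≠ y := by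
      simp [ae_iff, measure_singleton]
    have hsl : ∀ x : E3, x ≠ y → IntegrableOn (fun t => kerMaj t (x - y)) (Ioi 0) ∧
        ∫ t in Ioi 0, kerMaj t (x - y) ≤ C / ‖x - y‖ ^ 2 := fun x hx => hmaj _ (sub_ne_zero.2 hx)
    have hcH : ∀ x : E3, AEStronglyMeasurable (fun t => H t (x - y)) (volume.restrict (Ioi 0)) :=
      fun x => (hH.comp (f := fun t : ℝ => (t, x - y)) (by fun_prop)
        (fun z hz => ⟨hz, mem_univ _⟩)).aestronglyMeasurable measurableSet_Ioi
    have hbd : ∀ x : E3, ∀ᵐ t ∂(volume.restrict (Ioi (0 : ℝ))), ‖H t (x - y)‖ ≤ kerMaj t (x - y) := by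
      intro x
      filter_upwards [ae_restrict_mem measurableSet_Ioi] with t ht using hb t ht _
    refine (integrable_prod_iff hm).2 ⟨?_, ?_⟩
    · filter_upwards [hne] with x hx
      exact ((hsl x hx).1.mono' (hcH x) (hbd x)).mul_const _
    · refine ((hψ.integrable_mul_inv_norm_sq y).norm.const_mul C).mono'
        hm.norm.integral_prod_right' ?_
      filter_upwards [hne] with x hx
      rw [Real.norm_of_nonneg (integral_nonneg fun t => norm_nonneg _)]
      simp_rw [norm_mul]
      rw [integral_mul_const, ← mul_assoc]
      gcongr
      calc ∫ t in Ioi 0, ‖H t (x - y)‖ ≤ ∫ t in Ioi 0, kerMaj t (x - y) :=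
            integral_mono_ae (((hsl x hx).1.mono' (hcH x) (hbd x)).norm) (hsl x hx).1 (hbd x)
        _ ≤ C / ‖x - y‖ ^ 2 := (hsl x hx).2
        _ = C * ‖(‖x - y‖ ^ 2)⁻¹‖ := by
            rw [Real.norm_of_nonneg (by positivity), div_eq_mul_inv]
  refine ⟨hint.integral_prod_right, ?_⟩
  rw [← integral_integral_swap (f := fun x t => H t (x - y) * ψ x) hint]
  simp_rw [integral_mul_const]

end TimeIntegral

/-- The kernel `∂ₖ N` of the gradient of the Newton potential. -/
def gradKer (k : Fin 3) (x : E3) : ℝ := ∫ t in Ioi 0, -pderiv k (heat t) x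

/-- The third derivatives of the fundamental solution of the bilaplacian. -/
def thirdKer (i l k : Fin 3) (x : E3) : ℝ :=
  ∫ t in Ioi 0, t * pderiv i (pderiv l (pderiv k (heat t))) x

lemma continuousOn_heat_inv : ContinuousOn (fun p : ℝ × E3 => (2 * p.1)⁻¹) (Ioi 0 ×ˢ univ) :=
  ContinuousOn.inv₀ (by fun_prop) fun p hp => by have : 0 < p.1 := hp.1; positivity

lemma continuousOn_pderiv_heat (k : Fin 3) :
    ContinuousOn (fun z : ℝ × E3 => -pderiv k (heat z.1) z.2) (Ioi 0 ×ˢ univ) := by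
  simp only [pderiv_heat]
  exact (((continuousOn_heat_inv.neg).mul (by fun_prop)).mul contDiffOn_heat.continuousOn).neg

lemma continuousOn_pderiv3_heat (i l k : Fin 3) :
    ContinuousOn (fun z : ℝ × E3 => z.1 * pderiv i (pderiv l (pderiv k (heat z.1))) z.2)
      (Ioi 0 ×ˢ univ) := by
  simp only [pderiv3_heat]
  have h := continuousOn_heat_inv
  refine ContinuousOn.mul (by fun_prop) (ContinuousOn.mul (ContinuousOn.add ?_ ?_)
    contDiffOn_heat.continuousOn)
  · exact (((h.pow 3).neg.mul (by fun_prop)).mul (by fun_prop)).mul (by fun_prop)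
  · exact (h.pow 2).mul (by fun_prop)

lemma isNewtonType_gradKer (k : Fin 3) : IsNewtonType (gradKer k) :=
  isNewtonType_timeIntegral (continuousOn_pderiv_heat k) fun t ht x => by
    rw [abs_neg]; exact abs_pderiv_heat_le ht k x

lemma isNewtonType_thirdKer (i l k : Fin 3) : IsNewtonType (thirdKer i l k) :=
  isNewtonType_timeIntegral (continuousOn_pderiv3_heat i l k) fun t ht x =>
    abs_mul_pderiv3_heat_le ht i l k x

lemma integral_pderiv_sub_mul {f φ : E3 → ℝ} (hf : ContDiff ℝ 1 f) (hφ : IsTest φ) (k : Fin 3)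
    (y : E3) : ∫ x, pderiv k f (x - y) * φ x = -∫ x, f (x - y) * pderiv k φ x := by
  have h := integral_mul_pderiv (f := fun x => f (x + -y))
    (hf.comp (contDiff_id.add contDiff_const)) (hφ.contDiff 1) hφ.compact k
  simp_rw [pderiv_translate] at h
  simp only [← sub_eq_add_neg] at h
  rw [h, neg_neg]

lemma integral_heat_sub_mul (t : ℝ) (ψ : E3 → ℝ) (y : E3) :
    ∫ x, heat t (x - y) * ψ x = heatExt t ψ y := by
  simp only [conv, heat_sub_comm t y]

/-- The kernel is never differentiated pointwise. Its derivative is moved onto ψ inside the time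
integral, and the evenness of the heat kernel turns the pairing into a time integral of a heat
extension. -/
lemma integral_gradKer_mul {ψ : E3 → ℝ} (hψ : IsTest ψ) (k : Fin 3) (y : E3) :
    IntegrableOn (fun t => heatExt t (pderiv k ψ) y) (Ioi 0) ∧
      ∫ x, gradKer k (x - y) * ψ x = ∫ t in Ioi 0, heatExt t (pderiv k ψ) y := by
  have h := integral_timeIntegral_mul (H := fun t x => -pderiv k (heat t) x)
    (continuousOn_pderiv_heat k) (fun t ht x => by
      rw [abs_neg]; exact abs_pderiv_heat_le ht k x) hψ y
  have e : ∀ t, ∫ x, -pderiv k (heat t) (x - y) * ψ x = heatExt t (pderiv k ψ) y := by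
    intro t
    simp_rw [neg_mul]
    rw [integral_neg, integral_pderiv_sub_mul (contDiff_nat_of_top (contDiff_heat t) 1) hψ,
      neg_neg, integral_heat_sub_mul]
  simp only [e] at h
  exact h

lemma integral_thirdKer_mul {ψ : E3 → ℝ} (hψ : IsTest ψ) (i l k : Fin 3) (y : E3) :
    IntegrableOn (fun t => t * heatExt t (pderiv k (pderiv l (pderiv i ψ))) y) (Ioi 0) ∧
      ∫ x, thirdKer i l k (x - y) * ψ x
        = -∫ t in Ioi 0, t * heatExt t (pderiv k (pderiv l (pderiv i ψ))) y := by
  have h := integral_timeIntegral_mul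
    (H := fun t x => t * pderiv i (pderiv l (pderiv k (heat t))) x)
    (continuousOn_pderiv3_heat i l k) (fun t ht x => abs_mul_pderiv3_heat_le ht i l k x) hψ y
  have e : ∀ t, ∫ x, (t * pderiv i (pderiv l (pderiv k (heat t))) (x - y)) * ψ x
      = -(t * heatExt t (pderiv k (pderiv l (pderiv i ψ))) y) := by
    intro t
    have h0 := contDiff_heat t
    have h1 := contDiff_top_pderiv k h0
    have h2 := contDiff_top_pderiv l h1
    simp_rw [mul_assoc]
    rw [integral_const_mul, integral_pderiv_sub_mul (contDiff_nat_of_top h2 1) hψ,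
      integral_pderiv_sub_mul (contDiff_nat_of_top h1 1) (hψ.pderiv i),
      integral_pderiv_sub_mul (contDiff_nat_of_top h0 1) ((hψ.pderiv i).pderiv l),
      integral_heat_sub_mul]
    ring
  simp only [e] at h
  refine ⟨?_, ?_⟩
  · simpa using h.1.neg
  · rw [← integral_neg]; exact h.2

/-! ### Heat flow of test functions and the distributional equations of the kernels. -/

lemma pderiv_heatExt_test {χ : E3 → ℝ} (hχ : IsTest χ) (t : ℝ) (k : Fin 3) :
    pderiv k (heatExt t χ) = heatExt t (pderiv k χ) := by
  rw [pderiv_heatExt (IsBddSupp.of_isTest hχ)]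
  funext y
  have h := integral_pderiv_sub_mul (contDiff_nat_of_top (contDiff_heat t) 1)
    (hχ.reflect 0) k (-y)
  have e : ∀ x, pderiv k (fun z => χ (0 - z)) x = -pderiv k χ (-x) := by
    intro x
    have : (fun z => χ (0 - z)) = fun z => χ ((-1 : ℝ) • z) := by funext z; simp
    rw [this, pderiv_comp_smul hχ.differentiable]
    simp
  simp_rw [e, sub_neg_eq_add] at h
  simp only [conv]
  rw [← integral_neg_eq_self (fun x => pderiv k (heat t) (y - x) * χ x),
    ← integral_neg_eq_self (fun x => heat t (y - x) * pderiv k χ x)]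
  simp only [mul_neg, integral_neg, neg_neg, zero_sub] at h
  simp only [sub_neg_eq_add, add_comm y]
  exact h

lemma hasDerivAt_heatExt_test {χ : E3 → ℝ} (hχ : IsTest χ) {t : ℝ} (ht : 0 < t) (y : E3) :
    HasDerivAt (fun s => heatExt s χ y) (heatExt t (Δ χ) y) t := by
  refine (hasDerivAt_heatExt (IsBddSupp.of_isTest hχ) ht y).congr_deriv ?_
  have e : Δ χ = fun x => ∑ k, pderiv k (pderiv k χ) x := by
    funext x; exact laplacian_eq_sum (hχ.contDiff 2) x
  rw [e]
  simp only [pderiv_heatExt_test hχ, pderiv_heatExt_test (hχ.pderiv _)]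
  simp only [heatExt, conv, Finset.mul_sum]
  rw [integral_finsetSum]
  intro k _
  exact (IsBddSupp.of_isTest ((hχ.pderiv k).pderiv k)).integrable_continuous_mul
    ((contDiff_heat t).continuous.comp (by fun_prop))

lemma abs_heatExt_le {f : E3 → ℝ} {t : ℝ} (ht : 0 < t) (y : E3) (hf : Integrable f) :
    |heatExt t f y| ≤ (4 * Real.pi * t) ^ (-(3 / 2) : ℝ) * ∫ x, |f x| := by
  rw [← integral_const_mul, ← Real.norm_eq_abs, heatExt, conv]
  refine norm_integral_le_of_norm_le (hf.abs.const_mul _) (Eventually.of_forall fun x => ?_)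
  rw [norm_mul, Real.norm_of_nonneg (heat_pos ht _).le]
  exact mul_le_mul_of_nonneg_right (heat_le ht _) (abs_nonneg _)

lemma abs_heatExt_le_of_bound {f : E3 → ℝ} {t : ℝ} (ht : 0 < t) (y : E3) {M : ℝ}
    (hM : ∀ x, |f x| ≤ M) : |heatExt t f y| ≤ M := by
  have : |heatExt t f y| ≤ ∫ x, heat t (y - x) * M := by
    rw [← Real.norm_eq_abs, heatExt, conv]
    refine norm_integral_le_of_norm_le (((integrable_heat ht).comp_sub_left y).mul_const M)
      (Eventually.of_forall fun x => ?_)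
    rw [norm_mul, Real.norm_of_nonneg (heat_pos ht _).le]
    exact mul_le_mul_of_nonneg_left (hM x) (heat_pos ht _).le
  rwa [integral_mul_const, integral_sub_left_eq_self (heat t), integral_heat ht, one_mul] at this

lemma tendsto_heatExt_atTop {f : E3 → ℝ} (hf : Integrable f) (y : E3) :
    Tendsto (fun t => heatExt t f y) atTop (𝓝 0) := by
  have h1 : Tendsto (fun t : ℝ => (4 * Real.pi * t) ^ (-(3 / 2) : ℝ) * ∫ x, |f x|) atTop (𝓝 0) := by
    have : Tendsto (fun t : ℝ => 4 * Real.pi * t) atTop atTop :=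
      tendsto_id.const_mul_atTop (by positivity)
    simpa using ((tendsto_rpow_neg_atTop (by norm_num : (0 : ℝ) < 3 / 2)).comp this).mul_const
      (∫ x, |f x|)
  refine squeeze_zero_norm' ?_ h1
  filter_upwards [eventually_gt_atTop 0] with t ht using abs_heatExt_le ht y hf

lemma tendsto_mul_heatExt_atTop {f : E3 → ℝ} (hf : Integrable f) (y : E3) :
    Tendsto (fun t => t * heatExt t f y) atTop (𝓝 0) := by
  have h1 : Tendsto (fun t : ℝ => (4 * Real.pi) ^ (-(3 / 2) : ℝ) * t ^ (-(1 / 2) : ℝ) *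
      ∫ x, |f x|) atTop (𝓝 0) := by
    simpa using ((tendsto_rpow_neg_atTop (by norm_num : (0 : ℝ) < 1 / 2)).const_mul
      ((4 * Real.pi) ^ (-(3 / 2) : ℝ))).mul_const (∫ x, |f x|)
  refine squeeze_zero_norm' ?_ h1
  filter_upwards [eventually_gt_atTop 0] with t ht
  rw [norm_mul, Real.norm_of_nonneg ht.le]
  refine (mul_le_mul_of_nonneg_left (abs_heatExt_le ht y hf) ht.le).trans (le_of_eq ?_)
  rw [Real.mul_rpow (by positivity) ht.le]
  have : t ^ (-(1 / 2) : ℝ) = t ^ (-(3 / 2) : ℝ) * t := by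
    rw [← Real.rpow_add_one ht.ne']; norm_num
  rw [this]; ring

lemma heat_sqrt_smul {t : ℝ} (ht : 0 < t) (w : E3) :
    heat t (Real.sqrt t • w) = (Real.sqrt t ^ 3)⁻¹ * heat 1 w := by
  have hpi := Real.pi_pos
  have h1 : (Real.sqrt t ^ 3)⁻¹ = t ^ (-(3 / 2) : ℝ) := by
    rw [Real.sqrt_eq_rpow, ← Real.rpow_natCast, ← Real.rpow_mul ht.le, ← Real.rpow_neg ht.le]
    norm_num
  unfold heat
  rw [norm_smul, mul_pow, Real.norm_of_nonneg (Real.sqrt_nonneg t), Real.sq_sqrt ht.le, h1,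
    Real.mul_rpow (by positivity) ht.le]
  have e : -(4 * t)⁻¹ * (t * ‖w‖ ^ 2) = -(4 * 1)⁻¹ * ‖w‖ ^ 2 := by field_simp
  rw [e]
  ring_nf

/-- The substitution z = √t w makes the kernel independent of t, and dominated convergence applies
since χ is bounded and continuous. -/
lemma tendsto_heatExt_zero {χ : E3 → ℝ} (hχ : IsTest χ) (y : E3) :
    Tendsto (fun t => heatExt t χ y) (𝓝[>] 0) (𝓝 (χ y)) := by
  obtain ⟨M, hM0, hM⟩ := hχ.exists_bound
  have e : ∀ t, 0 < t → heatExt t χ y = ∫ w, heat 1 w * χ (y - Real.sqrt t • w) := by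
    intro t ht
    rw [heatExt, conv_comm]
    have h := Measure.integral_comp_smul (volume : Measure E3)
      (fun z => heat t z * χ (y - z)) (Real.sqrt t)
    simp_rw [heat_sqrt_smul ht] at h
    have hs : 0 < Real.sqrt t := Real.sqrt_pos.2 ht
    simp only [finrank_euclideanSpace, Fintype.card_fin, smul_eq_mul, mul_assoc] at h
    rw [integral_const_mul, abs_of_pos (by positivity)] at h
    exact (mul_left_cancel₀ (by positivity) h).symm
  have hlim : Tendsto (fun t => ∫ w, heat 1 w * χ (y - Real.sqrt t • w)) (𝓝[>] 0)
      (𝓝 (∫ w, heat 1 w * χ y)) := by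
    refine tendsto_integral_filter_of_dominated_convergence (fun w => heat 1 w * M) ?_ ?_
      ((integrable_heat one_pos).mul_const M) ?_
    · refine Eventually.of_forall fun t => Continuous.aestronglyMeasurable ?_
      exact (contDiff_heat 1).continuous.mul (hχ.continuous.comp (by fun_prop))
    · refine Eventually.of_forall fun t => Eventually.of_forall fun w => ?_
      rw [norm_mul, Real.norm_of_nonneg (heat_pos one_pos _).le]
      exact mul_le_mul_of_nonneg_left (hM _) (heat_pos one_pos _).le
    · refine Eventually.of_forall fun w => ?_
      have hc : Continuous fun t => heat 1 w * χ (y - Real.sqrt t • w) :=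
        continuous_const.mul (hχ.continuous.comp (by fun_prop))
      have := hc.tendsto 0
      simp only [Real.sqrt_zero, zero_smul, sub_zero] at this
      exact this.mono_left nhdsWithin_le_nhds
  rw [integral_mul_const, integral_heat one_pos, one_mul] at hlim
  refine hlim.congr' ?_
  filter_upwards [self_mem_nhdsWithin] with t ht using (e t ht).symm

/-- The integrand is the time derivative of Pₜχ(y), which goes from χ(y) at t = 0 to 0 at t = ∞.
This is ΔN = δ. -/
lemma integral_heatExt_laplacian {χ : E3 → ℝ} (hχ : IsTest χ) (y : E3)
    (hint : IntegrableOn (fun t => heatExt t (Δ χ) y) (Ioi 0)) :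
    ∫ t in Ioi 0, heatExt t (Δ χ) y = -χ y := by
  have h := integral_Ioi_deriv_mul_eq_sub (a := 0) (a' := χ y) (b' := 0) (u := fun _ : ℝ => (1 : ℝ))
    (u' := fun _ => 0) (v := fun t => heatExt t χ y) (v' := fun t => heatExt t (Δ χ) y)
    (fun x _ => hasDerivAt_const x 1) (fun t ht => hasDerivAt_heatExt_test hχ ht y)
    (by
      refine hint.congr (Eventually.of_forall fun t => ?_)
      simp)
    (by
      refine (tendsto_heatExt_zero hχ y).congr fun t => ?_
      simp)
    (by
      refine (tendsto_heatExt_atTop hχ.integrable y).congr fun t => ?_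
      simp)
  simpa using h

lemma laplacian_fun_eq {φ : E3 → ℝ} (hφ : IsTest φ) :
    Δ φ = fun x => ∑ k, pderiv k (pderiv k φ) x := by
  funext x; exact laplacian_eq_sum (hφ.contDiff 2) x

lemma pderiv_sum {ι : Type*} {s : Finset ι} {φ : ι → E3 → ℝ} (h : ∀ i ∈ s, IsTest (φ i))
    (k : Fin 3) (x : E3) : pderiv k (fun x => ∑ i ∈ s, φ i x) x = ∑ i ∈ s, pderiv k (φ i) x := by
  simp only [pderiv]
  rw [fderiv_fun_sum fun i hi => (h i hi).differentiable x]
  simp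

lemma pderiv_laplacian {φ : E3 → ℝ} (hφ : IsTest φ) (k : Fin 3) :
    pderiv k (Δ φ) = Δ (pderiv k φ) := by
  rw [laplacian_fun_eq hφ, laplacian_fun_eq (hφ.pderiv k)]
  funext x
  rw [pderiv_sum fun i _ => (hφ.pderiv i).pderiv i]
  refine Finset.sum_congr rfl fun i _ => ?_
  rw [pderiv_comm ((hφ.pderiv i).contDiff 2) k i, pderiv_comm (hφ.contDiff 2) k i]

/-- The divergence of the kernel `gradKer` is the Dirac mass. -/
lemma sum_integral_gradKer_pderiv {φ : E3 → ℝ} (hφ : IsTest φ) (y : E3) :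
    ∑ k, ∫ x, gradKer k (x - y) * pderiv k φ x = -φ y := by
  have h := fun k => integral_gradKer_mul (hφ.pderiv k) k y
  have e : ∀ t, ∑ k, heatExt t (pderiv k (pderiv k φ)) y = heatExt t (Δ φ) y := by
    intro t
    rw [laplacian_fun_eq hφ]
    simp only [heatExt, conv, Finset.mul_sum]
    rw [integral_finsetSum]
    intro k _
    exact (IsBddSupp.of_isTest ((hφ.pderiv k).pderiv k)).integrable_continuous_mul
      ((contDiff_heat t).continuous.comp (by fun_prop))
  have hi : IntegrableOn (fun t => ∑ k, heatExt t (pderiv k (pderiv k φ)) y) (Ioi 0) :=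
    integrable_finsetSum _ fun k _ => (h k).1
  simp_rw [fun k => (h k).2]
  rw [← integral_finsetSum _ fun k _ => (h k).1]
  simp only [e] at hi ⊢
  exact integral_heatExt_laplacian hφ y hi

/-- `Δ gradKer k` is the `k`-th derivative of the Dirac mass. -/
lemma integral_gradKer_laplacian {φ : E3 → ℝ} (hφ : IsTest φ) (k : Fin 3) (y : E3) :
    ∫ x, gradKer k (x - y) * (Δ φ) x = -pderiv k φ y := by
  have h := integral_gradKer_mul hφ.laplacian k y
  rw [pderiv_laplacian hφ] at h
  rw [h.2]
  exact integral_heatExt_laplacian (hφ.pderiv k) y h.1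

/-- Integration by parts in time for t ∂ₜPₜη(y). The boundary terms vanish, at 0 because Pₜη stays
bounded and at infinity because t Pₜη is O(t^(-1/2)). This is ΔΦ = N. -/
lemma integral_mul_heatExt_laplacian {η : E3 → ℝ} (hη : IsTest η) (y : E3)
    (h1 : IntegrableOn (fun t => heatExt t η y) (Ioi 0))
    (h2 : IntegrableOn (fun t => t * heatExt t (Δ η) y) (Ioi 0)) :
    ∫ t in Ioi 0, t * heatExt t (Δ η) y = -∫ t in Ioi 0, heatExt t η y := by
  have h := integral_Ioi_deriv_mul_eq_sub (a := 0) (a' := 0) (b' := 0) (u := fun t : ℝ => t)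
    (u' := fun _ => 1) (v := fun t => heatExt t η y) (v' := fun t => heatExt t (Δ η) y)
    (fun x _ => hasDerivAt_id x) (fun t ht => hasDerivAt_heatExt_test hη ht y)
    (by
      refine (h1.add h2).congr (Eventually.of_forall fun t => ?_)
      simp)
    (by
      have := (tendsto_id.mono_left nhdsWithin_le_nhds : Tendsto (fun t : ℝ => t) (𝓝[>] 0) (𝓝 0)).mul
        (tendsto_heatExt_zero hη y)
      rw [zero_mul] at this
      exact this)
    (tendsto_mul_heatExt_atTop hη.integrable y)
  simp only [one_mul] at h
  rw [integral_add h1 h2] at h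
  linarith

/-- `Δ thirdKer i l k` is the second derivative `∂ᵢ ∂ₗ` of `gradKer k`. -/
lemma integral_thirdKer_laplacian {φ : E3 → ℝ} (hφ : IsTest φ) (i l k : Fin 3) (y : E3) :
    ∫ x, thirdKer i l k (x - y) * (Δ φ) x
      = ∫ x, gradKer k (x - y) * pderiv l (pderiv i φ) x := by
  set η := pderiv k (pderiv l (pderiv i φ))
  have hη : IsTest η := ((hφ.pderiv i).pderiv l).pderiv k
  have h1 := integral_thirdKer_mul hφ.laplacian i l k y
  have h2 := integral_gradKer_mul ((hφ.pderiv i).pderiv l) k y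
  have e : pderiv k (pderiv l (pderiv i (Δ φ))) = Δ η := by
    rw [pderiv_laplacian hφ, pderiv_laplacian (hφ.pderiv i), pderiv_laplacian ((hφ.pderiv i).pderiv l)]
  rw [e] at h1
  rw [h1.2, h2.2]
  rw [integral_mul_heatExt_laplacian hη y h2.1 h1.1, neg_neg]

/-! ### Integrals of powers of the distance. -/

lemma exists_lintegral_radial : ∃ c : ℝ, 0 < c ∧ ∀ f : ℝ → ℝ, (∀ r, 0 ≤ f r) →
    IntegrableOn (fun r => r ^ 2 * f r) (Ioi 0) →
    ∫⁻ x : E3, ENNReal.ofReal (f ‖x‖) = ENNReal.ofReal (c * ∫ r in Ioi 0, r ^ 2 * f r) := by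
  refine ⟨3 * (volume : Measure E3).real (Metric.ball 0 1), ?_, fun f hf hint => ?_⟩
  · have : 0 < (volume : Measure E3).real (Metric.ball 0 1) :=
      ENNReal.toReal_pos (Metric.measure_ball_pos _ _ one_pos).ne' measure_ball_lt_top.ne
    positivity
  · have h1 : Integrable (fun x : E3 => f ‖x‖) := by
      rw [integrable_fun_norm_addHaar]
      simpa using hint
    rw [← ofReal_integral_eq_lintegral_ofReal h1 (Eventually.of_forall fun x => hf _),
      integral_fun_norm_addHaar]
    simp [mul_assoc]

lemma exists_lintegral_ball_inv_sq : ∃ c : ℝ, 0 < c ∧ ∀ R, 0 < R →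
    ∫⁻ x in Metric.ball (0 : E3) R, ENNReal.ofReal (‖x‖ ^ 2)⁻¹ ≤ ENNReal.ofReal (c * R) := by
  obtain ⟨c, hc, h⟩ := exists_lintegral_radial
  refine ⟨c, hc, fun R hR => ?_⟩
  have e : ∀ r : ℝ, r ∈ Ioi (0 : ℝ) →
      r ^ 2 * (Iio R).indicator (fun r => (r ^ 2)⁻¹) r = (Iio R).indicator (fun _ => 1) r := by
    intro r hr
    have hr : 0 < r := hr
    by_cases h : r < R
    · simp [h, hr.ne']
    · simp [h]
  have h2 := h ((Iio R).indicator fun r => (r ^ 2)⁻¹)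
    (indicator_nonneg fun r _ => by positivity) (by
      rw [integrableOn_congr_fun e measurableSet_Ioi]
      rw [IntegrableOn, integrable_indicator_iff measurableSet_Iio, IntegrableOn,
        Measure.restrict_restrict measurableSet_Iio]
      refine integrableOn_const ?_
      rw [Iio_inter_Ioi]; simp)
  rw [setIntegral_congr_fun measurableSet_Ioi e, setIntegral_indicator measurableSet_Iio,
    Ioi_inter_Iio] at h2
  simp only [integral_const, smul_eq_mul, mul_one, measureReal_restrict_apply_univ,
    Real.volume_real_Ioo_of_le hR.le, sub_zero] at h2
  rw [← h2, ← lintegral_indicator Metric.isOpen_ball.measurableSet]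
  refine lintegral_mono fun x => ?_
  by_cases hx : ‖x‖ < R
  · simp [hx]
  · simp [hx]

lemma exists_lintegral_compl_ball_inv_four : ∃ c : ℝ, 0 < c ∧ ∀ R, 0 < R →
    ∫⁻ x in (Metric.ball (0 : E3) R)ᶜ, ENNReal.ofReal (‖x‖ ^ 4)⁻¹ ≤ ENNReal.ofReal (c / R) := by
  obtain ⟨c, hc, h⟩ := exists_lintegral_radial
  refine ⟨c, hc, fun R hR => ?_⟩
  have e : ∀ r : ℝ, r ∈ Ioi (0 : ℝ) → r ^ 2 * (Ici R).indicator (fun r => (r ^ 4)⁻¹) r =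
      (Ici R).indicator (fun r => r ^ (-2 : ℝ)) r := by
    intro r hr
    have hr : 0 < r := hr
    by_cases h : R ≤ r
    · have : r ^ (-2 : ℝ) = (r ^ 2)⁻¹ := by
        rw [Real.rpow_neg hr.le]; norm_cast
      simp only [indicator, mem_Ici, h, if_true, this]
      field_simp
    · simp [h]
  have hs : (Ici R) ∩ Ioi 0 = Ici R := inter_eq_left.2 fun r hr => lt_of_lt_of_le hR hr
  have h2 := h ((Ici R).indicator fun r => (r ^ 4)⁻¹)
    (indicator_nonneg fun r _ => by positivity) (by
      rw [integrableOn_congr_fun e measurableSet_Ioi]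
      rw [IntegrableOn, integrable_indicator_iff measurableSet_Ici, IntegrableOn,
        Measure.restrict_restrict measurableSet_Ici, hs]
      exact (integrableOn_Ici_iff_integrableOn_Ioi (by simp)).2 (integrableOn_Ioi_rpow_of_lt (by norm_num) hR))
  rw [setIntegral_congr_fun measurableSet_Ioi e, setIntegral_indicator measurableSet_Ici,
    inter_comm, hs, integral_Ici_eq_integral_Ioi, integral_Ioi_rpow_of_lt (by norm_num) hR] at h2
  have e2 : c * (-R ^ (-2 + 1 : ℝ) / (-2 + 1)) = c / R := by
    rw [show (-2 + 1 : ℝ) = -1 by norm_num, Real.rpow_neg_one]; field_simp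
  rw [e2] at h2
  rw [← h2, ← lintegral_indicator Metric.isOpen_ball.measurableSet.compl]
  refine lintegral_mono fun x => ?_
  by_cases hx : R ≤ ‖x‖
  · simp [hx, not_lt.2 hx]
  · simp [hx, not_le.1 hx]

/-- For |y| ≤ 2R the ball lies in the ball of radius 3R about y, and R ≤ 9R³/(R+|y|)². For |y| > 2R
every point of the ball satisfies |x-y| ≥ (R+|y|)/3. Having both regimes in one formula, uniform in
R, yields local integrability of potentials as well as their vanishing means. -/
lemma exists_lintegral_ball_inv_sq_sub : ∃ c : ℝ, 0 < c ∧ ∀ R, 0 < R → ∀ y,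
    ∫⁻ x in Metric.ball (0 : E3) R, ENNReal.ofReal (‖x - y‖ ^ 2)⁻¹
      ≤ ENNReal.ofReal (c * (R ^ 3 / (R + ‖y‖) ^ 2)) := by
  obtain ⟨c, hc, h⟩ := exists_lintegral_ball_inv_sq
  set V := (volume : Measure E3).real (Metric.ball 0 1)
  have hV : 0 ≤ V := measureReal_nonneg
  refine ⟨27 * c + 9 * V, by positivity, fun R hR y => ?_⟩
  have hy := norm_nonneg y
  rcases le_or_gt ‖y‖ (2 * R) with hyR | hyR
  · calc _ ≤ ∫⁻ x in (fun x => x - y) ⁻¹' Metric.ball (0 : E3) (3 * R),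
          ENNReal.ofReal (‖x - y‖ ^ 2)⁻¹ := by
          refine lintegral_mono_set fun x hx => ?_
          simp only [mem_preimage, mem_ball_zero_iff] at hx ⊢
          linarith [norm_sub_le x y]
      _ = ∫⁻ x in Metric.ball (0 : E3) (3 * R), ENNReal.ofReal (‖x‖ ^ 2)⁻¹ :=
          (measurePreserving_sub_right volume y).setLIntegral_comp_preimage_emb
            (MeasurableEquiv.subRight y).measurableEmbedding
            (fun z => ENNReal.ofReal (‖z‖ ^ 2)⁻¹) _
      _ ≤ ENNReal.ofReal (c * (3 * R)) := h _ (by positivity)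
      _ ≤ _ := by
          refine ENNReal.ofReal_le_ofReal ?_
          have : R / 9 ≤ R ^ 3 / (R + ‖y‖) ^ 2 := by
            rw [div_le_div_iff₀ (by norm_num) (by positivity)]
            nlinarith [mul_nonneg hR.le (mul_nonneg (by linarith : 0 ≤ 2 * R - ‖y‖)
              (by linarith : 0 ≤ 4 * R + ‖y‖))]
          nlinarith [mul_le_mul_of_nonneg_left this hc.le, mul_nonneg hV (by positivity :
            0 ≤ R ^ 3 / (R + ‖y‖) ^ 2)]
  · have hvol : volume (Metric.ball (0 : E3) R) = ENNReal.ofReal (R ^ 3 * V) := by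
      rw [Measure.addHaar_ball volume (0 : E3) hR.le, finrank_euclideanSpace, Fintype.card_fin,
        ENNReal.ofReal_mul (by positivity), ofReal_measureReal measure_ball_lt_top.ne]
    calc _ ≤ ∫⁻ x in Metric.ball (0 : E3) R, ENNReal.ofReal (9 / (R + ‖y‖) ^ 2) := by
          refine setLIntegral_mono measurable_const fun x hx => ENNReal.ofReal_le_ofReal ?_
          have hx' : ‖x‖ < R := by simpa using hx
          have h1 : (R + ‖y‖) / 3 ≤ ‖x - y‖ := by
            have := norm_sub_norm_le y x
            rw [norm_sub_rev] at this
            linarith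
          rw [inv_eq_one_div, div_le_div_iff₀ (by
            have : 0 < ‖x - y‖ := by linarith
            positivity) (by positivity)]
          nlinarith
      _ = ENNReal.ofReal (9 / (R + ‖y‖) ^ 2 * (R ^ 3 * V)) := by
          rw [lintegral_const, Measure.restrict_apply_univ, hvol,
            ← ENNReal.ofReal_mul (by positivity)]
      _ ≤ _ := by
          refine ENNReal.ofReal_le_ofReal ?_
          have : 9 / (R + ‖y‖) ^ 2 * (R ^ 3 * V) = 9 * V * (R ^ 3 / (R + ‖y‖) ^ 2) := by ring
          rw [this]
          gcongr
          linarith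

/-- The weighted integral of `‖x - y‖⁻² ‖y‖⁻²` decays like `‖x‖⁻¹`. -/
lemma exists_lintegral_inv_sq_mul_inv_sq : ∃ c : ℝ, 0 < c ∧ ∀ x : E3, x ≠ 0 →
    ∫⁻ y, ENNReal.ofReal (‖x - y‖ ^ 2)⁻¹ * ENNReal.ofReal (‖y‖ ^ 2)⁻¹
      ≤ ENNReal.ofReal (c / ‖x‖) := by
  obtain ⟨c, hc, h⟩ := exists_lintegral_ball_inv_sq
  obtain ⟨d, hd, h'⟩ := exists_lintegral_compl_ball_inv_four
  refine ⟨4 * c + 4 * d, by positivity, fun x hx => ?_⟩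
  set R := ‖x‖ / 2 with hR
  have hx0 : 0 < ‖x‖ := norm_pos_iff.2 hx
  have hR0 : 0 < R := by positivity
  let F : E3 → ℝ≥0∞ := (Metric.ball 0 R).indicator fun z => ENNReal.ofReal (‖z‖ ^ 2)⁻¹
  let H : E3 → ℝ≥0∞ := ((Metric.ball 0 R)ᶜ).indicator fun z => ENNReal.ofReal (‖z‖ ^ 4)⁻¹
  have hm2 : Measurable fun z : E3 => ENNReal.ofReal (‖z‖ ^ 2)⁻¹ := by fun_prop
  have hm4 : Measurable fun z : E3 => ENNReal.ofReal (‖z‖ ^ 4)⁻¹ := by fun_prop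
  have hF : Measurable F := hm2.indicator Metric.isOpen_ball.measurableSet
  have hH : Measurable H := hm4.indicator Metric.isOpen_ball.measurableSet.compl
  have hsq : ∀ z : E3, R ≤ ‖z‖ → ENNReal.ofReal (‖z‖ ^ 2)⁻¹ ≤ ENNReal.ofReal (R ^ 2)⁻¹ := by
    intro z hz
    refine ENNReal.ofReal_le_ofReal ?_
    gcongr
  -- With R = |x|/2 the points y and x - y cannot both lie in the ball of radius R. If one does, the
  -- other factor is at most R⁻²; if neither does, the product is at most the sum of the squares of
  -- the two factors.
  have key : ∀ y, ENNReal.ofReal (‖x - y‖ ^ 2)⁻¹ * ENNReal.ofReal (‖y‖ ^ 2)⁻¹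
      ≤ ENNReal.ofReal (R ^ 2)⁻¹ * (F (x - y) + F y) + (H (x - y) + H y) := by
    intro y
    have htri : 2 * R ≤ ‖x - y‖ + ‖y‖ := by
      have := norm_add_le (x - y) y
      rw [sub_add_cancel] at this
      linarith
    by_cases h1 : ‖y‖ < R
    · have hFy : F y = ENNReal.ofReal (‖y‖ ^ 2)⁻¹ := by simp [F, h1]
      calc _ ≤ ENNReal.ofReal (R ^ 2)⁻¹ * F y := by
            rw [hFy]; exact mul_le_mul' (hsq _ (by linarith)) le_rfl
        _ ≤ ENNReal.ofReal (R ^ 2)⁻¹ * (F (x - y) + F y) := mul_le_mul' le_rfl le_add_self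
        _ ≤ _ := le_self_add
    by_cases h2 : ‖x - y‖ < R
    · have hFy : F (x - y) = ENNReal.ofReal (‖x - y‖ ^ 2)⁻¹ := by simp [F, h2]
      calc _ ≤ F (x - y) * ENNReal.ofReal (R ^ 2)⁻¹ := by
            rw [hFy]; exact mul_le_mul' le_rfl (hsq _ (by linarith))
        _ ≤ ENNReal.ofReal (R ^ 2)⁻¹ * (F (x - y) + F y) := by
            rw [mul_comm]; exact mul_le_mul' le_rfl le_self_add
        _ ≤ _ := le_self_add
    · have e1 : H (x - y) = ENNReal.ofReal (‖x - y‖ ^ 4)⁻¹ := by simp [H, not_lt.1 h2]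
      have e2 : H y = ENNReal.ofReal (‖y‖ ^ 4)⁻¹ := by simp [H, not_lt.1 h1]
      refine le_trans ?_ le_add_self
      rw [e1, e2, ← ENNReal.ofReal_mul (by positivity), ← ENNReal.ofReal_add (by positivity)
        (by positivity)]
      refine ENNReal.ofReal_le_ofReal ?_
      have p4 : ∀ z : E3, (‖z‖ ^ 4)⁻¹ = ((‖z‖ ^ 2)⁻¹) ^ 2 := fun z => by
        rw [inv_pow, ← pow_mul]
      rw [p4, p4]
      nlinarith [sq_nonneg ((‖x - y‖ ^ 2)⁻¹ - (‖y‖ ^ 2)⁻¹), sq_nonneg (‖x - y‖ ^ 2)⁻¹,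
        sq_nonneg (‖y‖ ^ 2)⁻¹]
  have hFi : ∫⁻ y, F y ≤ ENNReal.ofReal (c * R) := by
    rw [lintegral_indicator Metric.isOpen_ball.measurableSet]; exact h R hR0
  have hHi : ∫⁻ y, H y ≤ ENNReal.ofReal (d / R) := by
    rw [lintegral_indicator Metric.isOpen_ball.measurableSet.compl]; exact h' R hR0
  have hsub : ∀ f : E3 → ℝ≥0∞, ∫⁻ y, f (x - y) = ∫⁻ y, f y := fun f =>
    lintegral_sub_left_eq_self f x
  calc _ ≤ ∫⁻ y, (ENNReal.ofReal (R ^ 2)⁻¹ * (F (x - y) + F y) + (H (x - y) + H y)) :=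
        lintegral_mono key
    _ = ENNReal.ofReal (R ^ 2)⁻¹ * ((∫⁻ y, F y) + ∫⁻ y, F y) + ((∫⁻ y, H y) + ∫⁻ y, H y) := by
        rw [lintegral_add_left (by fun_prop), lintegral_const_mul _ (by fun_prop),
          lintegral_add_left (by fun_prop), lintegral_add_left (by fun_prop), hsub, hsub]
    _ ≤ ENNReal.ofReal (R ^ 2)⁻¹ * (ENNReal.ofReal (c * R) + ENNReal.ofReal (c * R))
          + (ENNReal.ofReal (d / R) + ENNReal.ofReal (d / R)) := by gcongr
    _ = ENNReal.ofReal ((R ^ 2)⁻¹ * (c * R + c * R) + (d / R + d / R)) := by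
        rw [← ENNReal.ofReal_add (by positivity) (by positivity),
          ← ENNReal.ofReal_mul (by positivity), ← ENNReal.ofReal_add (by positivity)
          (by positivity), ← ENNReal.ofReal_add (by positivity) (by positivity)]
    _ = _ := by
        congr 1
        rw [hR]; field_simp; ring

/-! ### The class of densities that can be convolved with the kernels, and growth of the potentials.
-/

/-- Integrability against the weight `(1 + ‖y‖)⁻²`. -/
def IsWeightIntegrable (G : E3 → ℝ) : Prop := Integrable fun y => ((1 + ‖y‖) ^ 2)⁻¹ * G y

/-- The mean values of `|w|` over the balls of radius `R` tend to zero as `R → ∞`. -/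
def HasVanishingMeans (w : E3 → ℝ) : Prop :=
  Tendsto (fun R : ℝ => ENNReal.ofReal (R ^ 3)⁻¹ * ∫⁻ x in Metric.ball (0 : E3) R, ‖w x‖ₑ)
    atTop (𝓝 0)

namespace IsWeightIntegrable

variable {G F : E3 → ℝ}

lemma continuous_weight : Continuous fun y : E3 => ((1 + ‖y‖) ^ 2)⁻¹ :=
  Continuous.inv₀ (by fun_prop) fun y => by positivity

lemma locallyIntegrable (hG : IsWeightIntegrable G) : LocallyIntegrable G := by
  have := (Integrable.locallyIntegrable hG).smul_continuous (g := fun y : E3 => (1 + ‖y‖) ^ 2)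
    (by fun_prop)
  refine this.congr (Eventually.of_forall fun y => ?_)
  have : (1 + ‖y‖) ^ 2 ≠ 0 := by positivity
  simp only [smul_eq_mul]
  field_simp

lemma aestronglyMeasurable (hG : IsWeightIntegrable G) : AEStronglyMeasurable G volume :=
  hG.locallyIntegrable.aestronglyMeasurable

lemma of_integrable (hG : Integrable G) : IsWeightIntegrable G := by
  refine (hG.bdd_mul (c := 1) continuous_weight.aestronglyMeasurable
    (Eventually.of_forall fun y => ?_))
  rw [Real.norm_of_nonneg (by positivity)]
  have := norm_nonneg y
  exact inv_le_one_of_one_le₀ (by nlinarith)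

lemma memLp_weight {r : ℝ} (hr : 3 / 2 < r) :
    MemLp (fun y : E3 => ((1 + ‖y‖) ^ 2)⁻¹) (ENNReal.ofReal r) volume := by
  have hr0 : 0 < r := by linarith
  refine (integrable_norm_rpow_iff continuous_weight.aestronglyMeasurable
    (by simpa using hr0) (by simp)).1 ?_
  have := integrable_one_add_norm (E := E3) (μ := volume) (r := 2 * r) (by simp; linarith)
  refine this.congr (Eventually.of_forall fun y => ?_)
  have hy : 0 < 1 + ‖y‖ := by positivity
  simp only
  rw [Real.norm_of_nonneg (by positivity), ENNReal.toReal_ofReal hr0.le,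
    Real.rpow_neg hy.le, Real.inv_rpow (by positivity), Real.rpow_mul hy.le]
  norm_cast

/-- Hölder's inequality: the weight is in the dual space because the conjugate exponent exceeds 3/2,
which is the condition r < 3. -/
lemma of_memLp {r : ℝ} (h1 : 1 < r) (h3 : r < 3) (hG : MemLp G (ENNReal.ofReal r) volume) :
    IsWeightIntegrable G := by
  have hr : r.HolderConjugate (Real.conjExponent r) := Real.HolderConjugate.conjExponent h1
  have hc : 3 / 2 < Real.conjExponent r := by
    rw [Real.conjExponent, lt_div_iff₀ (by linarith)]; linarith
  haveI : ENNReal.HolderConjugate (ENNReal.ofReal (Real.conjExponent r)) (ENNReal.ofReal r) :=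
    hr.symm.ennrealOfReal
  exact (memLp_weight hc).integrable_mul hG

/-- Far away, the decay of G together with the weight gives (1+|y|)⁻⁴, which is integrable in
dimension three. -/
lemma of_decay (hG : LocallyIntegrable G) {M a : ℝ} (ha : 0 < a)
    (h : ∀ᵐ y, a ≤ ‖y‖ → ‖y‖ ^ 2 * |G y| ≤ M) : IsWeightIntegrable G := by
  have hm : AEStronglyMeasurable (fun y => ((1 + ‖y‖) ^ 2)⁻¹ * G y) volume :=
    continuous_weight.aestronglyMeasurable.mul hG.aestronglyMeasurable
  rw [IsWeightIntegrable, ← integrableOn_univ, ← union_compl_self (Metric.closedBall (0 : E3) a)]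
  refine IntegrableOn.union ?_ ?_
  · have := (hG.smul_continuous continuous_weight).integrableOn_isCompact
      (isCompact_closedBall (0 : E3) a)
    simpa only [smul_eq_mul, mul_comm] using this
  · have h4 := (integrable_one_add_norm (E := E3) (μ := volume) (r := 4)
      (by simp; norm_num)).const_mul (((1 + a) / a) ^ 2 * |M|)
    refine h4.integrableOn.mono' hm.restrict ?_
    filter_upwards [ae_restrict_mem Metric.isClosed_closedBall.measurableSet.compl,
      ae_restrict_of_ae h] with y hy hyM
    have hay : a ≤ ‖y‖ := by
      simp only [mem_compl_iff, mem_closedBall_zero_iff, not_le] at hy; exact hy.le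
    have hy0 : 0 < ‖y‖ := ha.trans_le hay
    have hM := (hyM hay).trans (le_abs_self M)
    have e : (1 + ‖y‖) ^ (-4 : ℝ) = ((1 + ‖y‖) ^ 2)⁻¹ * ((1 + ‖y‖) ^ 2)⁻¹ := by
      rw [Real.rpow_neg (by positivity), ← mul_inv, ← pow_add]; norm_cast
    rw [norm_mul, Real.norm_of_nonneg (by positivity), Real.norm_eq_abs, e]
    have h2 : (1 + ‖y‖) ^ 2 ≤ ((1 + a) / a) ^ 2 * ‖y‖ ^ 2 := by
      rw [← mul_pow]
      refine pow_le_pow_left₀ (by positivity) ?_ 2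
      rw [div_mul_eq_mul_div, le_div_iff₀ ha]; nlinarith
    have h3 : |G y| ≤ ((1 + a) / a) ^ 2 * |M| * ((1 + ‖y‖) ^ 2)⁻¹ := by
      rw [← div_eq_mul_inv, le_div_iff₀ (by positivity)]
      calc _ ≤ |G y| * (((1 + a) / a) ^ 2 * ‖y‖ ^ 2) := by gcongr
        _ = ((1 + a) / a) ^ 2 * (‖y‖ ^ 2 * |G y|) := by ring
        _ ≤ _ := by gcongr
    calc _ ≤ ((1 + ‖y‖) ^ 2)⁻¹ * (((1 + a) / a) ^ 2 * |M| * ((1 + ‖y‖) ^ 2)⁻¹) := by gcongr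
      _ = _ := by ring

lemma enorm_mul_weight_le (G : E3 → ℝ) {R : ℝ} (hR : 1 ≤ R) :
    ∀ y, ‖G y‖ₑ * ENNReal.ofReal ((R + ‖y‖) ^ 2)⁻¹ ≤ ‖((1 + ‖y‖) ^ 2)⁻¹ * G y‖ₑ := by
  intro y
  rw [enorm_mul, mul_comm, Real.enorm_of_nonneg (r := ((1 + ‖y‖) ^ 2)⁻¹) (by positivity)]
  refine mul_le_mul' (ENNReal.ofReal_le_ofReal ?_) le_rfl
  gcongr

end IsWeightIntegrable

lemma IsNewtonType.exists_lintegral_ball_le {K : E3 → ℝ} (hK : IsNewtonType K) :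
    ∃ c : ℝ, 0 < c ∧ ∀ R, 0 < R → ∀ y, ∫⁻ x in Metric.ball (0 : E3) R, ‖K (x - y)‖ₑ
      ≤ ENNReal.ofReal (c * (R ^ 3 / (R + ‖y‖) ^ 2)) := by
  obtain ⟨c, hc, h⟩ := exists_lintegral_ball_inv_sq_sub
  obtain ⟨C, hC, hb⟩ := hK.bound
  refine ⟨C * c, by positivity, fun R hR y => ?_⟩
  have hne : ∀ᵐ x : E3 ∂(volume.restrict (Metric.ball 0 R)), x ≠ y :=
    ae_restrict_of_ae (by simp [ae_iff, measure_singleton])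
  calc _ ≤ ∫⁻ x in Metric.ball (0 : E3) R, ENNReal.ofReal C * ENNReal.ofReal (‖x - y‖ ^ 2)⁻¹ := by
        refine lintegral_mono_ae ?_
        filter_upwards [hne] with x hx
        rw [← ENNReal.ofReal_mul hC.le, Real.enorm_eq_ofReal_abs, ← div_eq_mul_inv]
        exact ENNReal.ofReal_le_ofReal (hb _ (sub_ne_zero.2 hx))
    _ = ENNReal.ofReal C * ∫⁻ x in Metric.ball (0 : E3) R, ENNReal.ofReal (‖x - y‖ ^ 2)⁻¹ :=
        lintegral_const_mul _ (by fun_prop)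
    _ ≤ ENNReal.ofReal C * ENNReal.ofReal (c * (R ^ 3 / (R + ‖y‖) ^ 2)) := by gcongr; exact h R hR y
    _ = _ := by rw [← ENNReal.ofReal_mul hC.le, mul_assoc]

section

variable {K G : E3 → ℝ}

lemma IsNewtonType.aestronglyMeasurable_prod (hK : IsNewtonType K)
    (hG : AEStronglyMeasurable G volume) (s : Set E3) :
    AEStronglyMeasurable (fun z : E3 × E3 => K (z.1 - z.2) * G z.2)
      ((volume.restrict s).prod volume) := by
  have h : AEStronglyMeasurable (fun z : E3 × E3 => K (z.1 - z.2) * G z.2)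
      ((volume : Measure E3).prod volume) := by
    have := hG.convolution_integrand (ContinuousLinearMap.mul ℝ ℝ) hK.meas
    refine this.congr (Eventually.of_forall fun z => ?_)
    simp [mul_comm]
  exact h.mono_ac ((Measure.absolutelyContinuous_of_le Measure.restrict_le_self).prod
    Measure.AbsolutelyContinuous.rfl)

lemma IsNewtonType.exists_lintegral_prod_le (hK : IsNewtonType K) :
    ∃ c : ℝ, 0 < c ∧ ∀ G : E3 → ℝ, AEStronglyMeasurable G volume → ∀ R, 0 < R →
      ∫⁻ z, ‖K (z.1 - z.2) * G z.2‖ₑ ∂((volume.restrict (Metric.ball (0 : E3) R)).prod volume)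
        ≤ ENNReal.ofReal (c * R ^ 3) * ∫⁻ y, ‖G y‖ₑ * ENNReal.ofReal ((R + ‖y‖) ^ 2)⁻¹ := by
  obtain ⟨c, hc, h⟩ := hK.exists_lintegral_ball_le
  refine ⟨c, hc, fun G hG R hR => ?_⟩
  have hm := hK.aestronglyMeasurable_prod hG (Metric.ball 0 R)
  rw [lintegral_prod_symm _ hm.enorm]
  calc _ ≤ ∫⁻ y, ENNReal.ofReal (c * R ^ 3) * (‖G y‖ₑ * ENNReal.ofReal ((R + ‖y‖) ^ 2)⁻¹) := by
        refine lintegral_mono fun y => ?_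
        simp only [enorm_mul]
        rw [lintegral_mul_const' _ _ enorm_ne_top]
        refine (mul_le_mul' (h R hR y) le_rfl).trans (le_of_eq ?_)
        rw [div_eq_mul_inv, ← mul_assoc, ENNReal.ofReal_mul (by positivity)]
        ring
    _ = _ := lintegral_const_mul' _ _ ENNReal.ofReal_ne_top

lemma IsNewtonType.integrable_prod (hK : IsNewtonType K) (hG : IsWeightIntegrable G) (R : ℝ) :
    Integrable (fun z : E3 × E3 => K (z.1 - z.2) * G z.2)
      ((volume.restrict (Metric.ball (0 : E3) R)).prod volume) := by
  obtain ⟨c, hc, h⟩ := hK.exists_lintegral_prod_le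
  have h1 : Integrable (fun z : E3 × E3 => K (z.1 - z.2) * G z.2)
      ((volume.restrict (Metric.ball (0 : E3) (max R 1))).prod volume) := by
    refine ⟨hK.aestronglyMeasurable_prod hG.aestronglyMeasurable _, ?_⟩
    refine (h G hG.aestronglyMeasurable (max R 1) (by positivity)).trans_lt ?_
    refine ENNReal.mul_lt_top ENNReal.ofReal_lt_top ?_
    exact (lintegral_mono (IsWeightIntegrable.enorm_mul_weight_le G (le_max_right _ _))).trans_lt hG.2
  refine h1.mono_measure ?_
  exact Measure.prod_mono (Measure.restrict_mono (Metric.ball_subset_ball (le_max_left _ _)) le_rfl)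
    le_rfl

lemma IsNewtonType.locallyIntegrable_conv (hK : IsNewtonType K) (hG : IsWeightIntegrable G) :
    LocallyIntegrable (conv K G) := by
  intro x
  refine ⟨Metric.ball 0 (‖x‖ + 1), Metric.isOpen_ball.mem_nhds (by simp), ?_⟩
  exact (hK.integrable_prod hG _).integral_prod_left

/-- Fubini's theorem on the support of ψ. It reduces every distributional statement about a
potential to one about the kernel, tested against ψ for each fixed y. -/
lemma IsNewtonType.integral_conv_mul (hK : IsNewtonType K) (hG : IsWeightIntegrable G)
    {ψ : E3 → ℝ} (hψ : IsTest ψ) :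
    Integrable (fun y => G y * ∫ x, K (x - y) * ψ x) ∧
      ∫ x, conv K G x * ψ x = ∫ y, G y * ∫ x, K (x - y) * ψ x := by
  obtain ⟨M, hM0, hM⟩ := hψ.exists_bound
  obtain ⟨R, hR0, hR⟩ := hψ.exists_support
  set μ := (volume : Measure E3).restrict (Metric.ball 0 R)
  have hint : Integrable (fun z : E3 × E3 => K (z.1 - z.2) * G z.2 * ψ z.1) (μ.prod volume) := by
    have := (hK.integrable_prod hG R).bdd_mul (c := M)
      (hψ.continuous.comp continuous_fst).aestronglyMeasurable
      (Eventually.of_forall fun z => hM z.1)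
    refine this.congr (Eventually.of_forall fun z => ?_)
    simp [mul_comm]
  have hrestr : ∀ F : E3 → ℝ, ∫ x, F x * ψ x = ∫ x, F x * ψ x ∂μ := by
    intro F
    refine (setIntegral_eq_integral_of_forall_compl_eq_zero fun x hx => ?_).symm
    rw [hR x (by simpa using hx), mul_zero]
  have e : ∀ y, ∫ x, K (x - y) * G y * ψ x ∂μ = G y * ∫ x, K (x - y) * ψ x := by
    intro y
    rw [hrestr, ← integral_const_mul]
    refine integral_congr_ae (Eventually.of_forall fun x => ?_)
    simp only; ring
  constructor
  · have := hint.integral_prod_right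
    simpa only [e] using this
  · rw [hrestr]
    simp only [conv, ← integral_mul_const]
    rw [integral_integral_swap hint]
    simp only [e]

/-- The normalized mean over the ball of radius R is at most c ∫ |G(y)| (R+|y|)⁻² dy, and this tends
to 0 by dominated convergence, the case R = 1 being the majorant. -/
lemma IsNewtonType.hasVanishingMeans_conv (hK : IsNewtonType K) (hG : IsWeightIntegrable G) :
    HasVanishingMeans (conv K G) := by
  obtain ⟨c, hc, h⟩ := hK.exists_lintegral_prod_le
  have hlim : Tendsto (fun R : ℝ => ∫⁻ y, ‖G y‖ₑ * ENNReal.ofReal ((R + ‖y‖) ^ 2)⁻¹) atTop (𝓝 0) := by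
    have := tendsto_lintegral_filter_of_dominated_convergence' (μ := (volume : Measure E3))
      (l := (atTop : Filter ℝ)) (F := fun R y => ‖G y‖ₑ * ENNReal.ofReal ((R + ‖y‖) ^ 2)⁻¹)
      (f := fun _ => 0) (fun y => ‖((1 + ‖y‖) ^ 2)⁻¹ * G y‖ₑ) ?_ ?_ hG.2.ne ?_
    · simpa using this
    · refine Eventually.of_forall fun R => hG.aestronglyMeasurable.enorm.mul ?_
      exact Measurable.aemeasurable (by fun_prop)
    · filter_upwards [eventually_ge_atTop 1] with R hR
      exact Eventually.of_forall (IsWeightIntegrable.enorm_mul_weight_le G hR)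
    · refine Eventually.of_forall fun y => ?_
      have h1 : Tendsto (fun R : ℝ => ((R + ‖y‖) ^ 2)⁻¹) atTop (𝓝 0) :=
        ((tendsto_pow_atTop (by norm_num)).comp
          (tendsto_atTop_add_const_right _ _ tendsto_id)).inv_tendsto_atTop
      have h2 := ENNReal.tendsto_ofReal h1
      rw [ENNReal.ofReal_zero] at h2
      simpa using ENNReal.Tendsto.const_mul h2 (Or.inr (enorm_ne_top (x := G y)))
  have hlim2 := ENNReal.Tendsto.const_mul hlim (Or.inr (ENNReal.ofReal_ne_top (r := c)))
  rw [mul_zero] at hlim2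
  refine tendsto_of_tendsto_of_tendsto_of_le_of_le' tendsto_const_nhds hlim2
    (Eventually.of_forall fun _ => zero_le) ?_
  filter_upwards [eventually_gt_atTop 0] with R hR
  have hm := hK.aestronglyMeasurable_prod hG.aestronglyMeasurable (Metric.ball 0 R)
  calc _ ≤ ENNReal.ofReal (R ^ 3)⁻¹ * ∫⁻ x in Metric.ball (0 : E3) R, ∫⁻ y, ‖K (x - y) * G y‖ₑ := by
        gcongr with x
        exact enorm_integral_le_lintegral_enorm _
    _ = ENNReal.ofReal (R ^ 3)⁻¹ * ∫⁻ z, ‖K (z.1 - z.2) * G z.2‖ₑ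
          ∂((volume.restrict (Metric.ball (0 : E3) R)).prod volume) := by
        rw [lintegral_prod _ hm.enorm]
    _ ≤ ENNReal.ofReal (R ^ 3)⁻¹ * (ENNReal.ofReal (c * R ^ 3) *
          ∫⁻ y, ‖G y‖ₑ * ENNReal.ofReal ((R + ‖y‖) ^ 2)⁻¹) := by
        gcongr; exact h G hG.aestronglyMeasurable R hR
    _ = _ := by
        rw [← mul_assoc, ← ENNReal.ofReal_mul (by positivity)]
        congr 2
        field_simp

end

namespace HasVanishingMeans

lemma add {v w : E3 → ℝ} (hv : HasVanishingMeans v) (hw : HasVanishingMeans w)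
    (hm : AEStronglyMeasurable v volume) : HasVanishingMeans fun x => v x + w x := by
  have := Tendsto.add hv hw
  rw [add_zero] at this
  refine tendsto_of_tendsto_of_tendsto_of_le_of_le tendsto_const_nhds this (fun _ => zero_le) fun R => ?_
  simp only
  rw [← mul_add, ← lintegral_add_left' hm.restrict.enorm]
  gcongr with x
  exact enorm_add_le _ _

lemma const_mul {w : E3 → ℝ} (hw : HasVanishingMeans w) (c : ℝ) :
    HasVanishingMeans fun x => c * w x := by
  have := ENNReal.Tendsto.const_mul hw (Or.inr (enorm_ne_top (x := c)))
  rw [mul_zero] at this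
  refine this.congr fun R => ?_
  simp only [enorm_mul]
  rw [lintegral_const_mul' _ _ enorm_ne_top]
  ring

/-- By Hölder's inequality the means are O(R^(-3/r)). -/
lemma of_memLp {w : E3 → ℝ} {r : ℝ} (hr : 1 ≤ r) (hw : MemLp w (ENNReal.ofReal r) volume) :
    HasVanishingMeans w := by
  set V := (volume : Measure E3).real (Metric.ball 0 1)
  have hr0 : 0 < r := by linarith
  have hlim : Tendsto (fun R : ℝ => eLpNorm w (ENNReal.ofReal r) volume *
      ENNReal.ofReal (V ^ (1 - 1 / r) * R ^ (-(3 / r)))) atTop (𝓝 0) := by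
    have h1 := (tendsto_rpow_neg_atTop (by positivity : 0 < 3 / r)).const_mul (V ^ (1 - 1 / r))
    have h2 := ENNReal.tendsto_ofReal h1
    simp only [mul_zero, ENNReal.ofReal_zero] at h2
    simpa using ENNReal.Tendsto.const_mul h2 (Or.inr hw.2.ne)
  refine tendsto_of_tendsto_of_tendsto_of_le_of_le' tendsto_const_nhds hlim
    (Eventually.of_forall fun _ => zero_le) ?_
  filter_upwards [eventually_gt_atTop 0] with R hR
  have hvol : volume (Metric.ball (0 : E3) R) = ENNReal.ofReal (R ^ 3 * V) := by
    rw [Measure.addHaar_ball volume (0 : E3) hR.le, finrank_euclideanSpace, Fintype.card_fin,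
      ENNReal.ofReal_mul (by positivity), ofReal_measureReal measure_ball_lt_top.ne]
  have h := eLpNorm_le_eLpNorm_mul_rpow_measure_univ (μ := volume.restrict (Metric.ball (0 : E3) R))
    (p := 1) (q := ENNReal.ofReal r) (by simpa using hr) hw.1.restrict
  rw [eLpNorm_one_eq_lintegral_enorm, Measure.restrict_apply_univ, hvol,
    ENNReal.toReal_ofReal hr0.le, ENNReal.toReal_one, div_one] at h
  have hV : 0 ≤ V := measureReal_nonneg
  have hp : 0 ≤ 1 - 1 / r := by rw [sub_nonneg, div_le_one hr0]; exact hr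
  rw [ENNReal.ofReal_rpow_of_nonneg (by positivity) hp] at h
  calc _ ≤ ENNReal.ofReal (R ^ 3)⁻¹ * (eLpNorm w (ENNReal.ofReal r) volume *
        ENNReal.ofReal ((R ^ 3 * V) ^ (1 - 1 / r))) := by
        gcongr
        exact h.trans (mul_le_mul' (eLpNorm_mono_measure _ Measure.restrict_le_self) le_rfl)
    _ = eLpNorm w (ENNReal.ofReal r) volume *
        ENNReal.ofReal ((R ^ 3)⁻¹ * (R ^ 3 * V) ^ (1 - 1 / r)) := by
        rw [ENNReal.ofReal_mul (by positivity)]; ring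
    _ = _ := by
        congr 2
        rw [Real.mul_rpow (by positivity) hV, ← Real.rpow_natCast, ← Real.rpow_neg hR.le,
          ← Real.rpow_mul hR.le, ← mul_assoc, ← Real.rpow_add hR, mul_comm]
        congr 2
        push_cast
        field_simp
        ring

/-- Inside a ball w is integrable, and outside it w is O(|x|⁻¹), hence in L⁴. Any exponent above 3
would do. -/
lemma of_decay {w : E3 → ℝ} (hw : LocallyIntegrable w) {M a : ℝ}
    (h : ∀ᵐ x, a < ‖x‖ → ‖x‖ * |w x| ≤ M) : HasVanishingMeans w := by
  have ha' : 0 < max a 1 := by positivity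
  set B := Metric.closedBall (0 : E3) (max a 1)
  have hB : MeasurableSet B := Metric.isClosed_closedBall.measurableSet
  have h1 : HasVanishingMeans (B.indicator w) := by
    refine of_memLp le_rfl ?_
    rw [ENNReal.ofReal_one, memLp_one_iff_integrable, integrable_indicator_iff hB]
    exact hw.integrableOn_isCompact (isCompact_closedBall _ _)
  have h2 : HasVanishingMeans (Bᶜ.indicator w) := by
    refine of_memLp (r := 4) (by norm_num) ?_
    have hm : AEStronglyMeasurable (Bᶜ.indicator w) volume :=
      hw.aestronglyMeasurable.indicator hB.compl
    refine (integrable_norm_rpow_iff hm (by simp) (by simp)).1 ?_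
    refine ((integrable_one_add_norm (E := E3) (μ := volume) (r := 4)
      (by simp; norm_num)).const_mul ((2 * |M|) ^ 4)).mono' (by
        exact (hm.norm.aemeasurable.pow_const _).aestronglyMeasurable) ?_
    filter_upwards [h] with x hx
    rw [Real.norm_of_nonneg (by positivity)]
    by_cases hxB : x ∈ B
    · simp only [indicator, mem_compl_iff, hxB, not_true, if_false, norm_zero]
      rw [Real.zero_rpow (by simp)]
      positivity
    · have hx1 : max a 1 < ‖x‖ := by
        simpa only [B, mem_closedBall_zero_iff, not_le] using hxB
      have hx2 := (hx ((le_max_left _ _).trans_lt hx1)).trans (le_abs_self M)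
      have hx3 : 1 < ‖x‖ := (le_max_right _ _).trans_lt hx1
      rw [indicator_of_mem (by exact hxB), Real.rpow_neg (by positivity), ← div_eq_mul_inv]
      rw [ENNReal.toReal_ofReal (by norm_num),
        show (4 : ℝ) = ((4 : ℕ) : ℝ) by norm_num, Real.rpow_natCast, Real.rpow_natCast, ← div_pow]
      refine pow_le_pow_left₀ (norm_nonneg _) ?_ 4
      rw [le_div_iff₀ (by positivity), Real.norm_eq_abs]
      nlinarith [abs_nonneg (w x)]
  have := h1.add h2 (hw.aestronglyMeasurable.indicator hB)
  refine this.congr fun R => ?_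
  simp only [fun x => congrFun (indicator_self_add_compl B w) x, ← Pi.add_apply]

end HasVanishingMeans

/-! ### L^p bound for the gradient of convolutions with `gradKer`. -/

lemma heatExt_two_mul {η : E3 → ℝ} (hη : IsBddSupp η) {s : ℝ} (hs : 0 < s) (y : E3) :
    heatExt (2 * s) η y = ∫ x, heat s (x - y) * heatExt s η x := by
  have hint : Integrable (fun z : E3 × E3 => heat s (z.1 - y) * (heat s (z.1 - z.2) * η z.2))
      (volume.prod volume) := by
    refine (integrable_conv_prod (integrable_heat hs) hη.integrable).bdd_mul
      (c := (4 * Real.pi * s) ^ (-(3 / 2) : ℝ)) ?_ (Eventually.of_forall fun z => ?_)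
    · exact ((contDiff_heat s).continuous.comp (by fun_prop)).aestronglyMeasurable
    · rw [Real.norm_of_nonneg (heat_pos hs _).le]; exact heat_le hs _
  simp only [conv, ← integral_const_mul]
  rw [integral_integral_swap hint]
  refine integral_congr_ae (Eventually.of_forall fun z => ?_)
  simp only [← mul_assoc]
  rw [integral_mul_const, integral_heat_mul_heat hs]

/-- Self-adjointness and the semigroup law let both functions be evolved for half of the time, which
produces the symmetric form of the bilinear estimate. -/
lemma integral_mul_heatExt_two_mul {f η : E3 → ℝ} (hf : IsBddSupp f) (hη : IsTest η) {s : ℝ}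
    (hs : 0 < s) : ∫ y, f y * heatExt (2 * s) η y = ∫ x, heatExt s f x * heatExt s η x := by
  obtain ⟨M, -, hM⟩ := hη.exists_bound
  have hη' := IsBddSupp.of_isTest hη
  have hint : Integrable (fun z : E3 × E3 => heatExt s η z.1 * (heat s (z.1 - z.2) * f z.2))
      (volume.prod volume) := by
    refine (integrable_conv_prod (integrable_heat hs) hf.integrable).bdd_mul
      (c := M) ?_ (Eventually.of_forall fun z => abs_heatExt_le_of_bound hs _ hM)
    exact ((contDiff_heatExt hη' s).continuous.comp continuous_fst).aestronglyMeasurable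
  simp only [heatExt_two_mul hη' hs, ← integral_const_mul]
  have e : ∀ y, ∫ x, f y * (heat s (x - y) * heatExt s η x)
      = ∫ x, heatExt s η x * (heat s (x - y) * f y) := fun y =>
    integral_congr_ae (Eventually.of_forall fun x => by simp only; ring)
  simp only [e]
  rw [← integral_integral_swap hint]
  simp only [integral_const_mul]
  refine integral_congr_ae (Eventually.of_forall fun x => ?_)
  simp only [conv]; ring

lemma integrable_pderiv_heat {t : ℝ} (ht : 0 < t) (k : Fin 3) : Integrable (pderiv k (heat t)) := by
  have h1 : Integrable fun x : E3 => ‖x‖ * Real.exp (-(4 * t)⁻¹ * ‖x‖ ^ 2) := by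
    rw [integrable_fun_norm_addHaar volume (f := fun r => r * Real.exp (-(4 * t)⁻¹ * r ^ 2))]
    have := integrableOn_rpow_mul_exp_neg_mul_sq (b := (4 * t)⁻¹) (by positivity) (s := 3)
      (by norm_num)
    refine this.congr_fun (fun r hr => ?_) measurableSet_Ioi
    simp only [finrank_euclideanSpace, Fintype.card_fin, smul_eq_mul]
    rw [show (3 : ℝ) = ((3 : ℕ) : ℝ) by norm_num, Real.rpow_natCast]
    ring
  refine (h1.const_mul ((2 * t)⁻¹ * (4 * Real.pi * t) ^ (-(3 / 2) : ℝ))).mono'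
    (contDiff_top_pderiv k (contDiff_heat t)).continuous.aestronglyMeasurable
    (Eventually.of_forall fun x => ?_)
  have hpi := Real.pi_pos
  rw [pderiv_heat]
  simp only [norm_mul, norm_neg, heat, Real.norm_eq_abs, Real.abs_exp]
  rw [abs_of_pos (by positivity : 0 < (2 * t)⁻¹),
    abs_of_pos (by positivity : 0 < (4 * Real.pi * t) ^ (-(3 / 2) : ℝ))]
  have : |x k| ≤ ‖x‖ := PiLp.norm_apply_le x k
  calc _ ≤ (2 * t)⁻¹ * ‖x‖ * ((4 * Real.pi * t) ^ (-(3 / 2) : ℝ)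
        * Real.exp (-(4 * t)⁻¹ * ‖x‖ ^ 2)) := by gcongr
    _ = _ := by ring

lemma integral_heatExt_mul_pderiv_pderiv {f φ : E3 → ℝ} (hf : IsBddSupp f) (hφ : IsTest φ) {s : ℝ}
    (hs : 0 < s) (k j : Fin 3) :
    ∫ x, heatExt s f x * heatExt s (pderiv k (pderiv j φ)) x
      = -∫ x, pderiv k (heatExt s f) x * pderiv j (heatExt s φ) x := by
  have hj := hφ.pderiv j
  have hkj := hj.pderiv k
  have hbd : ∀ {η : E3 → ℝ}, IsTest η → ∃ M, ∀ x, ‖heatExt s η x‖ ≤ M := fun hη =>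
    let ⟨M, _, hM⟩ := hη.exists_bound
    ⟨M, fun x => abs_heatExt_le_of_bound hs x hM⟩
  have hc : ∀ {η : E3 → ℝ}, IsTest η → AEStronglyMeasurable (heatExt s η) volume := fun hη =>
    (contDiff_heatExt (IsBddSupp.of_isTest hη) s).continuous.aestronglyMeasurable
  have hi0 : Integrable (heatExt s f) := integrable_conv (integrable_heat hs) hf.integrable
  have hi1 : Integrable (pderiv k (heatExt s f)) := by
    rw [pderiv_heatExt hf]; exact integrable_conv (integrable_pderiv_heat hs k) hf.integrable
  obtain ⟨M1, hM1⟩ := hbd hj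
  obtain ⟨M2, hM2⟩ := hbd hkj
  rw [pderiv_heatExt_test hφ, ← pderiv_heatExt_test hj]
  refine integral_mul_fderiv_eq_neg_fderiv_mul_of_integrable ?_ ?_ ?_ ?_ ?_
  · exact hi1.mul_bdd (c := M1) (hc hj) (Eventually.of_forall hM1)
  · change Integrable fun x => heatExt s f x * pderiv k (heatExt s (pderiv j φ)) x
    rw [pderiv_heatExt_test hj]
    exact hi0.mul_bdd (c := M2) (hc hkj) (Eventually.of_forall hM2)
  · exact hi0.mul_bdd (c := M1) (hc hj) (Eventually.of_forall hM1)
  · exact fun x _ => (contDiff_heatExt hf s).differentiable (by simp) x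
  · exact fun x _ => (contDiff_heatExt (IsBddSupp.of_isTest hj) s).differentiable (by simp) x

lemma integral_mul_integral_heatExt {f η : E3 → ℝ} (hf : IsBddSupp f) (hη : IsTest η) :
    ∫ y, f y * ∫ t in Ioi 0, heatExt t η y = ∫ t in Ioi 0, ∫ y, f y * heatExt t η y := by
  obtain ⟨M, hM0, hM⟩ := hη.exists_bound
  set D : ℝ := (4 * Real.pi) ^ (-(3 / 2) : ℝ) * ∫ x, |η x|
  have hD : 0 ≤ D := mul_nonneg (by positivity) (integral_nonneg fun x => abs_nonneg _)
  -- A bound for the heat extension that is uniform in space and integrable in time: the maximum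
  -- principle up to time 1, the t^(-3/2) decay afterwards.
  let m : ℝ → ℝ := (Iic 1).piecewise (fun _ => M) (fun t => D * t ^ (-(3 / 2) : ℝ))
  have hm : IntegrableOn m (Ioi 0) := by
    rw [← Ioc_union_Ioi_eq_Ioi (zero_le_one' ℝ)]
    refine IntegrableOn.union ?_ ?_
    · refine IntegrableOn.congr_fun (f := fun _ => M) (integrableOn_const (by simp)) (fun t ht => ?_)
        measurableSet_Ioc
      simp [m, ht.2]
    · refine IntegrableOn.congr_fun (f := fun t => D * t ^ (-(3 / 2) : ℝ))
        ((integrableOn_Ioi_rpow_of_lt (by norm_num) one_pos).const_mul D) (fun t ht => ?_)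
        measurableSet_Ioi
      have : ¬ t ≤ 1 := not_le.2 ht
      simp [m, this]
  have hbd : ∀ t, 0 < t → ∀ y, |heatExt t η y| ≤ m t := by
    intro t ht y
    by_cases h1 : t ≤ 1
    · simpa [m, h1] using abs_heatExt_le_of_bound ht y hM
    · have := abs_heatExt_le ht y hη.integrable
      rw [Real.mul_rpow (by positivity) ht.le] at this
      simp only [m, piecewise, mem_Iic, h1, if_false, D]
      linarith
  have hmeas : AEStronglyMeasurable (fun z : E3 × ℝ => f z.1 * heatExt z.2 η z.1)
      (volume.prod (volume.restrict (Ioi 0))) :=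
    hf.meas.comp_fst.mul (aestronglyMeasurable_prod_of_continuousOn (H := fun t x => heatExt t η x)
      (contDiffOn_heatExt (IsBddSupp.of_isTest hη)).continuousOn)
  have hint : Integrable (fun z : E3 × ℝ => f z.1 * heatExt z.2 η z.1)
      (volume.prod (volume.restrict (Ioi 0))) := by
    refine (hf.integrable.mul_prod hm).mono hmeas ?_
    have : ∀ᵐ z ∂((volume : Measure E3).prod (volume.restrict (Ioi (0 : ℝ)))), z.2 ∈ Ioi (0 : ℝ) :=
      Measure.quasiMeasurePreserving_snd.ae (ae_restrict_mem measurableSet_Ioi)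
    filter_upwards [this] with z hz
    simp only [norm_mul]
    gcongr
    exact (hbd _ hz _).trans (le_abs_self _)
  rw [← integral_integral_swap hint]
  simp only [integral_const_mul]

variable {p q : ℝ}

/-- The pairing equals ∫ ⟨f, Pₜ∂ₖ∂ⱼφ⟩ dt. Setting t = 2s, sharing the flow equally between f and φ
and integrating by parts once in space gives -2 ∫∫ ∂ₖPₛf ∂ⱼPₛφ, to which the bilinear embedding
applies. -/
theorem exists_conv_gradKer_le_of_isBddSupp (hpq : p.HolderConjugate q) : ∃ C : ℝ, 0 ≤ C ∧
    ∀ f φ : E3 → ℝ, IsBddSupp f → IsTest φ → ∀ k j,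
      ENNReal.ofReal |∫ x, conv (gradKer k) f x * pderiv j φ x| ≤ ENNReal.ofReal C *
        (eLpNorm f (ENNReal.ofReal p) volume * eLpNorm φ (ENNReal.ofReal q) volume) := by
  obtain ⟨C, hC, h⟩ := exists_gradForm_le hpq
  refine ⟨2 * C, by positivity, fun f φ hf hφ k j => ?_⟩
  have hφ' := IsBddSupp.of_isTest hφ
  have hkj := (hφ.pderiv j).pderiv k
  set N := eLpNorm f (ENNReal.ofReal p) volume * eLpNorm φ (ENNReal.ofReal q) volume
  have e1 : ∫ x, conv (gradKer k) f x * pderiv j φ x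
      = 2 * ∫ s in Ioi 0, -∫ x, pderiv k (heatExt s f) x * pderiv j (heatExt s φ) x := by
    rw [((isNewtonType_gradKer k).integral_conv_mul (.of_integrable hf.integrable)
      (hφ.pderiv j)).2]
    simp_rw [fun y => (integral_gradKer_mul (hφ.pderiv j) k y).2]
    rw [integral_mul_integral_heatExt hf hkj]
    have := integral_comp_mul_left_Ioi' (fun t => ∫ y, f y * heatExt t (pderiv k (pderiv j φ)) y) 0
      two_pos
    rw [mul_zero] at this
    rw [← this, smul_eq_mul]
    congr 1
    refine setIntegral_congr_fun measurableSet_Ioi fun s hs => ?_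
    change ∫ y, f y * heatExt (2 * s) (pderiv k (pderiv j φ)) y = _
    rw [integral_mul_heatExt_two_mul hf hkj hs, integral_heatExt_mul_pderiv_pderiv hf hφ hs]
  -- The positive half line is exhausted by intervals (1/(n+1), n+1], on which the embedding holds
  -- with one and the same constant.
  have hsup : ∫⁻ s in Ioi 0, ∫⁻ x, gradProd f φ k j s x ≤ ENNReal.ofReal C * N := by
    have hU : Ioi (0 : ℝ) = ⋃ n : ℕ, Ioc ((n + 1 : ℝ)⁻¹) (n + 1) := by
      ext t
      simp only [mem_Ioi, mem_iUnion, mem_Ioc]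
      constructor
      · intro ht
        obtain ⟨n, hn⟩ := exists_nat_gt (max t t⁻¹)
        refine ⟨n, ?_, ?_⟩
        · rw [inv_lt_comm₀ (by positivity) ht]
          linarith [le_max_right t t⁻¹]
        · linarith [le_max_left t t⁻¹]
      · rintro ⟨n, hn, -⟩
        exact lt_trans (by positivity) hn
    have hmono : Monotone fun n : ℕ => Ioc ((n + 1 : ℝ)⁻¹) (n + 1) := by
      intro n m hnm
      have : (n : ℝ) ≤ m := by exact_mod_cast hnm
      exact Ioc_subset_Ioc (by gcongr) (by gcongr)
    rw [hU, setLIntegral_iUnion_of_directed _ hmono.directed_le]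
    refine iSup_le fun n => h f φ hf hφ' _ _ (by positivity) ?_ k j
    have : (1 : ℝ) ≤ n + 1 := by linarith [(n : ℕ).cast_nonneg (α := ℝ)]
    exact (inv_le_one_of_one_le₀ this).trans this
  have e2 : ENNReal.ofReal |∫ s in Ioi 0, -∫ x, pderiv k (heatExt s f) x * pderiv j (heatExt s φ) x|
      ≤ ENNReal.ofReal C * N := by
    rw [← Real.enorm_eq_ofReal_abs]
    refine (enorm_integral_le_lintegral_enorm _).trans (le_trans ?_ hsup)
    refine lintegral_mono fun s => ?_
    rw [enorm_neg]
    exact enorm_integral_le_lintegral_enorm _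
  rw [e1, abs_mul, ENNReal.ofReal_mul (abs_nonneg _), abs_two, ENNReal.ofReal_mul (by norm_num),
    mul_assoc]
  gcongr

/-- Truncation of a function to a bounded function with bounded support. -/
def trunc (G : E3 → ℝ) (n : ℕ) : E3 → ℝ :=
  {y | ‖y‖ < n ∧ |G y| ≤ n}.indicator G

lemma isBddSupp_trunc {G : E3 → ℝ} (hG : AEStronglyMeasurable G volume) (n : ℕ) :
    IsBddSupp (trunc G n) := by
  refine ⟨hG.indicator₀ ?_, ⟨n, fun x => ?_⟩, ⟨n + 1, by positivity, fun x hx => ?_⟩⟩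
  · refine NullMeasurableSet.inter ?_ ?_
    · exact (measurableSet_lt measurable_norm measurable_const).nullMeasurableSet
    · exact nullMeasurableSet_le hG.norm.aemeasurable aemeasurable_const
  · by_cases h : x ∈ {y | ‖y‖ < n ∧ |G y| ≤ n}
    · rw [trunc, indicator_of_mem h]; exact h.2
    · rw [trunc, indicator_of_notMem h, abs_zero]; positivity
  · refine indicator_of_notMem (fun h => ?_) _
    have : ‖x‖ < n := h.1
    linarith

lemma abs_trunc_le (G : E3 → ℝ) (n : ℕ) (x : E3) : ‖trunc G n x‖ ≤ ‖G x‖ :=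
  norm_indicator_le_norm_self _ _

lemma eventually_trunc_eq (G : E3 → ℝ) (x : E3) : ∀ᶠ n : ℕ in atTop, trunc G n x = G x := by
  filter_upwards [eventually_gt_atTop (Nat.ceil (max ‖x‖ |G x|))] with n hn
  have h1 : max ‖x‖ |G x| < n := (Nat.le_ceil _).trans_lt (by exact_mod_cast hn)
  exact indicator_of_mem (s := {y | ‖y‖ < n ∧ |G y| ≤ n}) ⟨(le_max_left _ _).trans_lt h1, ((le_max_right _ _).trans_lt h1).le⟩ _

/-- Weak gradient bounds for convolutions extend from bounded functions with bounded support. -/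
lemma IsNewtonType.ofReal_abs_integral_le {K : E3 → ℝ} (hK : IsNewtonType K) {j : Fin 3} {C : ℝ}
    (h : ∀ f φ : E3 → ℝ, IsBddSupp f → IsTest φ →
      ENNReal.ofReal |∫ x, conv K f x * pderiv j φ x| ≤ ENNReal.ofReal C *
        (eLpNorm f (ENNReal.ofReal p) volume * eLpNorm φ (ENNReal.ofReal q) volume))
    {G φ : E3 → ℝ} (hG : IsWeightIntegrable G) (hφ : IsTest φ) :
    ENNReal.ofReal |∫ x, conv K G x * pderiv j φ x| ≤ ENNReal.ofReal C *
      (eLpNorm G (ENNReal.ofReal p) volume * eLpNorm φ (ENNReal.ofReal q) volume) := by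
  have hlim : Tendsto (fun n : ℕ => ∫ x, conv K (trunc G n) x * pderiv j φ x) atTop
      (𝓝 (∫ x, conv K G x * pderiv j φ x)) := by
    obtain ⟨hi, he⟩ := hK.integral_conv_mul hG (hφ.pderiv j)
    have hn := fun n => hK.integral_conv_mul
      (IsWeightIntegrable.of_integrable (isBddSupp_trunc hG.aestronglyMeasurable n).integrable)
      (hφ.pderiv j)
    rw [he]
    simp_rw [fun n => (hn n).2]
    refine tendsto_integral_of_dominated_convergence _ (fun n => (hn n).1.1) hi.norm (fun n => ?_) ?_
    · refine Eventually.of_forall fun y => ?_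
      rw [norm_mul, norm_mul]
      gcongr
      exact abs_trunc_le G n y
    · refine Eventually.of_forall fun y => ?_
      refine tendsto_const_nhds.congr' ?_
      filter_upwards [eventually_trunc_eq G y] with n hn
      rw [hn]
  refine le_of_tendsto (ENNReal.tendsto_ofReal hlim.abs) (Eventually.of_forall fun n => ?_)
  refine (h _ φ (isBddSupp_trunc hG.aestronglyMeasurable n) hφ).trans ?_
  gcongr
  exact eLpNorm_mono (abs_trunc_le G n)

/-! ### The dual of L^p, and functionals bounded by finitely many L^p norms. -/

section LpDuality

variable {α : Type*} [MeasurableSpace α] {μ : Measure α} {p q : ℝ}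

lemma tendsto_eLpNorm_sub_of_dominated (hp : 0 < p) {ι : Type*} {l : Filter ι}
    [l.IsCountablyGenerated] {F : ι → α → ℝ} {f g : α → ℝ}
    (hF : ∀ i, AEStronglyMeasurable (F i) μ) (hf : AEStronglyMeasurable f μ)
    (hg : MemLp g (ENNReal.ofReal p) μ)
    (hFg : ∀ i x, |F i x| ≤ g x) (hfg : ∀ x, |f x| ≤ g x)
    (hlim : ∀ x, Tendsto (fun i => F i x) l (𝓝 (f x))) :
    Tendsto (fun i => eLpNorm (fun x => F i x - f x) (ENNReal.ofReal p) μ) l (𝓝 0) := by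
  have hp0 : ENNReal.ofReal p ≠ 0 := by simpa using hp
  have h2g : MemLp (fun x => 2 * g x) (ENNReal.ofReal p) μ := hg.const_mul 2
  have hfin := (eLpNorm_lt_top_iff_lintegral_rpow_enorm_lt_top hp0 ENNReal.ofReal_ne_top).1 h2g.2
  simp only [ENNReal.toReal_ofReal hp.le] at hfin
  have h1 : Tendsto (fun i => ∫⁻ x, ‖F i x - f x‖ₑ ^ p ∂μ) l (𝓝 0) := by
    have := tendsto_lintegral_filter_of_dominated_convergence' (μ := μ) (l := l)
      (F := fun i x => ‖F i x - f x‖ₑ ^ p) (f := fun _ => 0) (fun x => ‖2 * g x‖ₑ ^ p) ?_ ?_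
      hfin.ne ?_
    · simpa using this
    · exact Eventually.of_forall fun i => ((hF i).sub hf).enorm.pow_const p
    · refine Eventually.of_forall fun i => Eventually.of_forall fun x => ?_
      gcongr
      rw [enorm_le_iff_norm_le, Real.norm_eq_abs, Real.norm_eq_abs]
      refine (abs_sub _ _).trans (le_trans ?_ (le_abs_self _))
      linarith [hFg i x, hfg x]
    · refine Eventually.of_forall fun x => ?_
      have h2 : Tendsto (fun i => F i x - f x) l (𝓝 0) := by
        simpa using (hlim x).sub_const (f x)
      have h3 := (continuous_enorm.tendsto (0 : ℝ)).comp h2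
      have h4 := (ENNReal.continuous_rpow_const (y := p)).tendsto (0 : ℝ≥0∞)
      rw [ENNReal.zero_rpow_of_pos hp] at h4
      rw [enorm_zero] at h3
      exact h4.comp h3
  have h5 := (ENNReal.continuous_rpow_const (y := 1 / p)).tendsto (0 : ℝ≥0∞)
  rw [ENNReal.zero_rpow_of_pos (by positivity)] at h5
  refine (h5.comp h1).congr fun i => ?_
  rw [Function.comp, eLpNorm_eq_lintegral_rpow_enorm_toReal hp0 ENNReal.ofReal_ne_top,
    ENNReal.toReal_ofReal hp.le]

open Classical in
/-- A functional on `L^p`, evaluated on functions. -/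
def evalLp {P : ℝ≥0∞} [Fact (1 ≤ P)] (F : Lp ℝ P μ →L[ℝ] ℝ) (g : α → ℝ) : ℝ :=
  if h : MemLp g P μ then F (h.toLp g) else 0

section evalLp

variable {P : ℝ≥0∞} [Fact (1 ≤ P)] (F : Lp ℝ P μ →L[ℝ] ℝ) {f g : α → ℝ}

lemma evalLp_of_memLp (h : MemLp g P μ) : evalLp F g = F (h.toLp g) := dif_pos h

lemma evalLp_congr (h : f =ᵐ[μ] g) : evalLp F f = evalLp F g := by
  by_cases hf : MemLp f P μ
  · have hg : MemLp g P μ := (memLp_congr_ae h).1 hf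
    rw [evalLp_of_memLp F hf, evalLp_of_memLp F hg, MemLp.toLp_congr hf hg h]
  · have hg : ¬ MemLp g P μ := fun hg => hf ((memLp_congr_ae h).2 hg)
    rw [evalLp, evalLp, dif_neg hf, dif_neg hg]

lemma evalLp_add (hf : MemLp f P μ) (hg : MemLp g P μ) :
    evalLp F (fun x => f x + g x) = evalLp F f + evalLp F g := by
  rw [evalLp_of_memLp F hf, evalLp_of_memLp F hg, ← map_add, ← MemLp.toLp_add hf hg]
  exact evalLp_of_memLp F (hf.add hg)

lemma evalLp_const_mul (hf : MemLp f P μ) (c : ℝ) :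
    evalLp F (fun x => c * f x) = c * evalLp F f := by
  rw [evalLp_of_memLp F hf, ← smul_eq_mul, ← map_smul, ← MemLp.toLp_const_smul c hf]
  exact evalLp_of_memLp F (hf.const_smul c)

lemma abs_evalLp_le (hf : MemLp f P μ) : |evalLp F f| ≤ ‖F‖ * (eLpNorm f P μ).toReal := by
  rw [evalLp_of_memLp F hf, ← Lp.norm_toLp f hf]
  exact F.le_opNorm _

lemma evalLp_sub (hf : MemLp f P μ) (hg : MemLp g P μ) :
    evalLp F (fun x => f x - g x) = evalLp F f - evalLp F g := by
  rw [evalLp_of_memLp F hf, evalLp_of_memLp F hg, ← map_sub, ← MemLp.toLp_sub hf hg]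
  exact evalLp_of_memLp F (hf.sub hg)

lemma evalLp_zero : evalLp F (fun _ => 0) = 0 := by
  have := evalLp_const_mul F (MemLp.zero (ε := ℝ) (p := P) (μ := μ)) 0
  simpa using this

end evalLp

variable [Fact (1 ≤ ENNReal.ofReal p)] (F : Lp ℝ (ENNReal.ofReal p) μ →L[ℝ] ℝ)

lemma tendsto_evalLp_of_dominated (hp : 0 < p) {ι : Type*} {l : Filter ι}
    [l.IsCountablyGenerated] {Φ : ι → α → ℝ} {f g : α → ℝ}
    (hF : ∀ i, AEStronglyMeasurable (Φ i) μ) (hf : AEStronglyMeasurable f μ)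
    (hg : MemLp g (ENNReal.ofReal p) μ)
    (hFg : ∀ i x, |Φ i x| ≤ g x) (hfg : ∀ x, |f x| ≤ g x)
    (hlim : ∀ x, Tendsto (fun i => Φ i x) l (𝓝 (f x))) :
    Tendsto (fun i => evalLp F (Φ i)) l (𝓝 (evalLp F f)) := by
  have hm : ∀ {h : α → ℝ}, AEStronglyMeasurable h μ → (∀ x, |h x| ≤ g x) →
      MemLp h (ENNReal.ofReal p) μ := fun hh hb => hg.of_le hh
        (Eventually.of_forall fun x => (hb x).trans (le_abs_self _))
  have h1 := tendsto_eLpNorm_sub_of_dominated hp hF hf hg hFg hfg hlim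
  have h2 := ((ENNReal.tendsto_toReal ENNReal.zero_ne_top).comp h1).const_mul ‖F‖
  simp only [ENNReal.toReal_zero, mul_zero] at h2
  refine tendsto_iff_norm_sub_tendsto_zero.2 (squeeze_zero (fun _ => norm_nonneg _) (fun i => ?_) h2)
  rw [← evalLp_sub F (hm (hF i) (hFg i)) (hm hf hfg)]
  exact abs_evalLp_le F ((hm (hF i) (hFg i)).sub (hm hf hfg))

open Classical in
/-- The signed measure `A ↦ F (w 1_A)` of a functional `F` on `L^p` and a weight `w ∈ L^p`. -/
def weightedSignedMeasure (hp : 0 < p) {w : α → ℝ} (hw : MemLp w (ENNReal.ofReal p) μ)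
    (hw0 : ∀ x, 0 ≤ w x) : SignedMeasure α where
  measureOf' A := if MeasurableSet A then evalLp F (A.indicator w) else 0
  empty' := by simp [evalLp_zero]
  not_measurable' A hA := if_neg hA
  m_iUnion' A hA hd := by
    have hm : ∀ i, MemLp ((A i).indicator w) (ENNReal.ofReal p) μ := fun i => hw.indicator (hA i)
    simp only [hA, MeasurableSet.iUnion hA, if_true]
    have hbd : ∀ (B : Set α) x, |B.indicator w x| ≤ w x := fun B x => by
      rw [abs_of_nonneg (indicator_nonneg (fun x _ => hw0 x) x)]
      exact indicator_le_self' (fun x _ => hw0 x) x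
    have hsum : ∀ s : Finset ℕ, ∑ i ∈ s, evalLp F ((A i).indicator w)
        = evalLp F ((⋃ i ∈ s, A i).indicator w) := by
      intro s
      induction s using Finset.induction_on with
      | empty => simp [evalLp_zero]
      | insert a s ha ih =>
        rw [Finset.sum_insert ha, ih, ← evalLp_add F (hm a)
          (hw.indicator (Finset.measurableSet_biUnion s fun i _ => hA i)),
          Finset.set_biUnion_insert, indicator_union_of_disjoint]
        refine disjoint_iUnion₂_right.2 fun i hi => hd ?_
        rintro rfl
        exact ha hi
    rw [HasSum]
    simp only [hsum]
    refine tendsto_evalLp_of_dominated F hp (g := w) (fun s => ?_) ?_ hw (fun s => hbd _) (hbd _) ?_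
    · exact hw.1.indicator (Finset.measurableSet_biUnion s fun i _ => hA i)
    · exact hw.1.indicator (MeasurableSet.iUnion hA)
    · intro x
      refine tendsto_const_nhds.congr' ?_
      by_cases hx : x ∈ ⋃ i, A i
      · obtain ⟨i, hi⟩ := mem_iUnion.1 hx
        filter_upwards [eventually_ge_atTop {i}] with s hs
        rw [indicator_of_mem hx, indicator_of_mem]
        exact mem_biUnion (by simpa using hs) hi
      · refine Eventually.of_forall fun s => ?_
        rw [indicator_of_notMem hx]
        refine (indicator_of_notMem ?_ _).symm
        exact fun h => hx (iUnion₂_subset_iUnion _ _ h)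

lemma weightedSignedMeasure_apply (hp : 0 < p) {w : α → ℝ} (hw : MemLp w (ENNReal.ofReal p) μ)
    (hw0 : ∀ x, 0 ≤ w x) {A : Set α} (hA : MeasurableSet A) :
    weightedSignedMeasure F hp hw hw0 A = evalLp F (A.indicator w) := if_pos hA

/-- On a σ-finite space indicators need not be in L^p, so they are multiplied by the weight w. The
resulting set function is a signed measure absolutely continuous with respect to μ. Its
Radon-Nikodym density represents F on simple multiples of w, and then on bounded multiples by
dominated convergence. -/
lemma exists_density (hp : 0 < p) [SigmaFinite μ] {w : α → ℝ} (hw : MemLp w (ENNReal.ofReal p) μ)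
    (hw0 : ∀ x, 0 ≤ w x) : ∃ h : α → ℝ, Measurable h ∧ Integrable h μ ∧
      ∀ b : α → ℝ, Measurable b → (∃ M, ∀ x, |b x| ≤ M) →
        evalLp F (fun x => b x * w x) = ∫ x, h x * b x ∂μ := by
  set ν := weightedSignedMeasure F hp hw hw0
  have hac : ν ≪ᵥ μ.toENNRealVectorMeasure := by
    refine VectorMeasure.AbsolutelyContinuous.mk fun A hA hμ => ?_
    rw [Measure.toENNRealVectorMeasure_apply_measurable hA] at hμ
    rw [weightedSignedMeasure_apply F hp hw hw0 hA, ← evalLp_zero F]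
    refine evalLp_congr F ?_
    exact indicator_meas_zero hμ
  have hint := SignedMeasure.integrable_rnDeriv ν μ
  refine ⟨ν.rnDeriv μ, SignedMeasure.measurable_rnDeriv ν μ, hint, fun b hb hbM => ?_⟩
  have hind : ∀ A, MeasurableSet A → evalLp F (A.indicator w) = ∫ x in A, ν.rnDeriv μ x ∂μ := by
    intro A hA
    rw [← weightedSignedMeasure_apply F hp hw hw0 hA, ← withDensityᵥ_apply hint hA,
      SignedMeasure.withDensityᵥ_rnDeriv_eq ν μ hac]
  have hbdd : ∀ {b : α → ℝ}, Measurable b → (∃ M, ∀ x, |b x| ≤ M) →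
      MemLp (fun x => b x * w x) (ENNReal.ofReal p) μ ∧
        Integrable (fun x => ν.rnDeriv μ x * b x) μ := by
    rintro b hb ⟨M, hM⟩
    refine ⟨?_, hint.mul_bdd (c := M) hb.aestronglyMeasurable (Eventually.of_forall hM)⟩
    refine (hw.const_mul M).of_le (hb.aestronglyMeasurable.mul hw.1)
      (Eventually.of_forall fun x => ?_)
    rw [norm_mul, norm_mul]
    gcongr
    exact (hM x).trans (le_abs_self M)
  have hsbd : ∀ s : SimpleFunc α ℝ, ∃ M, ∀ x, |s x| ≤ M := fun s =>
    let ⟨C, hC⟩ := s.exists_forall_norm_le; ⟨C, hC⟩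
  have hsimple : ∀ s : SimpleFunc α ℝ,
      evalLp F (fun x => s x * w x) = ∫ x, ν.rnDeriv μ x * s x ∂μ := by
    intro s
    induction s using SimpleFunc.induction with
    | const c hA =>
      rename_i A
      have e1 : (fun x => (SimpleFunc.piecewise A hA (SimpleFunc.const α c)
          (SimpleFunc.const α 0)) x * w x) = fun x => c * A.indicator w x := by
        funext x
        by_cases hx : x ∈ A <;> simp [hx]
      have e2 : (fun x => ν.rnDeriv μ x * (SimpleFunc.piecewise A hA (SimpleFunc.const α c)
          (SimpleFunc.const α 0)) x) = fun x => c * A.indicator (ν.rnDeriv μ) x := by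
        funext x
        by_cases hx : x ∈ A <;> simp [hx, mul_comm]
      rw [e1, e2, evalLp_const_mul F (hw.indicator hA), integral_const_mul,
        integral_indicator hA, hind A hA]
    | add _ hs ht =>
      rename_i s t _
      have h1 := hbdd s.measurable (hsbd s)
      have h2 := hbdd t.measurable (hsbd t)
      simp only [SimpleFunc.coe_add, Pi.add_apply, add_mul, mul_add]
      rw [evalLp_add F h1.1 h2.1, integral_add h1.2 h2.2, hs, ht]
  obtain ⟨M, hM⟩ := hbM
  have hM' : ∀ x, |b x| ≤ |M| := fun x => (hM x).trans (le_abs_self M)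
  have hsm := hb.stronglyMeasurable
  set s := hsm.approxBounded |M|
  have hslim : ∀ x, Tendsto (fun n => s n x) atTop (𝓝 (b x)) := fun x =>
    hsm.tendsto_approxBounded_of_norm_le (hM' x)
  have hsM : ∀ n x, |s n x| ≤ |M| := fun n x =>
    hsm.norm_approxBounded_le (abs_nonneg _) n x
  have l1 : Tendsto (fun n => evalLp F (fun x => s n x * w x)) atTop
      (𝓝 (evalLp F fun x => b x * w x)) := by
    refine tendsto_evalLp_of_dominated F hp (g := fun x => |M| * w x) (fun n => ?_) ?_
      (hw.const_mul _) (fun n x => ?_) (fun x => ?_) (fun x => (hslim x).mul_const _)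
    · exact (s n).measurable.aestronglyMeasurable.mul hw.1
    · exact hb.aestronglyMeasurable.mul hw.1
    · rw [abs_mul, abs_of_nonneg (hw0 x)]
      exact mul_le_mul_of_nonneg_right (hsM n x) (hw0 x)
    · rw [abs_mul, abs_of_nonneg (hw0 x)]
      exact mul_le_mul_of_nonneg_right (hM' x) (hw0 x)
  have l2 : Tendsto (fun n => ∫ x, ν.rnDeriv μ x * s n x ∂μ) atTop
      (𝓝 (∫ x, ν.rnDeriv μ x * b x ∂μ)) := by
    refine tendsto_integral_of_dominated_convergence (fun x => ‖ν.rnDeriv μ x‖ * |M|)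
      (fun n => ?_) (hint.norm.mul_const _) (fun n => Eventually.of_forall fun x => ?_)
      (Eventually.of_forall fun x => (hslim x).const_mul _)
    · exact hint.1.mul (s n).measurable.aestronglyMeasurable
    · rw [norm_mul]
      exact mul_le_mul_of_nonneg_left (hsM n x) (norm_nonneg _)
  simp only [hsimple] at l1
  exact tendsto_nhds_unique l1 l2

/-- Divide by I^(1/p) and use 1 - 1/p = 1/q. -/
lemma rpow_le_of_le_mul_rpow (hpq : p.HolderConjugate q) {I N : ℝ} (hI : 0 ≤ I) (hN : 0 ≤ N)
    (h : I ≤ N * I ^ (1 / p)) : I ≤ N ^ q := by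
  rcases hI.eq_or_lt with h0 | h0
  · rw [← h0]; exact Real.rpow_nonneg hN q
  · have h1 : I ^ (1 / q) ≤ N := by
      have e : I ^ (1 / q) * I ^ (1 / p) = I := by
        rw [← Real.rpow_add h0, one_div, one_div, add_comm, hpq.inv_add_inv_eq_one, Real.rpow_one]
      have hpos : 0 < I ^ (1 / p) := Real.rpow_pos_of_pos h0 _
      exact le_of_mul_le_mul_right (e.le.trans h) hpos
    calc I = (I ^ (1 / q)) ^ q := by
          rw [← Real.rpow_mul hI, one_div, inv_mul_cancel₀ hpq.symm.ne_zero, Real.rpow_one]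
      _ ≤ N ^ q := Real.rpow_le_rpow (Real.rpow_nonneg hI _) h1 hpq.symm.nonneg

/-- The dual of `L^p` is `L^q`. -/
theorem exists_memLp_dual (hpq : p.HolderConjugate q) [SigmaFinite μ] :
    ∃ h : α → ℝ, MemLp h (ENNReal.ofReal q) μ ∧
      eLpNorm h (ENNReal.ofReal q) μ ≤ ENNReal.ofReal ‖F‖ ∧
      ∀ φ : Lp ℝ (ENNReal.ofReal p) μ, F φ = ∫ x, h x * φ x ∂μ := by
  have hp := hpq.pos
  have hq := hpq.symm.pos
  obtain ⟨g, hg0, hgm, hg⟩ := exists_pos_lintegral_lt_of_sigmaFinite μ (ε := 1) one_ne_zero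
  -- A strictly positive function in L^p, obtained as the p-th root of a positive integrable one.
  -- Dividing by it is always possible.
  set w : α → ℝ := fun x => (g x : ℝ) ^ (1 / p)
  have hw0 : ∀ x, 0 < w x := fun x => Real.rpow_pos_of_pos (hg0 x) _
  have hwm : Measurable w := hgm.coe_nnreal_real.pow_const _
  have hw : MemLp w (ENNReal.ofReal p) μ := by
    refine ⟨hwm.aestronglyMeasurable, ?_⟩
    rw [eLpNorm_lt_top_iff_lintegral_rpow_enorm_lt_top (by simpa using hp) ENNReal.ofReal_ne_top,
      ENNReal.toReal_ofReal hp.le]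
    refine lt_of_le_of_lt (le_of_eq (lintegral_congr fun x => ?_)) (hg.trans ENNReal.one_lt_top)
    rw [Real.enorm_of_nonneg (hw0 x).le, ENNReal.ofReal_rpow_of_nonneg (hw0 x).le hp.le]
    simp only [w]
    rw [← Real.rpow_mul (g x).coe_nonneg, one_div, inv_mul_cancel₀ hp.ne', Real.rpow_one,
      ENNReal.ofReal_coe_nnreal]
  obtain ⟨d, hdm, hdi, hd⟩ := exists_density F hp hw fun x => (hw0 x).le
  set h : α → ℝ := fun x => d x / w x
  have hhm : Measurable h := hdm.div hwm
  have hdh : ∀ x, d x = h x * w x := fun x => (div_mul_cancel₀ _ (hw0 x).ne').symm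
  -- On this set the extremal function of Hölder's inequality is a bounded multiple of w. The sets
  -- increase to the whole space.
  let E : ℕ → Set α := fun n => {x | |h x| ^ (q - 1) ≤ n * w x}
  have hE : ∀ n, MeasurableSet (E n) := fun n =>
    measurableSet_le (hhm.abs.pow_const _) (hwm.const_mul _)
  have key : ∀ n, ∫⁻ x in E n, ENNReal.ofReal (|h x| ^ q) ∂μ ≤ ENNReal.ofReal (‖F‖ ^ q) := by
    intro n
    -- The product b·w is sign(h)|h|^(q-1) on E n, for which F returns the integral of |h|^q over E
    -- n while its p-norm is the p-th root of the same integral.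
    let b : α → ℝ := (E n).indicator fun x => SignType.sign (h x) * |h x| ^ (q - 1) / w x
    have hbm : Measurable b := by
      refine Measurable.indicator ?_ (hE n)
      refine Measurable.div (Measurable.mul ?_ (hhm.abs.pow_const _)) hwm
      have : (fun x => ((SignType.sign (h x) : SignType) : ℝ)) = fun x => h x / |h x| := by
        funext x
        rcases lt_trichotomy (h x) 0 with hx | hx | hx
        · rw [sign_neg hx, abs_of_neg hx]; simp [hx.ne]
        · simp [hx]
        · rw [sign_pos hx, abs_of_pos hx]; simp [hx.ne']
      rw [this]
      exact hhm.div hhm.abs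
    have habs : ∀ x ∈ E n, |b x| = |h x| ^ (q - 1) / w x := by
      intro x hx
      have h1 : 0 ≤ |h x| ^ (q - 1) := Real.rpow_nonneg (abs_nonneg _) _
      simp only [b, indicator_of_mem hx]
      rw [abs_div, abs_mul, abs_of_pos (hw0 x), abs_of_nonneg h1]
      rcases eq_or_ne (h x) 0 with h0 | h0
      · simp [h0, Real.zero_rpow (sub_pos.2 hpq.symm.lt).ne']
      · have : |((SignType.sign (h x) : SignType) : ℝ)| = 1 := by
          rcases lt_or_gt_of_ne h0 with h0 | h0
          · rw [sign_neg h0]; simp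
          · rw [sign_pos h0]; simp
        rw [this, one_mul]
    have hb0 : ∀ x, x ∉ E n → b x = 0 := fun x hx => indicator_of_notMem hx _
    have hbn : ∀ x, |b x| ≤ n := by
      intro x
      by_cases hx : x ∈ E n
      · rw [habs x hx, div_le_iff₀ (hw0 x)]; exact hx
      · rw [hb0 x hx, abs_zero]; positivity
    have hdb : ∀ x, d x * b x = (E n).indicator (fun x => |h x| ^ q) x := by
      intro x
      by_cases hx : x ∈ E n
      · have hwx := (hw0 x).ne'
        simp only [b, indicator_of_mem hx, hdh x]
        have h1 : h x * SignType.sign (h x) = |h x| := self_mul_sign _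
        have h2 : |h x| * |h x| ^ (q - 1) = |h x| ^ q := by
          rcases eq_or_ne (h x) 0 with h0 | h0
          · simp [h0, Real.zero_rpow hq.ne']
          · rw [mul_comm, ← Real.rpow_add_one (abs_pos.2 h0).ne', sub_add_cancel]
        rw [← h2, ← h1]
        field_simp
      · rw [hb0 x hx, mul_zero, indicator_of_notMem hx]
    have hdbi : Integrable (fun x => d x * b x) μ :=
      hdi.mul_bdd (c := n) hbm.aestronglyMeasurable (Eventually.of_forall hbn)
    have hbw : MemLp (fun x => b x * w x) (ENNReal.ofReal p) μ := by
      refine (hw.const_mul n).of_le (hbm.aestronglyMeasurable.mul hw.1)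
        (Eventually.of_forall fun x => ?_)
      rw [norm_mul, norm_mul, Real.norm_of_nonneg n.cast_nonneg]
      gcongr
      exact hbn x
    set I := ∫ x in E n, |h x| ^ q ∂μ
    have hIint : IntegrableOn (fun x => |h x| ^ q) (E n) μ := by
      rw [← integrable_indicator_iff (hE n)]
      exact hdbi.congr (Eventually.of_forall hdb)
    have hI0 : 0 ≤ I := integral_nonneg fun x => Real.rpow_nonneg (abs_nonneg _) _
    have hlint : ∫⁻ x in E n, ENNReal.ofReal (|h x| ^ q) ∂μ = ENNReal.ofReal I :=
      (ofReal_integral_eq_lintegral_ofReal hIint (Eventually.of_forall fun x =>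
        Real.rpow_nonneg (abs_nonneg _) _)).symm
    have hF1 : evalLp F (fun x => b x * w x) = I := by
      rw [hd b hbm ⟨n, hbn⟩]
      simp only [hdb]
      exact integral_indicator (hE n)
    have hnorm : eLpNorm (fun x => b x * w x) (ENNReal.ofReal p) μ = ENNReal.ofReal (I ^ (1 / p)) := by
      rw [eLpNorm_eq_lintegral_rpow_enorm_toReal (by simpa using hp) ENNReal.ofReal_ne_top,
        ENNReal.toReal_ofReal hp.le, ← ENNReal.ofReal_rpow_of_nonneg hI0 (by positivity), ← hlint,
        ← lintegral_indicator (hE n)]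
      congr 1
      refine lintegral_congr fun x => ?_
      by_cases hx : x ∈ E n
      · rw [indicator_of_mem hx, Real.enorm_eq_ofReal_abs, abs_mul, habs x hx, abs_of_pos (hw0 x),
          div_mul_cancel₀ _ (hw0 x).ne', ENNReal.ofReal_rpow_of_nonneg
          (Real.rpow_nonneg (abs_nonneg _) _) hp.le, ← Real.rpow_mul (abs_nonneg _)]
        congr 2
        rw [hpq.symm.sub_one_mul_conj]
      · rw [indicator_of_notMem hx, hb0 x hx, zero_mul, enorm_zero, ENNReal.zero_rpow_of_pos hp]
    have hle := abs_evalLp_le F hbw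
    rw [hF1, hnorm, abs_of_nonneg hI0, ENNReal.toReal_ofReal (Real.rpow_nonneg hI0 _)] at hle
    rw [hlint]
    exact ENNReal.ofReal_le_ofReal (rpow_le_of_le_mul_rpow hpq hI0 (norm_nonneg F) hle)
  have hU : (⋃ n, E n) = univ := by
    refine eq_univ_of_forall fun x => mem_iUnion.2 ?_
    obtain ⟨n, hn⟩ := exists_nat_ge (|h x| ^ (q - 1) / w x)
    exact ⟨n, (div_le_iff₀ (hw0 x)).1 hn⟩
  have hmono : Monotone E := fun n m hnm x hx => by
    have h1 : |h x| ^ (q - 1) ≤ n * w x := hx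
    have h2 : (n : ℝ) ≤ m := by exact_mod_cast hnm
    exact h1.trans (mul_le_mul_of_nonneg_right h2 (hw0 x).le)
  have hnormh : eLpNorm h (ENNReal.ofReal q) μ ≤ ENNReal.ofReal ‖F‖ := by
    have h1 : ∫⁻ x, ENNReal.ofReal (|h x| ^ q) ∂μ ≤ ENNReal.ofReal (‖F‖ ^ q) := by
      rw [← setLIntegral_univ, ← hU, setLIntegral_iUnion_of_directed _ hmono.directed_le]
      exact iSup_le key
    rw [eLpNorm_eq_lintegral_rpow_enorm_toReal (by simpa using hq) ENNReal.ofReal_ne_top,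
      ENNReal.toReal_ofReal hq.le]
    have e : ENNReal.ofReal ‖F‖ = ENNReal.ofReal (‖F‖ ^ q) ^ (1 / q) := by
      rw [ENNReal.ofReal_rpow_of_nonneg (by positivity) (by positivity),
        ← Real.rpow_mul (norm_nonneg F), mul_one_div_cancel hq.ne', Real.rpow_one]
    rw [e]
    refine ENNReal.rpow_le_rpow (le_trans (le_of_eq (lintegral_congr fun x => ?_)) h1) (by positivity)
    rw [Real.enorm_eq_ofReal_abs, ENNReal.ofReal_rpow_of_nonneg (abs_nonneg _) hq.le]
  have hh : MemLp h (ENNReal.ofReal q) μ :=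
    ⟨hhm.aestronglyMeasurable, hnormh.trans_lt ENNReal.ofReal_lt_top⟩
  refine ⟨h, hh, hnormh, fun φ => ?_⟩
  have hφm : Measurable φ := (Lp.stronglyMeasurable φ).measurable
  have hφ : MemLp φ (ENNReal.ofReal p) μ := Lp.memLp φ
  haveI : ENNReal.HolderConjugate (ENNReal.ofReal q) (ENNReal.ofReal p) := hpq.symm.ennrealOfReal
  have hhφ : Integrable (fun x => h x * φ x) μ := hh.integrable_mul hφ
  -- Truncation that makes φ/w bounded, so that the representation already known for bounded
  -- multiples of w applies. Both sides then pass to the limit.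
  let S : ℕ → Set α := fun n => {x | |φ x| ≤ n * w x}
  have hS : ∀ n, MeasurableSet (S n) := fun n => measurableSet_le hφm.abs (hwm.const_mul _)
  have hSev : ∀ x, ∀ᶠ n in atTop, x ∈ S n := by
    intro x
    obtain ⟨n, hn⟩ := exists_nat_ge (|φ x| / w x)
    filter_upwards [eventually_ge_atTop n] with m hm
    have h2 : (n : ℝ) ≤ m := by exact_mod_cast hm
    exact ((div_le_iff₀ (hw0 x)).1 hn).trans (mul_le_mul_of_nonneg_right h2 (hw0 x).le)
  have hSlim : ∀ (f : α → ℝ) x, Tendsto (fun n => (S n).indicator f x) atTop (𝓝 (f x)) := by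
    intro f x
    refine tendsto_const_nhds.congr' ?_
    filter_upwards [hSev x] with n hn
    rw [indicator_of_mem hn]
  have l1 : Tendsto (fun n => evalLp F ((S n).indicator φ)) atTop (𝓝 (evalLp F φ)) :=
    tendsto_evalLp_of_dominated F hp (g := fun x => |φ x|) (fun n => hφ.1.indicator (hS n)) hφ.1
      hφ.norm (fun n x => norm_indicator_le_norm_self (⇑φ) x) (fun x => le_rfl) (hSlim φ)
  have l2 : Tendsto (fun n => ∫ x, (S n).indicator (fun x => h x * φ x) x ∂μ) atTop
      (𝓝 (∫ x, h x * φ x ∂μ)) :=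
    tendsto_integral_of_dominated_convergence _ (fun n => hhφ.1.indicator (hS n)) hhφ.norm
      (fun n => Eventually.of_forall fun x => norm_indicator_le_norm_self _ _)
      (Eventually.of_forall (hSlim _))
  have e : ∀ n, evalLp F ((S n).indicator φ) = ∫ x, (S n).indicator (fun x => h x * φ x) x ∂μ := by
    intro n
    have h1 := hd (fun x => (S n).indicator φ x / w x) ((hφm.indicator (hS n)).div hwm) ⟨n, fun x => ?_⟩
    · simp only [fun x => div_mul_cancel₀ ((S n).indicator φ x) (hw0 x).ne'] at h1
      rw [h1]
      refine integral_congr_ae (Eventually.of_forall fun x => ?_)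
      have hwx := (hw0 x).ne'
      by_cases hx : x ∈ S n
      · simp only [indicator_of_mem hx, hdh x]; field_simp
      · simp only [indicator_of_notMem hx, zero_div, mul_zero]
    · by_cases hx : x ∈ S n
      · rw [indicator_of_mem hx, abs_div, abs_of_pos (hw0 x), div_le_iff₀ (hw0 x)]; exact hx
      · rw [indicator_of_notMem hx, zero_div, abs_zero]; positivity
  simp only [e] at l1
  have := tendsto_nhds_unique l1 l2
  rwa [evalLp_of_memLp F hφ, Lp.toLp_coeFn] at this

/-- A functional bounded by the `L^p` norms of finitely many linear maps is represented by
functions in `L^q`. -/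
theorem exists_memLp_of_abs_le_sum (hpq : p.HolderConjugate q) [SigmaFinite μ] {V : Type*}
    [AddCommGroup V] [Module ℝ V] {n : ℕ} (D : Fin n → V →ₗ[ℝ] Lp ℝ (ENNReal.ofReal p) μ)
    (ℓ : V →ₗ[ℝ] ℝ) {C : ℝ} (hC : 0 ≤ C) (hℓ : ∀ v, |ℓ v| ≤ C * ∑ m, ‖D m v‖) :
    ∃ h : Fin n → α → ℝ, (∀ m, MemLp (h m) (ENNReal.ofReal q) μ ∧
      eLpNorm (h m) (ENNReal.ofReal q) μ ≤ ENNReal.ofReal (C * n)) ∧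
      ∀ v, ℓ v = ∑ m, ∫ x, h m x * D m v x ∂μ := by
  let T : V →ₗ[ℝ] (Fin n → Lp ℝ (ENNReal.ofReal p) μ) := LinearMap.pi D
  have hT : ∀ v, |ℓ v| ≤ C * n * ‖T v‖ := by
    intro v
    refine (hℓ v).trans ?_
    rw [mul_assoc]
    gcongr
    calc ∑ m, ‖D m v‖ ≤ ∑ _m : Fin n, ‖T v‖ := Finset.sum_le_sum fun m _ => norm_le_pi_norm (T v) m
      _ = n * ‖T v‖ := by simp
  have hker : LinearMap.ker T ≤ LinearMap.ker ℓ := by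
    intro v hv
    have h1 := hT v
    rw [LinearMap.mem_ker.1 hv, norm_zero, mul_zero] at h1
    exact LinearMap.mem_ker.2 (abs_eq_zero.1 (le_antisymm h1 (abs_nonneg _)))
  -- The bound forces ℓ to vanish on the kernel of T, so ℓ descends to the range of T. The product
  -- carries the sup norm, hence the factor n in its norm.
  let f0 : LinearMap.range T →ₗ[ℝ] ℝ :=
    ((LinearMap.ker T).liftQ ℓ hker) ∘ₗ (T.quotKerEquivRange.symm : _ →ₗ[ℝ] _)
  have hf0 : ∀ v, f0 ⟨T v, LinearMap.mem_range_self T v⟩ = ℓ v := by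
    intro v
    have : T.quotKerEquivRange.symm ⟨T v, LinearMap.mem_range_self T v⟩
        = (LinearMap.ker T).mkQ v := LinearMap.quotKerEquivRange_symm_apply_image T v _
    simp only [f0, LinearMap.comp_apply, LinearEquiv.coe_coe, this]
    simp
  have hbd : ∀ z : LinearMap.range T, ‖f0 z‖ ≤ C * n * ‖z‖ := by
    rintro ⟨z, v, rfl⟩
    rw [hf0]
    exact hT v
  -- Hahn-Banach extension to the whole product. Restricting it to each factor gives a functional on
  -- a single L^p.
  obtain ⟨g, hg, hgn⟩ := exists_extension_norm_eq (LinearMap.range T) (f0.mkContinuous _ hbd)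
  have hgC : ‖g‖ ≤ C * n := by
    rw [hgn]; exact LinearMap.mkContinuous_norm_le _ (by positivity) _
  let F : Fin n → (Lp ℝ (ENNReal.ofReal p) μ →L[ℝ] ℝ) := fun m =>
    g.comp (ContinuousLinearMap.single ℝ (fun _ : Fin n => Lp ℝ (ENNReal.ofReal p) μ) m)
  have hF : ∀ m, ‖F m‖ ≤ C * n := by
    intro m
    refine ContinuousLinearMap.opNorm_le_bound _ (by positivity) fun φ => ?_
    refine (g.le_opNorm _).trans (mul_le_mul hgC (le_of_eq ?_) (norm_nonneg _) (by positivity))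
    exact Pi.norm_single (G := fun _ : Fin n => Lp ℝ (ENNReal.ofReal p) μ) φ
  choose h hh1 hh2 hh3 using fun m => exists_memLp_dual (F m) hpq
  refine ⟨h, fun m => ⟨hh1 m, (hh2 m).trans (ENNReal.ofReal_le_ofReal (hF m))⟩, fun v => ?_⟩
  have h1 := hg ⟨T v, LinearMap.mem_range_self T v⟩
  rw [LinearMap.mkContinuous_apply, hf0] at h1
  rw [← h1]
  simp_rw [← hh3]
  have h2 : T v = ∑ m, ContinuousLinearMap.single ℝ (fun _ : Fin n => Lp ℝ (ENNReal.ofReal p) μ) m (D m v) := by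
    exact (Finset.univ_sum_single (T v)).symm
  change g (T v) = _
  rw [h2, map_sum]
  rfl

end LpDuality

/-! ### Mollification and Liouville's theorem. -/

section Mollification

variable {η w : E3 → ℝ}

lemma conv_eq_convolution (η w : E3 → ℝ) :
    conv η w = convolution w η (ContinuousLinearMap.mul ℝ ℝ) volume := by
  funext x
  simp only [conv, convolution, ContinuousLinearMap.mul_apply']
  exact integral_congr_ae (Eventually.of_forall fun y => mul_comm _ _)

lemma IsTest.contDiff_conv (hη : IsTest η) (hw : LocallyIntegrable w) :
    ContDiff ℝ ∞ (conv η w) := by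
  rw [conv_eq_convolution]
  exact hη.compact.contDiff_convolution_right _ hw hη.smooth

lemma IsTest.pderiv_conv (hη : IsTest η) (hw : LocallyIntegrable w) (k : Fin 3) :
    StokesWholeSpace.pderiv k (conv η w) = conv (StokesWholeSpace.pderiv k η) w := by
  funext x
  rw [conv_eq_convolution, conv_eq_convolution]
  have h := (hη.compact.hasFDerivAt_convolution_right (ContinuousLinearMap.mul ℝ ℝ) hw
    (hη.contDiff 1) x)
  have : StokesWholeSpace.pderiv k (convolution w η (ContinuousLinearMap.mul ℝ ℝ) volume) x
      = (convolution w (fderiv ℝ η) ((ContinuousLinearMap.mul ℝ ℝ).precompR E3) volume x)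
        (basisVec k) := by
    rw [StokesWholeSpace.pderiv, h.fderiv, basisVec]
  rw [this, convolution_precompR_apply _ hw (hη.compact.fderiv ℝ)
    ((hη.contDiff 1).continuous_fderiv (by norm_num))]
  rfl

lemma IsTest.pderiv_reflect (hη : IsTest η) (k : Fin 3) (a x : E3) :
    StokesWholeSpace.pderiv k (fun y => η (a - y)) x = -StokesWholeSpace.pderiv k η (a - x) := by
  have h := (hη.differentiable (a - x)).hasFDerivAt.comp x ((hasFDerivAt_id x).const_sub a)
  have h2 : fderiv ℝ (fun y => η (a - y)) x = _ := h.fderiv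
  rw [StokesWholeSpace.pderiv, h2]
  simp [StokesWholeSpace.pderiv]

lemma IsTest.laplacian_reflect (hη : IsTest η) (a : E3) :
    (Δ fun y => η (a - y)) = fun x => (Δ η) (a - x) := by
  rw [laplacian_fun_eq (hη.reflect a), laplacian_fun_eq hη]
  funext x
  refine Finset.sum_congr rfl fun k _ => ?_
  have : StokesWholeSpace.pderiv k (fun y => η (a - y))
      = fun y => (-1) * StokesWholeSpace.pderiv k η (a - y) := by
    funext y; rw [hη.pderiv_reflect]; ring
  rw [this, pderiv_const_mul ((hη.pderiv k).reflect a).differentiable, (hη.pderiv k).pderiv_reflect]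
  ring

/-- Both derivatives fall on η, and y ↦ η(z - y) is an admissible test function for the weak
harmonicity of w. -/
lemma IsTest.sum_pderiv_conv_eq_zero (hη : IsTest η) (hw : LocallyIntegrable w)
    (h : ∀ φ, IsTest φ → ∫ x, w x * (Δ φ) x = 0) (z : E3) :
    ∑ k, StokesWholeSpace.pderiv k (StokesWholeSpace.pderiv k (conv η w)) z = 0 := by
  have hint : ∀ k ∈ (Finset.univ : Finset (Fin 3)), Integrable fun y =>
      StokesWholeSpace.pderiv k (StokesWholeSpace.pderiv k η) (z - y) * w y := fun k _ => by
    have h2 := ((hη.pderiv k).pderiv k).reflect z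
    have := hw.integrable_smul_left_of_hasCompactSupport h2.continuous h2.compact
    simpa only [smul_eq_mul] using this
  simp_rw [hη.pderiv_conv hw, (hη.pderiv _).pderiv_conv hw]
  simp only [conv]
  rw [← integral_finsetSum _ hint]
  have h1 := h _ (hη.reflect z)
  rw [hη.laplacian_reflect, laplacian_fun_eq hη] at h1
  rw [← h1]
  refine integral_congr_ae (Eventually.of_forall fun y => ?_)
  simp only [Finset.sum_mul, mul_comm (w y)]

/-- Tonelli's theorem: for |x| < R only points with |y| < R + r contribute. -/
lemma IsTest.lintegral_conv_le (hη : IsTest η) (hw : LocallyIntegrable w) {r : ℝ}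
    (hr : ∀ x, r ≤ ‖x‖ → η x = 0) (R : ℝ) :
    ∫⁻ x in Metric.ball (0 : E3) R, ‖conv η w x‖ₑ
      ≤ (∫⁻ x, ‖η x‖ₑ) * ∫⁻ y in Metric.ball (0 : E3) (R + r), ‖w y‖ₑ := by
  have hm : AEMeasurable (Function.uncurry fun x y : E3 => ‖η (x - y)‖ₑ * ‖w y‖ₑ)
      ((volume.restrict (Metric.ball (0 : E3) R)).prod
        (volume.restrict (Metric.ball (0 : E3) (R + r)))) := by
    have h1 : AEMeasurable (fun z : E3 × E3 => ‖η (z.1 - z.2)‖ₑ)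
        ((volume.restrict (Metric.ball (0 : E3) R)).prod
          (volume.restrict (Metric.ball (0 : E3) (R + r)))) :=
      (hη.continuous.comp (continuous_fst.sub continuous_snd)).measurable.enorm.aemeasurable
    exact h1.mul (hw.aestronglyMeasurable.restrict.comp_snd).enorm
  calc _ ≤ ∫⁻ x in Metric.ball (0 : E3) R, ∫⁻ y in Metric.ball (0 : E3) (R + r),
        ‖η (x - y)‖ₑ * ‖w y‖ₑ := by
        refine setLIntegral_mono' Metric.isOpen_ball.measurableSet fun x hx => ?_
        refine (enorm_integral_le_lintegral_enorm _).trans (le_of_eq ?_)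
        rw [← lintegral_indicator Metric.isOpen_ball.measurableSet]
        refine lintegral_congr fun y => ?_
        by_cases hy : y ∈ Metric.ball (0 : E3) (R + r)
        · rw [indicator_of_mem hy, enorm_mul]
        · have hx' : ‖x‖ < R := by simpa using hx
          have hy' : R + r ≤ ‖y‖ := by simpa using hy
          rw [indicator_of_notMem hy, hr (x - y), zero_mul, enorm_zero]
          have := norm_sub_norm_le y x
          rw [norm_sub_rev] at this
          linarith
    _ = ∫⁻ y in Metric.ball (0 : E3) (R + r), ∫⁻ x in Metric.ball (0 : E3) R,
          ‖η (x - y)‖ₑ * ‖w y‖ₑ := lintegral_lintegral_swap hm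
    _ ≤ ∫⁻ y in Metric.ball (0 : E3) (R + r), (∫⁻ x, ‖η x‖ₑ) * ‖w y‖ₑ := by
        refine lintegral_mono fun y => ?_
        rw [lintegral_mul_const' _ _ enorm_ne_top]
        refine mul_le_mul' ?_ le_rfl
        refine (lintegral_mono' Measure.restrict_le_self le_rfl).trans (le_of_eq ?_)
        exact lintegral_sub_right_eq_self (fun x => ‖η x‖ₑ) y
    _ = _ := by
        refine lintegral_const_mul' _ _ ?_
        exact (hη.integrable.2).ne

end Mollification

/-- A radial test function `κ` and a function `ρ` with `y ρ(y) = ∇κ(y)` and `∫ ρ ≠ 0`. -/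
lemma exists_radial_pair : ∃ κ ρ : E3 → ℝ, IsTest κ ∧ IsTest ρ ∧
    (∀ k y, pderiv k κ y = ρ y * y k) ∧ (∀ y, 2 ≤ ‖y‖ → ρ y = 0) ∧ ∫ y, ρ y ≠ 0 := by
  -- A smooth decreasing profile that is 1 for r ≤ 1 and 0 for r ≥ 2. The pair is κ(y) = m(|y|²) and
  -- ρ(y) = 2m'(|y|²).
  let m : ℝ → ℝ := fun r => Real.smoothTransition (2 - r)
  have hmc : ContDiff ℝ ∞ m := Real.smoothTransition.contDiff.comp (contDiff_const.sub contDiff_id)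
  have hm0 : ∀ r, 2 ≤ r → m r = 0 := fun r hr => Real.smoothTransition.zero_of_nonpos (by linarith)
  have hmd : ContDiff ℝ ∞ (deriv m) := by
    have : ContDiff ℝ ((∞ : ℕ∞ω) + 1) m := by simpa using hmc
    exact (contDiff_succ_iff_deriv.1 this).2.2
  have hm0' : ∀ r, 2 < r → deriv m r = 0 := by
    intro r hr
    have : m =ᶠ[𝓝 r] fun _ => 0 := by
      filter_upwards [lt_mem_nhds hr] with x hx using hm0 x hx.le
    rw [this.deriv_eq, deriv_const]
  have hmanti : Antitone m := fun a b hab => Real.smoothTransition.monotone (by linarith)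
  have hmd0 : ∀ r, deriv m r ≤ 0 := fun r => hmanti.deriv_nonpos
  have hnsq : ContDiff ℝ ∞ fun y : E3 => ‖y‖ ^ 2 := contDiff_norm_sq ℝ
  have hsup : ∀ f : ℝ → ℝ, (∀ r, 2 < r → f r = 0) → HasCompactSupport fun y : E3 => f (‖y‖ ^ 2) := by
    intro f hf
    refine HasCompactSupport.of_support_subset_isCompact (isCompact_closedBall (0 : E3) 2)
      fun y hy => ?_
    rw [mem_closedBall_zero_iff]
    by_contra hlt
    push Not at hlt
    exact hy (hf _ (by nlinarith))
  refine ⟨fun y => m (‖y‖ ^ 2), fun y => 2 * deriv m (‖y‖ ^ 2), ⟨hmc.comp hnsq, ?_⟩,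
    ⟨contDiff_const.mul (hmd.comp hnsq), ?_⟩, ?_, ?_, ?_⟩
  · exact hsup m fun r hr => hm0 r hr.le
  · exact hsup (fun r => 2 * deriv m r) fun r hr => by rw [hm0' r hr, mul_zero]
  · intro k y
    have h := ((hmc.differentiable (by simp) (‖y‖ ^ 2)).hasDerivAt).comp_hasFDerivAt y
      (hasFDerivAt_norm_sq_E3 y)
    have h2 : fderiv ℝ (fun y : E3 => m (‖y‖ ^ 2)) y = _ := h.fderiv
    rw [pderiv, h2]
    simp [EuclideanSpace.inner_single_right]
    ring
  · intro y hy
    simp only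
    rw [hm0' _ (by nlinarith), mul_zero]
  -- Since ρ ≤ 0 is continuous, a zero integral would make m' vanish on [0, ∞), contradicting m(0) =
  -- 1 and m(2) = 0.
  · intro h0
    have hc : Continuous fun y : E3 => -(2 * deriv m (‖y‖ ^ 2)) :=
      (continuous_const.mul (hmd.continuous.comp hnsq.continuous)).neg
    have hcs : HasCompactSupport fun y : E3 => -(2 * deriv m (‖y‖ ^ 2)) :=
      hsup (fun r => -(2 * deriv m r)) fun r hr => by rw [hm0' r hr, mul_zero, neg_zero]
    have hz : (fun y : E3 => -(2 * deriv m (‖y‖ ^ 2))) = 0 := by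
      have h1 : ∫ y : E3, -(2 * deriv m (‖y‖ ^ 2)) = 0 := by rw [integral_neg, h0, neg_zero]
      rw [integral_eq_zero_iff_of_nonneg (fun y => by
        have := hmd0 (‖y‖ ^ 2); simp only [Pi.zero_apply]; linarith)
        (hc.integrable_of_hasCompactSupport hcs)] at h1
      exact (Continuous.ae_eq_iff_eq volume hc continuous_const).1 h1
    have hd : ∀ r, 0 ≤ r → deriv m r = 0 := by
      intro r hr
      have := congrFun hz ((Real.sqrt r) • basisVec 0)
      have e : ‖(Real.sqrt r) • basisVec 0‖ ^ 2 = r := by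
        rw [norm_smul, basisVec, PiLp.norm_single, norm_one, mul_one,
          Real.norm_of_nonneg (Real.sqrt_nonneg r), Real.sq_sqrt hr]
      rw [e] at this
      simpa using this
    have hconst : m 2 = m 0 := by
      refine constant_of_has_deriv_right_zero (f := m) (a := 0) (b := 2) hmc.continuous.continuousOn
        (fun x hx => ?_) 2 (by simp)
      rw [← hd x hx.1]
      exact ((hmc.differentiable (by simp) x).hasDerivAt).hasDerivWithinAt
    rw [hm0 2 le_rfl] at hconst
    have : m 0 = 1 := Real.smoothTransition.one_of_one_le (by norm_num)
    linarith

/-- The mean value property in the form needed below: weighted radial means of a harmonic function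
do not depend on the radius. -/
lemma integral_radial_mean {W κ ρ : E3 → ℝ} (hW : ContDiff ℝ ∞ W)
    (hharm : ∀ z, ∑ k, pderiv k (pderiv k W) z = 0) (hκ : IsTest κ) (hρ : IsTest ρ)
    (hκρ : ∀ k y, pderiv k κ y = ρ y * y k) (R : ℝ) :
    ∫ y, W (R • y) * ρ y = W 0 * ∫ y, ρ y := by
  obtain ⟨r, -, hr⟩ := hρ.exists_support
  have hWd : Differentiable ℝ W := hW.differentiable (by simp)
  have hfd : Continuous (fderiv ℝ W) := hW.continuous_fderiv (by simp)
  have hexp : ∀ z y : E3, fderiv ℝ W z y = ∑ k, y k * pderiv k W z := by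
    intro z y
    conv_lhs => rw [← (EuclideanSpace.basisFun (Fin 3) ℝ).sum_repr y]
    simp [pderiv]
  -- The derivative in s is ∫ ∇W(sy)·y ρ(y) dy = ∫ ∇W(sy)·∇κ(y) dy = -s ∫ ΔW(sy) κ(y) dy = 0.
  have hder : ∀ s : ℝ, HasDerivAt (fun s : ℝ => ∫ y, W (s • y) * ρ y) 0 s := by
    intro s
    have h := hasDerivAt_integral_of_support (F := fun s y => W (s • y))
      (F' := fun s y => fderiv ℝ W (s • y) y) (f := ρ) (R := r) (a := s) one_pos hρ.integrable hr
      (fun s _ y => by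
        have h1 : HasDerivAt (fun r : ℝ => r • y) y s := by
          simpa using (hasDerivAt_id s).smul_const y
        exact (hWd (s • y)).hasFDerivAt.comp_hasDerivAt s h1)
      (fun s _ => hW.continuous.comp (continuous_const_smul s))
      (by
        refine Continuous.continuousOn ?_
        exact (hfd.comp (by fun_prop : Continuous fun z : ℝ × E3 => z.1 • z.2)).clm_apply
          continuous_snd)
    refine h.congr_deriv ?_
    have hck : ∀ k, ContDiff ℝ 1 fun y : E3 => pderiv k W (s • y) := fun k =>
      (contDiff_nat_of_top (contDiff_top_pderiv k hW) 1).comp (contDiff_const_smul s)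
    have e1 : ∀ y, fderiv ℝ W (s • y) y * ρ y = ∑ k, pderiv k W (s • y) * pderiv k κ y := by
      intro y
      rw [hexp, Finset.sum_mul]
      refine Finset.sum_congr rfl fun k _ => ?_
      rw [hκρ]; ring
    simp only [e1]
    rw [integral_finsetSum]
    · have e2 : ∀ k, ∫ y, pderiv k W (s • y) * pderiv k κ y
          = -∫ y, (s * pderiv k (pderiv k W) (s • y)) * κ y := by
        intro k
        rw [integral_mul_pderiv (hck k) (hκ.contDiff 1) hκ.compact]
        simp_rw [pderiv_comp_smul ((contDiff_top_pderiv k hW).differentiable (by simp))]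
      simp only [e2]
      rw [Finset.sum_neg_distrib, ← integral_finsetSum]
      · have : ∀ y, ∑ k, s * pderiv k (pderiv k W) (s • y) * κ y = 0 := by
          intro y
          rw [← Finset.sum_mul, ← Finset.mul_sum, hharm, mul_zero, zero_mul]
        simp [this]
      · intro k _
        have hc : Continuous fun y : E3 => s * pderiv k (pderiv k W) (s • y) :=
          continuous_const.mul ((contDiff_top_pderiv k (contDiff_top_pderiv k hW)).continuous.comp
            (continuous_const_smul s))
        exact (hc.mul hκ.continuous).integrable_of_hasCompactSupport hκ.compact.mul_left
    · intro k _
      exact ((hck k).continuous.mul (hκ.pderiv k).continuous).integrable_of_hasCompactSupport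
        (hκ.pderiv k).compact.mul_left
  have hconst := is_const_of_deriv_eq_zero (fun s => (hder s).differentiableAt)
    (fun s => (hder s).deriv) R 0
  simp only [zero_smul] at hconst
  rw [hconst, integral_const_mul]

/-- Liouville's theorem for weakly harmonic functions with vanishing means at infinity. -/
theorem ae_eq_zero_of_harmonic {w : E3 → ℝ} (hw : LocallyIntegrable w) (hv : HasVanishingMeans w)
    (h : ∀ φ, IsTest φ → ∫ x, w x * (Δ φ) x = 0) : w =ᵐ[volume] 0 := by
  obtain ⟨κ, ρ, hκ, hρ, hκρ, hρ2, hρ0⟩ := exists_radial_pair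
  obtain ⟨M, hM0, hM⟩ := hρ.exists_bound
  -- It suffices that w annihilates each test function ψ. The integral of wψ is the value at 0 of
  -- the mollification of w by the reflection of ψ, a smooth harmonic function.
  refine ae_eq_zero_of_integral_contDiff_smul_eq_zero hw fun ψ hψs hψc => ?_
  have hη : IsTest fun x => ψ (0 - x) := IsTest.reflect ⟨hψs, hψc⟩ 0
  set η : E3 → ℝ := fun x => ψ (0 - x)
  obtain ⟨r, hr0, hr⟩ := hη.exists_support
  set W := conv η w
  have hW : ContDiff ℝ ∞ W := hη.contDiff_conv hw
  have hW0 : W 0 = ∫ x, ψ x • w x := by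
    simp [W, conv, η]
  have hmean := integral_radial_mean hW (hη.sum_pderiv_conv_eq_zero hw h) hκ hρ hκρ
  set N := ∫⁻ x, ‖η x‖ₑ
  have hN : N ≠ ⊤ := hη.integrable.2.ne
  -- The weight ρ(·/R) lives in the ball of radius 2R, and the mollification there sees w only in
  -- the ball of radius 2R + r ≤ 3R. The number 27 renormalizes R³ to (3R)³.
  have hbound : ∀ R : ℝ, 0 < R → r ≤ R → ‖W 0 * ∫ y, ρ y‖ₑ ≤ ENNReal.ofReal (27 * M) * N *
      (ENNReal.ofReal ((3 * R) ^ 3)⁻¹ * ∫⁻ y in Metric.ball (0 : E3) (3 * R), ‖w y‖ₑ) := by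
    intro R hR hrR
    have hsc : ∫ y, W (R • y) * ρ y = (R ^ 3)⁻¹ * ∫ y, W y * ρ (R⁻¹ • y) := by
      have := Measure.integral_comp_smul (volume : Measure E3) (fun y => W y * ρ (R⁻¹ • y)) R
      simp only [smul_smul, inv_mul_cancel₀ hR.ne', one_smul, finrank_euclideanSpace,
        Fintype.card_fin, smul_eq_mul] at this
      rw [this, abs_of_pos (by positivity)]
    rw [← hmean R, hsc, enorm_mul, Real.enorm_of_nonneg (by positivity)]
    calc _ ≤ ENNReal.ofReal (R ^ 3)⁻¹ * (∫⁻ y in Metric.ball (0 : E3) (2 * R),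
          ENNReal.ofReal M * ‖W y‖ₑ) := by
          gcongr
          refine (enorm_integral_le_lintegral_enorm _).trans ?_
          rw [← lintegral_indicator Metric.isOpen_ball.measurableSet]
          refine lintegral_mono fun y => ?_
          by_cases hy : y ∈ Metric.ball (0 : E3) (2 * R)
          · rw [indicator_of_mem hy, enorm_mul, mul_comm]
            gcongr
            rw [Real.enorm_eq_ofReal_abs]
            exact ENNReal.ofReal_le_ofReal (hM _)
          · have hy' : 2 * R ≤ ‖y‖ := by simpa using hy
            rw [indicator_of_notMem hy, hρ2, mul_zero, enorm_zero]
            rw [norm_smul, Real.norm_of_nonneg (by positivity), ← div_eq_inv_mul, le_div_iff₀ hR]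
            exact hy'
      _ ≤ ENNReal.ofReal (R ^ 3)⁻¹ * (ENNReal.ofReal M *
          (N * ∫⁻ y in Metric.ball (0 : E3) (3 * R), ‖w y‖ₑ)) := by
          rw [lintegral_const_mul' _ _ ENNReal.ofReal_ne_top]
          gcongr
          refine (hη.lintegral_conv_le hw hr (2 * R)).trans ?_
          gcongr
          linarith
      _ = _ := by
          have : ENNReal.ofReal (R ^ 3)⁻¹ = ENNReal.ofReal 27 * ENNReal.ofReal ((3 * R) ^ 3)⁻¹ := by
            rw [← ENNReal.ofReal_mul (by norm_num)]
            congr 1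
            field_simp
            norm_num
          rw [this, ENNReal.ofReal_mul (by norm_num)]
          ring
  have hlim : Tendsto (fun R : ℝ => ENNReal.ofReal (27 * M) * N * (ENNReal.ofReal ((3 * R) ^ 3)⁻¹ *
      ∫⁻ y in Metric.ball (0 : E3) (3 * R), ‖w y‖ₑ)) atTop (𝓝 0) := by
    have h1 := hv.comp (tendsto_id.const_mul_atTop (by norm_num : (0 : ℝ) < 3))
    have h2 := ENNReal.Tendsto.const_mul h1 (Or.inr (ENNReal.mul_ne_top ENNReal.ofReal_ne_top hN)
      : _ ∨ ENNReal.ofReal (27 * M) * N ≠ ⊤)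
    rw [mul_zero] at h2
    exact h2
  have hle : ‖W 0 * ∫ y, ρ y‖ₑ ≤ 0 := by
    refine ge_of_tendsto hlim ?_
    filter_upwards [eventually_ge_atTop r] with R hR using hbound R (hr0.trans_le hR) hR
  have h0 : W 0 * ∫ y, ρ y = 0 := by simpa using hle
  rw [← hW0]
  exact (mul_eq_zero.1 h0).resolve_right hρ0

/-! ### Weak derivatives and the L^p theory of the two kernels. -/

lemma IsTest.memLp {φ : E3 → ℝ} (hφ : IsTest φ) (P : ℝ≥0∞) : MemLp φ P volume :=
  (IsBddSupp.of_isTest hφ).memLp P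

lemma integrable_mul_test {w φ : E3 → ℝ} (hw : LocallyIntegrable w) (hφ : IsTest φ) :
    Integrable fun x => w x * φ x := by
  have := hw.integrable_smul_right_of_hasCompactSupport hφ.continuous hφ.compact
  simpa only [smul_eq_mul] using this

/-- `h` is the weak partial derivative `∂ⱼ w`. -/
def IsWeakDeriv (j : Fin 3) (w h : E3 → ℝ) : Prop :=
  ∀ φ, IsTest φ → ∫ x, w x * pderiv j φ x = -∫ x, h x * φ x

lemma ae_eq_of_integral_test_eq {v w : E3 → ℝ} (hv : LocallyIntegrable v)
    (hw : LocallyIntegrable w) (h : ∀ φ, IsTest φ → ∫ x, v x * φ x = ∫ x, w x * φ x) :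
    v =ᵐ[volume] w := by
  refine ae_eq_of_integral_contDiff_smul_eq hv hw fun φ hφ hc => ?_
  have := h φ ⟨hφ, hc⟩
  simpa only [smul_eq_mul, mul_comm] using this

lemma IsWeakDeriv.ae_eq {j : Fin 3} {w h h' : E3 → ℝ} (h1 : IsWeakDeriv j w h)
    (h2 : IsWeakDeriv j w h') (hl : LocallyIntegrable h) (hl' : LocallyIntegrable h') :
    h =ᵐ[volume] h' :=
  ae_eq_of_integral_test_eq hl hl' fun φ hφ => neg_injective ((h1 φ hφ).symm.trans (h2 φ hφ))

lemma IsWeakDeriv.add {j : Fin 3} {w w' h h' : E3 → ℝ} (h1 : IsWeakDeriv j w h)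
    (h2 : IsWeakDeriv j w' h') (hw : LocallyIntegrable w) (hw' : LocallyIntegrable w')
    (hl : LocallyIntegrable h) (hl' : LocallyIntegrable h') :
    IsWeakDeriv j (fun x => w x + w' x) fun x => h x + h' x := by
  intro φ hφ
  simp only [add_mul]
  rw [integral_add (integrable_mul_test hw (hφ.pderiv j)) (integrable_mul_test hw' (hφ.pderiv j)),
    integral_add (integrable_mul_test hl hφ) (integrable_mul_test hl' hφ), h1 φ hφ, h2 φ hφ, neg_add]

lemma IsWeakDeriv.neg {j : Fin 3} {w h : E3 → ℝ} (h1 : IsWeakDeriv j w h) :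
    IsWeakDeriv j (fun x => -w x) fun x => -h x := by
  intro φ hφ
  simp only [neg_mul, integral_neg, h1 φ hφ]

/-- A test function as an element of `L^P`. -/
def testToLp (P : ℝ≥0∞) [Fact (1 ≤ P)] : ScalarTest →ₗ[ℝ] Lp ℝ P (volume : Measure E3) where
  toFun φ := (φ.isTest.memLp P).toLp φ
  map_add' _ _ := rfl
  map_smul' _ _ := rfl

lemma coeFn_testToLp (P : ℝ≥0∞) [Fact (1 ≤ P)] (φ : ScalarTest) : testToLp P φ =ᵐ[volume] φ :=
  MemLp.coeFn_toLp (φ.isTest.memLp P)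

lemma norm_testToLp (P : ℝ≥0∞) [Fact (1 ≤ P)] (φ : ScalarTest) :
    ‖testToLp P φ‖ = (eLpNorm φ P volume).toReal :=
  Lp.norm_toLp _ (φ.isTest.memLp P)

lemma pderiv_add {φ ψ : E3 → ℝ} (hφ : Differentiable ℝ φ) (hψ : Differentiable ℝ ψ) (k : Fin 3)
    (x : E3) : pderiv k (fun x => φ x + ψ x) x = pderiv k φ x + pderiv k ψ x := by
  simp only [pderiv]
  rw [fderiv_fun_add (hφ x) (hψ x)]
  rfl

variable {p q : ℝ}

/-- The functional φ ↦ -∫ w ∂ⱼφ is bounded in the L^q norm of φ, so duality, applied to the single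
map from test functions to L^q, represents it by a function in L^p. -/
theorem exists_weakDeriv_of_le (hpq : p.HolderConjugate q) {w : E3 → ℝ} (hw : LocallyIntegrable w)
    {j : Fin 3} {C : ℝ} (hC : 0 ≤ C) (h : ∀ φ, IsTest φ →
      ENNReal.ofReal |∫ x, w x * pderiv j φ x| ≤ ENNReal.ofReal C * eLpNorm φ (ENNReal.ofReal q) volume) :
    ∃ d : E3 → ℝ, MemLp d (ENNReal.ofReal p) volume ∧
      eLpNorm d (ENNReal.ofReal p) volume ≤ ENNReal.ofReal C ∧ IsWeakDeriv j w d := by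
  haveI : Fact (1 ≤ ENNReal.ofReal q) := ⟨by simpa using hpq.symm.lt.le⟩
  let ℓ : ScalarTest →ₗ[ℝ] ℝ :=
    { toFun := fun φ => -∫ x, w x * pderiv j φ x
      map_add' := fun φ ψ => by
        rw [← neg_add, ← integral_add (integrable_mul_test hw (φ.isTest.pderiv j))
          (integrable_mul_test hw (ψ.isTest.pderiv j))]
        congr 1
        refine integral_congr_ae (Eventually.of_forall fun x => ?_)
        have := pderiv_add φ.isTest.differentiable ψ.isTest.differentiable j x
        simp only [← mul_add, ← this]
        rfl
      map_smul' := fun c φ => by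
        simp only [RingHom.id_apply, smul_eq_mul, mul_neg]
        rw [← integral_const_mul]
        congr 1
        refine integral_congr_ae (Eventually.of_forall fun x => ?_)
        have := pderiv_const_mul φ.isTest.differentiable j c x
        simp only [mul_left_comm c, ← this]
        rfl }
  obtain ⟨d, hd, hd2⟩ := exists_memLp_of_abs_le_sum hpq.symm (n := 1)
    (fun _ => testToLp (ENNReal.ofReal q)) ℓ hC (fun φ => by
      have h1 := h φ φ.isTest
      have h2 := (φ.isTest.memLp (ENNReal.ofReal q)).2.ne
      rw [Fin.sum_univ_one, norm_testToLp, show |ℓ φ| = |∫ x, w x * pderiv j φ x| from abs_neg _]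
      have h3 := ENNReal.toReal_mono (ENNReal.mul_ne_top ENNReal.ofReal_ne_top h2) h1
      rwa [ENNReal.toReal_mul, ENNReal.toReal_ofReal (abs_nonneg _), ENNReal.toReal_ofReal hC] at h3)
  refine ⟨d 0, (hd 0).1, by simpa using (hd 0).2, fun φ hφ => ?_⟩
  have h1 := hd2 hφ.bundle
  rw [Fin.sum_univ_one] at h1
  have h2 : ∫ x, d 0 x * testToLp (ENNReal.ofReal q) hφ.bundle x = ∫ x, d 0 x * φ x := by
    refine integral_congr_ae ?_
    filter_upwards [coeFn_testToLp (ENNReal.ofReal q) hφ.bundle] with x hx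
    rw [hx, hφ.coe_bundle]
  rw [h2] at h1
  rw [← h1]
  simp [ℓ]

/-- Convolutions with kernels satisfying the weak gradient bound have weak derivatives in `L^p`. -/
lemma IsNewtonType.exists_weakDeriv (hpq : p.HolderConjugate q) {K : E3 → ℝ} (hK : IsNewtonType K)
    {j : Fin 3} {C : ℝ} (hC : 0 ≤ C)
    (h : ∀ f φ : E3 → ℝ, IsBddSupp f → IsTest φ →
      ENNReal.ofReal |∫ x, conv K f x * pderiv j φ x| ≤ ENNReal.ofReal C *
        (eLpNorm f (ENNReal.ofReal p) volume * eLpNorm φ (ENNReal.ofReal q) volume))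
    {G : E3 → ℝ} (hG : IsWeightIntegrable G) (hGp : MemLp G (ENNReal.ofReal p) volume) :
    ∃ d : E3 → ℝ, MemLp d (ENNReal.ofReal p) volume ∧ eLpNorm d (ENNReal.ofReal p) volume
      ≤ ENNReal.ofReal C * eLpNorm G (ENNReal.ofReal p) volume ∧ IsWeakDeriv j (conv K G) d := by
  have e : ENNReal.ofReal (C * (eLpNorm G (ENNReal.ofReal p) volume).toReal)
      = ENNReal.ofReal C * eLpNorm G (ENNReal.ofReal p) volume := by
    rw [ENNReal.ofReal_mul hC, ENNReal.ofReal_toReal hGp.2.ne]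
  obtain ⟨d, h1, h2, h3⟩ := exists_weakDeriv_of_le hpq (hK.locallyIntegrable_conv hG) (j := j)
    (C := C * (eLpNorm G (ENNReal.ofReal p) volume).toReal) (by positivity) fun φ hφ => by
      rw [e, mul_assoc]
      exact hK.ofReal_abs_integral_le h hG hφ
  exact ⟨d, h1, e ▸ h2, h3⟩

/-- `∑ᵢ ∂ᵢ thirdKer i l k = ∂ₗ gradKer k`. -/
lemma sum_integral_thirdKer_pderiv {φ : E3 → ℝ} (hφ : IsTest φ) (l k : Fin 3) (y : E3) :
    ∑ i, ∫ x, thirdKer i l k (x - y) * pderiv i φ x = ∫ x, gradKer k (x - y) * pderiv l φ x := by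
  set η := pderiv k (pderiv l φ)
  have hη : IsTest η := (hφ.pderiv l).pderiv k
  have h1 := fun i => integral_thirdKer_mul (hφ.pderiv i) i l k y
  have h2 := integral_gradKer_mul (hφ.pderiv l) k y
  have hcomm : ∀ i, pderiv k (pderiv l (pderiv i (pderiv i φ))) = pderiv i (pderiv i η) := by
    intro i
    have c : ∀ {f : E3 → ℝ} (hf : IsTest f) (a b : Fin 3), pderiv a (pderiv b f) = pderiv b (pderiv a f) :=
      fun hf a b => pderiv_comm (hf.contDiff 2) a b
    rw [c (hφ.pderiv i) l i, c hφ l i, c ((hφ.pderiv l).pderiv i) k i, c (hφ.pderiv l) k i]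
  have e : ∀ t, ∑ i, t * heatExt t (pderiv i (pderiv i η)) y = t * heatExt t (Δ η) y := by
    intro t
    rw [← Finset.mul_sum, laplacian_fun_eq hη]
    congr 1
    simp only [heatExt, conv, Finset.mul_sum]
    rw [integral_finsetSum]
    intro i _
    exact (IsBddSupp.of_isTest ((hη.pderiv i).pderiv i)).integrable_continuous_mul
      ((contDiff_heat t).continuous.comp (by fun_prop))
  simp_rw [hcomm] at h1
  have hi : IntegrableOn (fun t => ∑ i, t * heatExt t (pderiv i (pderiv i η)) y) (Ioi 0) :=
    integrable_finsetSum _ fun i _ => (h1 i).1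
  simp_rw [fun i => (h1 i).2]
  rw [Finset.sum_neg_distrib, ← integral_finsetSum _ fun i _ => (h1 i).1]
  simp only [e] at hi ⊢
  rw [h2.2, integral_mul_heatExt_laplacian hη y h2.1 hi, neg_neg]

/-- Boundedness in `L^p` of `G ↦ ∇ (thirdKer * G)` for bounded functions with bounded support. -/
theorem exists_conv_thirdKer_le_of_isBddSupp (hpq : p.HolderConjugate q) : ∃ C : ℝ, 0 ≤ C ∧
    ∀ f φ : E3 → ℝ, IsBddSupp f → IsTest φ → ∀ i l k j,
      ENNReal.ofReal |∫ x, conv (thirdKer i l k) f x * pderiv j φ x| ≤ ENNReal.ofReal C *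
        (eLpNorm f (ENNReal.ofReal p) volume * eLpNorm φ (ENNReal.ofReal q) volume) := by
  obtain ⟨C, hC, h⟩ := exists_conv_gradKer_le_of_isBddSupp hpq
  -- For p ≥ 3, membership of d in L^p does not ensure integrability against (1+|y|)⁻², which is
  -- needed to convolve it again. As f is also in L², d coincides almost everywhere with a
  -- derivative in L², for which this integrability is known.
  have h22 : (2 : ℝ).HolderConjugate 2 := Real.HolderConjugate.two_two
  obtain ⟨C2, hC2, h2⟩ := exists_conv_gradKer_le_of_isBddSupp h22
  refine ⟨C * C, by positivity, fun f φ hf hφ i l k j => ?_⟩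
  have hfW : IsWeightIntegrable f := .of_integrable hf.integrable
  have hk := isNewtonType_gradKer k
  have hi := isNewtonType_gradKer i
  have hb := isNewtonType_thirdKer i l k
  obtain ⟨d, hd, hdn, hdw⟩ := hk.exists_weakDeriv hpq (j := l) hC
    (fun f φ hf hφ => h f φ hf hφ k l) hfW (hf.memLp _)
  obtain ⟨d2, hd2, -, hdw2⟩ := hk.exists_weakDeriv h22 (j := l) hC2
    (fun f φ hf hφ => h2 f φ hf hφ k l) hfW (hf.memLp _)
  have hdl : LocallyIntegrable d := hd.locallyIntegrable (by simpa using hpq.lt.le)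
  have hd2W : IsWeightIntegrable d2 := .of_memLp (by norm_num) (by norm_num) hd2
  have hdd : d2 =ᵐ[volume] d := hdw2.ae_eq hdw hd2W.locallyIntegrable hdl
  have hdW : IsWeightIntegrable d := Integrable.congr hd2W (by
    filter_upwards [hdd] with x hx
    rw [hx])
  -- Both sides have the same distributional Laplacian and vanishing means at infinity, so
  -- Liouville's theorem identifies them. The gradient is then bounded by two Riesz bounds in
  -- succession, hence C·C.
  have heq : conv (thirdKer i l k) f =ᵐ[volume] conv (gradKer i) d := by
    have hz := ae_eq_zero_of_harmonic (w := fun x => conv (thirdKer i l k) f x + (-1) * conv (gradKer i) d x)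
      ((hb.locallyIntegrable_conv hfW).add ((hi.locallyIntegrable_conv hdW).smul (-1 : ℝ)))
      ((hb.hasVanishingMeans_conv hfW).add ((hi.hasVanishingMeans_conv hdW).const_mul (-1))
        (hb.locallyIntegrable_conv hfW).aestronglyMeasurable) fun ψ hψ => by
      simp only [add_mul, mul_assoc]
      rw [integral_add (integrable_mul_test (hb.locallyIntegrable_conv hfW) hψ.laplacian)
        ((integrable_mul_test (hi.locallyIntegrable_conv hdW) hψ.laplacian).const_mul _),
        integral_const_mul, (hb.integral_conv_mul hfW hψ.laplacian).2,
        (hi.integral_conv_mul hdW hψ.laplacian).2]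
      simp_rw [integral_thirdKer_laplacian hψ, integral_gradKer_laplacian hψ]
      rw [← (hk.integral_conv_mul hfW ((hψ.pderiv i).pderiv l)).2, hdw _ (hψ.pderiv i)]
      simp only [mul_neg, integral_neg]
      ring
    filter_upwards [hz] with x hx
    simp only [Pi.zero_apply] at hx
    linarith
  have e : ∫ x, conv (thirdKer i l k) f x * pderiv j φ x = ∫ x, conv (gradKer i) d x * pderiv j φ x :=
    integral_congr_ae (by filter_upwards [heq] with x hx; rw [hx])
  rw [e]
  refine (hi.ofReal_abs_integral_le (fun f φ hf hφ => h f φ hf hφ i j) hdW hφ).trans ?_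
  calc _ ≤ ENNReal.ofReal C * ((ENNReal.ofReal C * eLpNorm f (ENNReal.ofReal p) volume) *
        eLpNorm φ (ENNReal.ofReal q) volume) := by gcongr
    _ = _ := by rw [ENNReal.ofReal_mul hC]; ring

/-- Weak derivatives of convolutions with `gradKer` and `thirdKer` are bounded in `L^p`. -/
theorem exists_weakDeriv_conv (hpq : p.HolderConjugate q) : ∃ C : ℝ, 0 ≤ C ∧ ∀ G : E3 → ℝ, IsWeightIntegrable G →
    MemLp G (ENNReal.ofReal p) volume → ∀ j,
    (∀ k, ∃ d : E3 → ℝ, MemLp d (ENNReal.ofReal p) volume ∧ eLpNorm d (ENNReal.ofReal p) volume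
      ≤ ENNReal.ofReal C * eLpNorm G (ENNReal.ofReal p) volume ∧
      IsWeakDeriv j (conv (gradKer k) G) d) ∧
    (∀ i l k, ∃ d : E3 → ℝ, MemLp d (ENNReal.ofReal p) volume ∧ eLpNorm d (ENNReal.ofReal p) volume
      ≤ ENNReal.ofReal C * eLpNorm G (ENNReal.ofReal p) volume ∧
      IsWeakDeriv j (conv (thirdKer i l k) G) d) := by
  obtain ⟨C, hC, h⟩ := exists_conv_gradKer_le_of_isBddSupp hpq
  obtain ⟨D, hD, h'⟩ := exists_conv_thirdKer_le_of_isBddSupp hpq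
  have hCD : ENNReal.ofReal C ≤ ENNReal.ofReal (C + D) := ENNReal.ofReal_le_ofReal (by linarith)
  have hDC : ENNReal.ofReal D ≤ ENNReal.ofReal (C + D) := ENNReal.ofReal_le_ofReal (by linarith)
  refine ⟨C + D, by positivity, fun G hG hGp j => ⟨fun k => ?_, fun i l k => ?_⟩⟩
  · obtain ⟨d, h1, h2, h3⟩ := (isNewtonType_gradKer k).exists_weakDeriv hpq (j := j) hC
      (fun f φ hf hφ => h f φ hf hφ k j) hG hGp
    exact ⟨d, h1, h2.trans (mul_le_mul' hCD le_rfl), h3⟩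
  · obtain ⟨d, h1, h2, h3⟩ := (isNewtonType_thirdKer i l k).exists_weakDeriv hpq (j := j) hD
      (fun f φ hf hφ => h' f φ hf hφ i l k j) hG hGp
    exact ⟨d, h1, h2.trans (mul_le_mul' hDC le_rfl), h3⟩

/-! ### Representation of forces in W^{-1,q} supported in a ball. -/

/-- The vector test function `ψ eᵢ`. -/
def vecTest (i : Fin 3) : ScalarTest →L[ℝ] VectorTest :=
  TestFunction.postcompCLM (ContinuousLinearMap.toSpanSingleton ℝ (basisVec i))

lemma vecTest_apply (i : Fin 3) (ψ : ScalarTest) (x : E3) :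
    vecTest i ψ x = ψ x • basisVec i := by
  simp [vecTest]

lemma pairing_vecTest (f : VectorDistribution) (i : Fin 3) (ψ : ScalarTest) :
    pairing f (vecTest i ψ) = f ψ i := by
  have h : ∀ j, TestFunction.postcompCLM (𝕜 := ℝ) (EuclideanSpace.proj j : E3 →L[ℝ] ℝ) (vecTest i ψ)
      = if j = i then ψ else 0 := by
    intro j
    ext x
    rw [TestFunction.postcompCLM_apply]
    simp only [Function.comp_apply, vecTest_apply]
    by_cases hj : j = i <;> simp [hj]
  simp only [pairing, h]
  rw [Finset.sum_eq_single i]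
  · simp
  · intro j _ hj
    simp [hj]
  · simp

lemma norm_fderiv_le_sum {ψ : E3 → ℝ} (x : E3) : ‖fderiv ℝ ψ x‖ ≤ ∑ k, |pderiv k ψ x| := by
  refine ContinuousLinearMap.opNorm_le_bound _ (by positivity) fun v => ?_
  have hexp : fderiv ℝ ψ x v = ∑ k, v k * pderiv k ψ x := by
    conv_lhs => rw [← (EuclideanSpace.basisFun (Fin 3) ℝ).sum_repr v]
    simp [pderiv]
  rw [hexp, Finset.sum_mul]
  refine (norm_sum_le _ _).trans (Finset.sum_le_sum fun k _ => ?_)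
  rw [norm_mul, mul_comm]
  have : ‖v k‖ ≤ ‖v‖ := PiLp.norm_apply_le v k
  gcongr
  exact le_rfl

lemma sobolevNorm_vecTest_le {r : ℝ} (hr : 1 ≤ r) (i : Fin 3) (ψ : ScalarTest) :
    sobolevNorm r (vecTest i ψ) ≤ eLpNorm ψ (ENNReal.ofReal r) volume
      + ∑ k, eLpNorm (pderiv k ψ) (ENNReal.ofReal r) volume := by
  have hn : ‖basisVec i‖ = 1 := by simp
  refine add_le_add ?_ ?_
  · refine eLpNorm_mono fun x => ?_
    rw [vecTest_apply, norm_smul, hn, mul_one]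
  · have h1 : ∀ x, fderiv ℝ (vecTest i ψ) x
        = (ContinuousLinearMap.toSpanSingleton ℝ (basisVec i)).comp (fderiv ℝ ψ x) := fun x =>
      ((ContinuousLinearMap.toSpanSingleton ℝ (basisVec i)).hasFDerivAt.comp x
        (ψ.isTest.differentiable x).hasFDerivAt).fderiv
    calc eLpNorm (fderiv ℝ (vecTest i ψ)) (ENNReal.ofReal r) volume
        ≤ eLpNorm (∑ k, fun x => |pderiv k ψ x|) (ENNReal.ofReal r) volume := by
          refine eLpNorm_mono_real fun x => ?_
          rw [h1, Finset.sum_apply]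
          refine (ContinuousLinearMap.opNorm_comp_le _ _).trans ?_
          rw [ContinuousLinearMap.norm_toSpanSingleton, hn, one_mul]
          exact norm_fderiv_le_sum x
      _ ≤ ∑ k, eLpNorm (fun x => |pderiv k ψ x|) (ENNReal.ofReal r) volume :=
          eLpNorm_sum_le (fun k _ => (ψ.isTest.pderiv k).continuous.abs.aestronglyMeasurable)
            (by simpa using hr)
      _ = _ := by
          refine Finset.sum_congr rfl fun k _ => ?_
          exact eLpNorm_norm (pderiv k ψ)

/-- The supremum in the definition runs over the unit ball only. Scaling a scalar component to that
ball gives the homogeneous bound. -/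
lemma abs_apply_le_negSobolevNorm {q : ℝ} (hq : 1 < q) {D : Set E3} {f : VectorDistribution}
    (hf : negSobolevNorm q D f < ⊤) {ψ : ScalarTest} (hψ : tsupport ψ ⊆ D) (i : Fin 3) :
    |f ψ i| ≤ (negSobolevNorm q D f).toReal *
      ((eLpNorm ψ (ENNReal.ofReal (q / (q - 1))) volume).toReal
        + ∑ k, (eLpNorm (pderiv k ψ) (ENNReal.ofReal (q / (q - 1))) volume).toReal) := by
  set r := q / (q - 1)
  have hr : 1 ≤ r := by rw [le_div_iff₀ (by linarith)]; linarith
  set N := negSobolevNorm q D f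
  set S := (eLpNorm ψ (ENNReal.ofReal r) volume).toReal
        + ∑ k, (eLpNorm (pderiv k ψ) (ENNReal.ofReal r) volume).toReal
  have hS0 : 0 ≤ S := by positivity
  -- The scale t is left free because S might be zero. It is taken below as 1/(S + δ) with δ small.
  have key : ∀ t : ℝ, 0 < t → t * S ≤ 1 → t * |f ψ i| ≤ N.toReal := by
    intro t ht htS
    set ψt : ScalarTest := (ψ.isTest.const_mul t).bundle
    have hc : ⇑ψt = fun x => t * ψ x := rfl
    have h1 : sobolevNorm r (vecTest i ψt) ≤ 1 := by
      refine (sobolevNorm_vecTest_le hr i ψt).trans ?_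
      have e1 : eLpNorm ψt (ENNReal.ofReal r) volume
          = ENNReal.ofReal (t * (eLpNorm ψ (ENNReal.ofReal r) volume).toReal) := by
        rw [ENNReal.ofReal_mul ht.le, ENNReal.ofReal_toReal (ψ.isTest.memLp _).2.ne,
          ← Real.enorm_of_nonneg ht.le]
        exact eLpNorm_const_smul t ψ _ _
      have e2 : ∀ k, eLpNorm (pderiv k ψt) (ENNReal.ofReal r) volume
          = ENNReal.ofReal (t * (eLpNorm (pderiv k ψ) (ENNReal.ofReal r) volume).toReal) := by
        intro k
        rw [ENNReal.ofReal_mul ht.le, ENNReal.ofReal_toReal ((ψ.isTest.pderiv k).memLp _).2.ne,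
          ← Real.enorm_of_nonneg ht.le, ← eLpNorm_const_smul t]
        congr 1
        funext x
        exact pderiv_const_mul ψ.isTest.differentiable k t x
      rw [e1]
      simp_rw [e2]
      rw [← ENNReal.ofReal_sum_of_nonneg fun k _ => by positivity,
        ← ENNReal.ofReal_add (by positivity) (by positivity), ← Finset.mul_sum, ← mul_add]
      simpa using ENNReal.ofReal_le_ofReal htS
    have h2 : tsupport (vecTest i ψt) ⊆ D := by
      refine Subset.trans (closure_mono fun x hx => ?_) hψ
      intro h0
      refine hx ?_
      rw [vecTest_apply, hc]
      simp only [h0, mul_zero, zero_smul]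
    have h3 : ENNReal.ofReal |pairing f (vecTest i ψt)| ≤ N :=
      le_iSup_of_le (vecTest i ψt) (le_iSup_of_le h2 (le_iSup_of_le h1 le_rfl))
    have h4 : f ψt i = t * f ψ i := by
      have : ψt = t • ψ := rfl
      rw [this, map_smul]
      rfl
    rw [pairing_vecTest, h4, abs_mul, abs_of_pos ht] at h3
    have := ENNReal.toReal_mono hf.ne h3
    rwa [ENNReal.toReal_ofReal (by positivity)] at this
  refine le_of_forall_pos_le_add fun ε hε => ?_
  have hN0 : 0 ≤ N.toReal := ENNReal.toReal_nonneg
  set δ := ε / (N.toReal + 1)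
  have hδ : 0 < δ := by positivity
  have h1 := key (S + δ)⁻¹ (by positivity) (by
    rw [inv_mul_le_iff₀ (by positivity)]; linarith)
  rw [inv_mul_le_iff₀ (by positivity)] at h1
  have h2 : δ * N.toReal ≤ ε := by
    rw [div_mul_eq_mul_div, div_le_iff₀ (by positivity)]; nlinarith
  nlinarith

/-- Multiplication of test functions by a fixed test function. -/
def mulTest {χ : E3 → ℝ} (hχ : IsTest χ) : ScalarTest →ₗ[ℝ] ScalarTest where
  toFun φ := (φ.isTest.mul_left hχ.smooth).bundle
  map_add' φ ψ := by
    ext x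
    exact mul_add _ _ _
  map_smul' c φ := by
    ext x
    exact mul_left_comm _ _ _

/-- Partial derivatives of test functions. -/
def pderivTest (k : Fin 3) : ScalarTest →ₗ[ℝ] ScalarTest where
  toFun φ := (φ.isTest.pderiv k).bundle
  map_add' φ ψ := by
    ext x
    exact pderiv_add φ.isTest.differentiable ψ.isTest.differentiable k x
  map_smul' c φ := by
    ext x
    exact pderiv_const_mul φ.isTest.differentiable k c x

lemma pderiv_mul_test {χ φ : E3 → ℝ} (hχ : IsTest χ) (hφ : IsTest φ) (k : Fin 3) (x : E3) :
    pderiv k (fun x => χ x * φ x) x = pderiv k χ x * φ x + χ x * pderiv k φ x := by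
  simp only [pderiv]
  rw [fderiv_fun_mul (hχ.differentiable x) (hφ.differentiable x)]
  simp
  ring

/-- As f lives in the closed ball of radius ρ, it does not distinguish φ from χφ, which is supported
inside the ball of radius 2ρ. There f is bounded by the four norms of χφ and its derivatives, so
duality gives four functions in L^q. The product rule moves χ and its derivatives onto them, which
also confines their supports. -/
lemma exists_force_representation {q ρ : ℝ} (hq : 1 < q) (hρ : 0 < ρ) : ∃ C : ℝ, 0 ≤ C ∧
    ∀ f : VectorDistribution, negSobolevNorm q (Metric.ball 0 (2 * ρ)) f < ⊤ →
    IsVanishingOn f (Metric.closedBall (0 : E3) ρ)ᶜ → ∀ i, ∃ (a : E3 → ℝ) (b : Fin 3 → E3 → ℝ),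
      (MemLp a (ENNReal.ofReal q) volume ∧ eLpNorm a (ENNReal.ofReal q) volume
        ≤ ENNReal.ofReal C * negSobolevNorm q (Metric.ball 0 (2 * ρ)) f ∧
        ∀ x, 3 * ρ / 2 ≤ ‖x‖ → a x = 0) ∧
      (∀ k, MemLp (b k) (ENNReal.ofReal q) volume ∧ eLpNorm (b k) (ENNReal.ofReal q) volume
        ≤ ENNReal.ofReal C * negSobolevNorm q (Metric.ball 0 (2 * ρ)) f ∧
        ∀ x, 3 * ρ / 2 ≤ ‖x‖ → b k x = 0) ∧
      ∀ φ : ScalarTest, f φ i = (∫ x, a x * φ x) + ∑ k, ∫ x, b k x * pderiv k φ x := by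
  have hpq : (q / (q - 1)).HolderConjugate q := (Real.HolderConjugate.conjExponent hq).symm
  set r := q / (q - 1)
  haveI : Fact (1 ≤ ENNReal.ofReal r) := ⟨by simpa using hpq.lt.le⟩
  -- The cutoff is 1 beyond radius ρ, up to 5ρ/4, so that φ - χφ vanishes near the support of f; it
  -- ends at 3ρ/2 < 2ρ.
  let bump : ContDiffBump (0 : E3) := ⟨5 * ρ / 4, 3 * ρ / 2, by positivity, by linarith⟩
  have hχ : IsTest bump := ⟨bump.contDiff, bump.hasCompactSupport⟩
  set χ : E3 → ℝ := ⇑bump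
  have hχ0 : ∀ x, 3 * ρ / 2 ≤ ‖x‖ → χ x = 0 := fun x hx =>
    bump.zero_of_le_dist (by simpa using hx)
  have hχ1 : ∀ x, ‖x‖ ≤ 5 * ρ / 4 → χ x = 1 := fun x hx =>
    bump.one_of_mem_closedBall (by simpa using hx)
  have hχs : tsupport χ ⊆ Metric.closedBall 0 (3 * ρ / 2) := bump.tsupport_eq.le
  -- On the sphere of radius 3ρ/2 too the gradient vanishes, since χ attains its minimum 0 there.
  have hdχ0 : ∀ k x, 3 * ρ / 2 ≤ ‖x‖ → pderiv k χ x = 0 := by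
    intro k x hx
    have hmin : IsLocalMin χ x := by
      rw [IsLocalMin, IsMinFilter, hχ0 x hx]
      exact Eventually.of_forall fun y => bump.nonneg
    simp [pderiv, hmin.fderiv_eq_zero]
  choose M hM0 hM using fun k => (hχ.pderiv k).exists_bound
  have hχle : ∀ x, |χ x| ≤ 1 := fun x => by
    rw [abs_of_nonneg bump.nonneg]; exact bump.le_one
  refine ⟨4 * (1 + ∑ k, M k),
    mul_nonneg (by norm_num) (add_nonneg zero_le_one (Finset.sum_nonneg fun k _ => hM0 k)), fun f hf hfs i => ?_⟩
  set N := negSobolevNorm q (Metric.ball 0 (2 * ρ)) f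
  let D : Fin 4 → ScalarTest →ₗ[ℝ] Lp ℝ (ENNReal.ofReal r) (volume : Measure E3) :=
    Fin.cons ((testToLp _).comp (mulTest hχ))
      fun k => (testToLp _).comp ((pderivTest k).comp (mulTest hχ))
  let ℓ : ScalarTest →ₗ[ℝ] ℝ :=
    (EuclideanSpace.proj i : E3 →L[ℝ] ℝ).toLinearMap ∘ₗ (f : ScalarTest →ₗ[ℝ] E3) ∘ₗ (mulTest hχ)
  have hℓ : ∀ φ, ℓ φ = f (mulTest hχ φ) i := fun φ => rfl
  have htsupp : ∀ φ : ScalarTest, tsupport (mulTest hχ φ) ⊆ Metric.ball 0 (2 * ρ) := by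
    intro φ
    refine (closure_mono (Function.support_mul_subset_left χ φ)).trans (hχs.trans ?_)
    exact Metric.closedBall_subset_ball (by linarith)
  obtain ⟨h, hh, hrep⟩ := exists_memLp_of_abs_le_sum hpq D ℓ (ENNReal.toReal_nonneg (a := N))
    fun φ => by
      refine (abs_apply_le_negSobolevNorm hq hf (htsupp φ) i).trans (le_of_eq ?_)
      have e0 : ‖D 0 φ‖ = (eLpNorm (mulTest hχ φ) (ENNReal.ofReal r) volume).toReal :=
        norm_testToLp _ _
      have e1 : ∀ k : Fin 3, ‖D k.succ φ‖
          = (eLpNorm (pderiv k (mulTest hχ φ)) (ENNReal.ofReal r) volume).toReal := fun k =>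
        norm_testToLp _ _
      rw [Fin.sum_univ_succ (f := fun m => ‖D m φ‖), e0]
      simp_rw [e1]
      rfl
  have hNr : ENNReal.ofReal (N.toReal * ((4 : ℕ) : ℝ)) = 4 * N := by
    rw [ENNReal.ofReal_mul ENNReal.toReal_nonneg, ENNReal.ofReal_toReal hf.ne, mul_comm]
    simp
  simp only [hNr] at hh
  have hmulχ : ∀ m, MemLp (fun x => χ x * h m x) (ENNReal.ofReal q) volume ∧
      eLpNorm (fun x => χ x * h m x) (ENNReal.ofReal q) volume ≤ 4 * N := by
    intro m
    have hle : ∀ x, ‖χ x * h m x‖ ≤ ‖h m x‖ := fun x => by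
      rw [norm_mul]; exact mul_le_of_le_one_left (norm_nonneg _) (hχle x)
    exact ⟨(hh m).1.of_le (hχ.continuous.aestronglyMeasurable.mul (hh m).1.1)
      (Eventually.of_forall hle), (eLpNorm_mono hle).trans (hh m).2⟩
  have hmuld : ∀ k m, MemLp (fun x => pderiv k χ x * h m x) (ENNReal.ofReal q) volume ∧
      eLpNorm (fun x => pderiv k χ x * h m x) (ENNReal.ofReal q) volume
        ≤ ENNReal.ofReal (M k) * (4 * N) := by
    intro k m
    have hle : ∀ x, ‖pderiv k χ x * h m x‖ ≤ M k * ‖h m x‖ := fun x => by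
      rw [norm_mul]; exact mul_le_mul_of_nonneg_right (hM k x) (norm_nonneg _)
    refine ⟨(hh m).1.of_le_mul ((hχ.pderiv k).continuous.aestronglyMeasurable.mul (hh m).1.1)
      (Eventually.of_forall hle), ?_⟩
    refine (eLpNorm_le_mul_eLpNorm_of_ae_le_mul (Eventually.of_forall hle) _).trans ?_
    gcongr
    exact (hh m).2
  have hC : ENNReal.ofReal (4 * (1 + ∑ k, M k)) * N = 4 * N + ∑ k, ENNReal.ofReal (M k) * (4 * N) := by
    rw [ENNReal.ofReal_mul (by norm_num), ENNReal.ofReal_add (by norm_num)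
      (Finset.sum_nonneg fun k _ => hM0 k), ENNReal.ofReal_sum_of_nonneg fun k _ => hM0 k,
      ← Finset.sum_mul]
    simp only [ENNReal.ofReal_one, ENNReal.ofReal_ofNat]
    ring
  have hq1 : (1 : ℝ≥0∞) ≤ ENNReal.ofReal q := by simpa using hq.le
  refine ⟨fun x => χ x * h 0 x + ∑ k, pderiv k χ x * h (Fin.succ k) x,
    fun k x => χ x * h (Fin.succ k) x, ⟨?_, ?_, ?_⟩, fun k => ⟨(hmulχ _).1, ?_, ?_⟩, fun φ => ?_⟩
  · exact (hmulχ 0).1.add (memLp_finsetSum _ fun k _ => (hmuld k k.succ).1)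
  · rw [hC]
    refine (eLpNorm_add_le (hmulχ 0).1.1
      (memLp_finsetSum _ fun k _ => (hmuld k k.succ).1).1 hq1).trans ?_
    refine add_le_add (hmulχ 0).2 ?_
    have := eLpNorm_sum_le (s := Finset.univ) (f := fun k x => pderiv k χ x * h (Fin.succ k) x)
      (μ := volume) (fun k _ => (hmuld k k.succ).1.1) hq1
    have e : (fun x => ∑ k, pderiv k χ x * h (Fin.succ k) x)
        = ∑ k, fun x => pderiv k χ x * h (Fin.succ k) x := by
      funext x; simp
    rw [e]
    exact this.trans (Finset.sum_le_sum fun k _ => (hmuld k k.succ).2)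
  · intro x hx
    simp [hχ0 x hx, hdχ0 _ x hx]
  · rw [hC]; exact (hmulχ _).2.trans le_self_add
  · intro x hx
    simp [hχ0 x hx]
  · have hfφ : f φ i = ℓ φ := by
      rw [hℓ]
      have hz : f (φ - mulTest hχ φ) = 0 := by
        refine hfs _ ?_
        have hsub : tsupport (φ - mulTest hχ φ : ScalarTest) ⊆ {x : E3 | 5 * ρ / 4 ≤ ‖x‖} := by
          refine closure_minimal (fun x hx => ?_) (isClosed_le continuous_const continuous_norm)
          by_contra hlt
          refine hx ?_
          change φ x - χ x * φ x = 0
          rw [hχ1 x (not_le.1 hlt).le, one_mul, sub_self]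
        intro x hx
        have : 5 * ρ / 4 ≤ ‖x‖ := hsub hx
        simp only [mem_compl_iff, mem_closedBall_zero_iff, not_le]
        linarith
      rw [map_sub, sub_eq_zero] at hz
      rw [hz]
    rw [hfφ, hrep, Fin.sum_univ_succ]
    have hl : ∀ m, LocallyIntegrable (h m) := fun m => (hh m).1.locallyIntegrable hq1
    have e0 : ∫ x, h 0 x * D 0 φ x = ∫ x, χ x * h 0 x * φ x := by
      refine integral_congr_ae ?_
      filter_upwards [coeFn_testToLp (ENNReal.ofReal r) (mulTest hχ φ)] with x hx
      have : D 0 φ x = χ x * φ x := hx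
      rw [this]; ring
    have e1 : ∀ k : Fin 3, ∫ x, h k.succ x * D k.succ φ x
        = (∫ x, pderiv k χ x * h k.succ x * φ x) + ∫ x, χ x * h k.succ x * pderiv k φ x := by
      intro k
      have i1 : Integrable fun x => pderiv k χ x * h k.succ x * φ x := by
        refine (integrable_mul_test (hl k.succ) (φ.isTest.mul_left (hχ.pderiv k).smooth)).congr
          (Eventually.of_forall fun x => ?_)
        simp only; ring
      have i2 : Integrable fun x => χ x * h k.succ x * pderiv k φ x := by
        refine (integrable_mul_test (hl k.succ) ((φ.isTest.pderiv k).mul_left hχ.smooth)).congr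
          (Eventually.of_forall fun x => ?_)
        simp only; ring
      rw [← integral_add i1 i2]
      refine integral_congr_ae ?_
      filter_upwards [coeFn_testToLp (ENNReal.ofReal r) (pderivTest k (mulTest hχ φ))] with x hx
      have : D k.succ φ x = pderiv k (fun x => χ x * φ x) x := hx
      rw [this, pderiv_mul_test hχ φ.isTest]; ring
    rw [e0]
    simp_rw [e1]
    rw [Finset.sum_add_distrib, ← add_assoc]
    congr 1
    have i0 : Integrable fun x => χ x * h 0 x * φ x := by
      refine (integrable_mul_test (hl 0) (φ.isTest.mul_left hχ.smooth)).congr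
        (Eventually.of_forall fun x => ?_)
      simp only; ring
    have ik : ∀ k ∈ (Finset.univ : Finset (Fin 3)),
        Integrable fun x => pderiv k χ x * h k.succ x * φ x := fun k _ => by
      refine (integrable_mul_test (hl k.succ) (φ.isTest.mul_left (hχ.pderiv k).smooth)).congr
        (Eventually.of_forall fun x => ?_)
      simp only; ring
    rw [← integral_finsetSum _ ik, ← integral_add i0 (integrable_finsetSum _ ik)]
    refine integral_congr_ae (Eventually.of_forall fun x => ?_)
    simp only [add_mul, Finset.sum_mul]

/-! ### Norm bounds and pointwise decay of potentials. -/

/-- The condition 2q > 3 makes |x|⁻² integrable to the power q at infinity. This is where the lower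
bound on q enters. -/
lemma memLp_tail {q R : ℝ} (hq : 3 / 2 < q) (hR : 0 < R) :
    MemLp ((Metric.ball (0 : E3) R)ᶜ.indicator fun x => (‖x‖ ^ 2)⁻¹) (ENNReal.ofReal q) volume := by
  have hm : Measurable ((Metric.ball (0 : E3) R)ᶜ.indicator fun x => (‖x‖ ^ 2)⁻¹) :=
    (measurable_norm.pow_const 2).inv.indicator Metric.isOpen_ball.measurableSet.compl
  refine (IsWeightIntegrable.memLp_weight hq).of_le_mul (c := ((1 + R) / R) ^ 2)
    hm.aestronglyMeasurable (Eventually.of_forall fun x => ?_)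
  by_cases hx : R ≤ ‖x‖
  · have hx0 : 0 < ‖x‖ := hR.trans_le hx
    rw [indicator_of_mem (by simpa using hx), Real.norm_of_nonneg (by positivity),
      Real.norm_of_nonneg (by positivity), ← inv_pow, ← inv_pow, ← mul_pow]
    refine pow_le_pow_left₀ (by positivity) ?_ 2
    rw [← div_eq_mul_inv, div_div, inv_eq_one_div, div_le_div_iff₀ hx0 (by positivity)]
    nlinarith
  · rw [indicator_of_notMem (by simpa using hx), norm_zero]
    positivity

variable {K : E3 → ℝ} {q : ℝ}

lemma eLpNorm_one_le_of_ball (hq : 1 ≤ q) (R : ℝ) {a : E3 → ℝ}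
    (ha : AEStronglyMeasurable a volume) :
    ∫⁻ y in Metric.ball (0 : E3) R, ‖a y‖ₑ ≤ eLpNorm a (ENNReal.ofReal q) volume *
      volume (Metric.ball (0 : E3) R) ^ (1 - 1 / q) := by
  have h := eLpNorm_le_eLpNorm_mul_rpow_measure_univ (μ := volume.restrict (Metric.ball (0 : E3) R))
    (p := 1) (q := ENNReal.ofReal q) (by simpa using hq) ha.restrict
  rw [eLpNorm_one_eq_lintegral_enorm, Measure.restrict_apply_univ, ENNReal.toReal_ofReal (by linarith),
    ENNReal.toReal_one, div_one] at h
  exact h.trans (mul_le_mul' (eLpNorm_mono_measure _ Measure.restrict_le_self) le_rfl)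

/-- The far field of the potential of a density in a ball. -/
lemma IsNewtonType.exists_lintegral_far_le (hK : IsNewtonType K) (hq : 1 ≤ q) {R R' : ℝ}
    (hR : 0 < R) (hRR' : R < R') : ∃ C : ℝ, 0 ≤ C ∧ ∀ a : E3 → ℝ, AEStronglyMeasurable a volume →
      ∀ x, R' ≤ ‖x‖ → ∫⁻ y in Metric.ball (0 : E3) R, ‖K (x - y) * a y‖ₑ
        ≤ ENNReal.ofReal (C / ‖x‖ ^ 2) * eLpNorm a (ENNReal.ofReal q) volume := by
  obtain ⟨c, hc, hb⟩ := hK.bound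
  set v := volume (Metric.ball (0 : E3) R) ^ (1 - 1 / q)
  have hv : v ≠ ⊤ := ENNReal.rpow_ne_top_of_nonneg
    (by rw [sub_nonneg, div_le_one (by linarith)]; exact hq) measure_ball_lt_top.ne
  -- For |y| < R and |x| ≥ R' one has |x - y| ≥ |x| - R ≥ θ|x|. The gap between R and R' keeps θ
  -- positive.
  set θ := 1 - R / R'
  have hR' : 0 < R' := hR.trans hRR'
  have hθ : 0 < θ := by
    have : R / R' < 1 := (div_lt_one hR').2 hRR'
    simp only [θ]; linarith
  refine ⟨c / θ ^ 2 * v.toReal, by positivity, fun a ha x hx => ?_⟩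
  have hx0 : 0 < ‖x‖ := hR'.trans_le hx
  calc _ ≤ ∫⁻ y in Metric.ball (0 : E3) R, ENNReal.ofReal (c / (θ * ‖x‖) ^ 2) * ‖a y‖ₑ := by
        refine setLIntegral_mono' Metric.isOpen_ball.measurableSet fun y hy => ?_
        have hy' : ‖y‖ < R := by simpa using hy
        have h1 : θ * ‖x‖ ≤ ‖x - y‖ := by
          have h2 := norm_sub_norm_le x y
          have h3 : R ≤ R / R' * ‖x‖ := by
            rw [div_mul_eq_mul_div, le_div_iff₀ hR']; nlinarith
          have h4 : θ * ‖x‖ = ‖x‖ - R / R' * ‖x‖ := by simp only [θ]; ring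
          linarith
        have hne : x - y ≠ 0 := norm_pos_iff.1 (lt_of_lt_of_le (by positivity) h1)
        rw [enorm_mul]
        refine mul_le_mul' ?_ le_rfl
        rw [Real.enorm_eq_ofReal_abs]
        refine ENNReal.ofReal_le_ofReal ((hb _ hne).trans ?_)
        gcongr
    _ = ENNReal.ofReal (c / (θ * ‖x‖) ^ 2) * ∫⁻ y in Metric.ball (0 : E3) R, ‖a y‖ₑ :=
        lintegral_const_mul' _ _ ENNReal.ofReal_ne_top
    _ ≤ ENNReal.ofReal (c / (θ * ‖x‖) ^ 2) * (eLpNorm a (ENNReal.ofReal q) volume * v) := by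
        gcongr; exact eLpNorm_one_le_of_ball hq R ha
    _ = _ := by
        have : c / θ ^ 2 * v.toReal / ‖x‖ ^ 2 = c / (θ * ‖x‖) ^ 2 * v.toReal := by
          rw [mul_pow]; field_simp
        rw [this, ENNReal.ofReal_mul (by positivity), ENNReal.ofReal_toReal hv]
        ring

/-- Schur's test for nonnegative kernels. -/
lemma lintegral_schur_le {μ ν : Measure E3} [SFinite μ] [SFinite ν] {p : ℝ}
    (hpq : p.HolderConjugate q) {k : E3 → E3 → ℝ≥0∞} (hkm : Measurable (Function.uncurry k))
    {A B : ℝ≥0∞} (hA : ∀ x, ∫⁻ y, k x y ∂ν ≤ A) (hB : ∀ y, ∫⁻ x, k x y ∂μ ≤ B) (hAt : A ≠ ⊤)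
    (hBt : B ≠ ⊤) {h : E3 → ℝ≥0∞} (hh : AEMeasurable h ν) :
    ∫⁻ x, (∫⁻ y, k x y * h y ∂ν) ^ q ∂μ ≤ (A ^ (1 / p)) ^ q * (B * ∫⁻ y, h y ^ q ∂ν) := by
  have hq0 := hpq.symm.pos
  have hp0 := hpq.pos
  have hpt : ∀ x, (∫⁻ y, k x y * h y ∂ν) ^ q
      ≤ (A ^ (1 / p)) ^ q * ∫⁻ y, k x y * h y ^ q ∂ν := by
    intro x
    have hkx : Measurable (k x) := hkm.comp measurable_prodMk_left
    -- Hölder's inequality after the splitting k = k^(1/p) k^(1/q): the first factor is controlled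
    -- by A and the second keeps h^q under the kernel.
    have h1 : ∀ y, k x y * h y = k x y ^ (1 / p) * (k x y ^ (1 / q) * h y) := fun y => by
      rw [← mul_assoc, ← ENNReal.rpow_add_of_nonneg _ _ (by positivity) (by positivity), one_div,
        one_div, hpq.inv_add_inv_eq_one, ENNReal.rpow_one]
    have h2 := ENNReal.lintegral_mul_le_Lp_mul_Lq ν hpq
      (f := fun y => k x y ^ (1 / p)) (g := fun y => k x y ^ (1 / q) * h y)
      (hkx.pow_const _).aemeasurable ((hkx.pow_const _).aemeasurable.mul hh)
    simp only [Pi.mul_apply] at h2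
    have e1 : ∀ y, (k x y ^ (1 / p)) ^ p = k x y := fun y => by
      rw [← ENNReal.rpow_mul, one_div, inv_mul_cancel₀ hp0.ne', ENNReal.rpow_one]
    have e2 : ∀ y, (k x y ^ (1 / q) * h y) ^ q = k x y * h y ^ q := fun y => by
      rw [ENNReal.mul_rpow_of_nonneg _ _ hq0.le, ← ENNReal.rpow_mul, one_div,
        inv_mul_cancel₀ hq0.ne', ENNReal.rpow_one]
    simp only [e1, e2] at h2
    calc _ ≤ (A ^ (1 / p) * (∫⁻ y, k x y * h y ^ q ∂ν) ^ (1 / q)) ^ q := by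
          refine ENNReal.rpow_le_rpow ((lintegral_congr h1).le.trans (h2.trans ?_)) hq0.le
          exact mul_le_mul' (ENNReal.rpow_le_rpow (hA x) (by positivity)) le_rfl
      _ = _ := by
          rw [ENNReal.mul_rpow_of_nonneg _ _ hq0.le,
            ← ENNReal.rpow_mul (∫⁻ y, k x y * h y ^ q ∂ν), one_div,
            one_div, inv_mul_cancel₀ hq0.ne', ENNReal.rpow_one]
  have hmeas : AEMeasurable (Function.uncurry fun x y => k x y * h y ^ q) (μ.prod ν) :=
    hkm.aemeasurable.mul ((hh.comp_snd).pow_const q)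
  have hD : (A ^ (1 / p)) ^ q ≠ ⊤ := ENNReal.rpow_ne_top_of_nonneg hq0.le
    (ENNReal.rpow_ne_top_of_nonneg (by positivity) hAt)
  calc _ ≤ ∫⁻ x, (A ^ (1 / p)) ^ q * ∫⁻ y, k x y * h y ^ q ∂ν ∂μ := lintegral_mono hpt
    _ = (A ^ (1 / p)) ^ q * ∫⁻ y, ∫⁻ x, k x y * h y ^ q ∂μ ∂ν := by
        rw [lintegral_const_mul' _ _ hD, lintegral_lintegral_swap hmeas]
    _ ≤ (A ^ (1 / p)) ^ q * ∫⁻ y, B * h y ^ q ∂ν := by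
        refine mul_le_mul' le_rfl (lintegral_mono fun y => ?_)
        have hky : Measurable fun x => k x y := hkm.comp (measurable_id.prodMk measurable_const)
        rw [lintegral_mul_const _ hky]
        exact mul_le_mul' (hB y) le_rfl
    _ = _ := by rw [lintegral_const_mul' _ _ hBt]

/-- Young's inequality for the potential of a density in a ball, restricted to a ball. -/
lemma IsNewtonType.exists_lintegral_near_le (hK : IsNewtonType K) (hq : 1 < q) {R R' : ℝ}
    (hR : 0 < R) (hR' : 0 < R') : ∃ C : ℝ≥0∞, C ≠ ⊤ ∧ ∀ a : E3 → ℝ, AEStronglyMeasurable a volume →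
      ∫⁻ x in Metric.ball (0 : E3) R', (∫⁻ y in Metric.ball (0 : E3) R, ‖K (x - y) * a y‖ₑ) ^ q
        ≤ C * ∫⁻ y, ‖a y‖ₑ ^ q := by
  obtain ⟨c, hc, hb⟩ := hK.bound
  obtain ⟨d, hd, hint⟩ := exists_lintegral_ball_inv_sq_sub
  obtain ⟨p, hpq⟩ : ∃ p : ℝ, p.HolderConjugate q :=
    ⟨_, (Real.HolderConjugate.conjExponent hq).symm⟩
  have hq0 := hpq.symm.pos
  have hkm : Measurable (Function.uncurry fun x y : E3 => ENNReal.ofReal (‖x - y‖ ^ 2)⁻¹) := by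
    unfold Function.uncurry; fun_prop
  have hkint : ∀ R, 0 < R → ∀ y, ∫⁻ x in Metric.ball (0 : E3) R, ENNReal.ofReal (‖x - y‖ ^ 2)⁻¹
      ≤ ENNReal.ofReal (d * R) := by
    intro R hR y
    refine (hint R hR y).trans (ENNReal.ofReal_le_ofReal ?_)
    gcongr
    rw [div_le_iff₀ (by positivity)]
    have := norm_nonneg y
    nlinarith [mul_nonneg hR.le (by positivity : 0 ≤ 2 * R * ‖y‖ + ‖y‖ ^ 2)]
  have hkint' : ∀ x, ∫⁻ y in Metric.ball (0 : E3) R, ENNReal.ofReal (‖x - y‖ ^ 2)⁻¹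
      ≤ ENNReal.ofReal (d * R) := by
    intro x
    refine le_trans (le_of_eq (lintegral_congr fun y => ?_)) (hkint R hR x)
    rw [norm_sub_rev]
  have hcq : ENNReal.ofReal c ^ q ≠ ⊤ :=
    ENNReal.rpow_ne_top_of_nonneg hq0.le ENNReal.ofReal_ne_top
  have hAq : (ENNReal.ofReal (d * R) ^ (1 / p)) ^ q ≠ ⊤ := ENNReal.rpow_ne_top_of_nonneg hq0.le
    (ENNReal.rpow_ne_top_of_nonneg (by have := hpq.pos; positivity) ENNReal.ofReal_ne_top)
  refine ⟨ENNReal.ofReal c ^ q * ((ENNReal.ofReal (d * R) ^ (1 / p)) ^ q *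
    ENNReal.ofReal (d * R')), ENNReal.mul_ne_top hcq (ENNReal.mul_ne_top hAq ENNReal.ofReal_ne_top),
    fun a ha => ?_⟩
  have h1 : ∀ x, (∫⁻ y in Metric.ball (0 : E3) R, ‖K (x - y) * a y‖ₑ) ^ q ≤ ENNReal.ofReal c ^ q *
      (∫⁻ y in Metric.ball (0 : E3) R, ENNReal.ofReal (‖x - y‖ ^ 2)⁻¹ * ‖a y‖ₑ) ^ q := by
    intro x
    have hne : ∀ᵐ y ∂(volume.restrict (Metric.ball (0 : E3) R)), y ≠ x :=
      ae_restrict_of_ae (by simp [ae_iff, measure_singleton])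
    rw [← ENNReal.mul_rpow_of_nonneg _ _ hq0.le, ← lintegral_const_mul' _ _ ENNReal.ofReal_ne_top]
    refine ENNReal.rpow_le_rpow (lintegral_mono_ae ?_) hq0.le
    filter_upwards [hne] with y hy
    rw [enorm_mul, ← mul_assoc]
    refine mul_le_mul' ?_ le_rfl
    rw [← ENNReal.ofReal_mul hc.le, Real.enorm_eq_ofReal_abs, ← div_eq_mul_inv]
    exact ENNReal.ofReal_le_ofReal (hb _ (sub_ne_zero.2 hy.symm))
  refine (lintegral_mono h1).trans ?_
  rw [lintegral_const_mul' _ _ hcq, mul_assoc, mul_assoc]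
  refine mul_le_mul' le_rfl ((lintegral_schur_le hpq hkm hkint' (hkint R' hR')
    ENNReal.ofReal_ne_top ENNReal.ofReal_ne_top ha.restrict.enorm).trans ?_)
  exact mul_le_mul' le_rfl (mul_le_mul' le_rfl
    (lintegral_mono' Measure.restrict_le_self le_rfl))

/-- Potentials of densities supported in a ball: `L^q` bound and decay. -/
lemma IsNewtonType.exists_conv_le_of_support (hK : IsNewtonType K) (hq : 3 / 2 < q) {R R' : ℝ}
    (hR : 0 < R) (hRR' : R < R') : ∃ C : ℝ, 0 ≤ C ∧ ∀ a : E3 → ℝ,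
      MemLp a (ENNReal.ofReal q) volume → (∀ x, R ≤ ‖x‖ → a x = 0) →
      (MemLp (conv K a) (ENNReal.ofReal q) volume ∧ eLpNorm (conv K a) (ENNReal.ofReal q) volume
        ≤ ENNReal.ofReal C * eLpNorm a (ENNReal.ofReal q) volume) ∧
      ∀ x, R' ≤ ‖x‖ → ‖x‖ ^ 2 * |conv K a x| ≤ C * (eLpNorm a (ENNReal.ofReal q) volume).toReal := by
  have hR' := hR.trans hRR'
  have hq1 : 1 < q := by linarith
  have hq0 : 0 < q := by linarith
  obtain ⟨C1, hC1, hfar⟩ := hK.exists_lintegral_far_le hq1.le hR hRR'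
  obtain ⟨C2, hC2, hnear⟩ := hK.exists_lintegral_near_le hq1 hR hR'
  -- The potential is estimated in L^q by Young's inequality inside the ball of radius R' and by the
  -- tail |x|⁻² outside it.
  set T := (Metric.ball (0 : E3) R')ᶜ.indicator fun x => (‖x‖ ^ 2)⁻¹
  have hT := memLp_tail hq hR'
  set τ := (eLpNorm T (ENNReal.ofReal q) volume).toReal
  have hτ : ENNReal.ofReal τ = eLpNorm T (ENNReal.ofReal q) volume := ENNReal.ofReal_toReal hT.2.ne
  have hC2' : C2 ^ (1 / q) ≠ ⊤ := ENNReal.rpow_ne_top_of_nonneg (by positivity) hC2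
  set κ := (C2 ^ (1 / q)).toReal
  have hκ : ENNReal.ofReal κ = C2 ^ (1 / q) := ENNReal.ofReal_toReal hC2'
  have hκ0 : 0 ≤ κ := ENNReal.toReal_nonneg
  have hτ0 : 0 ≤ τ := ENNReal.toReal_nonneg
  refine ⟨κ + C1 * τ + C1, by positivity, fun a ha hsupp => ?_⟩
  have hpt : ∀ x, ‖conv K a x‖ₑ ≤ ∫⁻ y in Metric.ball (0 : E3) R, ‖K (x - y) * a y‖ₑ := by
    intro x
    refine (enorm_integral_le_lintegral_enorm _).trans (le_of_eq ?_)
    rw [← lintegral_indicator Metric.isOpen_ball.measurableSet]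
    refine lintegral_congr fun y => ?_
    by_cases hy : y ∈ Metric.ball (0 : E3) R
    · rw [indicator_of_mem hy]
    · rw [indicator_of_notMem hy, hsupp y (by simpa using hy), mul_zero, enorm_zero]
  set A := eLpNorm a (ENNReal.ofReal q) volume
  have hA : A ≠ ⊤ := ha.2.ne
  have hdec : ∀ x, R' ≤ ‖x‖ → |conv K a x| ≤ C1 * A.toReal * (‖x‖ ^ 2)⁻¹ := by
    intro x hx
    have h1 := (hpt x).trans (hfar a ha.1 x hx)
    have h2 := ENNReal.toReal_mono (ENNReal.mul_ne_top ENNReal.ofReal_ne_top hA) h1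
    rw [ENNReal.toReal_mul, ENNReal.toReal_ofReal (by positivity), toReal_enorm,
      Real.norm_eq_abs] at h2
    refine h2.trans (le_of_eq ?_)
    rw [div_eq_mul_inv]; ring
  have haW : IsWeightIntegrable a := by
    refine .of_integrable ?_
    have hi : IntegrableOn a (Metric.closedBall 0 R) :=
      (ha.locallyIntegrable (by simpa using hq1.le)).integrableOn_isCompact (isCompact_closedBall _ _)
    refine (integrableOn_iff_integrable_of_support_subset fun x hx => ?_).1 hi
    rw [mem_closedBall_zero_iff]
    by_contra hlt
    exact hx (hsupp x (not_le.1 hlt).le)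
  have hm : AEStronglyMeasurable (conv K a) volume :=
    (hK.locallyIntegrable_conv haW).aestronglyMeasurable
  have hBm := (Metric.isOpen_ball (x := (0 : E3)) (ε := R')).measurableSet
  have hn : eLpNorm (conv K a) (ENNReal.ofReal q) volume ≤ ENNReal.ofReal (κ + C1 * τ) * A := by
    have e := indicator_self_add_compl (Metric.ball (0 : E3) R') (conv K a)
    have n1 : eLpNorm ((Metric.ball (0 : E3) R').indicator (conv K a)) (ENNReal.ofReal q) volume
        ≤ ENNReal.ofReal κ * A := by
      rw [eLpNorm_indicator_eq_eLpNorm_restrict hBm, hκ,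
        eLpNorm_eq_lintegral_rpow_enorm_toReal (by simpa using hq0) ENNReal.ofReal_ne_top,
        ENNReal.toReal_ofReal hq0.le]
      have hA' : A = (∫⁻ y, ‖a y‖ₑ ^ q) ^ (1 / q) := by
        simp only [A]
        rw [eLpNorm_eq_lintegral_rpow_enorm_toReal (by simpa using hq0) ENNReal.ofReal_ne_top,
          ENNReal.toReal_ofReal hq0.le]
      rw [hA', ← ENNReal.mul_rpow_of_nonneg _ _ (by positivity)]
      refine ENNReal.rpow_le_rpow (le_trans (lintegral_mono fun x => ?_) (hnear a ha.1))
        (by positivity)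
      exact ENNReal.rpow_le_rpow (hpt x) hq0.le
    have n2 : eLpNorm ((Metric.ball (0 : E3) R')ᶜ.indicator (conv K a)) (ENNReal.ofReal q) volume
        ≤ ENNReal.ofReal (C1 * τ) * A := by
      have h1 : ∀ x, ‖(Metric.ball (0 : E3) R')ᶜ.indicator (conv K a) x‖ ≤ C1 * A.toReal * ‖T x‖ := by
        intro x
        by_cases hx : R' ≤ ‖x‖
        · have hx' : x ∈ (Metric.ball (0 : E3) R')ᶜ := by simpa using hx
          simp only [T, indicator_of_mem hx']
          rw [Real.norm_of_nonneg (by positivity : 0 ≤ (‖x‖ ^ 2)⁻¹)]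
          exact hdec x hx
        · have hx' : x ∉ (Metric.ball (0 : E3) R')ᶜ := by simpa using hx
          rw [indicator_of_notMem hx', norm_zero]
          positivity
      refine (eLpNorm_le_mul_eLpNorm_of_ae_le_mul (Eventually.of_forall h1) _).trans (le_of_eq ?_)
      rw [← hτ, ENNReal.ofReal_mul hC1, ENNReal.ofReal_mul hC1, ENNReal.ofReal_toReal hA]
      ring
    rw [← e, ENNReal.ofReal_add hκ0 (by positivity), add_mul]
    exact (eLpNorm_add_le (hm.indicator hBm) (hm.indicator hBm.compl)
      (by simpa using hq1.le)).trans (add_le_add n1 n2)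
  refine ⟨⟨⟨hm, hn.trans_lt (by finiteness)⟩, hn.trans ?_⟩, fun x hx => ?_⟩
  · exact mul_le_mul' (ENNReal.ofReal_le_ofReal (by linarith)) le_rfl
  · have hx0 : 0 < ‖x‖ := hR'.trans_le hx
    have h1 := mul_le_mul_of_nonneg_left (hdec x hx) (by positivity : 0 ≤ ‖x‖ ^ 2)
    refine h1.trans ?_
    have h2 : ‖x‖ ^ 2 * (C1 * A.toReal * (‖x‖ ^ 2)⁻¹) = C1 * A.toReal := by field_simp
    rw [h2]
    have : 0 ≤ A.toReal := ENNReal.toReal_nonneg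
    nlinarith [mul_nonneg (add_nonneg hκ0 (mul_nonneg hC1 hτ0)) this]

/-- Decay of potentials of densities that are in `L^q` near the origin and bounded by `‖y‖⁻²` far
from it. -/
lemma IsNewtonType.exists_decay (hK : IsNewtonType K) (hq : 1 ≤ q) {R R' : ℝ}
    (hR : 0 < R) (hRR' : R < R') : ∃ C : ℝ, 0 ≤ C ∧ ∀ (F : E3 → ℝ) (A : ℝ), 0 ≤ A →
      AEStronglyMeasurable F volume → eLpNorm F (ENNReal.ofReal q) volume ≤ ENNReal.ofReal A →
      (∀ᵐ y, R ≤ ‖y‖ → ‖y‖ ^ 2 * |F y| ≤ A) → ∀ x, R' ≤ ‖x‖ → ‖x‖ * |conv K F x| ≤ C * A := by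
  have hR' := hR.trans hRR'
  obtain ⟨C1, hC1, hfar⟩ := hK.exists_lintegral_far_le hq hR hRR'
  obtain ⟨c, hc, hb⟩ := hK.bound
  obtain ⟨d, hd, hint⟩ := exists_lintegral_inv_sq_mul_inv_sq
  refine ⟨C1 / R' + c * d, by positivity, fun F A hA hF hFq hdec x hx => ?_⟩
  have hx0 : 0 < ‖x‖ := hR'.trans_le hx
  have hBm := (Metric.isOpen_ball (x := (0 : E3)) (ε := R)).measurableSet
  have hne : ∀ᵐ y : E3, y ≠ x := by simp [ae_iff, measure_singleton]
  -- The part of the density beyond R is replaced by A|y|⁻². The integral over the exterior is then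
  -- enlarged to the whole space, where it is O(|x|⁻¹).
  have h2 : ∫⁻ y in (Metric.ball (0 : E3) R)ᶜ, ‖K (x - y) * F y‖ₑ ≤ ENNReal.ofReal (c * A * (d / ‖x‖)) := by
    calc _ ≤ ∫⁻ y in (Metric.ball (0 : E3) R)ᶜ, ENNReal.ofReal (c * A) *
          (ENNReal.ofReal (‖x - y‖ ^ 2)⁻¹ * ENNReal.ofReal (‖y‖ ^ 2)⁻¹) := by
          refine lintegral_mono_ae ?_
          filter_upwards [ae_restrict_mem hBm.compl, ae_restrict_of_ae hdec, ae_restrict_of_ae hne]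
            with y hy hFy hyx
          have hy' : R ≤ ‖y‖ := by simpa using hy
          have hy0 : 0 < ‖y‖ := hR.trans_le hy'
          rw [← ENNReal.ofReal_mul (by positivity), ← ENNReal.ofReal_mul (by positivity),
            Real.enorm_eq_ofReal_abs, abs_mul]
          refine ENNReal.ofReal_le_ofReal ?_
          have k1 := hb _ (sub_ne_zero.2 hyx.symm)
          have k2 : |F y| ≤ A * (‖y‖ ^ 2)⁻¹ := by
            rw [← div_eq_mul_inv, le_div_iff₀ (by positivity), mul_comm]; exact hFy hy'
          calc _ ≤ c / ‖x - y‖ ^ 2 * (A * (‖y‖ ^ 2)⁻¹) := by gcongr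
            _ = _ := by rw [div_eq_mul_inv]; ring
      _ ≤ ENNReal.ofReal (c * A) * ∫⁻ y, ENNReal.ofReal (‖x - y‖ ^ 2)⁻¹ * ENNReal.ofReal (‖y‖ ^ 2)⁻¹ := by
          rw [lintegral_const_mul' _ _ ENNReal.ofReal_ne_top]
          gcongr
          exact Measure.restrict_le_self
      _ ≤ ENNReal.ofReal (c * A) * ENNReal.ofReal (d / ‖x‖) := by
          gcongr; exact hint x (norm_pos_iff.1 hx0)
      _ = _ := (ENNReal.ofReal_mul (by positivity)).symm
  have h1 : ∫⁻ y in Metric.ball (0 : E3) R, ‖K (x - y) * F y‖ₑ ≤ ENNReal.ofReal (C1 / ‖x‖ ^ 2 * A) := by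
    rw [ENNReal.ofReal_mul (by positivity)]
    exact (hfar F hF x hx).trans (mul_le_mul' le_rfl hFq)
  have h3 : ENNReal.ofReal |conv K F x| ≤ ENNReal.ofReal (C1 / ‖x‖ ^ 2 * A + c * A * (d / ‖x‖)) := by
    rw [ENNReal.ofReal_add (by positivity) (by positivity), ← Real.enorm_eq_ofReal_abs]
    refine (enorm_integral_le_lintegral_enorm _).trans ?_
    rw [← lintegral_add_compl _ hBm]
    exact add_le_add h1 h2
  have h4 := (ENNReal.ofReal_le_ofReal_iff (by positivity)).1 h3
  calc ‖x‖ * |conv K F x| ≤ ‖x‖ * (C1 / ‖x‖ ^ 2 * A + c * A * (d / ‖x‖)) := by gcongr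
    _ = C1 / ‖x‖ * A + c * d * A := by field_simp
    _ ≤ C1 / R' * A + c * d * A := by gcongr
    _ = _ := by ring

/-! ### Distributional identities for potentials, and forces as divergences. -/

lemma sum_integral_conv_gradKer_pderiv {F φ : E3 → ℝ} (hF : IsWeightIntegrable F) (hφ : IsTest φ) :
    ∑ k, ∫ x, conv (gradKer k) F x * pderiv k φ x = -∫ y, F y * φ y := by
  have h := fun k => (isNewtonType_gradKer k).integral_conv_mul hF (hφ.pderiv k)
  simp only [(h _).2]
  rw [← integral_finsetSum _ fun k _ => (h k).1, ← integral_neg]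
  refine integral_congr_ae (Eventually.of_forall fun y => ?_)
  simp only
  rw [← Finset.mul_sum, sum_integral_gradKer_pderiv hφ, mul_neg]

lemma sum_integral_conv_thirdKer_pderiv {F φ : E3 → ℝ} (hF : IsWeightIntegrable F) (hφ : IsTest φ)
    (l k : Fin 3) : ∑ i, ∫ x, conv (thirdKer i l k) F x * pderiv i φ x
      = ∫ x, conv (gradKer k) F x * pderiv l φ x := by
  have h := fun i => (isNewtonType_thirdKer i l k).integral_conv_mul hF (hφ.pderiv i)
  simp only [(h _).2]
  rw [← integral_finsetSum _ fun i _ => (h i).1,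
    ((isNewtonType_gradKer k).integral_conv_mul hF (hφ.pderiv l)).2]
  refine integral_congr_ae (Eventually.of_forall fun y => ?_)
  simp only
  rw [← Finset.mul_sum, sum_integral_thirdKer_pderiv hφ]

lemma integral_conv_gradKer_laplacian {F φ : E3 → ℝ} (hF : IsWeightIntegrable F) (hφ : IsTest φ)
    (k : Fin 3) : ∫ x, conv (gradKer k) F x * (Δ φ) x = -∫ y, F y * pderiv k φ y := by
  rw [((isNewtonType_gradKer k).integral_conv_mul hF hφ.laplacian).2, ← integral_neg]
  simp only [integral_gradKer_laplacian hφ, mul_neg]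

lemma integral_conv_thirdKer_laplacian {F φ : E3 → ℝ} (hF : IsWeightIntegrable F) (hφ : IsTest φ)
    (i l k : Fin 3) : ∫ x, conv (thirdKer i l k) F x * (Δ φ) x
      = ∫ x, conv (gradKer k) F x * pderiv l (pderiv i φ) x := by
  rw [((isNewtonType_thirdKer i l k).integral_conv_mul hF hφ.laplacian).2,
    ((isNewtonType_gradKer k).integral_conv_mul hF ((hφ.pderiv i).pderiv l)).2]
  simp only [integral_thirdKer_laplacian hφ]

variable {q : ℝ}

/-- A distribution in `W^{-1,q}` with support in a ball is the divergence of a tensor in `L^q` which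
decays like `|x|⁻²`. -/
lemma exists_force_tensor {ρ : ℝ} (hq : 3 / 2 < q) (hρ : 0 < ρ) : ∃ C : ℝ, 0 ≤ C ∧
    ∀ f : VectorDistribution, negSobolevNorm q (Metric.ball 0 (2 * ρ)) f < ⊤ →
    IsVanishingOn f (Metric.closedBall (0 : E3) ρ)ᶜ → ∀ i, ∃ Θ : Fin 3 → E3 → ℝ,
      (∀ k, MemLp (Θ k) (ENNReal.ofReal q) volume ∧ eLpNorm (Θ k) (ENNReal.ofReal q) volume
        ≤ ENNReal.ofReal (C * (negSobolevNorm q (Metric.ball 0 (2 * ρ)) f).toReal) ∧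
        ∀ x, 7 * ρ / 4 ≤ ‖x‖ → ‖x‖ ^ 2 * |Θ k x|
          ≤ C * (negSobolevNorm q (Metric.ball 0 (2 * ρ)) f).toReal) ∧
      ∀ φ : ScalarTest, f φ i = -∑ k, ∫ x, Θ k x * pderiv k φ x := by
  have hq1 : 1 < q := by linarith
  obtain ⟨C0, hC0, hrep⟩ := exists_force_representation hq1 hρ
  have h32 : 0 < 3 * ρ / 2 := by positivity
  -- The radii 3ρ/2 < 7ρ/4 < 2ρ: support of a and b, start of the decay of the tensor, start of the
  -- decay of the velocity.
  choose c hc0 hc using fun k => (isNewtonType_gradKer k).exists_conv_le_of_support hq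
    h32 (R' := 7 * ρ / 4) (by linarith)
  have hcs : ∀ k, c k ≤ ∑ l, c l := fun k =>
    Finset.single_le_sum (f := c) (fun l _ => hc0 l) (Finset.mem_univ k)
  have hcs0 : 0 ≤ ∑ l, c l := Finset.sum_nonneg fun l _ => hc0 l
  refine ⟨(∑ l, c l) * C0 + C0, by positivity, fun f hf hv i => ?_⟩
  obtain ⟨a, b, ⟨ha, haN, has⟩, hb, hfab⟩ := hrep f hf hv i
  set N := negSobolevNorm q (Metric.ball 0 (2 * ρ)) f
  have hN : ENNReal.ofReal N.toReal = N := ENNReal.ofReal_toReal hf.ne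
  have hN0 : 0 ≤ N.toReal := ENNReal.toReal_nonneg
  have haN' : (eLpNorm a (ENNReal.ofReal q) volume).toReal ≤ C0 * N.toReal := by
    refine ENNReal.toReal_le_of_le_ofReal (by positivity) (haN.trans (le_of_eq ?_))
    rw [ENNReal.ofReal_mul hC0, hN]
  have haL : LocallyIntegrable a := ha.locallyIntegrable (by simpa using hq1.le)
  have haW : IsWeightIntegrable a := .of_decay (M := 0) haL h32
    (Eventually.of_forall fun y hy => by simp [has y hy])
  have hbL : ∀ k, LocallyIntegrable (b k) := fun k =>
    (hb k).1.locallyIntegrable (by simpa using hq1.le)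
  -- Since the divergence of ∇N * a is a, the zeroth order part of the force becomes a divergence as
  -- well. The price is a tail |x|⁻² in place of bounded support.
  refine ⟨fun k x => conv (gradKer k) a x - b k x, fun k => ?_, fun φ => ?_⟩
  · obtain ⟨⟨h1, h2⟩, h3⟩ := hc k a ha has
    refine ⟨h1.sub (hb k).1, ?_, fun x hx => ?_⟩
    · refine (eLpNorm_sub_le h1.1 (hb k).1.1 (by simpa using hq1.le)).trans ?_
      rw [add_mul, ENNReal.ofReal_add (by positivity) (by positivity), mul_assoc,
        ENNReal.ofReal_mul hcs0, ENNReal.ofReal_mul hC0, hN]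
      exact add_le_add (h2.trans (mul_le_mul' (ENNReal.ofReal_le_ofReal (hcs k)) haN)) (hb k).2.1
    · beta_reduce
      rw [(hb k).2.2 x (by linarith), sub_zero]
      refine (h3 x hx).trans ?_
      calc _ ≤ (∑ l, c l) * (C0 * N.toReal) := by
            gcongr
            exact hcs k
        _ ≤ _ := by nlinarith [mul_nonneg hC0 hN0]
  · have hφ := φ.isTest
    have hint : ∀ k, Integrable fun x => conv (gradKer k) a x * pderiv k φ x := fun k =>
      integrable_mul_test ((isNewtonType_gradKer k).locallyIntegrable_conv haW) (hφ.pderiv k)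
    have h1 := sum_integral_conv_gradKer_pderiv haW hφ
    have h2 : ∀ k, ∫ x, (conv (gradKer k) a x - b k x) * pderiv k φ x
        = (∫ x, conv (gradKer k) a x * pderiv k φ x) - ∫ x, b k x * pderiv k φ x := fun k => by
      simp only [sub_mul]
      exact integral_sub (hint k) (integrable_mul_test (hbL k) (hφ.pderiv k))
    simp only [h2]
    rw [Finset.sum_sub_distrib, h1, hfab φ]
    ring

/-! ### Existence for the Stokes system in scalar components. -/

/-- Densities of size `A`: bounded by `A` in `L^q`, and by `A |x|⁻²` for `|x| ≥ R`. -/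
structure IsDensity (q R A : ℝ) (F : E3 → ℝ) : Prop where
  memLp : MemLp F (ENNReal.ofReal q) volume
  norm_le : eLpNorm F (ENNReal.ofReal q) volume ≤ ENNReal.ofReal A
  decay : ∀ᵐ y, R ≤ ‖y‖ → ‖y‖ ^ 2 * |F y| ≤ A

/-- Functions of size `A`: weak gradient bounded by `A` in `L^q`, and bounded by `A |x|⁻¹` for
`|x| ≥ R`. -/
structure IsPotential (q R A : ℝ) (w : E3 → ℝ) : Prop where
  locallyIntegrable : LocallyIntegrable w
  exists_weakDeriv : ∀ j, ∃ d : E3 → ℝ, MemLp d (ENNReal.ofReal q) volume ∧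
    eLpNorm d (ENNReal.ofReal q) volume ≤ ENNReal.ofReal A ∧ IsWeakDeriv j w d
  decay : ∀ x, R ≤ ‖x‖ → ‖x‖ * |w x| ≤ A

namespace IsPotential

variable {R A B : ℝ} {v w : E3 → ℝ}

lemma add (hq : 1 ≤ q) (hA : 0 ≤ A) (hB : 0 ≤ B) (hv : IsPotential q R A v)
    (hw : IsPotential q R B w) : IsPotential q R (A + B) fun x => v x + w x where
  locallyIntegrable := hv.1.add hw.1
  exists_weakDeriv j := by
    obtain ⟨d, h1, h2, h3⟩ := hv.2 j
    obtain ⟨e, k1, k2, k3⟩ := hw.2 j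
    have hq' : 1 ≤ ENNReal.ofReal q := by simpa using hq
    refine ⟨fun x => d x + e x, h1.add k1, ?_, h3.add k3 hv.1 hw.1 (h1.locallyIntegrable hq')
      (k1.locallyIntegrable hq')⟩
    rw [ENNReal.ofReal_add hA hB]
    exact (eLpNorm_add_le h1.1 k1.1 hq').trans (add_le_add h2 k2)
  decay x hx := by
    have h1 := abs_add_le (v x) (w x)
    have := hv.decay x hx
    have := hw.decay x hx
    nlinarith [norm_nonneg x]

lemma neg (hv : IsPotential q R A v) : IsPotential q R A fun x => -v x where
  locallyIntegrable := hv.1.neg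
  exists_weakDeriv j := by
    obtain ⟨d, h1, h2, h3⟩ := hv.2 j
    exact ⟨fun x => -d x, h1.neg, (eLpNorm_neg d _ _).le.trans h2, h3.neg⟩
  decay x hx := by rw [abs_neg]; exact hv.decay x hx

lemma zero : IsPotential q R 0 fun _ => 0 where
  locallyIntegrable := locallyIntegrable_const 0
  exists_weakDeriv j := ⟨fun _ => 0, MemLp.zero', by simp, fun φ _ => by simp⟩
  decay x _ := by simp

lemma sum {ι : Type*} {s : Finset ι} {v : ι → E3 → ℝ} (hq : 1 ≤ q) (hA : 0 ≤ A)
    (h : ∀ i ∈ s, IsPotential q R A (v i)) :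
    IsPotential q R (s.card * A) fun x => ∑ i ∈ s, v i x := by
  classical
  induction s using Finset.induction_on with
  | empty => simpa using zero
  | insert a s ha ih =>
    simp only [Finset.sum_insert ha, Finset.card_insert_of_notMem ha]
    have := add hq hA (by positivity) (h a (by simp)) (ih fun i hi => h i (by simp [hi]))
    convert this using 1
    push_cast; ring

end IsPotential

lemma IsDensity.isWeightIntegrable {R A : ℝ} {F : E3 → ℝ} (hF : IsDensity q R A F) (hq : 1 ≤ q)
    (hR : 0 < R) : IsWeightIntegrable F :=
  .of_decay (hF.memLp.locallyIntegrable (by simpa using hq)) hR hF.decay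

/-- The potentials of a density. -/
lemma exists_isPotential_conv {R R' : ℝ} (hq : 1 < q) (hR : 0 < R) (hRR' : R < R') :
    ∃ C : ℝ, 0 ≤ C ∧ ∀ (F : E3 → ℝ) (A : ℝ), 0 ≤ A → IsDensity q R A F →
      (∀ k, IsPotential q R' (C * A) (conv (gradKer k) F)) ∧
      ∀ i l k, IsPotential q R' (C * A) (conv (thirdKer i l k) F) := by
  obtain ⟨C0, hC0, h0⟩ := exists_weakDeriv_conv (Real.HolderConjugate.conjExponent hq)
  choose c hc0 hc using fun k => (isNewtonType_gradKer k).exists_decay hq.le hR hRR'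
  choose d hd0 hd using fun i l k => (isNewtonType_thirdKer i l k).exists_decay hq.le hR hRR'
  set S := ∑ k, c k
  set T := ∑ i, ∑ l, ∑ k, d i l k
  have hS : ∀ k, c k ≤ S := fun k =>
    Finset.single_le_sum (f := c) (fun l _ => hc0 l) (Finset.mem_univ k)
  have hT : ∀ i l k, d i l k ≤ T := fun i l k =>
    (Finset.single_le_sum (f := d i l) (fun k _ => hd0 i l k) (Finset.mem_univ k)).trans
    ((Finset.single_le_sum (f := fun l => ∑ k, d i l k)
      (fun l _ => Finset.sum_nonneg fun k _ => hd0 i l k) (Finset.mem_univ l)).trans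
    (Finset.single_le_sum (f := fun i => ∑ l, ∑ k, d i l k) (fun i _ => Finset.sum_nonneg fun l _ =>
      Finset.sum_nonneg fun k _ => hd0 i l k) (Finset.mem_univ i)))
  have hS0 : 0 ≤ S := (hc0 0).trans (hS 0)
  have hT0 : 0 ≤ T := (hd0 0 0 0).trans (hT 0 0 0)
  refine ⟨C0 + S + T, by positivity, fun F A hA hF => ?_⟩
  have hW := hF.isWeightIntegrable hq.le hR
  have hn : ENNReal.ofReal C0 * eLpNorm F (ENNReal.ofReal q) volume
      ≤ ENNReal.ofReal ((C0 + S + T) * A) := by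
    rw [ENNReal.ofReal_mul (by positivity)]
    exact mul_le_mul' (ENNReal.ofReal_le_ofReal (by linarith)) hF.norm_le
  refine ⟨fun k => ⟨(isNewtonType_gradKer k).locallyIntegrable_conv hW, fun j => ?_, fun x hx => ?_⟩,
    fun i l k => ⟨(isNewtonType_thirdKer i l k).locallyIntegrable_conv hW, fun j => ?_,
      fun x hx => ?_⟩⟩
  · obtain ⟨d, h1, h2, h3⟩ := (h0 F hW hF.memLp j).1 k
    exact ⟨d, h1, h2.trans hn, h3⟩
  · refine (hc k F A hA hF.memLp.1 hF.norm_le hF.decay x hx).trans ?_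
    gcongr
    linarith [hS k]
  · obtain ⟨d, h1, h2, h3⟩ := (h0 F hW hF.memLp j).2 i l k
    exact ⟨d, h1, h2.trans hn, h3⟩
  · refine (hd i l k F A hA hF.memLp.1 hF.norm_le hF.decay x hx).trans ?_
    gcongr
    linarith [hT i l k]

/-- Weak solutions of the Stokes system, with scalar components. -/
theorem exists_stokes_components {q R R' : ℝ} (hq : 1 < q) (hR : 0 < R) (hRR' : R < R') :
    ∃ C : ℝ, 0 ≤ C ∧ ∀ (Γ : Fin 3 → Fin 3 → E3 → ℝ) (g : E3 → ℝ) (A : ℝ), 0 ≤ A →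
      (∀ k i, IsDensity q R A (Γ k i)) → IsDensity q R A g →
      ∃ (u : Fin 3 → E3 → ℝ) (p : E3 → ℝ), (∀ i, IsPotential q R' (C * A) (u i)) ∧
        MemLp p (ENNReal.ofReal q) volume ∧
        eLpNorm p (ENNReal.ofReal q) volume ≤ ENNReal.ofReal (C * A) ∧
        (∀ i φ, IsTest φ → ∫ x, u i x * (Δ φ) x
          = -(∫ x, p x * pderiv i φ x) - ∑ k, ∫ x, Γ k i x * pderiv k φ x) ∧
        ∀ φ, IsTest φ → ∑ i, ∫ x, u i x * pderiv i φ x = -∫ x, g x * φ x := by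
  have hq' : 1 ≤ ENNReal.ofReal q := by simpa using hq.le
  obtain ⟨C, hC, hpot⟩ := exists_isPotential_conv hq hR hRR'
  -- Each velocity component is a sum of 3 + 9 + 1 potentials, each of size C·A. The pressure is g,
  -- of size A, minus nine derivatives of size C·A.
  refine ⟨13 * C + 1, by positivity, fun Γ g A hA hΓ hg => ?_⟩
  have hCA : 0 ≤ C * A := by positivity
  have hΓW := fun k i => (hΓ k i).isWeightIntegrable hq.le hR
  have hgW := hg.isWeightIntegrable hq.le hR
  have hPΓ := fun k i => hpot (Γ k i) A hA (hΓ k i)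
  have hPg := (hpot g A hA hg).1
  -- The function d k l is ∂ₗ(∂ₖN * Γₖₗ). These derivatives make up the pressure, so their existence
  -- in L^q is the pressure bound.
  choose d hd hdn hdw using fun k l => ((hPΓ k l).1 k).2 l
  have hdL := fun k l => (hd k l).locallyIntegrable hq'
  let V : Fin 3 → E3 → ℝ := fun i x => ∑ k, conv (gradKer k) (Γ k i) x
  let W : Fin 3 → E3 → ℝ := fun i x => ∑ k, ∑ l, conv (thirdKer i l k) (Γ k l) x
  have hV : ∀ i, IsPotential q R' (3 * (C * A)) (V i) := fun i => by
    simpa using IsPotential.sum (s := Finset.univ) hq.le hCA fun k _ => (hPΓ k i).1 k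
  have hW : ∀ i, IsPotential q R' (9 * (C * A)) (W i) := fun i => by
    have h1 : ∀ k, IsPotential q R' (3 * (C * A)) fun x => ∑ l, conv (thirdKer i l k) (Γ k l) x :=
      fun k => by
        simpa using IsPotential.sum (s := Finset.univ) hq.le hCA fun l _ => (hPΓ k l).2 i l k
    have := IsPotential.sum (s := Finset.univ) hq.le (by positivity) fun k _ => h1 k
    convert this using 1
    simp; ring
  have hu : ∀ i, IsPotential q R' (3 * (C * A) + 9 * (C * A) + C * A)
      fun x => V i x + -W i x + conv (gradKer i) g x := fun i =>
    ((hV i).add hq.le (by positivity) (by positivity) (hW i).neg).add hq.le (by positivity) hCA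
      (hPg i)
  have hsplit : ∀ i ψ, IsTest ψ → ∫ x, (V i x + -W i x + conv (gradKer i) g x) * ψ x
      = (∑ k, ∫ x, conv (gradKer k) (Γ k i) x * ψ x)
        - (∑ k, ∑ l, ∫ x, conv (thirdKer i l k) (Γ k l) x * ψ x)
        + ∫ x, conv (gradKer i) g x * ψ x := by
    intro i ψ hψ
    have i1 := integrable_mul_test (hV i).1 hψ
    have i2 := integrable_mul_test (hW i).1 hψ
    have i3 := integrable_mul_test (hPg i).1 hψ
    have e : ∀ x, (V i x + -W i x + conv (gradKer i) g x) * ψ x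
      = V i x * ψ x - W i x * ψ x + conv (gradKer i) g x * ψ x := fun x => by ring
    simp only [e]
    rw [integral_add (f := fun x => V i x * ψ x - W i x * ψ x) (i1.sub i2) i3, integral_sub i1 i2]
    simp only [V, W, Finset.sum_mul]
    rw [integral_finsetSum _ fun k _ => integrable_mul_test ((hPΓ k i).1 k).1 hψ,
      integral_finsetSum _ fun k _ => integrable_finsetSum _ fun l _ =>
        integrable_mul_test ((hPΓ k l).2 i l k).1 hψ]
    congr 2
    refine Finset.sum_congr rfl fun k _ => ?_
    exact integral_finsetSum _ fun l _ => integrable_mul_test ((hPΓ k l).2 i l k).1 hψ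
  have hS : MemLp (fun x => ∑ k, ∑ l, d k l x) (ENNReal.ofReal q) volume :=
    memLp_finsetSum _ fun k _ => memLp_finsetSum _ fun l _ => hd k l
  refine ⟨fun i x => V i x + -W i x + conv (gradKer i) g x, fun x => g x - ∑ k, ∑ l, d k l x,
    fun i => ?_, hg.memLp.sub hS, ?_, fun i φ hφ => ?_, fun φ hφ => ?_⟩
  · have h := hu i
    exact ⟨h.1, fun j => by
      obtain ⟨e, h1, h2, h3⟩ := h.2 j
      exact ⟨e, h1, h2.trans (ENNReal.ofReal_le_ofReal (by linarith)), h3⟩,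
      fun x hx => (h.3 x hx).trans (by linarith)⟩
  · have h1 : eLpNorm (fun x => ∑ k, ∑ l, d k l x) (ENNReal.ofReal q) volume
        ≤ ENNReal.ofReal (9 * (C * A)) := by
      have h2 : ∀ k, eLpNorm (fun x => ∑ l, d k l x) (ENNReal.ofReal q) volume
          ≤ ENNReal.ofReal (3 * (C * A)) := fun k => by
        have := eLpNorm_sum_le (s := Finset.univ) (f := d k) (fun l _ => (hd k l).1) hq'
        rw [show (fun x => ∑ l, d k l x) = ∑ l, d k l by ext; simp]
        refine (this.trans (Finset.sum_le_sum fun l _ => hdn k l)).trans (le_of_eq ?_)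
        rw [Finset.sum_const, Finset.card_univ, Fintype.card_fin, ENNReal.ofReal_mul (p := 3) (by norm_num)]
        simp
      have := eLpNorm_sum_le (s := Finset.univ) (f := fun k x => ∑ l, d k l x)
        (fun k _ => (memLp_finsetSum Finset.univ fun l _ => hd k l).1) hq'
      rw [show (fun x => ∑ k, ∑ l, d k l x) = ∑ k, fun x => ∑ l, d k l x by ext; simp]
      refine (this.trans (Finset.sum_le_sum fun k _ => h2 k)).trans (le_of_eq ?_)
      rw [Finset.sum_const, Finset.card_univ, Fintype.card_fin,
        show 9 * (C * A) = 3 * (3 * (C * A)) by ring, ENNReal.ofReal_mul (p := 3) (by norm_num)]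
      simp
    refine (eLpNorm_sub_le hg.memLp.1 hS.1 hq').trans ((add_le_add hg.norm_le h1).trans ?_)
    rw [← ENNReal.ofReal_add hA (by positivity)]
    exact ENNReal.ofReal_le_ofReal (by linarith)
  · rw [hsplit i _ hφ.laplacian]
    simp only [integral_conv_gradKer_laplacian (hΓW _ _) hφ, integral_conv_gradKer_laplacian hgW hφ,
      integral_conv_thirdKer_laplacian (hΓW _ _) hφ]
    have h1 : ∀ k l, ∫ x, conv (gradKer k) (Γ k l) x * pderiv l (pderiv i φ) x
        = -∫ x, d k l x * pderiv i φ x := fun k l => hdw k l _ (hφ.pderiv i)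
    have h2 : ∫ x, (g x - ∑ k, ∑ l, d k l x) * pderiv i φ x
        = (∫ x, g x * pderiv i φ x) - ∑ k, ∑ l, ∫ x, d k l x * pderiv i φ x := by
      simp only [sub_mul, Finset.sum_mul]
      have hi := fun k l => integrable_mul_test (hdL k l) (hφ.pderiv i)
      rw [integral_sub (integrable_mul_test hgW.locallyIntegrable (hφ.pderiv i))
        (integrable_finsetSum _ fun k _ => integrable_finsetSum _ fun l _ => hi k l),
        integral_finsetSum _ fun k _ => integrable_finsetSum _ fun l _ => hi k l]
      congr 1
      exact Finset.sum_congr rfl fun k _ => integral_finsetSum _ fun l _ => hi k l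
    simp only [h1, h2, Finset.sum_neg_distrib]
    ring
  · simp only [hsplit _ _ (hφ.pderiv _)]
    rw [Finset.sum_add_distrib, Finset.sum_sub_distrib, sum_integral_conv_gradKer_pderiv hgW hφ]
    -- Summation over i contracts ∂ᵢ∂ᵢ∂ₗ∂ₖΦ to ∂ₗ∂ₖN, so V and W have the same divergence and only
    -- the potential of g contributes.
    have h1 : ∑ i, ∑ k, ∑ l, ∫ x, conv (thirdKer i l k) (Γ k l) x * pderiv i φ x
        = ∑ i, ∑ k, ∫ x, conv (gradKer k) (Γ k i) x * pderiv i φ x := by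
      rw [Finset.sum_comm, Finset.sum_comm (f := fun i k =>
        ∫ x, conv (gradKer k) (Γ k i) x * pderiv i φ x)]
      refine Finset.sum_congr rfl fun k _ => ?_
      rw [Finset.sum_comm]
      exact Finset.sum_congr rfl fun l _ => sum_integral_conv_thirdKer_pderiv (hΓW k l) hφ l k
    rw [h1, sub_self, zero_add]

/-! ### Uniqueness in scalar components. -/

/-- Uniqueness for the homogeneous Stokes system. -/
theorem stokes_components_ae_eq_zero {q a M : ℝ} (hq : 1 ≤ q) {u : Fin 3 → E3 → ℝ} {p : E3 → ℝ}
    (hu : ∀ i, LocallyIntegrable (u i)) (hdec : ∀ i, ∀ᵐ x, a < ‖x‖ → ‖x‖ * |u i x| ≤ M)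
    (hp : MemLp p (ENNReal.ofReal q) volume)
    (hmom : ∀ i φ, IsTest φ → ∫ x, u i x * (Δ φ) x = -∫ x, p x * pderiv i φ x)
    (hdiv : ∀ φ, IsTest φ → ∑ i, ∫ x, u i x * pderiv i φ x = 0) :
    p =ᵐ[volume] 0 ∧ ∀ i, u i =ᵐ[volume] 0 := by
  have hpL := hp.locallyIntegrable (by simpa using hq)
  have h0 : p =ᵐ[volume] 0 := by
    refine ae_eq_zero_of_harmonic hpL (.of_memLp hq hp) fun φ hφ => ?_
    rw [laplacian_fun_eq hφ]
    simp only [Finset.mul_sum]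
    rw [integral_finsetSum _ fun i _ => integrable_mul_test hpL ((hφ.pderiv i).pderiv i)]
    -- The momentum equation is tested with ∂ᵢφ. Summed over i, the right side is the divergence of
    -- u tested with Δφ, which is zero, so p is weakly harmonic.
    have h1 : ∀ i, ∫ x, p x * pderiv i (pderiv i φ) x = -∫ x, u i x * pderiv i (Δ φ) x := fun i => by
      rw [pderiv_laplacian hφ, hmom i _ (hφ.pderiv i), neg_neg]
    simp only [h1, Finset.sum_neg_distrib, hdiv _ hφ.laplacian, neg_zero]
  refine ⟨h0, fun i => ae_eq_zero_of_harmonic (hu i) (.of_decay (hu i) (hdec i)) fun φ hφ => ?_⟩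
  rw [hmom i φ hφ, integral_eq_zero_of_ae, neg_zero]
  filter_upwards [h0] with x hx
  simp [hx]

/-! ### From components to vector fields, and norms of the data. -/

section components

variable {ι : Type*} [Fintype ι]

lemma locallyIntegrable_apply {u : E3 → EuclideanSpace ℝ ι} (hu : LocallyIntegrable u) (i : ι) :
    LocallyIntegrable fun x => u x i :=
  hu.mono ((PiLp.continuous_apply 2 _ i).comp_aestronglyMeasurable hu.aestronglyMeasurable)
    (Eventually.of_forall fun x => PiLp.norm_apply_le (u x) i)

lemma norm_toLp_le_sum (v : ι → ℝ) : ‖WithLp.toLp 2 v‖ ≤ ∑ i, |v i| := by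
  classical
  have h : WithLp.toLp 2 v = ∑ i, v i • (EuclideanSpace.single i 1 : EuclideanSpace ℝ ι) := by
    ext j
    simp [Finset.sum_apply, Pi.single_apply]
  rw [h]
  refine (norm_sum_le _ _).trans (Finset.sum_le_sum fun i _ => ?_)
  rw [norm_smul]
  simp

lemma aestronglyMeasurable_toLp {v : ι → E3 → ℝ} (hv : ∀ i, AEStronglyMeasurable (v i) volume) :
    AEStronglyMeasurable (fun x => WithLp.toLp 2 fun i => v i x) volume :=
  (PiLp.continuous_toLp 2 _).comp_aestronglyMeasurable
    (aemeasurable_pi_lambda _ fun i => (hv i).aemeasurable).aestronglyMeasurable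

lemma locallyIntegrable_toLp {v : ι → E3 → ℝ} (hv : ∀ i, LocallyIntegrable (v i)) :
    LocallyIntegrable fun x => WithLp.toLp 2 fun i => v i x := by
  have h : LocallyIntegrable fun x => ∑ i, ‖v i x‖ :=
    locallyIntegrable_finsetSum _ fun i _ x => (hv i x).norm
  refine h.mono (aestronglyMeasurable_toLp fun i => (hv i).aestronglyMeasurable)
    (Eventually.of_forall fun x => ?_)
  exact (norm_toLp_le_sum _).trans (le_abs_self _)

lemma memLp_toLp {P : ℝ≥0∞} (hP : 1 ≤ P) {v : ι → E3 → ℝ} {A : ℝ} (hA : 0 ≤ A)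
    (hv : ∀ i, MemLp (v i) P volume) (h : ∀ i, eLpNorm (v i) P volume ≤ ENNReal.ofReal A) :
    MemLp (fun x => WithLp.toLp 2 fun i => v i x) P volume ∧
      eLpNorm (fun x => WithLp.toLp 2 fun i => v i x) P volume
        ≤ ENNReal.ofReal (Fintype.card ι * A) := by
  have h1 : eLpNorm (fun x => WithLp.toLp 2 fun i => v i x) P volume
      ≤ ENNReal.ofReal (Fintype.card ι * A) := by
    have h2 : ∀ x, ‖WithLp.toLp 2 fun i => v i x‖ ≤ ‖(∑ i, fun x => ‖v i x‖) x‖ := fun x => by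
      rw [Finset.sum_apply]
      exact (norm_toLp_le_sum _).trans (le_abs_self _)
    refine (eLpNorm_mono h2).trans ((eLpNorm_sum_le (fun i _ => (hv i).1.norm) hP).trans ?_)
    simp only [eLpNorm_norm]
    refine (Finset.sum_le_sum fun i _ => h i).trans (le_of_eq ?_)
    rw [Finset.sum_const, Finset.card_univ, ENNReal.ofReal_mul (by positivity)]
    simp
  exact ⟨⟨aestronglyMeasurable_toLp fun i => (hv i).1, h1.trans_lt ENNReal.ofReal_lt_top⟩, h1⟩

end components

section data

variable {q ρ s : ℝ} {G : E3 → Tensor} {f : VectorDistribution} {g : E3 → ℝ}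

lemma IsAdmissibleData.ae_norm_tensor_le (h : IsAdmissibleData q ρ s G f g) :
    ∀ᵐ x, ‖x‖ ^ 2 * ‖G x‖ ≤ (eLpNorm (fun x => ‖x‖ ^ 2 • G x) ⊤ volume).toReal := by
  have h1 := ae_le_eLpNormEssSup (f := fun x : E3 => ‖x‖ ^ 2 • G x) (μ := volume)
  have h2 := h.memLp_weighted_tensor.2.ne
  rw [← eLpNorm_exponent_top] at h1
  filter_upwards [h1] with x hx
  have := ENNReal.toReal_mono h2 hx
  rwa [toReal_enorm, norm_smul, norm_pow, norm_norm] at this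

/-- The weight |x|² vanishes only at the origin, a null set, so it can be divided out. -/
lemma IsAdmissibleData.aestronglyMeasurable_tensor (h : IsAdmissibleData q ρ s G f g) :
    AEStronglyMeasurable G volume := by
  have h1 : AEStronglyMeasurable (fun x : E3 => (‖x‖ ^ 2)⁻¹ • (‖x‖ ^ 2 • G x)) volume :=
    ((measurable_norm.pow_const 2).inv.aestronglyMeasurable).smul h.memLp_weighted_tensor.1
  refine h1.congr ?_
  have hne : ∀ᵐ x : E3, x ≠ 0 := by simp [ae_iff, measure_singleton]
  filter_upwards [hne] with x hx
  rw [smul_smul, inv_mul_cancel₀ (by positivity), one_smul]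

/-- Inside the ball of radius s the norm is given. Outside, |G| is at most a multiple of |x|⁻²,
which is in L^q there because q > 3/2. -/
lemma exists_memLp_tensor (hq : 3 / 2 < q) (hs : 0 < s) : ∃ C : ℝ, 0 ≤ C ∧
    ∀ {ρ : ℝ} {G : E3 → Tensor} {f : VectorDistribution} {g : E3 → ℝ},
      IsAdmissibleData q ρ s G f g → MemLp G (ENNReal.ofReal q) volume ∧
        eLpNorm G (ENNReal.ofReal q) volume ≤ ENNReal.ofReal (C *
          ((eLpNorm (fun x => ‖x‖ ^ 2 • G x) ⊤ volume).toReal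
            + (eLpNorm G (ENNReal.ofReal q) (volume.restrict (Metric.ball 0 s))).toReal)) := by
  have hT := memLp_tail hq hs
  set T := (Metric.ball (0 : E3) s)ᶜ.indicator fun x => (‖x‖ ^ 2)⁻¹
  set τ := (eLpNorm T (ENNReal.ofReal q) volume).toReal
  have hτ : ENNReal.ofReal τ = eLpNorm T (ENNReal.ofReal q) volume := ENNReal.ofReal_toReal hT.2.ne
  have hτ0 : 0 ≤ τ := ENNReal.toReal_nonneg
  refine ⟨1 + τ, by positivity, fun {ρ G f g} h => ?_⟩
  set a := (eLpNorm (fun x => ‖x‖ ^ 2 • G x) ⊤ volume).toReal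
  set b := eLpNorm G (ENNReal.ofReal q) (volume.restrict (Metric.ball 0 s))
  have hb : ENNReal.ofReal b.toReal = b := ENNReal.ofReal_toReal h.memLp_tensor_near_zero.2.ne
  have ha0 : 0 ≤ a := ENNReal.toReal_nonneg
  have hb0 : 0 ≤ b.toReal := ENNReal.toReal_nonneg
  have hm := h.aestronglyMeasurable_tensor
  have hBm := (Metric.isOpen_ball (x := (0 : E3)) (ε := s)).measurableSet
  have hn : eLpNorm G (ENNReal.ofReal q) volume ≤ ENNReal.ofReal ((1 + τ) * (a + b.toReal)) := by
    have n2 : eLpNorm ((Metric.ball (0 : E3) s)ᶜ.indicator G) (ENNReal.ofReal q) volume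
        ≤ ENNReal.ofReal (a * τ) := by
      have h1 : ∀ᵐ x, ‖(Metric.ball (0 : E3) s)ᶜ.indicator G x‖ ≤ a * ‖T x‖ := by
        filter_upwards [h.ae_norm_tensor_le] with x hG
        by_cases hx : x ∈ (Metric.ball (0 : E3) s)ᶜ
        · have hx' : 0 < ‖x‖ := hs.trans_le (by simpa using hx)
          simp only [T, indicator_of_mem hx]
          rw [Real.norm_of_nonneg (by positivity : 0 ≤ (‖x‖ ^ 2)⁻¹), ← div_eq_mul_inv,
            le_div_iff₀ (by positivity), mul_comm]
          exact hG
        · rw [indicator_of_notMem hx, norm_zero]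
          positivity
      refine (eLpNorm_le_mul_eLpNorm_of_ae_le_mul h1 _).trans (le_of_eq ?_)
      rw [← hτ, ENNReal.ofReal_mul ha0]
    rw [← indicator_self_add_compl (Metric.ball (0 : E3) s) G]
    refine (eLpNorm_add_le (hm.indicator hBm) (hm.indicator hBm.compl)
      (by simp; linarith)).trans ?_
    rw [eLpNorm_indicator_eq_eLpNorm_restrict hBm]
    refine (add_le_add hb.ge n2).trans ?_
    rw [← ENNReal.ofReal_add hb0 (by positivity)]
    exact ENNReal.ofReal_le_ofReal (by nlinarith [mul_nonneg hτ0 hb0])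
  exact ⟨⟨hm, hn.trans_lt ENNReal.ofReal_lt_top⟩, hn⟩

lemma IsAdmissibleData.memLp_divergence_univ (h : IsAdmissibleData q ρ s G f g) (hρ : 0 < ρ) :
    MemLp g (ENNReal.ofReal q) volume ∧ eLpNorm g (ENNReal.ofReal q) volume
      = eLpNorm g (ENNReal.ofReal q) (volume.restrict (Metric.ball 0 ρ)) := by
  have e : ∀ r, ρ ≤ r → (Metric.ball (0 : E3) r).indicator g =ᵐ[volume] g := by
    intro r hr
    filter_upwards [h.support_divergence] with x hx
    by_cases hxr : x ∈ Metric.ball (0 : E3) r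
    · rw [indicator_of_mem hxr]
    · rw [indicator_of_notMem hxr, hx fun hxρ => hxr (Metric.ball_subset_ball hr hxρ)]
  have hBm := fun r => (Metric.isOpen_ball (x := (0 : E3)) (ε := r)).measurableSet
  refine ⟨(memLp_congr_ae (e (2 * ρ) (by linarith))).1
    ((memLp_indicator_iff_restrict (hBm _)).2 h.memLp_divergence), ?_⟩
  rw [← eLpNorm_congr_ae (e ρ le_rfl), eLpNorm_indicator_eq_eLpNorm_restrict (hBm ρ)]

end data

/-! ### Uniqueness for vector fields and weak gradients. -/

section uniqueness

variable {q ρ : ℝ} {G : E3 → Tensor} {f : VectorDistribution} {g : E3 → ℝ} {u u' : E3 → E3}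
  {p p' : E3 → ℝ}

lemma IsInSolutionClass.exists_decay (h : IsInSolutionClass q ρ u p) :
    ∃ M : ℝ, ∀ᵐ x, 2 * ρ < ‖x‖ → ‖x‖ * ‖u x‖ ≤ M := by
  have h1 := ae_le_eLpNormEssSup (f := fun x : E3 => ‖x‖ • u x)
    (μ := volume.restrict (Metric.closedBall 0 (2 * ρ))ᶜ)
  have h2 := h.decay.2.ne
  rw [← eLpNorm_exponent_top] at h1
  refine ⟨(eLpNorm (fun x => ‖x‖ • u x) ⊤
    (volume.restrict (Metric.closedBall 0 (2 * ρ))ᶜ)).toReal, ?_⟩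
  rw [ae_restrict_iff' Metric.isClosed_closedBall.measurableSet.compl] at h1
  filter_upwards [h1] with x hx hxρ
  have := ENNReal.toReal_mono h2 (hx (by simpa using hxρ))
  rwa [toReal_enorm, norm_smul, norm_norm] at this

/-- Uniqueness of solutions of the Stokes system. -/
theorem IsStokesSolution.ae_eq (hq : 1 ≤ q) (hu : IsStokesSolution G f g u p)
    (hu' : IsStokesSolution G f g u' p') (hc : IsInSolutionClass q ρ u p)
    (hc' : IsInSolutionClass q ρ u' p') : u' =ᵐ[volume] u ∧ p' =ᵐ[volume] p := by
  obtain ⟨M, hM⟩ := hc.exists_decay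
  obtain ⟨M', hM'⟩ := hc'.exists_decay
  have hL := fun i => locallyIntegrable_apply hu.locallyIntegrable_velocity i
  have hL' := fun i => locallyIntegrable_apply hu'.locallyIntegrable_velocity i
  have key := stokes_components_ae_eq_zero (a := 2 * ρ) (M := M' + M) hq
    (u := fun i x => u' x i - u x i) (p := fun x => p' x - p x) (fun i => (hL' i).sub (hL i))
    (fun i => ?_) (hc'.memLp_pressure.sub hc.memLp_pressure) (fun i φ hφ => ?_) fun φ hφ => ?_
  · obtain ⟨k1, k2⟩ := key
    refine ⟨?_, ?_⟩
    · filter_upwards [ae_all_iff.2 k2] with x hx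
      ext i
      exact sub_eq_zero.1 (hx i)
    · filter_upwards [k1] with x hx
      exact sub_eq_zero.1 hx
  · filter_upwards [hM, hM'] with x h1 h2 hx
    have e1 : |u x i| ≤ ‖u x‖ := PiLp.norm_apply_le (u x) i
    have e2 : |u' x i| ≤ ‖u' x‖ := PiLp.norm_apply_le (u' x) i
    have e3 := abs_sub (u' x i) (u x i)
    nlinarith [norm_nonneg x, h1 hx, h2 hx]
  · have h1 := hu.momentum i hφ.bundle
    have h2 := hu'.momentum i hφ.bundle
    simp only [IsTest.coe_bundle] at h1 h2
    simp only [sub_mul]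
    rw [integral_sub (integrable_mul_test (hL' i) hφ.laplacian)
      (integrable_mul_test (hL i) hφ.laplacian), integral_sub
      (integrable_mul_test hu'.locallyIntegrable_pressure (hφ.pderiv i))
      (integrable_mul_test hu.locallyIntegrable_pressure (hφ.pderiv i)), h1, h2]
    ring
  · have h1 := hu.divergence hφ.bundle
    have h2 := hu'.divergence hφ.bundle
    simp only [IsTest.coe_bundle] at h1 h2
    rw [integral_finsetSum _ fun k _ => integrable_mul_test (hL k) (hφ.pderiv k)] at h1
    rw [integral_finsetSum _ fun k _ => integrable_mul_test (hL' k) (hφ.pderiv k)] at h2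
    simp only [sub_mul]
    have e : ∀ i, ∫ x, (u' x i * pderiv i φ x - u x i * pderiv i φ x)
        = (∫ x, u' x i * pderiv i φ x) - ∫ x, u x i * pderiv i φ x := fun i =>
      integral_sub (integrable_mul_test (hL' i) (hφ.pderiv i))
        (integrable_mul_test (hL i) (hφ.pderiv i))
    simp only [e]
    rw [Finset.sum_sub_distrib]
    linarith

/-- Weak derivatives are determined by their pairings with test functions. This carries the estimate
from the constructed gradient to an arbitrary one. -/
lemma IsWeakGradient.ae_eq {U U' : E3 → Tensor} (h : IsWeakGradient u U) (h' : IsWeakGradient u' U')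
    (huu' : u' =ᵐ[volume] u) : U' =ᵐ[volume] U := by
  have key : ∀ z : Fin 3 × Fin 3, (fun x => U' x z) =ᵐ[volume] fun x => U x z := by
    rintro ⟨i, j⟩
    have h1 : IsWeakDeriv j (fun x => u x i) fun x => U x (i, j) :=
      fun φ hφ => h.integral_eq i j hφ.bundle
    have h2 : IsWeakDeriv j (fun x => u x i) fun x => U' x (i, j) := fun φ hφ => by
      refine Eq.trans (integral_congr_ae ?_) (h'.integral_eq i j hφ.bundle)
      filter_upwards [huu'] with x hx
      rw [hx, IsTest.coe_bundle]
    exact h2.ae_eq h1 (locallyIntegrable_apply h'.locallyIntegrable_grad _)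
      (locallyIntegrable_apply h.locallyIntegrable_grad _)
  filter_upwards [ae_all_iff.2 key] with x hx
  ext z
  exact hx z

end uniqueness

/-! ### Existence with the estimate, and conclusion. -/

/-- Existence of a solution of the Stokes system, with estimate. -/
theorem exists_stokes_solution {q ρ s : ℝ} (hq : 3 / 2 < q) (hρ : 0 < ρ) (hs : 0 < s) :
    ∃ c : ℝ, 0 < c ∧ ∀ (G : E3 → Tensor) (f : VectorDistribution) (g : E3 → ℝ),
      IsAdmissibleData q ρ s G f g → ∃ (u : E3 → E3) (p : E3 → ℝ) (U : E3 → Tensor),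
        IsStokesSolution G f g u p ∧ IsInSolutionClass q ρ u p ∧ IsWeakGradient u U ∧
        eLpNorm (fun x => ‖x‖ • u x) ⊤ (volume.restrict (Metric.closedBall 0 (2 * ρ))ᶜ)
            + eLpNorm U (ENNReal.ofReal q) volume + eLpNorm p (ENNReal.ofReal q) volume
          ≤ ENNReal.ofReal c * (eLpNorm (fun x => ‖x‖ ^ 2 • G x) ⊤ volume
            + eLpNorm G (ENNReal.ofReal q) (volume.restrict (Metric.ball 0 s))
            + negSobolevNorm q (Metric.ball 0 (2 * ρ)) f
            + eLpNorm g (ENNReal.ofReal q) (volume.restrict (Metric.ball 0 ρ))) := by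
  have hq1 : 1 < q := by linarith
  have hq' : 1 ≤ ENNReal.ofReal q := by simpa using hq1.le
  obtain ⟨C1, hC1, hten⟩ := exists_memLp_tensor hq hs
  obtain ⟨C2, hC2, hforce⟩ := exists_force_tensor hq hρ
  obtain ⟨C3, hC3, hsol⟩ := exists_stokes_components (R := 7 * ρ / 4) (R' := 2 * ρ) hq1
    (by positivity) (by linarith)
  set K := C1 + C2 + 1
  have hK : 1 ≤ K := by simp only [K]; linarith
  -- Three components in the decay norm, nine in the gradient and one pressure, each bounded by C3·K
  -- times the data. The final 1 only makes the constant positive.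
  refine ⟨13 * (C3 * K) + 1, by positivity, fun G f g h => ?_⟩
  obtain ⟨hGm, hGn⟩ := hten h
  have hGd := h.ae_norm_tensor_le
  obtain ⟨hgm, hgn⟩ := h.memLp_divergence_univ hρ
  choose Θ hΘ hfΘ using hforce f h.negSobolevNorm_lt_top h.support_force
  set a := eLpNorm (fun x => ‖x‖ ^ 2 • G x) ⊤ volume
  set b := eLpNorm G (ENNReal.ofReal q) (volume.restrict (Metric.ball 0 s))
  set N := negSobolevNorm q (Metric.ball 0 (2 * ρ)) f
  set e := eLpNorm g (ENNReal.ofReal q) (volume.restrict (Metric.ball 0 ρ))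
  have ha : a ≠ ⊤ := h.memLp_weighted_tensor.2.ne
  have hb : b ≠ ⊤ := h.memLp_tensor_near_zero.2.ne
  have hN : N ≠ ⊤ := h.negSobolevNorm_lt_top.ne
  have he : e ≠ ⊤ := hgn ▸ hgm.2.ne
  set D := a.toReal + b.toReal + N.toReal + e.toReal
  have hD : ENNReal.ofReal D = a + b + N + e := by
    simp only [D]
    rw [ENNReal.ofReal_add (by positivity) (by positivity),
      ENNReal.ofReal_add (by positivity) (by positivity),
      ENNReal.ofReal_add (by positivity) (by positivity), ENNReal.ofReal_toReal ha,
      ENNReal.ofReal_toReal hb, ENNReal.ofReal_toReal hN, ENNReal.ofReal_toReal he]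
  have ha0 : 0 ≤ a.toReal := ENNReal.toReal_nonneg
  have hb0 : 0 ≤ b.toReal := ENNReal.toReal_nonneg
  have hN0 : 0 ≤ N.toReal := ENNReal.toReal_nonneg
  have he0 : 0 ≤ e.toReal := ENNReal.toReal_nonneg
  have hD0 : 0 ≤ D := by positivity
  have hKD : 0 ≤ K * D := by positivity
  have hGΘ : C1 * (a.toReal + b.toReal) + C2 * N.toReal ≤ K * D := by
    have : K * D = C1 * D + C2 * D + D := by simp only [K]; ring
    have h1 : C1 * (a.toReal + b.toReal) ≤ C1 * D :=
      mul_le_mul_of_nonneg_left (by simp only [D]; linarith) hC1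
    have h2 : C2 * N.toReal ≤ C2 * D := mul_le_mul_of_nonneg_left (by simp only [D]; linarith) hC2
    linarith
  have hGΘ' : a.toReal + C2 * N.toReal ≤ K * D := by
    have : K * D = C1 * D + C2 * D + D := by simp only [K]; ring
    have h1 : a.toReal ≤ D := by simp only [D]; linarith
    have h2 : C2 * N.toReal ≤ C2 * D := mul_le_mul_of_nonneg_left (by simp only [D]; linarith) hC2
    have h3 : 0 ≤ C1 * D := by positivity
    linarith
  have heD : e.toReal ≤ K * D := by
    have h1 : e.toReal ≤ D := by simp only [D]; linarith
    nlinarith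
  have hGc : ∀ z, MemLp (fun x => G x z) (ENNReal.ofReal q) volume ∧
      eLpNorm (fun x => G x z) (ENNReal.ofReal q) volume
        ≤ ENNReal.ofReal (C1 * (a.toReal + b.toReal)) := fun z => by
    have h1 : ∀ x, ‖G x z‖ ≤ ‖G x‖ := fun x => PiLp.norm_apply_le (G x) z
    exact ⟨hGm.mono ((PiLp.continuous_apply 2 _ z).comp_aestronglyMeasurable hGm.1)
      (Eventually.of_forall h1), (eLpNorm_mono h1).trans hGn⟩
  -- The force is absorbed into the tensor. Beyond 7ρ/4 both G and Θ are bounded by multiples of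
  -- |y|⁻².
  have hΓ : ∀ k i, IsDensity q (7 * ρ / 4) (K * D) fun x => G x (k, i) + Θ i k x := fun k i => by
    obtain ⟨m1, n1⟩ := hGc (k, i)
    obtain ⟨m2, n2, d2⟩ := hΘ i k
    refine ⟨m1.add m2, (eLpNorm_add_le m1.1 m2.1 hq').trans ((add_le_add n1 n2).trans ?_), ?_⟩
    · rw [← ENNReal.ofReal_add (by positivity) (by positivity)]
      exact ENNReal.ofReal_le_ofReal hGΘ
    · filter_upwards [hGd] with y h1 hy
      have h2 : |G y (k, i)| ≤ ‖G y‖ := PiLp.norm_apply_le (G y) (k, i)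
      have h3 := abs_add_le (G y (k, i)) (Θ i k y)
      have h4 : 0 ≤ ‖y‖ ^ 2 := by positivity
      nlinarith [d2 y hy]
  have hgD : IsDensity q (7 * ρ / 4) (K * D) g := by
    refine ⟨hgm, ?_, ?_⟩
    · rw [hgn, ← ENNReal.ofReal_toReal he]
      exact ENNReal.ofReal_le_ofReal heD
    · filter_upwards [h.support_divergence] with y h1 hy
      rw [h1 (by simp; linarith)]
      simpa using hKD
  obtain ⟨u, p, hu, hp, hpn, hmom, hdiv⟩ := hsol _ g (K * D) hKD hΓ hgD
  choose d hd hdn hdw using fun i j => (hu i).exists_weakDeriv j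
  have hA : 0 ≤ C3 * (K * D) := by positivity
  have hGL := fun z => (hGc z).1.locallyIntegrable hq'
  have hΘL := fun i k => (hΘ i k).1.locallyIntegrable hq'
  have hUm := memLp_toLp (v := fun (z : Fin 3 × Fin 3) x => d z.1 z.2 x) hq' hA
    (fun z => hd z.1 z.2) fun z => hdn z.1 z.2
  have huL : LocallyIntegrable fun x => (WithLp.toLp 2 fun i => u i x : E3) :=
    locallyIntegrable_toLp fun i => (hu i).locallyIntegrable
  have hgrad : IsWeakGradient (fun x => WithLp.toLp 2 fun i => u i x)
      fun x => WithLp.toLp 2 fun z : Fin 3 × Fin 3 => d z.1 z.2 x :=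
    ⟨huL, hUm.1.locallyIntegrable hq', fun i j φ => hdw i j φ φ.isTest⟩
  have hdec : ∀ᵐ x ∂(volume.restrict (Metric.closedBall (0 : E3) (2 * ρ))ᶜ),
      ‖‖x‖ • (WithLp.toLp 2 fun i => u i x : E3)‖ ≤ 3 * (C3 * (K * D)) := by
    refine (ae_restrict_iff' Metric.isClosed_closedBall.measurableSet.compl).2
      (Eventually.of_forall fun x hx => ?_)
    have hx' : 2 * ρ < ‖x‖ := by simpa using hx
    rw [norm_smul, norm_norm]
    calc _ ≤ ‖x‖ * ∑ i, |u i x| := by gcongr; exact norm_toLp_le_sum _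
      _ = ∑ i, ‖x‖ * |u i x| := Finset.mul_sum _ _ _
      _ ≤ ∑ i : Fin 3, C3 * (K * D) := Finset.sum_le_sum fun i _ => (hu i).decay x hx'.le
      _ = _ := by simp
  have hdec' : eLpNorm (fun x => ‖x‖ • (WithLp.toLp 2 fun i => u i x : E3)) ⊤
      (volume.restrict (Metric.closedBall 0 (2 * ρ))ᶜ) ≤ ENNReal.ofReal (3 * (C3 * (K * D))) := by
    rw [eLpNorm_exponent_top]
    exact eLpNormEssSup_le_of_ae_bound hdec
  refine ⟨fun x => WithLp.toLp 2 fun i => u i x, p, _,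
    ⟨huL, hp.locallyIntegrable hq', fun i φ => ?_, fun φ => ?_⟩,
    ⟨⟨_, hgrad, hUm.1⟩, hp, ?_⟩, hgrad, ?_⟩
  · have hφ := φ.isTest
    have h1 : ∀ k, ∫ x, (G x (k, i) + Θ i k x) * pderiv k φ x
        = (∫ x, G x (k, i) * pderiv k φ x) + ∫ x, Θ i k x * pderiv k φ x := fun k => by
      simp only [add_mul]
      exact integral_add (integrable_mul_test (hGL _) (hφ.pderiv k))
        (integrable_mul_test (hΘL i k) (hφ.pderiv k))
    rw [hfΘ i φ, integral_finsetSum _ fun k _ => integrable_mul_test (hGL _) (hφ.pderiv k)]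
    refine (hmom i φ hφ).trans ?_
    simp only [h1]
    rw [Finset.sum_add_distrib]
    ring
  · have hφ := φ.isTest
    rw [integral_finsetSum _ fun k _ => integrable_mul_test (hu k).1 (hφ.pderiv k)]
    exact neg_eq_iff_eq_neg.2 (hdiv φ hφ)
  · exact ⟨(continuous_norm.aestronglyMeasurable.smul huL.aestronglyMeasurable).restrict,
      hdec'.trans_lt ENNReal.ofReal_lt_top⟩
  · refine (add_le_add (add_le_add hdec' hUm.2) hpn).trans ?_
    rw [← hD, ← ENNReal.ofReal_mul (by positivity), ← ENNReal.ofReal_add (by positivity) (by positivity),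
      ← ENNReal.ofReal_add (by positivity) (by positivity)]
    refine ENNReal.ofReal_le_ofReal ?_
    simp only [Fintype.card_prod, Fintype.card_fin]
    push_cast
    nlinarith

end StokesWholeSpace

end

theorem mainTheorem7 (q ρ s : ℝ) (hq : 3 / 2 < q) (hρ : 0 < ρ) (hs : 0 < s) :
    ∃ c : ℝ, 0 < c ∧
      ∀ (G : StokesWholeSpace.E3 → StokesWholeSpace.Tensor)
        (f : StokesWholeSpace.VectorDistribution) (g : StokesWholeSpace.E3 → ℝ),
        StokesWholeSpace.IsAdmissibleData q ρ s G f g →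
        (∃ (u : StokesWholeSpace.E3 → StokesWholeSpace.E3) (p : StokesWholeSpace.E3 → ℝ),
          StokesWholeSpace.IsStokesSolution G f g u p ∧
          StokesWholeSpace.IsInSolutionClass q ρ u p ∧
          ∀ (u' : StokesWholeSpace.E3 → StokesWholeSpace.E3) (p' : StokesWholeSpace.E3 → ℝ),
            StokesWholeSpace.IsStokesSolution G f g u' p' →
            StokesWholeSpace.IsInSolutionClass q ρ u' p' →
            u' =ᵐ[volume] u ∧ p' =ᵐ[volume] p) ∧
        ∀ (u : StokesWholeSpace.E3 → StokesWholeSpace.E3) (p : StokesWholeSpace.E3 → ℝ)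
          (U : StokesWholeSpace.E3 → StokesWholeSpace.Tensor),
          StokesWholeSpace.IsStokesSolution G f g u p →
          StokesWholeSpace.IsInSolutionClass q ρ u p →
          StokesWholeSpace.IsWeakGradient u U →
          (eLpNorm (fun x => ‖x‖ • u x) ∞ (volume.restrict (Metric.closedBall 0 (2 * ρ))ᶜ)
              + eLpNorm U (ENNReal.ofReal q) volume + eLpNorm p (ENNReal.ofReal q) volume
            ≤ ENNReal.ofReal c *
              (eLpNorm (fun x => ‖x‖ ^ 2 • G x) ∞ volume
                + eLpNorm G (ENNReal.ofReal q) (volume.restrict (Metric.ball 0 s))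
                + StokesWholeSpace.negSobolevNorm q (Metric.ball 0 (2 * ρ)) f
                + eLpNorm g (ENNReal.ofReal q) (volume.restrict (Metric.ball 0 ρ)))) ∧
          ((∀ᵐ x, x ∈ Metric.ball (0 : StokesWholeSpace.E3) s → G x = 0) →
            eLpNorm (fun x => ‖x‖ • u x) ∞ (volume.restrict (Metric.closedBall 0 (2 * ρ))ᶜ)
                + eLpNorm U (ENNReal.ofReal q) volume + eLpNorm p (ENNReal.ofReal q) volume
              ≤ ENNReal.ofReal c *
                (eLpNorm (fun x => ‖x‖ ^ 2 • G x) ∞ volume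
                  + StokesWholeSpace.negSobolevNorm q (Metric.ball 0 (2 * ρ)) f
                  + eLpNorm g (ENNReal.ofReal q) (volume.restrict (Metric.ball 0 ρ)))) := by
  obtain ⟨c, hc, hex⟩ := StokesWholeSpace.exists_stokes_solution hq hρ hs
  have hq1 : 1 ≤ q := by linarith
  refine ⟨c, hc, fun G f g h => ?_⟩
  obtain ⟨u₀, p₀, U₀, hsol, hcls, hgrad, hest⟩ := hex G f g h
  have huniq := fun u p (hu : StokesWholeSpace.IsStokesSolution G f g u p)
    (hu' : StokesWholeSpace.IsInSolutionClass q ρ u p) => hsol.ae_eq hq1 hu hcls hu'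
  refine ⟨⟨u₀, p₀, hsol, hcls, huniq⟩, fun u p U hu hu' hU => ?_⟩
  -- By uniqueness the given solution agrees almost everywhere with the constructed one, and so do
  -- the weak gradients. The norms in the estimate see only classes modulo null sets.
  obtain ⟨huu, hpp⟩ := huniq u p hu hu'
  have hUU := hgrad.ae_eq hU huu
  have e1 : (fun x => ‖x‖ • u x) =ᵐ[volume.restrict (Metric.closedBall 0 (2 * ρ))ᶜ]
      fun x => ‖x‖ • u₀ x := by
    filter_upwards [ae_restrict_of_ae huu] with x hx
    rw [hx]
  rw [← eLpNorm_congr_ae e1, ← eLpNorm_congr_ae hUU, ← eLpNorm_congr_ae hpp] at hest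
  refine ⟨hest, fun hG => hest.trans (le_of_eq ?_)⟩
  have hG0 : eLpNorm G (ENNReal.ofReal q) (volume.restrict (Metric.ball 0 s)) = 0 := by
    have : G =ᵐ[volume.restrict (Metric.ball 0 s)] 0 :=
      (ae_restrict_iff' Metric.isOpen_ball.measurableSet).2 hG
    rw [eLpNorm_congr_ae this, eLpNorm_zero]
  rw [hG0, add_zero]
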